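/- Setting. Let $D_x,D_c\ge 1$, $D=D_x+D_c$, and let $\mathcal X\subseteq[0,r]^{D_x}$, $\mathcal C\subseteq[0,r]^{D_c}$ be convex, compact and nonempty, $\mathcal Z=\mathcal X\times\mathcal C$; let $a,b,r,\sigma>0$. Gaussian process: $f$ is a sample path of $\mathcal{GP}(0,k)$ on $\mathcal Z$ with $k\le 1$, with differentiable sample paths and $\mathbb P(\sup_{z\in\mathcal Z}|\partial f(z)/\partial z_i|>L)\le a e^{-(L/b)^2}$ for all $i\in[D]$ and $L>0$. Contexts and noise: contexts $c_0,c_1,c_2,\dots\in\mathcal C$ are i.i.d. with density $p$, noises $\epsilon_t$ are i.i.d. $\mathcal N(0,\sigma^2)$, and $f$, the contexts and the noise are independent. The density $p$ on $\mathbb R^{D_c}$ vanishes outside $\mathcal C$ and is twice differentiable on $\mathbb R^{D_c}$ with square integrable second order partial derivatives. Kernel density estimate: $K$ is a bounded symmetric probability density on $\mathbb R^{D_c}$ with $\int uu^{\mathsf T}K(u)\,du=m_2 I$, $m_2>0$, and $\int\|u\|^{2+\eta}K(u)\,du<\infty$ for some $\eta>0$ (as for kernels of bounded support and Gaussian kernels).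 The bandwidths are deterministic, $h_t^{(i)}>0$, $h_t^{(i)}=\Theta(t^{-1/(4+D_c)})$, $\mathbf H_t=\mathrm{diag}(h_t^{(1)},\dots,h_t^{(D_c)})$, and $$\hat p_t(u)=\frac1{t|\mathbf H_t|}\sum_{i=0}^{t-1}K(\mathbf H_t^{-1}(u-c_i)),$$ so that $t$ contexts are available at iteration $t=1,2,\dots$. Algorithm DRBO-KDE with radii $\delta_t>0$: let $\mathcal D_{t-1}=\{(x_i,c_i,y_i)\}_{i=1}^{t-1}$ with $y_i=f(x_i,c_i)+\epsilon_i$, let $\mu_t$ and $\sigma_t^2$ be the Gaussian process posterior mean and variance given $\mathcal D_{t-1}$ (noise variance $\sigma^2$), and let $\mathrm{ucb}_t=\mu_t+\sqrt{\beta_t}\,\sigma_t$ with $$\beta_t=2\log\frac{t^2}{\sqrt{2\pi}}+2D_x\log\frac{t^2D_x a b r\sqrt\pi}{2}$$ (square roots of negative numbers, which can occur only for finitely many $t$, are read as $0$). Let $\mathcal B(\hat p_t,\delta_t)$ be the set of probability densities $q$ on $\mathbb R^{D_c}$ that are absolutely continuous with respect to $\hat p_t$ with $\int\hat p_t\,|q/\hat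 p_t-1|\le\delta_t$; expectations under $q$ or $\hat p_t$ of functions on $\mathcal C$ are integrals over $\mathcal C$. The decision $x_t$ is a measurable function of $c_0,\dots,c_{t-1}$ and $(x_i,y_i)_{1\le i<t}$ that maximizes $\inf_{q\in\mathcal B(\hat p_t,\delta_t)}\mathbb E_{c\sim q}[\mathrm{ucb}_t(x,c)]$ over $x\in\mathcal X$. With $x^*\in\arg\max_{x\in\mathcal X}\mathbb E_{c\sim p}[f(x,c)]$, let $$\mathrm{BCR}(T)=\mathbb E\Big[\sum_{t=1}^T\big(\mathbb E_{c\sim p}[f(x^*,c)]-\mathbb E_{c\sim p}[f(x_t,c)]\big)\Big],$$ and let $\gamma_T=\sup_{z_1,\dots,z_T\in\mathcal Z}I(\mathbf y;\mathbf f)$, where $I$ is the mutual information of $\mathbf f=(f(z_i))_i$ and its noisy observations $\mathbf y=(f(z_i)+\epsilon_i)_i$. Theorem. There are constants $C_1,C_2,C_3,C_4>0$, which depend only on $\mathcal X,\mathcal C,a,b,r,\sigma,p,K$ and $(h_t)$ (not on $k$, $(\delta_t)$ or $T$), such that for all $T\ge1$ the cumulative regret is integrable and $$\mathrm{BCR}(T)\le\frac{\pi^2}{3}+\sqrt{\beta_T\gamma_TC_2}\Big(\sqrt{T^{D_c/(4+D_c)}}+\sqrt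 T+\sqrt{C_3\textstyle\sum_{t=1}^T\delta_t^2}\Big)+2C_1T^{\frac{2+D_c}{4+D_c}}+\sum_{t=1}^TC_4\delta_t .$$ Moreover, for every $A$ there is $B>0$, depending only on $A$ and the same data, such that, if $0<\delta_t\le A\,t^{-2/(4+D_c)}$ for all $t\ge 1$, then for all $T\ge1$ $$\mathrm{BCR}(T)\le B\big(T^{\frac{2+D_c}{4+D_c}}+\sqrt{\beta_T\gamma_T T}\big);$$ if in addition $\beta_T\gamma_T=O(T^{D_c/(4+D_c)})$ (for instance if $\gamma_T$ is polylogarithmic in $T$), then $\mathrm{BCR}(T)=O(T^{(2+D_c)/(4+D_c)})$, and $\mathrm{BCR}(T)/T\to0$. -/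

import Mathlib

open MeasureTheory ProbabilityTheory Filter Topology Asymptotics

noncomputable section

namespace DRBO

/-- The joint input space `ℝ^{Dx} × ℝ^{Dc}` of decisions and contexts. -/
abbrev Pt (Dx Dc : ℕ) : Type := (Fin Dx → ℝ) × (Fin Dc → ℝ)

/-- The standard basis vectors of `ℝ^{Dx} × ℝ^{Dc}`. -/
def basisVec {Dx Dc : ℕ} : Fin Dx ⊕ Fin Dc → Pt Dx Dc
  | Sum.inl i => (Pi.single i 1, 0)
  | Sum.inr j => (0, Pi.single j 1)

/-! ### Densities, kernel density estimation, total variation balls -/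

/-- `q` is a probability density function with respect to Lebesgue measure. -/
structure IsPDF {d : ℕ} (q : (Fin d → ℝ) → ℝ) : Prop where
  measurable : Measurable q
  nonneg : ∀ c, 0 ≤ q c
  integral_eq_one : ∫ c, q c = 1

/-- The distribution with density `q`. -/
def law {d : ℕ} (q : (Fin d → ℝ) → ℝ) : Measure (Fin d → ℝ) :=
  volume.withDensity (fun c => ENNReal.ofReal (q c))

/-- `p` is a twice differentiable probability density, concentrated on `C`, with square integrable
second order partial derivatives (that is, the matrix of integrated products of second order
partial derivatives is finite). -/
structure IsSmoothPDFOn {d : ℕ} (C : Set (Fin d → ℝ)) (p : (Fin d → ℝ) → ℝ) : Prop where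
  isPDF : IsPDF p
  eq_zero_off : ∀ c, c ∉ C → p c = 0
  differentiable : Differentiable ℝ p
  differentiable_fderiv : Differentiable ℝ (fderiv ℝ p)
  memLp_second_deriv : ∀ i j : Fin d,
    MemLp (fun c => fderiv ℝ (fderiv ℝ p) c (Pi.single i 1) (Pi.single j 1)) 2 volume

/-- `K` is a bounded kernel for density estimation: a bounded symmetric probability density
with second moment matrix `m₂ I`, `m₂ > 0`, and a finite absolute moment of some order above 2
(this holds for kernels of bounded support and for Gaussian kernels). -/
structure IsKDEKernel {d : ℕ} (K : (Fin d → ℝ) → ℝ) : Prop where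
  isPDF : IsPDF K
  bounded : ∃ B : ℝ, ∀ u, K u ≤ B
  symm : ∀ u, K (-u) = K u
  second_moment : ∃ m₂ : ℝ, 0 < m₂ ∧ ∀ i j : Fin d,
    Integrable (fun u => u i * u j * K u) ∧ ∫ u, u i * u j * K u = if i = j then m₂ else 0
  higher_moment : ∃ η : ℝ, 0 < η ∧ Integrable (fun u => ‖u‖ ^ (2 + η) * K u)

/-- The bandwidths `h t i`, `t ≥ 1`, are positive and of order `Θ(t^{-1/(4+d)})`. -/
structure IsBandwidth {d : ℕ} (h : ℕ → Fin d → ℝ) : Prop where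
  pos : ∀ t, 1 ≤ t → ∀ i, 0 < h t i
  order : ∀ i, (fun t : ℕ => h t i) =Θ[atTop] (fun t : ℕ => (t : ℝ) ^ (-(1 / (4 + (d : ℝ)))))

/-- The kernel density estimate from the `t` samples `c 0, …, c (t-1)`, with diagonal bandwidth
matrix `H = diag h`: `∑ i < t, K (H⁻¹ (u - c i)) / (t |H|)`. -/
def kde {d : ℕ} (K : (Fin d → ℝ) → ℝ) (h : Fin d → ℝ) (t : ℕ) (c : ℕ → Fin d → ℝ)
    (u : Fin d → ℝ) : ℝ :=
  ∑ i ∈ Finset.range t, K (fun j => (u j - c i j) / h j) / ((t : ℝ) * ∏ j, h j)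

/-- The total variation `∫ p φ(q / p)` with `φ(s) = |s - 1|`. -/
def tvDist {d : ℕ} (q p : (Fin d → ℝ) → ℝ) : ℝ := ∫ c, p c * |q c / p c - 1|

/-- The ball of radius `δ` around `p`: densities `q`, absolutely continuous with respect
to `p`, at total variation at most `δ` from `p`. -/
def tvBall {d : ℕ} (p : (Fin d → ℝ) → ℝ) (δ : ℝ) : Set ((Fin d → ℝ) → ℝ) :=
  {q | IsPDF q ∧ law q ≪ law p ∧ tvDist q p ≤ δ}

/-- `E_{c ∼ q}[g c]` for a function `g` on the context space `C`
(extended by zero if `q` charges the complement of `C`). -/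
def expect {d : ℕ} (C : Set (Fin d → ℝ)) (q g : (Fin d → ℝ) → ℝ) : ℝ := ∫ c in C, g c * q c

/-! ### Gaussian process regression -/

section GP

variable {Z : Type*}

/-- The regularized kernel matrix `K + σ² I` at the design points `z`. -/
def gram (k : Z → Z → ℝ) (σ : ℝ) {n : ℕ} (z : Fin n → Z) : Matrix (Fin n) (Fin n) ℝ :=
  Matrix.of (fun i j => k (z i) (z j)) + σ ^ 2 • (1 : Matrix (Fin n) (Fin n) ℝ)

/-- Posterior mean at `w` given observations `y` at `z`. -/
def postMean (k : Z → Z → ℝ) (σ : ℝ) {n : ℕ} (z : Fin n → Z) (y : Fin n → ℝ) (w : Z) : ℝ :=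
  (fun i => k (z i) w) ⬝ᵥ ((gram k σ z)⁻¹.mulVec y)

/-- Posterior covariance at `w`, `w'` given observations at `z`. -/
def postCov (k : Z → Z → ℝ) (σ : ℝ) {n : ℕ} (z : Fin n → Z) (w w' : Z) : ℝ :=
  k w w' - (fun i => k (z i) w) ⬝ᵥ ((gram k σ z)⁻¹.mulVec (fun i => k (z i) w'))

/-- Upper confidence bound `μ + √β σ` at `w`, with posterior mean `μ` and posterior standard
deviation `σ`. -/
def ucb (k : Z → Z → ℝ) (σ β : ℝ) {n : ℕ} (z : Fin n → Z) (y : Fin n → ℝ) (w : Z) : ℝ :=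
  postMean k σ z y w + Real.sqrt β * Real.sqrt (postCov k σ z w w)

end GP

/-- `β_t = 2 log(t² / √(2π)) + 2 Dx log(t² Dx a b r √π / 2)`. -/
def ucbBeta (Dx : ℕ) (a b r : ℝ) (t : ℕ) : ℝ :=
  2 * Real.log ((t : ℝ) ^ 2 / Real.sqrt (2 * Real.pi)) +
    2 * (Dx : ℝ) * Real.log ((t : ℝ) ^ 2 * (Dx : ℝ) * a * b * r * Real.sqrt Real.pi / 2)

section Runs

variable {Ω : Type*} [MeasurableSpace Ω] {Dx Dc : ℕ}

/-- `f` is a sample path of the Gaussian process `GP(0, k)` on `Z`, with `k ≤ 1`, differentiable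
sample paths, and sub-Gaussian tails for the suprema of its partial derivatives. -/
structure IsLipschitzGP (P : Measure Ω) (Z : Set (Pt Dx Dc)) (k : Pt Dx Dc → Pt Dx Dc → ℝ)
    (a b : ℝ) (f : Ω → Pt Dx Dc → ℝ) : Prop where
  measurable : ∀ z ∈ Z, Measurable (fun ω => f ω z)
  gaussian : IsGaussianProcess (fun (z : Z) ω => f ω z) P
  mean_zero : ∀ z ∈ Z, ∫ ω, f ω z ∂P = 0
  covariance_eq : ∀ z ∈ Z, ∀ z' ∈ Z, covariance (fun ω => f ω z) (fun ω => f ω z') P = k z z'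
  kernel_le_one : ∀ z ∈ Z, ∀ z' ∈ Z, k z z' ≤ 1
  differentiableOn : ∀ ω, DifferentiableOn ℝ (f ω) Z
  tail : ∀ i : Fin Dx ⊕ Fin Dc, ∀ L : ℝ, 0 < L →
    P {ω | ∃ z ∈ Z, L < |fderivWithin ℝ (f ω) Z z (basisVec i)|} ≤
      ENNReal.ofReal (a * Real.exp (-(L / b) ^ 2))

/-- The noisy evaluation `y_t = f(x_t, c_t) + ε_t`. -/
def obs (f : Ω → Pt Dx Dc → ℝ) (c : ℕ → Ω → Fin Dc → ℝ) (ε : ℕ → Ω → ℝ)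
    (x : ℕ → Ω → Fin Dx → ℝ) (t : ℕ) (ω : Ω) : ℝ :=
  f ω (x t ω, c t ω) + ε t ω

/-- What the decision maker has seen before choosing `x t`: the `t` contexts `c 0, …, c (t-1)`
and the decisions and noisy evaluations of the iterations `1, …, t-1`. -/
def history (f : Ω → Pt Dx Dc → ℝ) (c : ℕ → Ω → Fin Dc → ℝ) (ε : ℕ → Ω → ℝ)
    (x : ℕ → Ω → Fin Dx → ℝ) (t : ℕ) (ω : Ω) :
    (Fin t → Fin Dc → ℝ) × (Fin (t - 1) → (Fin Dx → ℝ) × ℝ) :=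
  (fun i => c i ω, fun i => (x (i + 1) ω, obs f c ε x (i + 1) ω))

/-- `ucb_t`, from the data `D_{t-1} = {(x_i, c_i, y_i)}_{i=1}^{t-1}`. -/
def ucbAt (k : Pt Dx Dc → Pt Dx Dc → ℝ) (σ β : ℝ) (f : Ω → Pt Dx Dc → ℝ)
    (c : ℕ → Ω → Fin Dc → ℝ) (ε : ℕ → Ω → ℝ) (x : ℕ → Ω → Fin Dx → ℝ) (t : ℕ) (ω : Ω)
    (w : Pt Dx Dc) : ℝ :=
  ucb k σ β (fun i : Fin (t - 1) => ((x (i + 1) ω, c (i + 1) ω) : Pt Dx Dc))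
    (fun i : Fin (t - 1) => obs f c ε x (i + 1) ω) w

/-- The distributionally robust acquisition function: the worst expectation of the function
`u` of decision and context, over a total variation ball around `p`. -/
def robustAcq (C : Set (Fin Dc → ℝ)) (u : Pt Dx Dc → ℝ) (p : (Fin Dc → ℝ) → ℝ) (δ : ℝ)
    (v : Fin Dx → ℝ) : ℝ :=
  sInf ((fun q => expect C q (fun s => u (v, s))) '' tvBall p δ)

/-- A run of DRBO-KDE: `f` is the Gaussian process, `c` the contexts, `ε` the noise, `x` the
decisions, and `xs` a maximizer of the stochastic objective. Iterations are numbered from 1;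
the context `c 0` is known at the start, so that `t` contexts are known at iteration `t`. -/
structure IsRun (P : Measure Ω) (X : Set (Fin Dx → ℝ)) (C : Set (Fin Dc → ℝ))
    (a b r σ : ℝ) (p K : (Fin Dc → ℝ) → ℝ) (h : ℕ → Fin Dc → ℝ) (δ : ℕ → ℝ)
    (k : Pt Dx Dc → Pt Dx Dc → ℝ) (f : Ω → Pt Dx Dc → ℝ) (c : ℕ → Ω → Fin Dc → ℝ)
    (ε : ℕ → Ω → ℝ) (x : ℕ → Ω → Fin Dx → ℝ) (xs : Ω → Fin Dx → ℝ) : Prop where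
  gp : IsLipschitzGP P (X ×ˢ C) k a b f
  -- the contexts are i.i.d. with density `p`
  context_measurable : ∀ t, Measurable (c t)
  context_mem : ∀ t ω, c t ω ∈ C
  context_law : ∀ t, P.map (c t) = law p
  context_indep : iIndepFun c P
  -- the noise is i.i.d. `N(0, σ²)`
  noise_measurable : ∀ t, Measurable (ε t)
  noise_law : ∀ t, P.map (ε t) = gaussianReal 0 (Real.toNNReal (σ ^ 2))
  noise_indep : iIndepFun ε P
  -- the Gaussian process, the contexts and the noise are independent
  context_noise_indep : IndepFun (fun ω t => c t ω) (fun ω t => ε t ω) P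
  gp_indep : IndepFun (fun ω (z : ↥(X ×ˢ C)) => f ω z)
    (fun ω => ((fun t => c t ω, fun t => ε t ω) : (ℕ → Fin Dc → ℝ) × (ℕ → ℝ))) P
  -- the decisions: `x t` is computed from the past and maximizes the acquisition function
  decision_mem : ∀ t, 1 ≤ t → ∀ ω, x t ω ∈ X
  decision_adapted : ∀ t, 1 ≤ t →
    Measurable[MeasurableSpace.comap (history f c ε x t) inferInstance] (x t)
  decision_max : ∀ t, 1 ≤ t → ∀ ω,
    IsMaxOn (robustAcq C (ucbAt k σ (ucbBeta Dx a b r t) f c ε x t ω)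
      (kde K (h t) t (fun i => c i ω)) (δ t)) X (x t ω)
  -- the optimum
  opt_mem : ∀ ω, xs ω ∈ X
  opt_max : ∀ ω, IsMaxOn (fun v => expect C p (fun s => f ω (v, s))) X (xs ω)

/-- Cumulative regret of the stochastic objective after `T` iterations. -/
def cumRegret (C : Set (Fin Dc → ℝ)) (p : (Fin Dc → ℝ) → ℝ) (f : Ω → Pt Dx Dc → ℝ)
    (x : ℕ → Ω → Fin Dx → ℝ) (xs : Ω → Fin Dx → ℝ) (T : ℕ) (ω : Ω) : ℝ :=
  ∑ t ∈ Finset.Icc 1 T,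
    (expect C p (fun s => f ω (xs ω, s)) - expect C p (fun s => f ω (x t ω, s)))

/-- Bayesian cumulative regret. -/
def BCR (P : Measure Ω) (C : Set (Fin Dc → ℝ)) (p : (Fin Dc → ℝ) → ℝ) (f : Ω → Pt Dx Dc → ℝ)
    (x : ℕ → Ω → Fin Dx → ℝ) (xs : Ω → Fin Dx → ℝ) (T : ℕ) : ℝ :=
  ∫ ω, cumRegret C p f x xs T ω ∂P

/-- The information gain `I(y_D; f_D)` of a data set `D` of inputs `z`: the mutual information of
the noisy observations `y_D` and the true values `f_D`, that is, the Kullback-Leibler divergence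
of their joint law from the product of their laws. -/
def infoGain (P : Measure Ω) (f : Ω → Pt Dx Dc → ℝ) (ε : ℕ → Ω → ℝ) {T : ℕ}
    (z : Fin T → Pt Dx Dc) : ENNReal :=
  InformationTheory.klDiv
    (P.map (fun ω => ((fun i => f ω (z i) + ε (i + 1) ω, fun i => f ω (z i)) :
      (Fin T → ℝ) × (Fin T → ℝ))))
    ((P.map (fun ω (i : Fin T) => f ω (z i) + ε (i + 1) ω)).prod
      (P.map (fun ω (i : Fin T) => f ω (z i))))

/-- The maximum information gain `γ_T` over data sets of `T` points of `Z`. -/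
def maxInfoGain (P : Measure Ω) (Z : Set (Pt Dx Dc)) (f : Ω → Pt Dx Dc → ℝ) (ε : ℕ → Ω → ℝ)
    (T : ℕ) : ℝ :=
  (⨆ z : Fin T → Z, infoGain P f ε (fun i => (z i : Pt Dx Dc))).toReal

end Runs

end DRBO

end

open DRBO

/-! Fix a sample path and pass from the optimum to the decision through the robust acquisition
function. Replace x* by a point g of a finite net of X of mesh r/t², then p by the estimate p̂, then
f(g,·) by ucb_t. Under every q of the ball, f ≤ ucb + (f - ucb)⁺, and f and (f - ucb)⁺ are moved
from q to p̂ at a cost proportional to δ_t. Since x_t maximizes the acquisition function and p̂ lies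
in its own ball, the acquisition value at g is at most the p̂-expectation of ucb_t(x_t,·). Returning
to f and to p, one step costs at most the net error, plus 2M‖p̂ - p‖₁, plus δ_t(2M + m), plus the
p̂-expectations of (f - ucb)⁺ at g, of |f - μ| at x_t and of √β σ_t at x_t (`expect_sub_expect_le`).
Here M bounds the path and m the posterior mean. The factor √β multiplies neither δ_t nor ‖p̂ - p‖₁.

Then take expectations. The path bound M is independent of the contexts, so its product with ‖p̂ -
p‖₁ has mean O(t^{-2/(4+Dc)}) by the mean integrated squared error of p̂; M has a mean because the
derivative tails give Lipschitz constants with a second moment. For the Gaussian terms,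
`FollowsPolicy.exists_disintegration` shows that, although the decisions are adaptive, the law of
the path given the history is the prior tilted by the Gaussian likelihood. A Fourier computation
(`integral_cexp_mul_likelihood`) shows that a tilted value of f is normal with mean μ_t and variance
σ_t². Hence (f - ucb)⁺ has conditional mean at most exp(-β/2) at each net point, β_t being such that
the sum over the net is O(t^{-2}), and |f - μ| has conditional mean at most σ_t.

There remains (1 + √β_t) times the mean of the p̂-expectation of σ_t(x_t,·). Comparing p̂ with p in
total variation would leave a term √β_t t^{-2/(4+Dc)}, too large by the factor √β_t. Instead
`lintegral_kde_mul_le` bounds it by three times the p-expectation plus an error smaller than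
t^{-2/(4+Dc)} by a power of t, which absorbs √β_t. Where p exceeds a level l, p̂ ≤ 2p + (p̂ - p)²/l;
where p is below l, p̂ is compared with its mean, a smoothing of p, and the regularity of σ_t lets
the smoothing act on pσ_t.

Finally c_t is independent of the history, so the p-expectation becomes E σ_t(x_t, c_t). The
Cauchy-Schwarz inequality and the identity of the information gain with ∑ ½ log(1 + σ_t²/σ²)
(`IsLipschitzGP.infoGain_eq`) produce √(β_T γ_T T). -/

set_option linter.unusedSectionVars false

/-! ### Tilting a Gaussian law by the likelihood of noisy observations. -/

namespace DRBO

/-- The likelihood ratio of observations `y` of the values `v`, with noise variance `σ²`, relative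
to pure noise. -/
noncomputable def likelihood (σ : ℝ) {n : ℕ} (y v : Fin n → ℝ) : ℝ :=
  Real.exp (∑ i, (y i * v i - v i ^ 2 / 2) / σ ^ 2)

lemma likelihood_pos (σ : ℝ) {n : ℕ} (y v : Fin n → ℝ) : 0 < likelihood σ y v := Real.exp_pos _

/-- Complete the square in `v`. The bound is uniform in `v`, so the likelihood is integrable under
every prior. -/
lemma likelihood_le (σ : ℝ) {n : ℕ} (y v : Fin n → ℝ) :
    likelihood σ y v ≤ Real.exp (∑ i, y i ^ 2 / (2 * σ ^ 2)) := by
  apply Real.exp_le_exp.2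
  apply Finset.sum_le_sum
  intro i _
  rw [← div_div]
  apply div_le_div_of_nonneg_right _ (sq_nonneg σ)
  nlinarith [sq_nonneg (y i - v i)]

lemma _root_.Measurable.likelihood {α : Type*} [MeasurableSpace α] (σ : ℝ) {n : ℕ}
    {y v : α → Fin n → ℝ} (hy : Measurable y) (hv : Measurable v) :
    Measurable (fun ω => likelihood σ (y ω) (v ω)) := by
  unfold DRBO.likelihood
  fun_prop

-- Up to a factor depending on `y`, the likelihood is a Gaussian function of `v - y`, hence the
-- Fourier transform of a Gaussian in a dual variable `N`. Integrals of the likelihood over the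
-- prior thereby become integrals of the characteristic function of the prior.
open Complex in
lemma fourier_likelihood (σ : ℝ) (hσ : 0 < σ) {n : ℕ} (y v : Fin n → ℝ) :
    ∫ N : Fin n → ℝ, cexp (-∑ i, ((σ ^ 2 / 2 : ℝ) : ℂ) * (N i : ℂ) ^ 2
        + ∑ i, (I * ((v i - y i : ℝ) : ℂ)) * N i) =
      (∏ _i : Fin n, ((Real.pi : ℂ) / ((σ ^ 2 / 2 : ℝ) : ℂ)) ^ (1 / 2 : ℂ)) *
        (Real.exp (-∑ i, y i ^ 2 / (2 * σ ^ 2)) * (likelihood σ y v : ℂ)) := by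
  rw [GaussianFourier.integral_cexp_neg_sum_mul_add]
  · rw [Finset.prod_mul_distrib]
    congr 1
    rw [← Complex.exp_sum, likelihood, ← ofReal_mul, ← Real.exp_add, Complex.ofReal_exp]
    congr 1
    rw [← Finset.sum_neg_distrib, ← Finset.sum_add_distrib, ofReal_sum]
    apply Finset.sum_congr rfl
    intro i _
    have : (σ : ℂ) ≠ 0 := by exact_mod_cast hσ.ne'
    rw [mul_pow, I_sq]
    push_cast
    field_simp
    ring
  · intro i
    rw [ofReal_re]
    positivity

open Complex in
/-- A Gaussian exponential tilt: the joint characteristic function of a variable `G` and of the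
values `F`, tilted by the likelihood of noisy observations of `F`. -/
lemma integral_cexp_mul_likelihood {Ω : Type*} [MeasurableSpace Ω] (P : Measure Ω)
    [IsProbabilityMeasure P] (σ : ℝ) (hσ : 0 < σ) {n : ℕ} {G : Ω → ℝ} {F : Ω → Fin n → ℝ}
    (hG : Measurable G) (hF : Measurable F) (v : ℝ) (κ : Fin n → ℝ)
    (Km : Matrix (Fin n) (Fin n) ℝ) (hKm : Km.transpose = Km)
    (hdet : IsUnit (Km + σ ^ 2 • (1 : Matrix (Fin n) (Fin n) ℝ)).det)
    (hchar : ∀ (s : ℝ) (N : Fin n → ℝ), ∫ ω, cexp (I * ((s * G ω + ∑ i, N i * F ω i : ℝ) : ℂ)) ∂P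
      = cexp ((-(s ^ 2 * v + 2 * s * (N ⬝ᵥ κ) + N ⬝ᵥ Km.mulVec N) / 2 : ℝ) : ℂ))
    (y : Fin n → ℝ) (s : ℝ) :
    ∫ ω, cexp (I * ((s * G ω : ℝ) : ℂ)) * (likelihood σ y (F ω) : ℂ) ∂P =
      cexp (I * ((s * (κ ⬝ᵥ ((Km + σ ^ 2 • (1 : Matrix (Fin n) (Fin n) ℝ))⁻¹.mulVec y)) : ℝ) : ℂ)
        - ((s ^ 2 / 2 * (v - κ ⬝ᵥ ((Km + σ ^ 2 • (1 : Matrix (Fin n) (Fin n) ℝ))⁻¹.mulVec κ))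
          : ℝ) : ℂ)) * ∫ ω, (likelihood σ y (F ω) : ℂ) ∂P := by
  set S := Km + σ ^ 2 • (1 : Matrix (Fin n) (Fin n) ℝ) with hS
  set c0 : ℂ := (∏ _i : Fin n, ((Real.pi : ℂ) / ((σ ^ 2 / 2 : ℝ) : ℂ)) ^ (1 / 2 : ℂ)) *
        (Real.exp (-∑ i, y i ^ 2 / (2 * σ ^ 2)) : ℂ) with hc0
  have hc0' : c0 ≠ 0 := by
    refine mul_ne_zero (Finset.prod_ne_zero_iff.2 fun i _ => ?_) (by
      exact_mod_cast (Real.exp_pos _).ne')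
    rw [Ne, cpow_eq_zero_iff]
    have h1 : (Real.pi : ℂ) ≠ 0 := by exact_mod_cast Real.pi_ne_zero
    have h2 : (σ : ℂ) ≠ 0 := by exact_mod_cast hσ.ne'
    rintro ⟨h, -⟩
    rw [div_eq_zero_iff] at h
    rcases h with h | h
    · exact h1 h
    · push_cast at h; simp [h2] at h
  -- the integrand after the Fourier representation
  set E : ℝ → Ω → (Fin n → ℝ) → ℂ := fun s ω N => cexp (-∑ i, ((σ ^ 2 / 2 : ℝ) : ℂ) * (N i : ℂ) ^ 2
        + ∑ i, (I * ((F ω i - y i : ℝ) : ℂ)) * N i) * cexp (I * ((s * G ω : ℝ) : ℂ)) with hE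
  -- The mean of `E s` over the prior: the Gaussian weight in `N` adds `σ ^ 2` times the identity to
  -- the quadratic form of `Km`, which gives `S`.
  set J : ℝ → (Fin n → ℝ) → ℂ := fun s N =>
    cexp ((-(N ⬝ᵥ S.mulVec N) / 2 - s * (N ⬝ᵥ κ) - s ^ 2 * v / 2 : ℝ) - I * ((N ⬝ᵥ y : ℝ) : ℂ)) with hJ
  have hEJ : ∀ s N, ∫ ω, E s ω N ∂P = J s N := by
    intro s N
    have h1 : ∀ ω, E s ω N = cexp ((-∑ i, (σ ^ 2 / 2) * (N i) ^ 2 : ℝ) - I * ((N ⬝ᵥ y : ℝ) : ℂ)) *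
        cexp (I * ((s * G ω + ∑ i, N i * F ω i : ℝ) : ℂ)) := by
      intro ω
      simp only [hE]
      rw [← Complex.exp_add, ← Complex.exp_add]
      congr 1
      have e1 : ∑ i, (I * ((F ω i - y i : ℝ) : ℂ)) * N i
          = I * ((∑ i, N i * F ω i : ℝ) : ℂ) - I * ((N ⬝ᵥ y : ℝ) : ℂ) := by
        simp only [dotProduct]
        push_cast
        rw [Finset.mul_sum, Finset.mul_sum, ← Finset.sum_sub_distrib]
        exact Finset.sum_congr rfl fun i _ => by ring
      rw [e1]
      push_cast
      ring
    simp_rw [h1]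
    rw [integral_const_mul, hchar, ← Complex.exp_add]
    simp only [hJ]
    congr 1
    have e2 : N ⬝ᵥ S.mulVec N = N ⬝ᵥ Km.mulVec N + ∑ i, σ ^ 2 * N i ^ 2 := by
      rw [hS, Matrix.add_mulVec, dotProduct_add, Matrix.smul_mulVec, Matrix.one_mulVec,
        dotProduct_smul, smul_eq_mul, dotProduct, dotProduct, Finset.mul_sum]
      congr 1
      exact Finset.sum_congr rfl fun i _ => by ring
    have e3 : ∑ i, (σ ^ 2 / 2) * (N i) ^ 2 = (∑ i, σ ^ 2 * N i ^ 2) / 2 := by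
      rw [Finset.sum_div]
      exact Finset.sum_congr rfl fun i _ => by ring
    rw [e2, e3]
    push_cast
    ring
  -- The modulus of the integrand is a Gaussian in `N` that does not depend on `ω`, which justifies
  -- Fubini.
  have hEint : ∀ s, Integrable (Function.uncurry (E s)) (P.prod volume) := by
    intro s
    have hg := GaussianFourier.integrable_cexp_neg_sum_mul_add
      (b := fun _ : Fin n => ((σ ^ 2 / 2 : ℝ) : ℂ)) (fun i => by
        rw [ofReal_re]; positivity) (fun _ => 0)
    refine (hg.norm.comp_snd P).mono' ?_ ?_
    · apply Measurable.aestronglyMeasurable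
      simp only [hE, Function.uncurry_def]
      fun_prop
    · refine ae_of_all _ fun q => ?_
      simp only [hE, Function.uncurry_def, norm_mul, Complex.norm_exp]
      simp [-Finset.sum_neg_distrib, ← ofReal_pow, ← ofReal_sub]
  have hfub : ∀ s, c0 * ∫ ω, cexp (I * ((s * G ω : ℝ) : ℂ)) * (likelihood σ y (F ω) : ℂ) ∂P
      = ∫ N, J s N := by
    intro s
    simp_rw [← hEJ s]
    rw [← integral_integral_swap (hEint s), ← integral_const_mul]
    congr 1
    ext ω
    simp only [hE]
    rw [integral_mul_const, fourier_likelihood σ hσ]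
    rw [hc0]
    ring
  set a := S⁻¹.mulVec κ with ha
  have hSt : S.transpose = S := by
    rw [hS, Matrix.transpose_add, hKm, Matrix.transpose_smul, Matrix.transpose_one]
  have hSa : S.mulVec a = κ := by
    rw [ha, Matrix.mulVec_mulVec, Matrix.mul_nonsing_inv _ hdet, Matrix.one_mulVec]
  have hay : κ ⬝ᵥ S⁻¹.mulVec y = a ⬝ᵥ y := by
    rw [ha, Matrix.dotProduct_mulVec, ← Matrix.mulVec_transpose, Matrix.transpose_nonsing_inv, hSt]
  have hsym : ∀ N, a ⬝ᵥ S.mulVec N = N ⬝ᵥ κ := by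
    intro N
    rw [Matrix.dotProduct_mulVec, ← Matrix.mulVec_transpose, hSt, hSa, dotProduct_comm]
  -- Completing the square: since `S a = κ`, translating by `s • a` removes the term linear in `N`
  -- with coefficient `s` and leaves a constant times `J 0`. The integral of `J 0` is the case `s =
  -- 0` of the Fubini identity, so no Gaussian determinant has to be computed.
  have hshift : ∀ N, J s (N - s • a) = cexp (I * ((s * (κ ⬝ᵥ S⁻¹.mulVec y) : ℝ) : ℂ)
        - ((s ^ 2 / 2 * (v - κ ⬝ᵥ a) : ℝ) : ℂ)) * J 0 N := by
    intro N
    simp only [hJ]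
    rw [← Complex.exp_add, hay]
    congr 1
    have e : (N - s • a) ⬝ᵥ S.mulVec (N - s • a) = N ⬝ᵥ S.mulVec N - 2 * s * (N ⬝ᵥ κ)
        + s ^ 2 * (κ ⬝ᵥ a) := by
      rw [Matrix.mulVec_sub, Matrix.mulVec_smul, hSa, sub_dotProduct, dotProduct_sub,
        dotProduct_sub, smul_dotProduct, smul_dotProduct, hsym, dotProduct_smul, dotProduct_smul,
        dotProduct_comm a κ]
      simp only [smul_eq_mul]
      ring
    rw [e, sub_dotProduct, sub_dotProduct, smul_dotProduct, smul_dotProduct, dotProduct_comm a κ]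
    simp only [smul_eq_mul]
    push_cast
    ring
  have key : c0 * ∫ ω, cexp (I * ((s * G ω : ℝ) : ℂ)) * (likelihood σ y (F ω) : ℂ) ∂P
      = c0 * (cexp (I * ((s * (κ ⬝ᵥ S⁻¹.mulVec y) : ℝ) : ℂ)
        - ((s ^ 2 / 2 * (v - κ ⬝ᵥ a) : ℝ) : ℂ)) * ∫ ω, (likelihood σ y (F ω) : ℂ) ∂P) := by
    rw [hfub s, ← integral_sub_right_eq_self (J s) (s • a)]
    simp_rw [hshift]
    rw [integral_const_mul, ← hfub 0]
    simp only [zero_mul, ofReal_zero, mul_zero, Complex.exp_zero, one_mul]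
    ring
  exact mul_left_cancel₀ hc0' key

end DRBO

/-! ### Posterior law of the values of the Gaussian process. -/

namespace DRBO

section GaussianValues

variable {Ω : Type*} [MeasurableSpace Ω] {P : Measure Ω} [IsProbabilityMeasure P] {Dx Dc : ℕ}
  {Z : Set (Pt Dx Dc)} {k : Pt Dx Dc → Pt Dx Dc → ℝ} {a b : ℝ} {f : Ω → Pt Dx Dc → ℝ}

lemma IsLipschitzGP.hasGaussianLaw (hf : IsLipschitzGP P Z k a b f) {z : Pt Dx Dc} (hz : z ∈ Z) :
    HasGaussianLaw (fun ω => f ω z) P :=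
  hf.gaussian.hasGaussianLaw_eval ⟨z, hz⟩

lemma IsLipschitzGP.memLp_two (hf : IsLipschitzGP P Z k a b f) {z : Pt Dx Dc} (hz : z ∈ Z) :
    MemLp (fun ω => f ω z) 2 P := (hf.hasGaussianLaw hz).memLp_two

lemma IsLipschitzGP.integrable (hf : IsLipschitzGP P Z k a b f) {z : Pt Dx Dc} (hz : z ∈ Z) :
    Integrable (fun ω => f ω z) P := (hf.hasGaussianLaw hz).integrable

lemma IsLipschitzGP.kernel_comm (hf : IsLipschitzGP P Z k a b f) {z w : Pt Dx Dc} (hz : z ∈ Z)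
    (hw : w ∈ Z) : k z w = k w z := by
  rw [← hf.covariance_eq z hz w hw, covariance_comm, hf.covariance_eq w hw z hz]

lemma IsLipschitzGP.integral_mul (hf : IsLipschitzGP P Z k a b f) {z w : Pt Dx Dc} (hz : z ∈ Z)
    (hw : w ∈ Z) : ∫ ω, f ω z * f ω w ∂P = k z w := by
  have h := covariance_eq_sub (hf.memLp_two hz) (hf.memLp_two hw)
  rw [hf.covariance_eq z hz w hw, hf.mean_zero z hz, hf.mean_zero w hw] at h
  simpa using h.symm

/-- Linear combinations of values of the Gaussian process. -/
lemma IsLipschitzGP.map_sum (hf : IsLipschitzGP P Z k a b f) {ι : Type*} [Fintype ι]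
    {z : ι → Pt Dx Dc} (hz : ∀ i, z i ∈ Z) (s : ι → ℝ) :
    P.map (fun ω => ∑ i, s i * f ω (z i)) =
      gaussianReal 0 (Real.toNNReal (∑ i, ∑ j, s i * s j * k (z i) (z j))) := by
  have h1 : IsGaussianProcess (fun (i : ι) ω => s i • f ω (z i)) P :=
    (hf.gaussian.comp_right (fun i : ι => (⟨z i, hz i⟩ : Z))).smul s
  have h2 := (h1.hasGaussianLaw_fun_sum (I := Finset.univ)).map_eq_gaussianReal
  simp only [smul_eq_mul] at h2
  rw [h2]
  have hL : ∀ i, MemLp (fun ω => s i * f ω (z i)) 2 P := fun i =>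
    (hf.memLp_two (hz i)).const_mul _
  congr 1
  · rw [integral_finsetSum _ fun i _ => (hf.integrable (hz i)).const_mul _]
    exact Finset.sum_eq_zero fun i _ => by rw [integral_const_mul, hf.mean_zero _ (hz i), mul_zero]
  · rw [variance_fun_sum hL]
    congr 1
    refine Finset.sum_congr rfl fun i _ => Finset.sum_congr rfl fun j _ => ?_
    rw [covariance_const_mul_left, covariance_const_mul_right, hf.covariance_eq _ (hz i) _ (hz j)]
    ring

/-- The double sum is the variance of `∑ i, s i * f ω (z i)`. -/
lemma IsLipschitzGP.sum_nonneg (hf : IsLipschitzGP P Z k a b f) {ι : Type*} [Fintype ι]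
    {z : ι → Pt Dx Dc} (hz : ∀ i, z i ∈ Z) (s : ι → ℝ) :
    0 ≤ ∑ i, ∑ j, s i * s j * k (z i) (z j) := by
  have hL : ∀ i, MemLp (fun ω => s i * f ω (z i)) 2 P := fun i =>
    (hf.memLp_two (hz i)).const_mul _
  have h := variance_nonneg (fun ω => ∑ i, s i * f ω (z i)) P
  rw [variance_fun_sum hL] at h
  convert h using 4
  rw [covariance_const_mul_left, covariance_const_mul_right, hf.covariance_eq _ (hz _) _ (hz _)]
  ring

open Complex in
lemma IsLipschitzGP.integral_cexp_sum (hf : IsLipschitzGP P Z k a b f) {ι : Type*} [Fintype ι]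
    {z : ι → Pt Dx Dc} (hz : ∀ i, z i ∈ Z) (s : ι → ℝ) :
    ∫ ω, cexp (I * ((∑ i, s i * f ω (z i) : ℝ) : ℂ)) ∂P =
      cexp ((-(∑ i, ∑ j, s i * s j * k (z i) (z j)) / 2 : ℝ) : ℂ) := by
  have h := congrArg (fun μ => charFun μ 1) (hf.map_sum hz s)
  rw [charFun_gaussianReal, charFun_apply_real, integral_map] at h
  · rw [Real.coe_toNNReal _ (hf.sum_nonneg hz s)] at h
    convert! h using 2
    · ext ω
      congr 1
      push_cast
      ring
    · push_cast
      ring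
  · exact (Finset.measurable_sum _ fun i _ => (hf.measurable _ (hz i)).const_mul _).aemeasurable
  · exact Measurable.aestronglyMeasurable (by fun_prop)

lemma IsLipschitzGP.gram_posDef (hf : IsLipschitzGP P Z k a b f) {σ : ℝ} (hσ : 0 < σ) {n : ℕ}
    {z : Fin n → Pt Dx Dc} (hz : ∀ i, z i ∈ Z) : (gram k σ z).PosDef := by
  refine Matrix.PosDef.of_dotProduct_mulVec_pos ?_ fun x hx => ?_
  · ext i j
    simp only [gram, Matrix.conjTranspose_apply, Matrix.add_apply, Matrix.of_apply,
      Matrix.smul_apply, Matrix.one_apply, star_trivial, hf.kernel_comm (hz j) (hz i)]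
    simp [eq_comm]
  · have h1 := hf.sum_nonneg hz x
    have h2 : 0 < ∑ i, σ ^ 2 * (x i) ^ 2 := by
      obtain ⟨i, hi⟩ := Function.ne_iff.1 hx
      simp only [Pi.zero_apply] at hi
      exact Finset.sum_pos' (fun i _ => by positivity) ⟨i, Finset.mem_univ _, by positivity⟩
    have h3 : star x ⬝ᵥ (gram k σ z).mulVec x
        = ∑ i, ∑ j, x i * x j * k (z i) (z j) + ∑ i, σ ^ 2 * (x i) ^ 2 := by
      rw [gram, Matrix.add_mulVec, dotProduct_add, Matrix.smul_mulVec, Matrix.one_mulVec]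
      simp only [star_trivial, dotProduct, Matrix.mulVec, Matrix.of_apply, Pi.smul_apply,
        smul_eq_mul, Finset.mul_sum]
      congr 1
      · exact Finset.sum_congr rfl fun i _ => Finset.sum_congr rfl fun j _ => by ring
      · exact Finset.sum_congr rfl fun i _ => by ring
    rw [h3]
    linarith

lemma IsLipschitzGP.gram_det (hf : IsLipschitzGP P Z k a b f) {σ : ℝ} (hσ : 0 < σ) {n : ℕ}
    {z : Fin n → Pt Dx Dc} (hz : ∀ i, z i ∈ Z) : IsUnit (gram k σ z).det :=
  ((hf.gram_posDef hσ hz).det_pos).ne'.isUnit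

lemma IsLipschitzGP.measurable_likelihood (hf : IsLipschitzGP P Z k a b f) {σ : ℝ} {n : ℕ}
    {z : Fin n → Pt Dx Dc} (hz : ∀ i, z i ∈ Z) (y : Fin n → ℝ) :
    Measurable (fun ω => likelihood σ y (fun i => f ω (z i))) :=
  measurable_const.likelihood σ (measurable_pi_lambda _ fun i => hf.measurable _ (hz i))

lemma IsLipschitzGP.integrable_likelihood (hf : IsLipschitzGP P Z k a b f) {σ : ℝ} {n : ℕ}
    {z : Fin n → Pt Dx Dc} (hz : ∀ i, z i ∈ Z) (y : Fin n → ℝ) :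
    Integrable (fun ω => likelihood σ y (fun i => f ω (z i))) P := by
  refine (integrable_const (Real.exp (∑ i, y i ^ 2 / (2 * σ ^ 2)))).mono' ?_
    (ae_of_all _ fun ω => ?_)
  · exact (hf.measurable_likelihood hz y).aestronglyMeasurable
  · rw [Real.norm_of_nonneg (likelihood_pos _ _ _).le]
    exact likelihood_le _ _ _

/-- The density, at `y`, of noisy observations at `z`, relative to pure noise. -/
noncomputable def evidence (P : Measure Ω) (f : Ω → Pt Dx Dc → ℝ) (σ : ℝ) {n : ℕ}
    (z : Fin n → Pt Dx Dc) (y : Fin n → ℝ) : ℝ :=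
  ∫ ω, likelihood σ y (fun i => f ω (z i)) ∂P

lemma IsLipschitzGP.evidence_pos (hf : IsLipschitzGP P Z k a b f) {σ : ℝ} {n : ℕ}
    {z : Fin n → Pt Dx Dc} (hz : ∀ i, z i ∈ Z) (y : Fin n → ℝ) : 0 < evidence P f σ z y := by
  refine (integral_pos_iff_support_of_nonneg (fun ω => (likelihood_pos _ _ _).le)
    (hf.integrable_likelihood hz y)).2 ?_
  rw [show (Function.support fun ω => likelihood σ y (fun i => f ω (z i))) = Set.univ from
    Set.eq_univ_of_forall fun ω => (likelihood_pos _ _ _).ne']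
  simp

-- The tilt formula for `G = s * f w + s' * f w'`. Two points are needed in order to control
-- posterior covariances and not only variances.
open Complex in
lemma IsLipschitzGP.integral_cexp_mul_likelihood (hf : IsLipschitzGP P Z k a b f) {σ : ℝ}
    (hσ : 0 < σ) {n : ℕ} {z : Fin n → Pt Dx Dc} (hz : ∀ i, z i ∈ Z) (y : Fin n → ℝ)
    {w w' : Pt Dx Dc} (hw : w ∈ Z) (hw' : w' ∈ Z) (s s' : ℝ) :
    ∫ ω, cexp (I * ((s * f ω w + s' * f ω w' : ℝ) : ℂ)) *
        (likelihood σ y (fun i => f ω (z i)) : ℂ) ∂P =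
      cexp (I * ((s * postMean k σ z y w + s' * postMean k σ z y w' : ℝ) : ℂ)
        - ((s ^ 2 * postCov k σ z w w + 2 * s * s' * postCov k σ z w w'
          + s' ^ 2 * postCov k σ z w' w') / 2 : ℝ)) * (evidence P f σ z y : ℂ) := by
  set Km : Matrix (Fin n) (Fin n) ℝ := Matrix.of (fun i j => k (z i) (z j)) with hKm
  have hg : Km + σ ^ 2 • (1 : Matrix (Fin n) (Fin n) ℝ) = gram k σ z := rfl
  set κ : Fin n → ℝ := fun i => k (z i) w
  set κ' : Fin n → ℝ := fun i => k (z i) w'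
  have hsymm : Km.transpose = Km := by
    ext i j
    simp [hKm, hf.kernel_comm (hz j) (hz i)]
  have hG : Measurable (fun ω => s * f ω w + s' * f ω w') :=
    ((hf.measurable _ hw).const_mul _).add ((hf.measurable _ hw').const_mul _)
  have h := DRBO.integral_cexp_mul_likelihood P σ hσ hG
    (measurable_pi_lambda _ fun i => hf.measurable _ (hz i))
    (s ^ 2 * k w w + 2 * s * s' * k w w' + s' ^ 2 * k w' w') (s • κ + s' • κ') Km hsymm
    (by rw [hg]; exact hf.gram_det hσ hz) ?_ y 1
  · simp only [one_mul] at h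
    rw [h, evidence, integral_complex_ofReal]
    congr 1
    rw [hg]
    have ht : ((gram k σ z)⁻¹).transpose = (gram k σ z)⁻¹ := by
      rw [Matrix.transpose_nonsing_inv, ← hg, Matrix.transpose_add, hsymm, Matrix.transpose_smul,
        Matrix.transpose_one]
    have hc : κ' ⬝ᵥ (gram k σ z)⁻¹.mulVec κ = κ ⬝ᵥ (gram k σ z)⁻¹.mulVec κ' := by
      rw [dotProduct_comm, Matrix.dotProduct_mulVec, ← Matrix.mulVec_transpose, ht]
    have e1 : (s • κ + s' • κ') ⬝ᵥ (gram k σ z)⁻¹.mulVec y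
        = s * postMean k σ z y w + s' * postMean k σ z y w' := by
      rw [add_dotProduct, smul_dotProduct, smul_dotProduct]
      rfl
    have e2 : (s • κ + s' • κ') ⬝ᵥ (gram k σ z)⁻¹.mulVec (s • κ + s' • κ')
        = s ^ 2 * (κ ⬝ᵥ (gram k σ z)⁻¹.mulVec κ) + 2 * s * s' * (κ ⬝ᵥ (gram k σ z)⁻¹.mulVec κ')
          + s' ^ 2 * (κ' ⬝ᵥ (gram k σ z)⁻¹.mulVec κ') := by
      rw [Matrix.mulVec_add, Matrix.mulVec_smul, Matrix.mulVec_smul, add_dotProduct,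
        dotProduct_add, dotProduct_add, smul_dotProduct, smul_dotProduct, dotProduct_smul,
        dotProduct_smul, smul_dotProduct, smul_dotProduct, dotProduct_smul, dotProduct_smul, hc]
      simp only [smul_eq_mul]
      ring
    rw [e1, e2]
    congr 2
    simp only [postCov, κ, κ']
    push_cast
    ring
  -- The characteristic function of the prior comes from the Gaussian law of a linear combination
  -- over the design points together with `w` and `w'`.
  · intro r N
    have h1 := hf.integral_cexp_sum (ι := Fin n ⊕ Fin 2) (z := Sum.elim z ![w, w'])
      (by rintro (i | i)
          · exact hz i
          · fin_cases i
            · exact hw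
            · exact hw') (Sum.elim N ![r * s, r * s'])
    simp only [Fintype.sum_sum_type, Fin.sum_univ_two, Sum.elim_inl, Sum.elim_inr,
      Matrix.cons_val_zero, Matrix.cons_val_one] at h1
    have e : ∀ ω, r * (s * f ω w + s' * f ω w') + ∑ i, N i * f ω (z i)
        = ∑ i, N i * f ω (z i) + (r * s * f ω w + r * s' * f ω w') := fun ω => by ring
    simp_rw [e]
    rw [h1]
    congr 2
    congr 2
    simp only [Finset.sum_add_distrib]
    have e1 : N ⬝ᵥ Km.mulVec N = ∑ i, ∑ j, N i * N j * k (z i) (z j) := by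
      simp only [dotProduct, Matrix.mulVec, hKm, Matrix.of_apply, Finset.mul_sum]
      exact Finset.sum_congr rfl fun i _ => Finset.sum_congr rfl fun j _ => by ring
    have e2 : ∑ i, N i * (r * s) * k (z i) w = r * s * ∑ i, N i * k (z i) w := by
      rw [Finset.mul_sum]; exact Finset.sum_congr rfl fun i _ => by ring
    have e2' : ∑ i, N i * (r * s') * k (z i) w' = r * s' * ∑ i, N i * k (z i) w' := by
      rw [Finset.mul_sum]; exact Finset.sum_congr rfl fun i _ => by ring
    have e3 : ∑ i, r * s * N i * k w (z i) = r * s * ∑ i, N i * k (z i) w := by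
      rw [Finset.mul_sum]
      exact Finset.sum_congr rfl fun i _ => by rw [hf.kernel_comm hw (hz i)]; ring
    have e3' : ∑ i, r * s' * N i * k w' (z i) = r * s' * ∑ i, N i * k (z i) w' := by
      rw [Finset.mul_sum]
      exact Finset.sum_congr rfl fun i _ => by rw [hf.kernel_comm hw' (hz i)]; ring
    have e4 : N ⬝ᵥ (s • κ + s' • κ')
        = s * ∑ i, N i * k (z i) w + s' * ∑ i, N i * k (z i) w' := by
      rw [dotProduct_add, dotProduct_smul, dotProduct_smul]
      rfl
    rw [e1, e2, e2', e3, e3', e4, hf.kernel_comm hw' hw]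
    ring

/-- The tilted characteristic function has modulus at most the total mass `evidence`, so the real
exponent in `integral_cexp_mul_likelihood` cannot be positive. -/
lemma IsLipschitzGP.postCov_quadratic_nonneg (hf : IsLipschitzGP P Z k a b f) {σ : ℝ}
    (hσ : 0 < σ) {n : ℕ} {z : Fin n → Pt Dx Dc} (hz : ∀ i, z i ∈ Z)
    {w w' : Pt Dx Dc} (hw : w ∈ Z) (hw' : w' ∈ Z) (s s' : ℝ) :
    0 ≤ s ^ 2 * postCov k σ z w w + 2 * s * s' * postCov k σ z w w'
          + s' ^ 2 * postCov k σ z w' w' := by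
  have h := hf.integral_cexp_mul_likelihood hσ hz 0 hw hw' s s'
  have h1 := norm_integral_le_integral_norm (μ := P) (fun ω =>
    Complex.exp (Complex.I * ((s * f ω w + s' * f ω w' : ℝ) : ℂ)) *
        (likelihood σ 0 (fun i => f ω (z i)) : ℂ))
  rw [h] at h1
  simp only [norm_mul, Complex.norm_exp] at h1
  have hE := hf.evidence_pos (σ := σ) hz 0
  have h2 : ∀ r : ℝ, (Complex.I * (r : ℂ)).re = 0 := by simp
  have h3 : ∀ ω, ‖(likelihood σ 0 (fun i => f ω (z i)) : ℂ)‖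
      = likelihood σ 0 (fun i => f ω (z i)) := fun ω => by
    rw [Complex.norm_of_nonneg (likelihood_pos _ _ _).le]
  simp only [h2, h3, Complex.sub_re, Complex.ofReal_re, Real.exp_zero, one_mul,
    Complex.norm_of_nonneg hE.le] at h1
  have h4 : Real.exp (0 - (s ^ 2 * postCov k σ z w w + 2 * s * s' * postCov k σ z w w'
          + s' ^ 2 * postCov k σ z w' w') / 2) ≤ 1 := by
    by_contra hcon
    push Not at hcon
    have : evidence P f σ z 0 < evidence P f σ z 0 := by
      calc evidence P f σ z 0 = 1 * evidence P f σ z 0 := (one_mul _).symm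
        _ < _ := mul_lt_mul_of_pos_right hcon hE
        _ ≤ evidence P f σ z 0 := h1
    exact lt_irrefl _ this
  have := Real.exp_le_one_iff.1 h4
  linarith

lemma IsLipschitzGP.postCov_nonneg (hf : IsLipschitzGP P Z k a b f) {σ : ℝ}
    (hσ : 0 < σ) {n : ℕ} {z : Fin n → Pt Dx Dc} (hz : ∀ i, z i ∈ Z) {w : Pt Dx Dc} (hw : w ∈ Z) :
    0 ≤ postCov k σ z w w := by
  simpa using hf.postCov_quadratic_nonneg hσ hz hw hw 1 0

lemma IsLipschitzGP.dotProduct_gram_inv_nonneg (hf : IsLipschitzGP P Z k a b f) {σ : ℝ}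
    (hσ : 0 < σ) {n : ℕ} {z : Fin n → Pt Dx Dc} (hz : ∀ i, z i ∈ Z) (κ : Fin n → ℝ) :
    0 ≤ κ ⬝ᵥ (gram k σ z)⁻¹.mulVec κ := by
  have := (hf.gram_posDef hσ hz).inv.posSemidef.dotProduct_mulVec_nonneg κ
  simpa using this

lemma IsLipschitzGP.postCov_le_one (hf : IsLipschitzGP P Z k a b f) {σ : ℝ}
    (hσ : 0 < σ) {n : ℕ} {z : Fin n → Pt Dx Dc} (hz : ∀ i, z i ∈ Z) {w : Pt Dx Dc} (hw : w ∈ Z) :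
    postCov k σ z w w ≤ 1 := by
  have h1 := hf.dotProduct_gram_inv_nonneg hσ hz (fun i => k (z i) w)
  have h2 := hf.kernel_le_one w hw w hw
  unfold postCov
  linarith

/-- A standard deviation is a Hilbert norm, so its increments are at most the posterior standard
deviation of `f w - f w'`, which conditioning can only decrease. This makes the posterior standard
deviation Lipschitz, uniformly in the design. -/
lemma IsLipschitzGP.sqrt_postCov_le (hf : IsLipschitzGP P Z k a b f) {σ : ℝ}
    (hσ : 0 < σ) {n : ℕ} {z : Fin n → Pt Dx Dc} (hz : ∀ i, z i ∈ Z)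
    {w w' : Pt Dx Dc} (hw : w ∈ Z) (hw' : w' ∈ Z) :
    √(postCov k σ z w w) ≤ √(postCov k σ z w' w') + √(∫ ω, (f ω w - f ω w') ^ 2 ∂P) := by
  set A := postCov k σ z w w
  set D := postCov k σ z w' w'
  set B := postCov k σ z w w'
  have hq := hf.postCov_quadratic_nonneg hσ hz hw hw'
  have hA : 0 ≤ A := hf.postCov_nonneg hσ hz hw
  have hD : 0 ≤ D := hf.postCov_nonneg hσ hz hw'
  have hB : B ≤ √A * √D := by
    have h := hq (√D) (-√A)
    rw [Real.sq_sqrt hD, neg_sq, Real.sq_sqrt hA] at h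
    change 0 ≤ D * A + 2 * √D * -√A * B + A * D at h
    by_contra hcon
    push Not at hcon
    -- When one of the variances vanishes, the form is affine in one coefficient, and a suitable
    -- value of it would make the form negative if `B` were positive.
    rcases eq_or_lt_of_le hA with h0 | h0
    · rw [← h0, Real.sqrt_zero, zero_mul] at hcon
      have h' := hq (-(D + 1) / B) 1
      change 0 ≤ (-(D + 1) / B) ^ 2 * A + 2 * (-(D + 1) / B) * 1 * B + 1 ^ 2 * D at h'
      rw [← h0] at h'
      have : 2 * (-(D + 1) / B) * 1 * B = -2 * (D + 1) := by field_simp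
      rw [this] at h'
      nlinarith
    rcases eq_or_lt_of_le hD with h1 | h1
    · rw [← h1, Real.sqrt_zero, mul_zero] at hcon
      have h' := hq 1 (-(A + 1) / B)
      change 0 ≤ 1 ^ 2 * A + 2 * 1 * (-(A + 1) / B) * B + (-(A + 1) / B) ^ 2 * D at h'
      rw [← h1] at h'
      have : 2 * 1 * (-(A + 1) / B) * B = -2 * (A + 1) := by field_simp
      rw [this] at h'
      nlinarith
    have hs : 0 < √A * √D := mul_pos (Real.sqrt_pos.2 h0) (Real.sqrt_pos.2 h1)
    have hAD : A * D = (√A * √D) * (√A * √D) := by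
      nlinarith [Real.sq_sqrt hA, Real.sq_sqrt hD]
    nlinarith
  -- Expanded, the left side is the prior variance of the increment minus a value of the quadratic
  -- form of the inverse matrix, which is nonnegative.
  have hk : A - 2 * B + D ≤ ∫ ω, (f ω w - f ω w') ^ 2 ∂P := by
    have e : ∫ ω, (f ω w - f ω w') ^ 2 ∂P = k w w - 2 * k w w' + k w' w' := by
      rw [← hf.integral_mul hw hw, ← hf.integral_mul hw hw', ← hf.integral_mul hw' hw',
        ← integral_const_mul]
      have i1 : Integrable (fun ω => f ω w * f ω w) P := (hf.memLp_two hw).integrable_mul (hf.memLp_two hw)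
      have i2 : Integrable (fun ω => f ω w * f ω w') P := (hf.memLp_two hw).integrable_mul (hf.memLp_two hw')
      have i3 : Integrable (fun ω => f ω w' * f ω w') P := (hf.memLp_two hw').integrable_mul (hf.memLp_two hw')
      rw [← integral_sub i1 (i2.const_mul 2), ← integral_add
        (f := fun ω => f ω w * f ω w - 2 * (f ω w * f ω w')) (i1.sub (i2.const_mul 2)) i3]
      congr 1
      ext ω
      ring
    rw [e]
    have h := hf.dotProduct_gram_inv_nonneg hσ hz
      ((fun i => k (z i) w) - (fun i => k (z i) w'))
    have hc : (fun i => k (z i) w') ⬝ᵥ (gram k σ z)⁻¹.mulVec (fun i => k (z i) w)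
        = (fun i => k (z i) w) ⬝ᵥ (gram k σ z)⁻¹.mulVec (fun i => k (z i) w') := by
      have ht : ((gram k σ z)⁻¹).transpose = (gram k σ z)⁻¹ := by
        have := (hf.gram_posDef hσ hz).inv.isHermitian
        simpa [Matrix.IsHermitian, Matrix.conjTranspose_eq_transpose_of_trivial] using this
      rw [dotProduct_comm, Matrix.dotProduct_mulVec, ← Matrix.mulVec_transpose, ht]
    rw [Matrix.mulVec_sub, dotProduct_sub, sub_dotProduct, sub_dotProduct, hc] at h
    simp only [A, B, D, postCov]
    linarith
  have h1 : (√A - √D) ^ 2 ≤ ∫ ω, (f ω w - f ω w') ^ 2 ∂P := by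
    nlinarith [Real.sq_sqrt hA, Real.sq_sqrt hD]
  have := Real.le_sqrt_of_sq_le h1
  linarith

/-- The posterior distribution of a value of the Gaussian process. -/
theorem IsLipschitzGP.map_withDensity_likelihood (hf : IsLipschitzGP P Z k a b f) {σ : ℝ}
    (hσ : 0 < σ) {n : ℕ} {z : Fin n → Pt Dx Dc} (hz : ∀ i, z i ∈ Z) (y : Fin n → ℝ)
    {w : Pt Dx Dc} (hw : w ∈ Z) :
    (P.withDensity (fun ω => ENNReal.ofReal (likelihood σ y (fun i => f ω (z i))))).map
        (fun ω => f ω w) =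
      ENNReal.ofReal (evidence P f σ z y) •
        gaussianReal (postMean k σ z y w) (Real.toNNReal (postCov k σ z w w)) := by
  have hlm : Measurable (fun ω => likelihood σ y (fun i => f ω (z i))) :=
    hf.measurable_likelihood hz y
  have hfin : IsFiniteMeasure
      (P.withDensity (fun ω => ENNReal.ofReal (likelihood σ y (fun i => f ω (z i))))) :=
    isFiniteMeasure_withDensity_ofReal (hf.integrable_likelihood hz y).2
  have hfin2 : IsFiniteMeasure (ENNReal.ofReal (evidence P f σ z y) •
        gaussianReal (postMean k σ z y w) (Real.toNNReal (postCov k σ z w w))) :=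
    Measure.smul_finite _ ENNReal.ofReal_ne_top
  -- Both are finite measures, and the two-point formula with `s' = 0` identifies their
  -- characteristic functions.
  apply Measure.ext_of_charFun
  ext s
  have hE := hf.evidence_pos (σ := σ) hz y
  rw [charFun_apply_real, integral_map (hf.measurable _ hw).aemeasurable
    (Measurable.aestronglyMeasurable (by fun_prop)),
    integral_withDensity_eq_integral_toReal_smul (by fun_prop) (by simp), charFun_apply_real,
    integral_smul_measure, ← charFun_apply_real, charFun_gaussianReal,
    Real.coe_toNNReal _ (hf.postCov_nonneg hσ hz hw), ENNReal.toReal_ofReal hE.le]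
  have h := hf.integral_cexp_mul_likelihood hσ hz y hw hw s 0
  simp only [zero_mul, add_zero, mul_zero, ne_eq, OfNat.ofNat_ne_zero, not_false_eq_true,
    zero_pow] at h
  rw [Complex.real_smul, mul_comm]
  convert! h using 1
  · congr 1
    ext ω
    rw [ENNReal.toReal_ofReal (likelihood_pos _ _ _).le, Complex.real_smul, mul_comm]
    congr 2
    push_cast
    ring
  · congr 2
    push_cast
    ring

lemma IsLipschitzGP.lintegral_likelihood_mul (hf : IsLipschitzGP P Z k a b f) {σ : ℝ}
    (hσ : 0 < σ) {n : ℕ} {z : Fin n → Pt Dx Dc} (hz : ∀ i, z i ∈ Z) (y : Fin n → ℝ)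
    {w : Pt Dx Dc} (hw : w ∈ Z) {φ : ℝ → ENNReal} (hφ : Measurable φ) :
    ∫⁻ ω, ENNReal.ofReal (likelihood σ y (fun i => f ω (z i))) * φ (f ω w) ∂P =
      ENNReal.ofReal (evidence P f σ z y) *
        ∫⁻ v, φ v ∂gaussianReal (postMean k σ z y w) (Real.toNNReal (postCov k σ z w w)) := by
  have hlm : Measurable (fun ω => likelihood σ y (fun i => f ω (z i))) :=
    hf.measurable_likelihood hz y
  have h := congrArg (fun μ => ∫⁻ v, φ v ∂μ) (hf.map_withDensity_likelihood hσ hz y hw)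
  simp only [lintegral_smul_measure, smul_eq_mul] at h
  rw [← h, lintegral_map hφ (hf.measurable _ hw),
    lintegral_withDensity_eq_lintegral_mul _ (by fun_prop)
      (g := fun ω => φ (f ω w)) (hφ.comp (hf.measurable _ hw))]
  rfl

lemma IsLipschitzGP.integral_likelihood_mul (hf : IsLipschitzGP P Z k a b f) {σ : ℝ}
    (hσ : 0 < σ) {n : ℕ} {z : Fin n → Pt Dx Dc} (hz : ∀ i, z i ∈ Z) (y : Fin n → ℝ)
    {w : Pt Dx Dc} (hw : w ∈ Z) {φ : ℝ → ℝ} (hφ : Measurable φ) :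
    ∫ ω, likelihood σ y (fun i => f ω (z i)) * φ (f ω w) ∂P =
      evidence P f σ z y *
        ∫ v, φ v ∂gaussianReal (postMean k σ z y w) (Real.toNNReal (postCov k σ z w w)) := by
  have hlm : Measurable (fun ω => likelihood σ y (fun i => f ω (z i))) :=
    hf.measurable_likelihood hz y
  have h := congrArg (fun μ => ∫ v, φ v ∂μ) (hf.map_withDensity_likelihood hσ hz y hw)
  simp only [integral_smul_measure, smul_eq_mul,
    ENNReal.toReal_ofReal (hf.evidence_pos (σ := σ) hz y).le] at h
  rw [← h, integral_map (hf.measurable _ hw).aemeasurable hφ.aestronglyMeasurable,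
    integral_withDensity_eq_integral_toReal_smul (by fun_prop) (by simp)]
  congr 1
  ext ω
  rw [ENNReal.toReal_ofReal (likelihood_pos _ _ _).le, smul_eq_mul]

end GaussianValues

end DRBO

/-! ### Evidence, information gain and posterior variances. -/

namespace DRBO

lemma toNNReal_sq_ne_zero {σ : ℝ} (hσ : 0 < σ) : Real.toNNReal (σ ^ 2) ≠ 0 := by
  simpa using hσ.ne'

/-- The shifted Gaussian measure as a tilt of the centered one. -/
lemma gaussianReal_eq_withDensity {σ : ℝ} (hσ : 0 < σ) (m : ℝ) :
    gaussianReal m (Real.toNNReal (σ ^ 2)) =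
      (gaussianReal 0 (Real.toNNReal (σ ^ 2))).withDensity
        (fun y => ENNReal.ofReal (Real.exp ((y * m - m ^ 2 / 2) / σ ^ 2))) := by
  rw [gaussianReal_of_var_ne_zero _ (toNNReal_sq_ne_zero hσ),
    gaussianReal_of_var_ne_zero _ (toNNReal_sq_ne_zero hσ),
    ← withDensity_mul _ (measurable_gaussianPDF _ _) (by fun_prop)]
  congr 1
  ext y
  rw [Pi.mul_apply, gaussianPDF, gaussianPDF, ← ENNReal.ofReal_mul (gaussianPDFReal_nonneg _ _ _)]
  congr 1
  rw [gaussianPDFReal, gaussianPDFReal, mul_assoc (√_)⁻¹ (Real.exp _), ← Real.exp_add,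
    Real.coe_toNNReal _ (sq_nonneg σ)]
  congr 2
  field_simp
  ring

/-- Exchanges the true value plus noise for pure noise, at the price of a likelihood factor. This is
the step by which the disintegration of histories proceeds. -/
lemma lintegral_gaussianReal_shift {σ : ℝ} (hσ : 0 < σ) (m : ℝ) {φ : ℝ → ENNReal}
    (hφ : Measurable φ) :
    ∫⁻ e, φ (m + e) ∂gaussianReal 0 (Real.toNNReal (σ ^ 2)) =
      ∫⁻ y, ENNReal.ofReal (Real.exp ((y * m - m ^ 2 / 2) / σ ^ 2)) * φ y
        ∂gaussianReal 0 (Real.toNNReal (σ ^ 2)) := by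
  have h := gaussianReal_map_const_add (μ := 0) (v := Real.toNNReal (σ ^ 2)) m
  rw [zero_add, gaussianReal_eq_withDensity hσ m] at h
  rw [← lintegral_map (f := φ) hφ (by fun_prop : Measurable fun e : ℝ => m + e), h,
    lintegral_withDensity_eq_lintegral_mul _ (by fun_prop) hφ]
  rfl

/-- On boxes the integral of the product density factorizes, because coordinates are independent
under the product measure. -/
lemma pi_withDensity {n : ℕ} {μ : Fin n → Measure ℝ} [∀ i, IsProbabilityMeasure (μ i)]
    {g : Fin n → ℝ → ENNReal} (hg : ∀ i, Measurable (g i))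
    [∀ i, SigmaFinite ((μ i).withDensity (g i))] :
    Measure.pi (fun i => (μ i).withDensity (g i)) =
      (Measure.pi μ).withDensity (fun x => ∏ i, g i (x i)) := by
  refine Measure.pi_eq fun s hs => ?_
  rw [withDensity_apply _ (MeasurableSet.univ_pi hs), ← lintegral_indicator (MeasurableSet.univ_pi hs)]
  have h1 : (Set.univ.pi s).indicator (fun x : Fin n → ℝ => ∏ i, g i (x i))
      = fun x => ∏ i, (s i).indicator (g i) (x i) := by
    ext x
    by_cases hx : x ∈ Set.univ.pi s
    · rw [Set.indicator_of_mem hx]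
      exact Finset.prod_congr rfl fun i _ => (Set.indicator_of_mem (hx i trivial) _).symm
    · rw [Set.indicator_of_notMem hx]
      simp only [Set.mem_pi, Set.mem_univ, true_implies, not_forall] at hx
      obtain ⟨i, hi⟩ := hx
      exact (Finset.prod_eq_zero (Finset.mem_univ i) (Set.indicator_of_notMem hi _)).symm
  have hind : iIndepFun (fun i (x : Fin n → ℝ) => (s i).indicator (g i) (x i)) (Measure.pi μ) :=
    iIndepFun_pi (fun i => ((hg i).indicator (hs i)).aemeasurable)
  rw [h1, lintegral_prod_eq_prod_lintegral_of_indepFun _ _ hind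
    (fun i => ((hg i).indicator (hs i)).comp (measurable_pi_apply i))]
  refine Finset.prod_congr rfl fun i _ => ?_
  rw [withDensity_apply _ (hs i), ← lintegral_indicator (hs i),
    (measurePreserving_eval μ i).lintegral_comp ((hg i).indicator (hs i))]

lemma pi_gaussianReal_map_add {σ : ℝ} (hσ : 0 < σ) {n : ℕ} (v : Fin n → ℝ) :
    (Measure.pi fun _ : Fin n => gaussianReal 0 (Real.toNNReal (σ ^ 2))).map (fun e => v + e) =
      (Measure.pi fun _ : Fin n => gaussianReal 0 (Real.toNNReal (σ ^ 2))).withDensity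
        (fun y => ENNReal.ofReal (likelihood σ y v)) := by
  have h1 : (fun e : Fin n → ℝ => v + e) = fun e i => v i + e i := rfl
  have h2 : ∀ i, (gaussianReal 0 (Real.toNNReal (σ ^ 2))).map (fun e => v i + e)
      = (gaussianReal 0 (Real.toNNReal (σ ^ 2))).withDensity
        (fun y => ENNReal.ofReal (Real.exp ((y * v i - v i ^ 2 / 2) / σ ^ 2))) := fun i => by
    rw [gaussianReal_map_const_add, zero_add, gaussianReal_eq_withDensity hσ]
  have h3 : ∀ i, SigmaFinite ((gaussianReal 0 (Real.toNNReal (σ ^ 2))).map (fun e => v i + e)) :=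
    fun i => by rw [gaussianReal_map_const_add]; infer_instance
  rw [h1, Measure.pi_map_pi (f := fun i e => v i + e) (fun i => by fun_prop)]
  have h4 : ∀ i, SigmaFinite ((gaussianReal 0 (Real.toNNReal (σ ^ 2))).withDensity
        (fun y => ENNReal.ofReal (Real.exp ((y * v i - v i ^ 2 / 2) / σ ^ 2)))) := fun i => by
    rw [← h2]; exact h3 i
  simp_rw [h2]
  rw [pi_withDensity (fun i => by fun_prop)]
  congr 1
  ext y
  rw [likelihood, Real.exp_sum, ENNReal.ofReal_prod_of_nonneg fun i _ => (Real.exp_pos _).le]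

/-- The evidence of one noisy observation of a Gaussian variable. -/
lemma integral_exp_gaussianReal {σ : ℝ} (hσ : 0 < σ) (m y : ℝ) {v : ℝ} (hv : 0 ≤ v) :
    ∫ x, Real.exp ((y * x - x ^ 2 / 2) / σ ^ 2) ∂gaussianReal m (Real.toNNReal v) =
      √(σ ^ 2 / (v + σ ^ 2)) *
        Real.exp (y ^ 2 / (2 * σ ^ 2) - (y - m) ^ 2 / (2 * (v + σ ^ 2))) := by
  rcases eq_or_lt_of_le hv with h0 | h0
  · rw [← h0, Real.toNNReal_zero, gaussianReal_zero_var, integral_dirac, zero_add,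
      div_self (by positivity), Real.sqrt_one, one_mul]
    congr 1
    field_simp
    ring
  · have hv0 : Real.toNNReal v ≠ 0 := by simpa using h0
    -- Variance and mean of the Gaussian variable conditioned on the observation `y`, found by
    -- completing the square; the remaining factor is the evidence.
    set w := v * σ ^ 2 / (v + σ ^ 2) with hw
    have hwpos : 0 < w := by positivity
    have hw0 : Real.toNNReal w ≠ 0 := by simpa using hwpos
    set c := (m * σ ^ 2 + y * v) / (v + σ ^ 2)
    rw [integral_gaussianReal_eq_integral_smul hv0]
    have h1 : ∀ x, gaussianPDFReal m (Real.toNNReal v) x • Real.exp ((y * x - x ^ 2 / 2) / σ ^ 2)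
        = (√(σ ^ 2 / (v + σ ^ 2)) *
        Real.exp (y ^ 2 / (2 * σ ^ 2) - (y - m) ^ 2 / (2 * (v + σ ^ 2)))) *
          gaussianPDFReal c (Real.toNNReal w) x := by
      intro x
      rw [smul_eq_mul, gaussianPDFReal, gaussianPDFReal, Real.coe_toNNReal _ hv,
        Real.coe_toNNReal _ hwpos.le, mul_assoc, ← Real.exp_add]
      have e1 : (√(2 * Real.pi * v))⁻¹ = √(σ ^ 2 / (v + σ ^ 2)) * (√(2 * Real.pi * w))⁻¹ := by
        rw [← Real.sqrt_inv, ← Real.sqrt_inv, ← Real.sqrt_mul (by positivity)]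
        congr 1
        rw [hw]
        field_simp
      have e2 : -(x - m) ^ 2 / (2 * v) + (y * x - x ^ 2 / 2) / σ ^ 2
          = y ^ 2 / (2 * σ ^ 2) - (y - m) ^ 2 / (2 * (v + σ ^ 2)) + -(x - c) ^ 2 / (2 * w) := by
        simp only [w, c]
        field_simp
        ring
      rw [e1, e2, Real.exp_add]
      ring
    simp_rw [h1]
    rw [integral_const_mul, integral_gaussianPDFReal_eq_one _ hw0, mul_one]

section InformationGain

variable {Ω : Type*} [MeasurableSpace Ω] {P : Measure Ω} [IsProbabilityMeasure P] {Dx Dc : ℕ}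
  {Z : Set (Pt Dx Dc)} {k : Pt Dx Dc → Pt Dx Dc → ℝ} {a b : ℝ} {f : Ω → Pt Dx Dc → ℝ}

/-- Chain rule: given the first `n` observations, the value at `z n` is normal with the posterior
mean and variance, so one more observation multiplies the evidence by that of a single Gaussian
variable. -/
lemma IsLipschitzGP.evidence_succ (hf : IsLipschitzGP P Z k a b f) {σ : ℝ} (hσ : 0 < σ)
    {z : ℕ → Pt Dx Dc} (hz : ∀ i, z i ∈ Z) (y : ℕ → ℝ) (n : ℕ) :
    evidence P f σ (fun i : Fin (n + 1) => z i) (fun i => y i) =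
      evidence P f σ (fun i : Fin n => z i) (fun i => y i) *
        (√(σ ^ 2 / (postCov k σ (fun i : Fin n => z i) (z n) (z n) + σ ^ 2)) *
          Real.exp (y n ^ 2 / (2 * σ ^ 2)
            - (y n - postMean k σ (fun i : Fin n => z i) (fun i => y i) (z n)) ^ 2
              / (2 * (postCov k σ (fun i : Fin n => z i) (z n) (z n) + σ ^ 2)))) := by
  have h := hf.integral_likelihood_mul hσ (z := fun i : Fin n => z i) (fun i => hz i)
    (fun i => y i) (hz n) (φ := fun v => Real.exp ((y n * v - v ^ 2 / 2) / σ ^ 2)) (by fun_prop)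
  rw [integral_exp_gaussianReal hσ _ _ (hf.postCov_nonneg hσ (fun i => hz i) (hz n))] at h
  rw [← h, evidence]
  congr 1
  ext ω
  simp only [likelihood]
  rw [Fin.sum_univ_castSucc, Real.exp_add]
  rfl

/-- The logarithm of the posterior odds, as a sum over the observations. -/
lemma IsLipschitzGP.sum_sub_log_evidence (hf : IsLipschitzGP P Z k a b f) {σ : ℝ} (hσ : 0 < σ)
    {z : ℕ → Pt Dx Dc} (hz : ∀ i, z i ∈ Z) (y v : ℕ → ℝ) (T : ℕ) :
    Real.log (likelihood σ (fun i : Fin T => y i) (fun i => v i)) -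
      Real.log (evidence P f σ (fun i : Fin T => z i) (fun i => y i)) =
    ∑ n ∈ Finset.range T, (1 / 2 * Real.log (1 + postCov k σ (fun i : Fin n => z i) (z n) (z n) / σ ^ 2)
      - (y n - v n) ^ 2 / (2 * σ ^ 2)
      + (y n - postMean k σ (fun i : Fin n => z i) (fun i => y i) (z n)) ^ 2
              / (2 * (postCov k σ (fun i : Fin n => z i) (z n) (z n) + σ ^ 2))) := by
  induction T with
  | zero => simp [likelihood, evidence]
  | succ n ih =>
    rw [Finset.sum_range_succ, ← ih, hf.evidence_succ hσ hz]
    have hV := hf.postCov_nonneg hσ (z := fun i : Fin n => z i) (fun i => hz i) (hz n)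
    have hE := hf.evidence_pos (σ := σ) (z := fun i : Fin n => z i) (fun i => hz i) (fun i => y i)
    rw [Real.log_mul hE.ne' (by positivity), Real.log_mul (by positivity) (Real.exp_pos _).ne',
      Real.log_exp, Real.log_sqrt (by positivity)]
    have e1 : Real.log (σ ^ 2 / (postCov k σ (fun i : Fin n => z i) (z n) (z n) + σ ^ 2))
        = - Real.log (1 + postCov k σ (fun i : Fin n => z i) (z n) (z n) / σ ^ 2) := by
      rw [← Real.log_inv]
      congr 1
      field_simp
      ring
    rw [e1]
    simp only [likelihood, Real.log_exp]
    rw [Fin.sum_univ_castSucc]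
    simp only [Fin.val_castSucc, Fin.val_last]
    generalize Real.log (1 + _) = l
    generalize ∑ i : Fin n, (y i * v i - v i ^ 2 / 2) / σ ^ 2 = l'
    field_simp
    ring

lemma IsLipschitzGP.integral_obs_mul (hf : IsLipschitzGP P Z k a b f) {σ : ℝ}
    {e : ℕ → Ω → ℝ} (hem : ∀ i, Measurable (e i))
    (hel : ∀ i, P.map (e i) = gaussianReal 0 (Real.toNNReal (σ ^ 2))) (hei : iIndepFun e P)
    (hfe : ∀ z ∈ Z, ∀ i, IndepFun (fun ω => f ω z) (e i) P)
    {z : ℕ → Pt Dx Dc} (hz : ∀ i, z i ∈ Z) (i j : ℕ) :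
    MemLp (fun ω => f ω (z i) + e i ω) 2 P ∧
    ∫ ω, (f ω (z i) + e i ω) * (f ω (z j) + e j ω) ∂P =
      k (z i) (z j) + if i = j then σ ^ 2 else 0 := by
  have hL : ∀ i, MemLp (e i) 2 P := fun i => by
    have h := memLp_id_gaussianReal' (μ := 0) (v := Real.toNNReal (σ ^ 2)) 2 (by simp)
    rw [← hel i] at h
    simpa using h.comp_of_map (hem i).aemeasurable
  have h0 : ∀ i, ∫ ω, e i ω ∂P = 0 := fun i => by
    have h := integral_id_gaussianReal (μ := 0) (v := Real.toNNReal (σ ^ 2))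
    rw [← hel i, integral_map (hem i).aemeasurable (by fun_prop)] at h
    exact h
  refine ⟨(hf.memLp_two (hz i)).add (hL i), ?_⟩
  have hee : ∫ ω, e i ω * e j ω ∂P = if i = j then σ ^ 2 else 0 := by
    split_ifs with hij
    · subst hij
      have h := variance_id_gaussianReal (μ := 0) (v := Real.toNNReal (σ ^ 2))
      rw [← hel i, variance_map (by fun_prop) (hem i).aemeasurable, Function.id_comp,
        variance_eq_sub (hL i), h0, Real.coe_toNNReal _ (sq_nonneg σ)] at h
      rw [← h]
      simp [pow_two]
    · have := (hei.indepFun hij).integral_mul_eq_mul_integral (hem i).aestronglyMeasurable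
        (hem j).aestronglyMeasurable
      simpa [h0] using this
  have hfe' : ∀ i j, ∫ ω, f ω (z i) * e j ω ∂P = 0 := fun i j => by
    have := (hfe (z i) (hz i) j).integral_mul_eq_mul_integral
      (hf.measurable _ (hz i)).aestronglyMeasurable (hem j).aestronglyMeasurable
    simpa [h0] using this
  have i1 : Integrable (fun ω => f ω (z i) * f ω (z j)) P :=
    (hf.memLp_two (hz i)).integrable_mul (hf.memLp_two (hz j))
  have i2 : Integrable (fun ω => f ω (z i) * e j ω) P := (hf.memLp_two (hz i)).integrable_mul (hL j)
  have i3 : Integrable (fun ω => f ω (z j) * e i ω) P := (hf.memLp_two (hz j)).integrable_mul (hL i)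
  have i4 : Integrable (fun ω => e i ω * e j ω) P := (hL i).integrable_mul (hL j)
  calc ∫ ω, (f ω (z i) + e i ω) * (f ω (z j) + e j ω) ∂P
      = ∫ ω, ((f ω (z i) * f ω (z j) + f ω (z i) * e j ω)
          + (f ω (z j) * e i ω + e i ω * e j ω)) ∂P := by congr 1; ext ω; ring
    _ = _ := by
      rw [integral_add (f := fun ω => f ω (z i) * f ω (z j) + f ω (z i) * e j ω)
        (g := fun ω => f ω (z j) * e i ω + e i ω * e j ω) (i1.add i2) (i3.add i4),
        integral_add i1 i2, integral_add i3 i4, hf.integral_mul (hz i) (hz j), hfe', hfe', hee]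
      ring

/-- The posterior mean is the linear predictor with coefficients `α = S⁻¹ κ`, where `S` is the
second moment matrix of the observations. Expanding the square, the cross term and the quadratic
term are both `κ ⬝ᵥ α`, up to the factor `-2`. -/
lemma IsLipschitzGP.integral_obs_sub_postMean (hf : IsLipschitzGP P Z k a b f) {σ : ℝ} (hσ : 0 < σ)
    {e : ℕ → Ω → ℝ} (hem : ∀ i, Measurable (e i))
    (hel : ∀ i, P.map (e i) = gaussianReal 0 (Real.toNNReal (σ ^ 2))) (hei : iIndepFun e P)
    (hfe : ∀ z ∈ Z, ∀ i, IndepFun (fun ω => f ω z) (e i) P)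
    {z : ℕ → Pt Dx Dc} (hz : ∀ i, z i ∈ Z) (n : ℕ) :
    Integrable (fun ω => (f ω (z n) + e n ω - postMean k σ (fun i : Fin n => z i)
        (fun i => f ω (z i) + e i ω) (z n)) ^ 2) P ∧
    ∫ ω, (f ω (z n) + e n ω - postMean k σ (fun i : Fin n => z i)
        (fun i => f ω (z i) + e i ω) (z n)) ^ 2 ∂P =
      postCov k σ (fun i : Fin n => z i) (z n) (z n) + σ ^ 2 := by
  set Y : ℕ → Ω → ℝ := fun i ω => f ω (z i) + e i ω
  have hY := hf.integral_obs_mul hem hel hei hfe hz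
  set S := gram k σ (fun i : Fin n => z i) with hS
  set κ : Fin n → ℝ := fun i => k (z i) (z n) with hκ
  set α := S⁻¹.mulVec κ with hα
  have hdet : IsUnit S.det := hf.gram_det hσ fun i => hz i
  have hSt : S⁻¹.transpose = S⁻¹ := by
    have := (hf.gram_posDef hσ (z := fun i : Fin n => z i) fun i => hz i).inv.isHermitian
    simpa [Matrix.IsHermitian, Matrix.conjTranspose_eq_transpose_of_trivial] using this
  have hm : ∀ ω, postMean k σ (fun i : Fin n => z i) (fun i => Y i ω) (z n)
      = ∑ i, α i * Y i ω := by
    intro ω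
    rw [postMean, Matrix.dotProduct_mulVec, ← Matrix.mulVec_transpose, ← hS, hSt]
    rfl
  have i1 : ∀ i j, Integrable (fun ω => Y i ω * Y j ω) P := fun i j =>
    ((hY i i).1).integrable_mul ((hY j j).1)
  have hS' : ∀ i j : Fin n, ∫ ω, Y i ω * Y j ω ∂P = S i j := by
    intro i j
    rw [(hY i j).2, hS, gram]
    simp [Matrix.one_apply, Fin.ext_iff]
  have hex : ∀ ω, (Y n ω - ∑ i : Fin n, α i * Y i ω) ^ 2 = Y n ω * Y n ω
      - 2 * ∑ i : Fin n, α i * (Y i ω * Y n ω)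
      + ∑ i : Fin n, ∑ j : Fin n, α i * α j * (Y i ω * Y j ω) := by
    intro ω
    have : ∑ i : Fin n, ∑ j : Fin n, α i * α j * (Y i ω * Y j ω)
        = (∑ i : Fin n, α i * Y i ω) * ∑ i : Fin n, α i * Y i ω := by
      rw [Finset.sum_mul_sum]
      exact Finset.sum_congr rfl fun i _ => Finset.sum_congr rfl fun j _ => by ring
    have h2 : ∑ i : Fin n, α i * (Y i ω * Y n ω) = (∑ i : Fin n, α i * Y i ω) * Y n ω := by
      rw [Finset.sum_mul]
      exact Finset.sum_congr rfl fun i _ => by ring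
    rw [this, h2]
    ring
  have i2 : Integrable (fun ω => ∑ i : Fin n, α i * (Y i ω * Y n ω)) P :=
    integrable_finsetSum _ fun i _ => (i1 i n).const_mul _
  have i3 : Integrable (fun ω => ∑ i : Fin n, ∑ j : Fin n, α i * α j * (Y i ω * Y j ω)) P :=
    integrable_finsetSum _ fun i _ => integrable_finsetSum _ fun j _ => (i1 i j).const_mul _
  change Integrable (fun ω => (Y n ω - postMean k σ (fun i : Fin n => z i)
      (fun i => Y i ω) (z n)) ^ 2) P ∧ ∫ ω, (Y n ω - postMean k σ (fun i : Fin n => z i)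
      (fun i => Y i ω) (z n)) ^ 2 ∂P = _
  simp_rw [hm, hex]
  have i4 : Integrable (fun ω => Y n ω * Y n ω - 2 * ∑ i : Fin n, α i * (Y i ω * Y n ω)) P :=
    (i1 n n).sub (i2.const_mul 2)
  refine ⟨i4.add i3, ?_⟩
  rw [integral_add i4 i3, integral_sub (i1 n n) (i2.const_mul 2), integral_const_mul]
  have e1 : ∫ ω, ∑ i : Fin n, α i * (Y i ω * Y n ω) ∂P = κ ⬝ᵥ α := by
    rw [dotProduct, integral_finsetSum _ fun (i : Fin n) _ => (i1 i n).const_mul (α i)]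
    refine Finset.sum_congr rfl fun i _ => ?_
    rw [integral_const_mul, (hY i n).2, if_neg (by omega), add_zero, mul_comm]
  have e2 : ∫ ω, ∑ i : Fin n, ∑ j : Fin n, α i * α j * (Y i ω * Y j ω) ∂P = κ ⬝ᵥ α := by
    rw [integral_finsetSum _ fun (i : Fin n) _ => integrable_finsetSum _ fun (j : Fin n) _ =>
      (i1 i j).const_mul (α i * α j)]
    have : S.mulVec α = κ := by
      rw [hα, Matrix.mulVec_mulVec, Matrix.mul_nonsing_inv _ hdet, Matrix.one_mulVec]
    rw [← this, dotProduct_comm]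
    simp only [dotProduct, Matrix.mulVec, Finset.mul_sum]
    refine Finset.sum_congr rfl fun i _ => ?_
    rw [integral_finsetSum _ fun (j : Fin n) _ => (i1 i j).const_mul (α i * α j)]
    refine Finset.sum_congr rfl fun j _ => ?_
    rw [integral_const_mul, hS']
    ring
  rw [e1, e2, (hY n n).2, if_pos rfl, postCov]
  change _ = k (z n) (z n) - κ ⬝ᵥ α + σ ^ 2
  ring

/-- The information gain of a design, in terms of the posterior variances. -/
theorem IsLipschitzGP.infoGain_eq (hf : IsLipschitzGP P Z k a b f) {σ : ℝ} (hσ : 0 < σ)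
    {ε : ℕ → Ω → ℝ} (hem : ∀ i, Measurable (ε i))
    (hel : ∀ i, P.map (ε i) = gaussianReal 0 (Real.toNNReal (σ ^ 2))) (hei : iIndepFun ε P)
    (hfe : IndepFun (fun ω (z : Z) => f ω z) (fun ω t => ε t ω) P)
    {z : ℕ → Pt Dx Dc} (hz : ∀ i, z i ∈ Z) (T : ℕ) :
    infoGain P f ε (fun i : Fin T => z i) = ENNReal.ofReal (∑ n ∈ Finset.range T,
      1 / 2 * Real.log (1 + postCov k σ (fun i : Fin n => z i) (z n) (z n) / σ ^ 2)) := by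
  -- Design points are numbered from 0 here, but the noise in `infoGain` starts at index 1.
  set e : ℕ → Ω → ℝ := fun i => ε (i + 1) with he
  have hei' : iIndepFun e P := hei.precomp (add_left_injective 1)
  have hem' : ∀ i, Measurable (e i) := fun i => hem _
  have hel' : ∀ i, P.map (e i) = gaussianReal 0 (Real.toNNReal (σ ^ 2)) := fun i => hel _
  set F : Ω → Fin T → ℝ := fun ω i => f ω (z i) with hF
  set E : Ω → Fin T → ℝ := fun ω i => e i ω with hE
  have hFm : Measurable F := measurable_pi_lambda _ fun i => hf.measurable _ (hz i)
  have hEm : Measurable E := measurable_pi_lambda _ fun i => hem' i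
  have hfe' : ∀ z ∈ Z, ∀ i, IndepFun (fun ω => f ω z) (e i) P := fun z hz i =>
    hfe.comp (φ := fun q : Z → ℝ => q ⟨z, hz⟩) (ψ := fun q : ℕ → ℝ => q (i + 1))
      (measurable_pi_apply _) (measurable_pi_apply _)
  have hFE : IndepFun F E P :=
    hfe.comp (φ := fun (q : Z → ℝ) (i : Fin T) => q ⟨z i, hz i⟩)
      (ψ := fun (q : ℕ → ℝ) (i : Fin T) => q (i + 1))
      (measurable_pi_lambda _ fun i => measurable_pi_apply _)
      (measurable_pi_lambda _ fun i => measurable_pi_apply _)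
  set γ : Measure (Fin T → ℝ) :=
    Measure.pi fun _ : Fin T => gaussianReal 0 (Real.toNNReal (σ ^ 2)) with hγ
  have hElaw : P.map E = γ := by
    have := (iIndepFun_iff_map_fun_eq_pi_map (fun i : Fin T => (hem' i).aemeasurable)).1
      (hei'.precomp (g := fun i : Fin T => (i : ℕ)) Fin.val_injective)
    rw [hE, this, hγ]
    simp_rw [hel']
  have hjoint : P.map (fun ω => (E ω, F ω)) = γ.prod (P.map F) := by
    rw [(indepFun_iff_map_prod_eq_prod_map_map hEm.aemeasurable hFm.aemeasurable).1 hFE.symm, hElaw]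
  have hPF : IsProbabilityMeasure (P.map F) := Measure.isProbabilityMeasure_map hFm.aemeasurable
  set μ := P.map (fun ω => (F ω + E ω, F ω)) with hμ
  have hYm : Measurable (fun ω => F ω + E ω) := hFm.add hEm
  have hlm : Measurable fun q : (Fin T → ℝ) × (Fin T → ℝ) => likelihood σ q.1 q.2 :=
    measurable_fst.likelihood σ measurable_snd
  -- Relative to pure noise times the prior, the joint law of observations and values has the
  -- likelihood as density, by the Gaussian shift for each fixed `v`.
  have hμ_eq : μ = (γ.prod (P.map F)).withDensity
      (fun q => ENNReal.ofReal (likelihood σ q.1 q.2)) := by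
    have h1 : μ = (γ.prod (P.map F)).map (fun q => (q.2 + q.1, q.2)) := by
      rw [← hjoint, Measure.map_map (by fun_prop) (hEm.prodMk hFm)]
      rfl
    rw [h1]
    refine Measure.ext_of_lintegral _ fun φ hφ => ?_
    rw [lintegral_map hφ (by fun_prop), lintegral_withDensity_eq_lintegral_mul _ (by fun_prop) hφ,
      lintegral_prod_symm _ (by fun_prop), lintegral_prod_symm _ (by fun_prop)]
    refine lintegral_congr fun v => ?_
    have h2 := congrArg (fun ν => ∫⁻ y, φ (y, v) ∂ν) (pi_gaussianReal_map_add hσ v)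
    simp only at h2
    have m1 : Measurable (fun y => ENNReal.ofReal (likelihood σ y v)) :=
      (measurable_id.likelihood σ measurable_const).ennreal_ofReal
    have m2 : Measurable (fun y => φ (y, v)) := by fun_prop
    rw [lintegral_map m2 (by fun_prop), lintegral_withDensity_eq_lintegral_mul _ m1 m2] at h2
    simpa using h2
  set Ev : (Fin T → ℝ) → ℝ := fun y => evidence P f σ (fun i : Fin T => z i) y with hEv
  have hEvpos : ∀ y, 0 < Ev y := fun y => hf.evidence_pos (fun i => hz i) y
  have hEvi : ∀ y, ∫⁻ v, ENNReal.ofReal (likelihood σ y v) ∂P.map F = ENNReal.ofReal (Ev y) := by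
    intro y
    have m1 : Measurable (fun v => ENNReal.ofReal (likelihood σ y v)) :=
      (measurable_const.likelihood σ measurable_id).ennreal_ofReal
    rw [lintegral_map m1 hFm,
      ← ofReal_integral_eq_lintegral_ofReal
        (hf.integrable_likelihood (fun i => hz i) y) (ae_of_all _ fun ω => (likelihood_pos _ _ _).le)]
    rfl
  have hEvm : Measurable (fun y => ENNReal.ofReal (Ev y)) := by
    simp_rw [← hEvi]
    exact hlm.ennreal_ofReal.lintegral_prod_right'
  have hEvm' : Measurable Ev := by
    have := hEvm.ennreal_toReal
    simpa only [ENNReal.toReal_ofReal (hEvpos _).le] using this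
  have hY_law : P.map (fun ω => F ω + E ω) = γ.withDensity (fun y => ENNReal.ofReal (Ev y)) := by
    have h1 : P.map (fun ω => F ω + E ω) = μ.map Prod.fst := by
      rw [hμ, Measure.map_map measurable_fst (hYm.prodMk hFm)]
      rfl
    rw [h1, hμ_eq]
    refine Measure.ext_of_lintegral _ fun φ hφ => ?_
    have m2 : Measurable (fun q : (Fin T → ℝ) × (Fin T → ℝ) => φ q.1) := hφ.comp measurable_fst
    rw [lintegral_map hφ measurable_fst, lintegral_withDensity_eq_lintegral_mul _ hlm.ennreal_ofReal
      m2, lintegral_withDensity_eq_lintegral_mul _ hEvm hφ,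
      lintegral_prod _ (hlm.ennreal_ofReal.mul m2).aemeasurable]
    refine lintegral_congr fun y => ?_
    have m1 : Measurable (fun v => ENNReal.ofReal (likelihood σ y v)) :=
      (measurable_const.likelihood σ measurable_id).ennreal_ofReal
    simp only [Pi.mul_apply]
    rw [lintegral_mul_const _ m1, hEvi]
  set ν := (P.map (fun ω => F ω + E ω)).prod (P.map F) with hν
  have hPY : IsProbabilityMeasure (P.map (fun ω => F ω + E ω)) :=
    Measure.isProbabilityMeasure_map hYm.aemeasurable
  have hν_eq : ν = (γ.prod (P.map F)).withDensity (fun q => ENNReal.ofReal (Ev q.1)) := by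
    have : SFinite (γ.withDensity (fun y => ENNReal.ofReal (Ev y))) := by
      rw [← hY_law]; infer_instance
    rw [hν, hY_law, prod_withDensity_left hEvm]
  -- The law of the observations has density `Ev` relative to pure noise, so the joint law has
  -- density likelihood over evidence relative to the product of the marginals. The divergence is
  -- the mean of its logarithm.
  set ρ : (Fin T → ℝ) × (Fin T → ℝ) → ENNReal := fun q => ENNReal.ofReal (likelihood σ q.1 q.2 / Ev q.1)
  have hρm : Measurable ρ := (hlm.div (hEvm'.comp measurable_fst)).ennreal_ofReal
  have hμν : μ = ν.withDensity ρ := by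
    have m1 : Measurable (fun q : (Fin T → ℝ) × (Fin T → ℝ) => ENNReal.ofReal (Ev q.1)) :=
      hEvm.comp measurable_fst
    rw [hμ_eq, hν_eq, ← withDensity_mul _ m1 hρm]
    congr 1
    ext q
    rw [Pi.mul_apply, ← ENNReal.ofReal_mul (hEvpos _).le]
    congr 1
    rw [mul_div_cancel₀ _ (hEvpos _).ne']
  have hac : μ ≪ ν := by rw [hμν]; exact withDensity_absolutelyContinuous _ _
  have hllr : llr μ ν =ᵐ[μ] fun q => Real.log (likelihood σ q.1 q.2) - Real.log (Ev q.1) := by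
    have h1 : μ.rnDeriv ν =ᵐ[ν] ρ := by
      conv_lhs => rw [hμν]
      exact Measure.rnDeriv_withDensity _ hρm
    filter_upwards [hac.ae_le h1] with q hq
    rw [llr, hq, ENNReal.toReal_ofReal (div_nonneg (likelihood_pos _ _ _).le (hEvpos _).le),
      Real.log_div (likelihood_pos _ _ _).ne' (hEvpos _).ne']
  set D : (Fin T → ℝ) × (Fin T → ℝ) → ℝ :=
    fun q => Real.log (likelihood σ q.1 q.2) - Real.log (Ev q.1) with hD
  have hDm : Measurable D := hlm.log.sub (hEvm'.comp measurable_fst).log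
  have hDω : ∀ ω, D (F ω + E ω, F ω) = ∑ n ∈ Finset.range T,
      (1 / 2 * Real.log (1 + postCov k σ (fun i : Fin n => z i) (z n) (z n) / σ ^ 2)
        - (e n ω) ^ 2 / (2 * σ ^ 2)
        + (f ω (z n) + e n ω - postMean k σ (fun i : Fin n => z i)
          (fun i => f ω (z i) + e i ω) (z n)) ^ 2
              / (2 * (postCov k σ (fun i : Fin n => z i) (z n) (z n) + σ ^ 2))) := by
    intro ω
    have := hf.sum_sub_log_evidence hσ hz (fun i => f ω (z i) + e i ω) (fun i => f ω (z i)) T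
    simp only [add_sub_cancel_left] at this
    exact this
  have he2 : ∀ n, Integrable (fun ω => (e n ω) ^ 2) P ∧ ∫ ω, (e n ω) ^ 2 ∂P = σ ^ 2 := by
    intro n
    have h1 := memLp_id_gaussianReal' (μ := 0) (v := Real.toNNReal (σ ^ 2)) 2 (by simp)
    rw [← hel' n] at h1
    have h2 : MemLp (e n) 2 P := by simpa using h1.comp_of_map (hem' n).aemeasurable
    refine ⟨h2.integrable_sq, ?_⟩
    have h := variance_id_gaussianReal (μ := 0) (v := Real.toNNReal (σ ^ 2))
    have h0 := integral_id_gaussianReal (μ := 0) (v := Real.toNNReal (σ ^ 2))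
    rw [← hel' n, integral_map (hem' n).aemeasurable (by fun_prop)] at h0
    rw [← hel' n, variance_map (by fun_prop) (hem' n).aemeasurable, Function.id_comp,
      variance_eq_sub h2, h0, Real.coe_toNNReal _ (sq_nonneg σ)] at h
    simpa using h
  -- The mean of the squared noise is `σ ^ 2` and that of the squared prediction error is the
  -- posterior variance plus `σ ^ 2`, so these two terms contribute `-1/2` and `1/2` and cancel.
  have hterm : ∀ n, Integrable (fun ω =>
      (1 / 2 * Real.log (1 + postCov k σ (fun i : Fin n => z i) (z n) (z n) / σ ^ 2)
        - (e n ω) ^ 2 / (2 * σ ^ 2)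
        + (f ω (z n) + e n ω - postMean k σ (fun i : Fin n => z i)
          (fun i => f ω (z i) + e i ω) (z n)) ^ 2
              / (2 * (postCov k σ (fun i : Fin n => z i) (z n) (z n) + σ ^ 2)))) P ∧
      ∫ ω, (1 / 2 * Real.log (1 + postCov k σ (fun i : Fin n => z i) (z n) (z n) / σ ^ 2)
        - (e n ω) ^ 2 / (2 * σ ^ 2)
        + (f ω (z n) + e n ω - postMean k σ (fun i : Fin n => z i)
          (fun i => f ω (z i) + e i ω) (z n)) ^ 2
              / (2 * (postCov k σ (fun i : Fin n => z i) (z n) (z n) + σ ^ 2))) ∂P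
        = 1 / 2 * Real.log (1 + postCov k σ (fun i : Fin n => z i) (z n) (z n) / σ ^ 2) := by
    intro n
    have hV := hf.postCov_nonneg hσ (z := fun i : Fin n => z i) (fun i => hz i) (hz n)
    have h1 := hf.integral_obs_sub_postMean hσ hem' hel' hei' hfe' hz n
    have i1 := (integrable_const (μ := P)
      (1 / 2 * Real.log (1 + postCov k σ (fun i : Fin n => z i) (z n) (z n) / σ ^ 2))).sub
      ((he2 n).1.div_const (2 * σ ^ 2))
    have i2 := h1.1.div_const (2 * (postCov k σ (fun i : Fin n => z i) (z n) (z n) + σ ^ 2))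
    refine ⟨i1.add i2, ?_⟩
    rw [integral_add (f := fun ω => 1 / 2 * Real.log (1 + postCov k σ (fun i : Fin n => z i)
      (z n) (z n) / σ ^ 2) - (e n ω) ^ 2 / (2 * σ ^ 2)) i1 i2, integral_sub (integrable_const _)
      ((he2 n).1.div_const _), integral_div, integral_div, h1.2, (he2 n).2]
    simp only [integral_const, probReal_univ, smul_eq_mul, one_mul]
    have : (postCov k σ (fun i : Fin n => z i) (z n) (z n) + σ ^ 2) ≠ 0 := by positivity
    field_simp
    ring
  have hDint : Integrable D μ := by
    rw [hμ, integrable_map_measure hDm.aestronglyMeasurable (hYm.prodMk hFm).aemeasurable]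
    change Integrable (fun ω => D (F ω + E ω, F ω)) P
    simp_rw [hDω]
    exact integrable_finsetSum _ fun n _ => (hterm n).1
  have hDval : ∫ q, D q ∂μ = ∑ n ∈ Finset.range T,
      1 / 2 * Real.log (1 + postCov k σ (fun i : Fin n => z i) (z n) (z n) / σ ^ 2) := by
    rw [hμ, integral_map (hYm.prodMk hFm).aemeasurable hDm.aestronglyMeasurable]
    simp_rw [hDω]
    rw [integral_finsetSum _ fun n _ => (hterm n).1]
    exact Finset.sum_congr rfl fun n _ => (hterm n).2
  have hPμ : IsProbabilityMeasure μ :=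
    Measure.isProbabilityMeasure_map (hYm.prodMk hFm).aemeasurable
  have : infoGain P f ε (fun i : Fin T => z i) = InformationTheory.klDiv μ ν := rfl
  rw [this, InformationTheory.klDiv_of_ac_of_integrable hac (hDint.congr hllr.symm),
    integral_congr_ae hllr, hDval]
  simp

/-- Concavity of the logarithm between `1` and `1 + c`. With `s` a posterior variance and `c = 1 / σ
^ 2`, it converts terms of the information gain into variances and yields the constant `2 / log (1 +
1 / σ ^ 2)`. -/
lemma mul_log_le_log_one_add {c s : ℝ} (hc : 0 ≤ c) (hs : 0 ≤ s) (hs1 : s ≤ 1) :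
    s * Real.log (1 + c) ≤ Real.log (1 + s * c) := by
  have h := strictConcaveOn_log_Ioi.concaveOn.2 (x := 1 + c) (y := 1)
    (by simp only [Set.mem_Ioi]; linarith) (by simp) hs (sub_nonneg.2 hs1) (by ring)
  simp only [smul_eq_mul, Real.log_one, mul_zero, add_zero, mul_one] at h
  convert! h using 2
  ring

/-- The posterior variances at the points of a design are bounded by the maximal information
gain. -/
theorem IsLipschitzGP.sum_postCov_le (hf : IsLipschitzGP P Z k a b f) {σ : ℝ} (hσ : 0 < σ)
    {ε : ℕ → Ω → ℝ} (hem : ∀ i, Measurable (ε i))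
    (hel : ∀ i, P.map (ε i) = gaussianReal 0 (Real.toNNReal (σ ^ 2))) (hei : iIndepFun ε P)
    (hfe : IndepFun (fun ω (z : Z) => f ω z) (fun ω t => ε t ω) P)
    {z : ℕ → Pt Dx Dc} (hz : ∀ i, z i ∈ Z) (T : ℕ) :
    ∑ n ∈ Finset.range T, postCov k σ (fun i : Fin n => z i) (z n) (z n) ≤
      2 / Real.log (1 + 1 / σ ^ 2) * maxInfoGain P Z f ε T := by
  have hl : 0 < Real.log (1 + 1 / σ ^ 2) := Real.log_pos (by
    have : 0 < 1 / σ ^ 2 := by positivity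
    linarith)
  have hV0 : ∀ (z : ℕ → Pt Dx Dc), (∀ i, z i ∈ Z) → ∀ n,
      0 ≤ postCov k σ (fun i : Fin n => z i) (z n) (z n) := fun z hz n =>
    hf.postCov_nonneg hσ (fun i => hz i) (hz n)
  have hV1 : ∀ (z : ℕ → Pt Dx Dc), (∀ i, z i ∈ Z) → ∀ n,
      postCov k σ (fun i : Fin n => z i) (z n) (z n) ≤ 1 := fun z hz n =>
    hf.postCov_le_one hσ (fun i => hz i) (hz n)
  -- Finiteness of the supremum is essential: `maxInfoGain` is a `toReal`, which would be 0 at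
  -- infinity. Since posterior variances are at most 1, every design of `T` points has a gain of at
  -- most `T / 2 * log (1 + 1 / σ ^ 2)`.
  have hfin : (⨆ w : Fin T → Z, infoGain P f ε (fun i => (w i : Pt Dx Dc))) ≠ ⊤ := by
    refine ne_top_of_le_ne_top (b := ENNReal.ofReal (T * (1 / 2 * Real.log (1 + 1 / σ ^ 2))))
      ENNReal.ofReal_ne_top (iSup_le fun w => ?_)
    set w' : ℕ → Pt Dx Dc := fun i => if h : i < T then w ⟨i, h⟩ else z 0 with hw'
    have hw'Z : ∀ i, w' i ∈ Z := fun i => by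
      simp only [hw']
      split_ifs
      · exact (w _).2
      · exact hz 0
    have : (fun i : Fin T => (w i : Pt Dx Dc)) = fun i : Fin T => w' i := by
      ext1 i
      simp [hw']
    rw [this, hf.infoGain_eq hσ hem hel hei hfe hw'Z]
    apply ENNReal.ofReal_le_ofReal
    refine (Finset.sum_le_card_nsmul _ _ _ fun n _ => ?_).trans (by rw [Finset.card_range, nsmul_eq_mul])
    have h0 := hV0 w' hw'Z n
    have h1 := hV1 w' hw'Z n
    have : 0 ≤ postCov k σ (fun i : Fin n => w' i) (w' n) (w' n) / σ ^ 2 := by positivity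
    gcongr
  have hle : ENNReal.ofReal (∑ n ∈ Finset.range T,
      1 / 2 * Real.log (1 + postCov k σ (fun i : Fin n => z i) (z n) (z n) / σ ^ 2)) ≤
      ⨆ w : Fin T → Z, infoGain P f ε (fun i => (w i : Pt Dx Dc)) := by
    rw [← hf.infoGain_eq hσ hem hel hei hfe hz]
    exact le_iSup (fun w : Fin T → Z => infoGain P f ε (fun i => (w i : Pt Dx Dc)))
      (fun i => ⟨z i, hz i⟩)
  have h2 := ENNReal.toReal_mono hfin hle
  rw [ENNReal.toReal_ofReal] at h2
  · rw [div_mul_eq_mul_div, le_div_iff₀ hl]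
    refine le_trans ?_ (mul_le_mul_of_nonneg_left h2 zero_le_two)
    rw [Finset.sum_mul, Finset.mul_sum]
    refine Finset.sum_le_sum fun n _ => ?_
    have := mul_log_le_log_one_add (c := 1 / σ ^ 2) (by positivity) (hV0 z hz n) (hV1 z hz n)
    rw [mul_one_div] at this
    linarith
  · refine Finset.sum_nonneg fun n _ => ?_
    have := hV0 z hz n
    have : 0 ≤ Real.log (1 + postCov k σ (fun i : Fin n => z i) (z n) (z n) / σ ^ 2) :=
      Real.log_nonneg (le_add_of_nonneg_right (by positivity))
    positivity

end InformationGain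

end DRBO

/-! ### Sample paths: measurable evaluation and moments of Lipschitz constants. -/

namespace DRBO

section Paths

/-- The value at `z` of the continuous function that takes the values `s n` at the points `d n`. -/
noncomputable def pathEval {E : Type*} [PseudoEMetricSpace E] [MeasurableSpace E]
    [OpensMeasurableSpace E] (d : ℕ → E) (s : ℕ → ℝ) (z : E) : ℝ :=
  limsup (fun n => s (SimpleFunc.nearestPtInd d n z)) atTop

lemma measurable_pathEval {E : Type*} [PseudoEMetricSpace E] [MeasurableSpace E]
    [OpensMeasurableSpace E] (d : ℕ → E) :
    Measurable (fun q : (ℕ → ℝ) × E => pathEval d q.1 q.2) := by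
  unfold pathEval
  refine Measurable.limsup fun n => ?_
  have h1 : Measurable (fun q : (ℕ → ℝ) × ℕ => q.1 q.2) :=
    measurable_from_prod_countable_left fun j => measurable_pi_apply j
  exact h1.comp (measurable_fst.prodMk
    ((SimpleFunc.nearestPtInd d n).measurable.comp measurable_snd))

/-- The nearest point to `z` among the first points of a dense sequence converges to `z`, and so do
the values of a continuous function. Thus a path is encoded by countably many variables and
evaluated by a jointly measurable map. -/
lemma pathEval_eq {E : Type*} [PseudoEMetricSpace E] [MeasurableSpace E]
    [OpensMeasurableSpace E] {Z : Set E} {g : E → ℝ} (hg : ContinuousOn g Z) {d : ℕ → E}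
    (hd : ∀ n, d n ∈ Z) {z : E} (hz : z ∈ Z) (hzd : z ∈ closure (Set.range d)) :
    pathEval d (fun n => g (d n)) z = g z := by
  have h1 : Tendsto (fun n => SimpleFunc.nearestPt d n z) atTop (𝓝[Z] z) :=
    tendsto_nhdsWithin_iff.2 ⟨SimpleFunc.tendsto_nearestPt hzd, Eventually.of_forall fun n => hd _⟩
  have h2 := (hg z hz).tendsto.comp h1
  exact h2.limsup_eq

/-- The least Lipschitz constant, on the points `d n`, of the function with values `s n`. -/
noncomputable def lipConst {E : Type*} [PseudoEMetricSpace E] (d : ℕ → E) (s : ℕ → ℝ) : ENNReal :=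
  ⨆ n, ⨆ m, ENNReal.ofReal |s n - s m| / edist (d n) (d m)

lemma measurable_lipConst {E : Type*} [PseudoEMetricSpace E] (d : ℕ → E) :
    Measurable (lipConst d) := by
  unfold lipConst
  fun_prop

/-- The inequality holds at pairs of the dense sequence by definition and is a closed condition on
pairs. -/
lemma abs_sub_le_lipConst {E : Type*} [PseudoMetricSpace E] {Z : Set E} {g : E → ℝ}
    (hg : ContinuousOn g Z) {d : ℕ → Z} (hd : DenseRange d)
    (hfin : lipConst (fun n => (d n : E)) (fun n => g (d n)) ≠ ⊤) {z w : E}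
    (hz : z ∈ Z) (hw : w ∈ Z) :
    |g z - g w| ≤ (lipConst (fun n => (d n : E)) (fun n => g (d n))).toReal * dist z w := by
  have hc : Continuous (fun q : Z => g q) := continuousOn_iff_continuous_domRestrict.1 hg
  refine DenseRange.induction_on₂ (p := fun z w : Z => |g z - g w| ≤
    (lipConst (fun n => (d n : E)) (fun n => g (d n))).toReal * dist (z : E) w) hd ?_ ?_ ⟨z, hz⟩ ⟨w, hw⟩
  · exact isClosed_le ((hc.comp continuous_fst).sub (hc.comp continuous_snd)).abs (by fun_prop)
  · intro n m
    set K := lipConst (fun n => (d n : E)) (fun n => g (d n)) with hK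
    have h1 : ENNReal.ofReal |g (d n) - g (d m)| / edist (d n : E) (d m) ≤ K :=
      le_iSup_of_le n (le_iSup_of_le m le_rfl)
    rcases eq_or_ne (edist (d n : E) (d m)) 0 with h0 | h0
    -- At distance 0 the quotient is `⊤` unless its numerator vanishes, so a finite constant forces
    -- equal values.
    · rw [h0] at h1
      have h2 : ENNReal.ofReal |g (d n) - g (d m)| = 0 := by
        by_contra hne
        rw [ENNReal.div_zero hne, top_le_iff] at h1
        exact hfin h1
      rw [ENNReal.ofReal_eq_zero] at h2
      exact h2.trans (by positivity)
    · rw [ENNReal.div_le_iff h0 (edist_ne_top _ _)] at h1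
      have h2 := ENNReal.toReal_mono (ENNReal.mul_ne_top hfin (edist_ne_top _ _)) h1
      rwa [ENNReal.toReal_ofReal (abs_nonneg _), ENNReal.toReal_mul, ← dist_edist] at h2

lemma lipConst_le {E : Type*} [PseudoMetricSpace E] {Z : Set E} {g : E → ℝ} {d : ℕ → Z} {L : ℝ}
    (hL : ∀ z ∈ Z, ∀ w ∈ Z, |g z - g w| ≤ L * dist z w) :
    lipConst (fun n => (d n : E)) (fun n => g (d n)) ≤ ENNReal.ofReal L := by
  refine iSup_le fun n => iSup_le fun m => ENNReal.div_le_of_le_mul ?_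
  have hL0 := hL _ (d n).2 _ (d m).2
  rcases le_or_gt 0 L with h | h
  · rw [edist_dist, ← ENNReal.ofReal_mul h]
    exact ENNReal.ofReal_le_ofReal hL0
  · have : |g (d n) - g (d m)| ≤ 0 := hL0.trans (mul_nonpos_of_nonpos_of_nonneg h.le dist_nonneg)
    rw [ENNReal.ofReal_of_nonpos this]
    exact zero_le

/-- A discrete layer cake formula: `N ^ 2` is the sum of the first `N` odd numbers, applied with `N`
the ceiling of `x`. -/
lemma ENNReal_sq_le_tsum (x : ENNReal) :
    x ^ 2 ≤ ∑' n : ℕ, if (n : ENNReal) < x then (2 * n + 1 : ENNReal) else 0 := by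
  have hN : ∀ N : ℕ, (∑ n ∈ Finset.range N, (2 * n + 1 : ENNReal)) = (N : ENNReal) ^ 2 := by
    intro N
    induction N with
    | zero => simp
    | succ n ih =>
      rw [Finset.sum_range_succ, ih]
      push_cast
      ring
  have hle : ∀ N : ℕ, (∀ n < N, (n : ENNReal) < x) → (N : ENNReal) ^ 2 ≤
      ∑' n : ℕ, if (n : ENNReal) < x then (2 * n + 1 : ENNReal) else 0 := by
    intro N h
    rw [← hN N]
    refine le_trans (le_of_eq ?_) (ENNReal.sum_le_tsum (Finset.range N))
    exact Finset.sum_congr rfl fun n hn => by rw [if_pos (h n (Finset.mem_range.1 hn))]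
  rcases eq_or_ne x ⊤ with rfl | hx
  · refine le_of_tendsto' (x := atTop) (f := fun N : ℕ => (N : ENNReal) ^ 2) ?_ fun N =>
      hle N fun n _ => ENNReal.natCast_lt_top n
    have := ((ENNReal.continuous_pow 2).tendsto ⊤).comp ENNReal.tendsto_nat_nhds_top
    simpa [Function.comp_def] using this
  · lift x to NNReal using hx
    refine le_trans ?_ (hle ⌈x⌉₊ fun n hn => by exact_mod_cast Nat.lt_ceil.1 hn)
    gcongr
    exact_mod_cast Nat.le_ceil x

variable {Ω : Type*} [MeasurableSpace Ω] {P : Measure Ω} [IsProbabilityMeasure P] {Dx Dc : ℕ}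
  {Z : Set (Pt Dx Dc)} {k : Pt Dx Dc → Pt Dx Dc → ℝ} {a b : ℝ} {f : Ω → Pt Dx Dc → ℝ}

lemma norm_le_sum_basisVec {Dx Dc : ℕ} (A : Pt Dx Dc →L[ℝ] ℝ) {L : ℝ} (hL : 0 ≤ L)
    (hA : ∀ i, |A (basisVec i)| ≤ L) : ‖A‖ ≤ (Dx + Dc) * L := by
  refine A.opNorm_le_bound (by positivity) fun v => ?_
  have hv : v = ∑ i : Fin Dx, v.1 i • basisVec (Sum.inl i) +
      ∑ j : Fin Dc, v.2 j • basisVec (Sum.inr j) := by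
    ext i
    · simp [basisVec, Finset.sum_apply, Pi.single_apply, Prod.fst_sum]
    · simp [basisVec, Finset.sum_apply, Pi.single_apply, Prod.snd_sum]
  have h1 : ∀ i, ‖v.1 i * A (basisVec (Sum.inl i))‖ ≤ ‖v‖ * L := fun i => by
    rw [norm_mul]
    exact mul_le_mul ((norm_le_pi_norm v.1 i).trans (norm_fst_le v)) (hA _) (norm_nonneg _)
      (norm_nonneg _)
  have h2 : ∀ i, ‖v.2 i * A (basisVec (Sum.inr i))‖ ≤ ‖v‖ * L := fun i => by
    rw [norm_mul]
    exact mul_le_mul ((norm_le_pi_norm v.2 i).trans (norm_snd_le v)) (hA _) (norm_nonneg _)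
      (norm_nonneg _)
  have h3 : A v = ∑ i : Fin Dx, v.1 i * A (basisVec (Sum.inl i)) +
      ∑ j : Fin Dc, v.2 j * A (basisVec (Sum.inr j)) := by
    conv_lhs => rw [hv]
    simp [map_sum]
  rw [h3]
  refine (norm_add_le _ _).trans ?_
  have h4 := (norm_sum_le Finset.univ (fun i : Fin Dx => v.1 i * A (basisVec (Sum.inl i)))).trans
    (Finset.sum_le_sum fun i _ => h1 i)
  have h5 := (norm_sum_le Finset.univ (fun i : Fin Dc => v.2 i * A (basisVec (Sum.inr i)))).trans
    (Finset.sum_le_sum fun i _ => h2 i)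
  simp only [Finset.sum_const, Finset.card_univ, Fintype.card_fin, nsmul_eq_mul] at h4 h5
  linarith

/-- A bound of the second moment of the Lipschitz constants of sample paths. -/
noncomputable def lipMoment (Dx Dc : ℕ) (a b : ℝ) : ℝ :=
  1 + 6 * ((Dx + Dc) * a * ((Dx + Dc) * b) ^ 4) * ∑' n : ℕ, 1 / ((n : ℝ) + 1) ^ 3

lemma summable_one_div_succ_pow_three : Summable fun n : ℕ => 1 / ((n : ℝ) + 1) ^ 3 := by
  have := (summable_nat_add_iff 1).2 (Real.summable_one_div_nat_pow.2 (by norm_num : 1 < 3))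
  simpa using this

lemma lipMoment_ge_one (Dx Dc : ℕ) {a b : ℝ} (ha : 0 < a) : 1 ≤ lipMoment Dx Dc a b := by
  unfold lipMoment
  have : 0 ≤ ∑' n : ℕ, 1 / ((n : ℝ) + 1) ^ 3 := tsum_nonneg fun n => by positivity
  have h4 : 0 ≤ ((Dx + Dc : ℝ) * b) ^ 4 := by positivity
  have : 0 ≤ 6 * ((Dx + Dc) * a * ((Dx + Dc) * b) ^ 4) * ∑' n : ℕ, 1 / ((n : ℝ) + 1) ^ 3 := by
    positivity
  linarith

/-- The mean value inequality on the convex set `Z` transfers the derivative tails to Lipschitz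
constants, and the second moment is summed over integer levels. The bound depends on neither the
kernel nor the dense sequence, which keeps the final constants uniform. -/
theorem IsLipschitzGP.lintegral_lipConst_sq_le (hf : IsLipschitzGP P Z k a b f) (hD : 0 < Dx + Dc)
    (ha : 0 < a) (hb : 0 < b) (hZ : Convex ℝ Z) (d : ℕ → Z) :
    ∫⁻ ω, lipConst (fun n => (d n : Pt Dx Dc)) (fun n => f ω (d n)) ^ 2 ∂P ≤
      ENNReal.ofReal (lipMoment Dx Dc a b) := by
  set Λ : Ω → ENNReal := fun ω => lipConst (fun n => (d n : Pt Dx Dc)) (fun n => f ω (d n)) with hΛ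
  have hΛm : Measurable Λ := (measurable_lipConst _).comp
    (measurable_pi_lambda _ fun n => hf.measurable _ (d n).2)
  set D : ℝ := Dx + Dc with hDdef
  have hD0 : 0 < D := by rw [hDdef]; exact_mod_cast hD
  have htail : ∀ L : ℝ, 0 < L →
      P {ω | ENNReal.ofReal L < Λ ω} ≤ ENNReal.ofReal (D * a * Real.exp (-(L / (D * b)) ^ 2)) := by
    intro L hL
    -- In the sup norm a functional has norm at most the sum of its values on the `D` basis vectors
    -- in modulus. A Lipschitz constant above `L` therefore needs a partial derivative above `L /
    -- D`.
    have hsub : {ω | ENNReal.ofReal L < Λ ω} ⊆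
        ⋃ i : Fin Dx ⊕ Fin Dc, {ω | ∃ z ∈ Z, L / D < |fderivWithin ℝ (f ω) Z z (basisVec i)|} := by
      intro ω hω
      by_contra hcon
      simp only [Set.mem_iUnion, Set.mem_ofPred_eq, not_exists, not_and, not_lt] at hcon hω
      have : Λ ω ≤ ENNReal.ofReal L := by
        refine lipConst_le fun z hz w hw => ?_
        have := hZ.norm_image_sub_le_of_norm_fderivWithin_le (hf.differentiableOn ω)
          (C := D * (L / D)) (fun z hz => norm_le_sum_basisVec _ (by positivity)
            fun i => hcon i z hz) hw hz
        rwa [Real.norm_eq_abs, mul_div_cancel₀ _ hD0.ne', ← dist_eq_norm] at this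
      exact absurd hω (not_lt.2 this)
    refine (measure_mono hsub).trans ((measure_iUnion_fintype_le _ _).trans ?_)
    refine (Finset.sum_le_sum fun i _ => hf.tail i (L / D) (by positivity)).trans (le_of_eq ?_)
    rw [Finset.sum_const, nsmul_eq_mul, mul_assoc, ENNReal.ofReal_mul hD0.le, div_div]
    congr 1
    rw [hDdef, Finset.card_univ, Fintype.card_sum, Fintype.card_fin, Fintype.card_fin,
      ← Nat.cast_add, ENNReal.ofReal_natCast]
  have hterm : ∀ n : ℕ, (2 * n + 1 : ENNReal) * P {ω | (n : ENNReal) < Λ ω} ≤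
      ENNReal.ofReal (if n = 0 then 1 else 6 * (D * a * (D * b) ^ 4) * (1 / (n : ℝ) ^ 3)) := by
    intro n
    rcases Nat.eq_zero_or_pos n with rfl | hn
    · simpa using prob_le_one
    · rw [if_neg hn.ne']
      have hn' : (0 : ℝ) < n := by exact_mod_cast hn
      have hn1 : (1 : ℝ) ≤ n := by exact_mod_cast hn
      have h1 := htail n hn'
      rw [ENNReal.ofReal_natCast] at h1
      have e : (2 * n + 1 : ENNReal) = ENNReal.ofReal (2 * n + 1) := by
        rw [ENNReal.ofReal_add (by positivity) zero_le_one, ENNReal.ofReal_mul zero_le_two]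
        simp
      rw [e]
      refine (mul_le_mul_right h1 _).trans ?_
      rw [← ENNReal.ofReal_mul (by positivity)]
      apply ENNReal.ofReal_le_ofReal
      set q := (n : ℝ) / (D * b) with hq
      have hq0 : 0 < q := by positivity
      -- Quartic decay is enough: the weight `2 * n + 1` leaves the summable `1 / n ^ 3` of
      -- `lipMoment`.
      have hexp : Real.exp (-q ^ 2) ≤ 2 / q ^ 4 := by
        rw [Real.exp_neg, inv_eq_one_div, div_le_div_iff₀ (Real.exp_pos _) (by positivity), one_mul]
        have := Real.quadratic_le_exp_of_nonneg (sq_nonneg q)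
        nlinarith [sq_nonneg q]
      have hq4 : q ^ 4 = n ^ 4 / (D * b) ^ 4 := by rw [hq, div_pow]
      calc (2 * (n : ℝ) + 1) * (D * a * Real.exp (-q ^ 2))
          ≤ (3 * n) * (D * a * (2 / q ^ 4)) := by
            gcongr
            linarith
        _ = _ := by
            rw [hq4]
            field_simp
            ring
  calc ∫⁻ ω, Λ ω ^ 2 ∂P ≤ ∫⁻ ω, ∑' n : ℕ,
        (if (n : ENNReal) < Λ ω then (2 * n + 1 : ENNReal) else 0) ∂P :=
        lintegral_mono fun ω => ENNReal_sq_le_tsum _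
    _ = ∑' n : ℕ, (2 * n + 1 : ENNReal) * P {ω | (n : ENNReal) < Λ ω} := by
        rw [lintegral_tsum fun n => (Measurable.ite (measurableSet_lt measurable_const hΛm)
          measurable_const measurable_const).aemeasurable]
        congr 1
        ext n
        have : (fun ω => if (n : ENNReal) < Λ ω then (2 * n + 1 : ENNReal) else 0)
            = {ω | (n : ENNReal) < Λ ω}.indicator fun _ => (2 * n + 1 : ENNReal) := by
          ext ω
          simp [Set.indicator_apply]
        rw [this, lintegral_indicator_const (measurableSet_lt measurable_const hΛm)]
    _ ≤ ∑' n : ℕ, ENNReal.ofReal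
          (if n = 0 then 1 else 6 * (D * a * (D * b) ^ 4) * (1 / (n : ℝ) ^ 3)) :=
        ENNReal.tsum_le_tsum hterm
    _ = ENNReal.ofReal (lipMoment Dx Dc a b) := by
        have hs : Summable fun n : ℕ =>
            6 * (D * a * (D * b) ^ 4) * (1 / ((n : ℝ) + 1) ^ 3) :=
          summable_one_div_succ_pow_three.mul_left _
        have hs' : Summable fun n : ℕ =>
            if n = 0 then (1 : ℝ) else 6 * (D * a * (D * b) ^ 4) * (1 / (n : ℝ) ^ 3) := by
          refine (summable_nat_add_iff 1).1 (hs.congr fun n => ?_)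
          simp
        rw [← ENNReal.ofReal_tsum_of_nonneg (fun n => ?_) hs', hs'.tsum_eq_zero_add]
        · congr 1
          rw [lipMoment, ← tsum_mul_left, hDdef]
          simp
        · split_ifs
          · exact zero_le_one
          · positivity

end Paths

end DRBO

/-! ### Independence of the past and the present. -/

namespace DRBO

section Independence

variable {Ω : Type*} [MeasurableSpace Ω] {P : Measure Ω} [IsProbabilityMeasure P]

/-- The joint law is the product of three laws, which the associativity of products of measures
regroups. -/
lemma indepFun_prodMk_left {α β γ : Type*} [MeasurableSpace α] [MeasurableSpace β]
    [MeasurableSpace γ] {X : Ω → α} {Y : Ω → β} {W : Ω → γ} (hX : Measurable X)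
    (hY : Measurable Y) (hW : Measurable W) (h1 : IndepFun X (fun ω => (Y ω, W ω)) P)
    (h2 : IndepFun Y W P) : IndepFun (fun ω => (X ω, Y ω)) W P := by
  have hX' : IsProbabilityMeasure (P.map X) := Measure.isProbabilityMeasure_map hX.aemeasurable
  have hY' : IsProbabilityMeasure (P.map Y) := Measure.isProbabilityMeasure_map hY.aemeasurable
  have hW' : IsProbabilityMeasure (P.map W) := Measure.isProbabilityMeasure_map hW.aemeasurable
  rw [indepFun_iff_map_prod_eq_prod_map_map (by fun_prop) (by fun_prop)] at h1 h2 ⊢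
  have h3 : IndepFun X Y P := by
    have := (indepFun_iff_map_prod_eq_prod_map_map (by fun_prop) (by fun_prop)).2 h1
    exact this.comp measurable_id measurable_fst
  rw [h3.map_prod_eq_prod_map_map (by fun_prop) (by fun_prop)]
  rw [h2] at h1
  have h4 := congrArg (fun μ => μ.map MeasurableEquiv.prodAssoc.symm) h1
  rw [Measure.map_map (MeasurableEquiv.measurable _) (by fun_prop), ← Measure.prodAssoc_prod,
    Measure.map_map (MeasurableEquiv.measurable _) (MeasurableEquiv.measurable _)] at h4
  rw [MeasurableEquiv.symm_comp_self, Measure.map_id] at h4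
  exact h4

lemma lintegral_of_indepFun {α β : Type*} [MeasurableSpace α] [MeasurableSpace β]
    {X : Ω → α} {Y : Ω → β} (hX : Measurable X) (hY : Measurable Y) (h : IndepFun X Y P)
    {Φ : α × β → ENNReal} (hΦ : Measurable Φ) :
    ∫⁻ ω, Φ (X ω, Y ω) ∂P = ∫⁻ ω, ∫⁻ y, Φ (X ω, y) ∂(P.map Y) ∂P := by
  have hY' : IsProbabilityMeasure (P.map Y) := Measure.isProbabilityMeasure_map hY.aemeasurable
  rw [← lintegral_map (f := Φ) (g := fun ω => (X ω, Y ω)) hΦ (by fun_prop),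
    h.map_prod_eq_prod_map_map (by fun_prop) (by fun_prop),
    lintegral_prod _ hΦ.aemeasurable, lintegral_map hΦ.lintegral_prod_right' hX]

open Classical in
/-- The first `t` terms of a sequence, padded by zeros. -/
noncomputable def trunc {α : Type*} [Zero α] (t : ℕ) (u : ℕ → α) : ℕ → α :=
  fun i => if i < t then u i else 0

lemma measurable_trunc {α : Type*} [Zero α] [MeasurableSpace α] (t : ℕ) :
    Measurable (trunc t : (ℕ → α) → ℕ → α) := by
  unfold trunc
  refine measurable_pi_lambda _ fun i => ?_
  by_cases h : i < t
  · simpa [h] using measurable_pi_apply i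
  · simp [h]

lemma trunc_trunc {α : Type*} [Zero α] {t u : ℕ} (htu : t ≤ u) (v : ℕ → α) :
    trunc t (trunc u v) = trunc t v := by
  ext i
  unfold trunc
  by_cases h : i < t
  · simp [h, h.trans_le htu]
  · simp [h]

lemma indepFun_trunc {α : Type*} [Zero α] [MeasurableSpace α] {c : ℕ → Ω → α}
    (hc : ∀ t, Measurable (c t)) (h : iIndepFun c P) (t : ℕ) :
    IndepFun (fun ω => trunc t (fun i => c i ω)) (c t) P := by
  have h1 := h.indepFun_finset (Finset.range t) {t} (by simp) hc
  have m1 : Measurable (fun (u : Finset.range t → α) (i : ℕ) =>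
      if hi : i < t then u ⟨i, Finset.mem_range.2 hi⟩ else 0) := by
    refine measurable_pi_lambda _ fun i => ?_
    by_cases hi : i < t
    · simpa [hi] using measurable_pi_apply _
    · simp [hi]
  have m2 : Measurable (fun (u : ({t} : Finset ℕ) → α) => u ⟨t, by simp⟩) := measurable_pi_apply _
  have h2 := h1.comp m1 m2
  convert h2 using 1
  · ext ω i
    unfold trunc
    by_cases hi : i < t <;> simp [hi]
  · rfl

/-- Independence of the path, the two sequences and the terms within each sequence is regrouped pair
by pair until the present `(c t, e t)` stands alone. This separates a fresh context and a fresh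
noise from everything that determines the decision at time `t`. -/
lemma indepFun_past {S' α β : Type*} [Zero α] [Zero β] [MeasurableSpace S'] [MeasurableSpace α]
    [MeasurableSpace β] {S : Ω → S'} {c : ℕ → Ω → α} {e : ℕ → Ω → β} (hS : Measurable S)
    (hc : ∀ t, Measurable (c t)) (he : ∀ t, Measurable (e t))
    (hci : iIndepFun c P) (hei : iIndepFun e P)
    (hce : IndepFun (fun ω t => c t ω) (fun ω t => e t ω) P)
    (hSi : IndepFun S (fun ω => (fun t => c t ω, fun t => e t ω)) P) (t : ℕ) :
    IndepFun (fun ω => (S ω, trunc t (fun i => c i ω), trunc t (fun i => e i ω)))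
      (fun ω => (c t ω, e t ω)) P := by
  have hc' : Measurable fun ω i => c i ω := measurable_pi_lambda _ hc
  have he' : Measurable fun ω i => e i ω := measurable_pi_lambda _ he
  have mc : Measurable fun ω => trunc t (fun i => c i ω) := (measurable_trunc t).comp hc'
  have me : Measurable fun ω => trunc t (fun i => e i ω) := (measurable_trunc t).comp he'
  have hct := hc t
  have het := he t
  have i1 := indepFun_trunc hc hci t
  have i2 := indepFun_trunc he hei t
  have i3 : IndepFun (fun ω => (trunc t (fun i => c i ω), c t ω))
      (fun ω => (trunc t (fun i => e i ω), e t ω)) P :=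
    hce.comp ((measurable_trunc t).prodMk (measurable_pi_apply t))
      ((measurable_trunc t).prodMk (measurable_pi_apply t))
  have i4 := indepFun_prodMk_left (mc.prodMk hct) me het i3 i2
  have i5 : IndepFun (fun ω => trunc t (fun i => e i ω))
      (fun ω => (trunc t (fun i => c i ω), c t ω)) P :=
    i3.symm.comp measurable_fst measurable_id
  have i6 := indepFun_prodMk_left me mc hct i5 i1
  have i7 : IndepFun (e t) (fun ω => (c t ω, (trunc t (fun i => c i ω), trunc t (fun i => e i ω)))) P :=
    i4.symm.comp (φ := id) (ψ := fun q : (((ℕ → α) × α) × (ℕ → β)) => (q.1.2, (q.1.1, q.2)))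
      measurable_id (by fun_prop)
  have i8 : IndepFun (c t) (fun ω => (trunc t (fun i => c i ω), trunc t (fun i => e i ω))) P :=
    i6.symm.comp (φ := id) (ψ := fun q : ((ℕ → β) × (ℕ → α)) => (q.2, q.1))
      measurable_id (by fun_prop)
  have i9 := indepFun_prodMk_left het hct (mc.prodMk me) i7 i8
  have i10 : IndepFun (fun ω => (trunc t (fun i => c i ω), trunc t (fun i => e i ω)))
      (fun ω => (c t ω, e t ω)) P :=
    i9.symm.comp (φ := id) (ψ := fun q : β × α => (q.2, q.1)) measurable_id (by fun_prop)
  refine indepFun_prodMk_left hS (mc.prodMk me) (hct.prodMk het) ?_ i10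
  refine hSi.comp (φ := id) (ψ := fun q : (ℕ → α) × (ℕ → β) =>
    ((trunc t q.1, trunc t q.2), (q.1 t, q.2 t))) measurable_id ?_
  exact (((measurable_trunc t).comp measurable_fst).prodMk
    ((measurable_trunc t).comp measurable_snd)).prodMk (by fun_prop)

end Independence

/-! ### Histories of adaptive decisions and their disintegration. -/

section Histories

/-- Records `(x_i, c_i, y_i)` of a run, padded by zeros. -/
abbrev Hist (Dx Dc : ℕ) : Type := ℕ → (Fin Dx → ℝ) × (Fin Dc → ℝ) × ℝ

open Classical in
/-- The identity on `Z`, and constantly `z₀` elsewhere. -/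
noncomputable def clip {E : Type*} (Z : Set E) (z₀ z : E) : E := if z ∈ Z then z else z₀

lemma clip_mem {E : Type*} {Z : Set E} {z₀ : E} (h : z₀ ∈ Z) (z : E) : clip Z z₀ z ∈ Z := by
  unfold clip
  split_ifs with hz
  exacts [hz, h]

lemma clip_eq {E : Type*} {Z : Set E} (z₀ : E) {z : E} (h : z ∈ Z) : clip Z z₀ z = z := if_pos h

lemma measurable_clip {E : Type*} [MeasurableSpace E] {Z : Set E} (hZ : MeasurableSet Z) (z₀ : E) :
    Measurable (clip Z z₀) := Measurable.ite hZ measurable_id measurable_const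

/-- The design point of the `i`-th record. -/
noncomputable def site {Dx Dc : ℕ} (Z : Set (Pt Dx Dc)) (z₀ : Pt Dx Dc) (h : Hist Dx Dc) (i : ℕ) :
    Pt Dx Dc := clip Z z₀ ((h i).1, (h i).2.1)

lemma measurable_site {Dx Dc : ℕ} {Z : Set (Pt Dx Dc)} (hZ : MeasurableSet Z) (z₀ : Pt Dx Dc)
    (i : ℕ) : Measurable (fun h : Hist Dx Dc => site Z z₀ h i) :=
  (measurable_clip hZ z₀).comp
    (by fun_prop : Measurable fun h : Hist Dx Dc => (((h i).1, (h i).2.1) : Pt Dx Dc))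

variable {Ω : Type*} [MeasurableSpace Ω] {P : Measure Ω} [IsProbabilityMeasure P] {Dx Dc : ℕ}

open Classical in
/-- The records available before iteration `t`. -/
noncomputable def record (f : Ω → Pt Dx Dc → ℝ) (c : ℕ → Ω → Fin Dc → ℝ) (ε : ℕ → Ω → ℝ)
    (x : ℕ → Ω → Fin Dx → ℝ) (t : ℕ) (ω : Ω) : Hist Dx Dc := fun i =>
  if i < t then (if i = 0 then (0, c 0 ω, 0) else (x i ω, c i ω, obs f c ε x i ω)) else 0

lemma record_succ (f : Ω → Pt Dx Dc → ℝ) (c : ℕ → Ω → Fin Dc → ℝ) (ε : ℕ → Ω → ℝ)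
    (x : ℕ → Ω → Fin Dx → ℝ) {t : ℕ} (ht : 1 ≤ t) (ω : Ω) :
    record f c ε x (t + 1) ω =
      Function.update (record f c ε x t ω) t (x t ω, c t ω, obs f c ε x t ω) := by
  ext1 i
  unfold record
  rcases lt_trichotomy i t with h | h | h
  · simp [h.ne, h, h.trans (Nat.lt_succ_self t)]
  · subst h
    simp [Nat.ne_zero_of_lt ht]
  · simp [h.ne', h.not_gt, Nat.not_lt.2 (Nat.succ_le_of_lt h)]

/-- A decision maker who follows the policy `π`, with true values given by `e` and `S`. -/
structure FollowsPolicy (Z : Set (Pt Dx Dc)) (z₀ : Pt Dx Dc) (f : Ω → Pt Dx Dc → ℝ)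
    (c : ℕ → Ω → Fin Dc → ℝ) (ε : ℕ → Ω → ℝ) (x : ℕ → Ω → Fin Dx → ℝ)
    (S : Ω → ℕ → ℝ) (e : (ℕ → ℝ) → Pt Dx Dc → ℝ) (π : ℕ → Hist Dx Dc → Fin Dx → ℝ) : Prop where
  measurableSet : MeasurableSet Z
  measurable_path : Measurable S
  measurable_eval : Measurable (fun q : (ℕ → ℝ) × Pt Dx Dc => e q.1 q.2)
  measurable_policy : ∀ t, Measurable (π t)
  obs_eq : ∀ t, 1 ≤ t → ∀ ω, obs f c ε x t ω = e (S ω) (clip Z z₀ (x t ω, c t ω)) + ε t ω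
  decision_eq : ∀ t, 1 ≤ t → ∀ ω, x t ω = π t (record f c ε x t ω)

variable {Z : Set (Pt Dx Dc)} {z₀ : Pt Dx Dc} {f : Ω → Pt Dx Dc → ℝ}
    {c : ℕ → Ω → Fin Dc → ℝ} {ε : ℕ → Ω → ℝ} {x : ℕ → Ω → Fin Dx → ℝ}
    {S : Ω → ℕ → ℝ} {e : (ℕ → ℝ) → Pt Dx Dc → ℝ} {π : ℕ → Hist Dx Dc → Fin Dx → ℝ}

lemma measurable_update_hist (t : ℕ) :
    Measurable (fun q : Hist Dx Dc × ((Fin Dx → ℝ) × (Fin Dc → ℝ) × ℝ) =>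
      Function.update q.1 t q.2) := by
  refine measurable_pi_lambda _ fun i => ?_
  by_cases h : i = t
  · subst h
    simpa using measurable_snd
  · simp only [Function.update_of_ne h]
    fun_prop

/-- By recursion along the policy, a history is a measurable function of the path and of the past
contexts and noises alone. Hence `indepFun_past` applies to it. -/
lemma FollowsPolicy.record_eq (hp : FollowsPolicy Z z₀ f c ε x S e π) (t : ℕ) :
    ∃ G : (ℕ → ℝ) × (ℕ → Fin Dc → ℝ) × (ℕ → ℝ) → Hist Dx Dc, Measurable G ∧
      ∀ ω, record f c ε x t ω = G (S ω, trunc t (fun i => c i ω), trunc t (fun i => ε i ω)) := by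
  induction t with
  | zero => exact ⟨fun _ => 0, measurable_const, fun ω => by ext1 i; simp [record]⟩
  | succ t ih =>
    obtain ⟨G, hG, h⟩ := ih
    rcases Nat.eq_zero_or_pos t with rfl | ht
    · refine ⟨fun q i => if i = 0 then (0, q.2.1 0, 0) else 0, ?_, fun ω => ?_⟩
      · refine measurable_pi_lambda _ fun i => ?_
        by_cases hi : i = 0
        · simp only [hi, if_true]
          fun_prop
        · simp [hi]
      · ext1 i
        unfold record trunc
        by_cases hi : i = 0 <;> simp [hi]
    · have mG : Measurable fun q : (ℕ → ℝ) × (ℕ → Fin Dc → ℝ) × (ℕ → ℝ) =>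
          G (q.1, trunc t q.2.1, trunc t q.2.2) := hG.comp (measurable_fst.prodMk
        (((measurable_trunc t).comp (measurable_fst.comp measurable_snd)).prodMk
          ((measurable_trunc t).comp (measurable_snd.comp measurable_snd))))
      have mπ := (hp.measurable_policy t).comp mG
      have mc : Measurable fun q : (ℕ → ℝ) × (ℕ → Fin Dc → ℝ) × (ℕ → ℝ) => q.2.1 t := by fun_prop
      have my := hp.measurable_eval.comp
        (measurable_fst.prodMk ((measurable_clip hp.measurableSet z₀).comp (mπ.prodMk mc)))
      refine ⟨fun q => Function.update (G (q.1, trunc t q.2.1, trunc t q.2.2)) t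
        (π t (G (q.1, trunc t q.2.1, trunc t q.2.2)), q.2.1 t,
          e q.1 (clip Z z₀ (π t (G (q.1, trunc t q.2.1, trunc t q.2.2)), q.2.1 t)) + q.2.2 t),
        ?_, fun ω => ?_⟩
      · exact (measurable_update_hist t).comp (mG.prodMk (mπ.prodMk (mc.prodMk
          (my.add (by fun_prop : Measurable
            fun q : (ℕ → ℝ) × (ℕ → Fin Dc → ℝ) × (ℕ → ℝ) => q.2.2 t)))))
      · rw [record_succ f c ε x ht, hp.obs_eq t ht, hp.decision_eq t ht, h]
        dsimp only
        rw [trunc_trunc t.le_succ, trunc_trunc t.le_succ]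
        simp [trunc]

lemma FollowsPolicy.measurable_record (hp : FollowsPolicy Z z₀ f c ε x S e π)
    (hc : ∀ t, Measurable (c t)) (he : ∀ t, Measurable (ε t)) (t : ℕ) :
    Measurable (record f c ε x t) := by
  obtain ⟨G, hG, h⟩ := hp.record_eq t
  have hc' : Measurable fun ω i => c i ω := measurable_pi_lambda _ hc
  have he' : Measurable fun ω i => ε i ω := measurable_pi_lambda _ he
  rw [funext h]
  exact hG.comp (hp.measurable_path.prodMk (((measurable_trunc t).comp hc').prodMk
    ((measurable_trunc t).comp he')))

lemma FollowsPolicy.indepFun (hp : FollowsPolicy Z z₀ f c ε x S e π)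
    (hc : ∀ t, Measurable (c t)) (he : ∀ t, Measurable (ε t))
    (hci : iIndepFun c P) (hei : iIndepFun ε P)
    (hce : IndepFun (fun ω t => c t ω) (fun ω t => ε t ω) P)
    (hSi : IndepFun S (fun ω => (fun t => c t ω, fun t => ε t ω)) P) (t : ℕ) :
    IndepFun (fun ω => (S ω, record f c ε x t ω)) (fun ω => (c t ω, ε t ω)) P := by
  obtain ⟨G, hG, h⟩ := hp.record_eq t
  have h1 := (indepFun_past hp.measurable_path hc he hci hei hce hSi t).comp
    (φ := fun q => (q.1, G q)) (ψ := id) (by fun_prop) measurable_id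
  rw [funext h]
  exact h1

/-- The likelihood ratio of the first `n` observations in a history. -/
noncomputable def histLik (Z : Set (Pt Dx Dc)) (z₀ : Pt Dx Dc) (σ : ℝ)
    (e : (ℕ → ℝ) → Pt Dx Dc → ℝ) (n : ℕ) (h : Hist Dx Dc) (s : ℕ → ℝ) : ℝ :=
  likelihood σ (fun i : Fin n => (h (i + 1)).2.2) (fun i : Fin n => e s (site Z z₀ h (i + 1)))

lemma FollowsPolicy.measurable_histLik (hp : FollowsPolicy Z z₀ f c ε x S e π) (σ : ℝ) (n : ℕ) :
    Measurable (fun q : Hist Dx Dc × (ℕ → ℝ) => histLik Z z₀ σ e n q.1 q.2) := by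
  unfold histLik
  refine Measurable.likelihood σ (by fun_prop) (measurable_pi_lambda _ fun i => ?_)
  exact hp.measurable_eval.comp (measurable_snd.prodMk
    ((measurable_site hp.measurableSet z₀ _).comp measurable_fst))

lemma histLik_update (σ : ℝ) (n : ℕ) (h : Hist Dx Dc) (s : ℕ → ℝ) (v : Fin Dx → ℝ)
    (u : Fin Dc → ℝ) (y : ℝ) :
    histLik Z z₀ σ e (n + 1) (Function.update h (n + 1) (v, u, y)) s =
      histLik Z z₀ σ e n h s *
        Real.exp ((y * e s (clip Z z₀ (v, u)) - e s (clip Z z₀ (v, u)) ^ 2 / 2) / σ ^ 2) := by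
  unfold histLik likelihood
  rw [Fin.sum_univ_castSucc, Real.exp_add]
  have : ∀ i : Fin n, ((i : ℕ) + 1 ≠ n + 1) := fun i => by have := i.2; omega
  simp [site, Function.update_of_ne (this _)]

/-- Given the history, the law of the path is the prior, tilted by the likelihood. -/
theorem FollowsPolicy.exists_disintegration (hp : FollowsPolicy Z z₀ f c ε x S e π)
    (hc : ∀ t, Measurable (c t)) (he : ∀ t, Measurable (ε t))
    (hci : iIndepFun c P) (hei : iIndepFun ε P)
    (hce : IndepFun (fun ω t => c t ω) (fun ω t => ε t ω) P)
    (hSi : IndepFun S (fun ω => (fun t => c t ω, fun t => ε t ω)) P) {σ : ℝ} (hσ : 0 < σ)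
    (hlaw : ∀ t, P.map (ε t) = gaussianReal 0 (Real.toNNReal (σ ^ 2))) (n : ℕ) :
    ∃ N : Measure (Hist Dx Dc), IsProbabilityMeasure N ∧
      ∀ Φ : (ℕ → ℝ) × Hist Dx Dc → ENNReal, Measurable Φ →
        ∫⁻ ω, Φ (S ω, record f c ε x (n + 1) ω) ∂P =
          ∫⁻ h, ∫⁻ ω, ENNReal.ofReal (histLik Z z₀ σ e n h (S ω)) * Φ (S ω, h) ∂P ∂N := by
  have hS := hp.measurable_path
  have hrec := hp.measurable_record hc he
  induction n with
  | zero =>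
    -- The first history contains only the context `c 0`, which is independent of the path, and the
    -- likelihood of no observations is 1.
    refine ⟨P.map (record f c ε x 1), Measure.isProbabilityMeasure_map (hrec 1).aemeasurable,
      fun Φ hΦ => ?_⟩
    have hi : IndepFun S (record f c ε x 1) P := by
      have hψ : Measurable (fun q : (ℕ → Fin Dc → ℝ) × (ℕ → ℝ) =>
          ((fun i => if i = 0 then (0, q.1 0, 0) else 0) : Hist Dx Dc)) := by
        refine measurable_pi_lambda _ fun i => ?_
        by_cases hi : i = 0
        · simp only [hi, if_true]
          fun_prop
        · simp [hi]
      have h1 := hSi.comp (φ := id) measurable_id hψ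
      convert h1 using 1
      · rfl
      · ext1 ω
        ext1 i
        unfold record
        by_cases hi : i = 0 <;> simp [hi]
    have hΦ' : Measurable fun q : Hist Dx Dc × (ℕ → ℝ) => Φ (q.2, q.1) := by fun_prop
    have hΦ'' : Measurable fun q : Hist Dx Dc × Ω => Φ (S q.2, q.1) := by fun_prop
    have h1 : ∀ h s, histLik Z z₀ σ e 0 h s = 1 := fun h s => by simp [histLik, likelihood]
    simp only [h1, ENNReal.ofReal_one, one_mul]
    rw [lintegral_map hΦ''.lintegral_prod_right' (hrec 1),
      lintegral_of_indepFun (hrec 1) hS hi.symm hΦ']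
    refine lintegral_congr fun ω => ?_
    have h2 : Measurable fun s => Φ (s, record f c ε x 1 ω) := by fun_prop
    exact lintegral_map h2 hS
  | succ n ih =>
    obtain ⟨N, hN, ih⟩ := ih
    set γ := gaussianReal 0 (Real.toNNReal (σ ^ 2)) with hγ
    set ρ : Measure (Fin Dc → ℝ) := P.map (c (n + 1)) with hρ
    have hρ' : IsProbabilityMeasure ρ :=
      Measure.isProbabilityMeasure_map (hc (n + 1)).aemeasurable
    have mπ := hp.measurable_policy (n + 1)
    -- the true value and the next history
    set m : Hist Dx Dc × (ℕ → ℝ) × (Fin Dc → ℝ) → ℝ := fun q =>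
      e q.2.1 (clip Z z₀ (π (n + 1) q.1, q.2.2)) with hm
    have mm : Measurable m := by
      refine hp.measurable_eval.comp ((by fun_prop : Measurable
        fun q : Hist Dx Dc × (ℕ → ℝ) × (Fin Dc → ℝ) => q.2.1).prodMk
          ((measurable_clip hp.measurableSet z₀).comp ?_))
      fun_prop
    set U : Hist Dx Dc × (Fin Dc → ℝ) × ℝ → Hist Dx Dc := fun q =>
      Function.update q.1 (n + 1) (π (n + 1) q.1, q.2.1, q.2.2) with hU
    have mU : Measurable U := by
      refine (measurable_update_hist (n + 1)).comp (measurable_fst.prodMk ?_)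
      fun_prop
    -- The reference law of the next history appends the decision of the policy, a fresh context and
    -- an observation of pure noise. Decision and context enter no likelihood factor, as their law
    -- given the history does not involve the path; this is why adaptivity is harmless.
    refine ⟨(N.prod (ρ.prod γ)).map U, Measure.isProbabilityMeasure_map mU.aemeasurable,
      fun Φ hΦ => ?_⟩
    have mL : Measurable fun q : Hist Dx Dc × (ℕ → ℝ) =>
        ENNReal.ofReal (histLik Z z₀ σ e n q.1 q.2) :=
      (hp.measurable_histLik σ n).ennreal_ofReal
    have mL' : Measurable fun q : Hist Dx Dc × (ℕ → ℝ) =>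
        ENNReal.ofReal (histLik Z z₀ σ e (n + 1) q.1 q.2) :=
      (hp.measurable_histLik σ (n + 1)).ennreal_ofReal
    have hcε : P.map (fun ω => (c (n + 1) ω, ε (n + 1) ω)) = ρ.prod γ := by
      have : IndepFun (c (n + 1)) (ε (n + 1)) P :=
        hce.comp (measurable_pi_apply (n + 1)) (measurable_pi_apply (n + 1))
      rw [this.map_prod_eq_prod_map_map (hc _).aemeasurable (he _).aemeasurable, hlaw]
    set Ψ : ((ℕ → ℝ) × Hist Dx Dc) × ((Fin Dc → ℝ) × ℝ) → ENNReal := fun q =>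
      Φ (q.1.1, U (q.1.2, q.2.1, m (q.1.2, q.1.1, q.2.1) + q.2.2)) with hΨ
    have mΨ : Measurable Ψ := by
      refine hΦ.comp ((by fun_prop : Measurable fun q : ((ℕ → ℝ) × Hist Dx Dc) ×
        ((Fin Dc → ℝ) × ℝ) => q.1.1).prodMk (mU.comp ?_))
      fun_prop
    -- The current context and noise are independent of the path and of the history, so they may be
    -- integrated separately.
    have step1 : ∫⁻ ω, Φ (S ω, record f c ε x (n + 1 + 1) ω) ∂P =
        ∫⁻ ω, ∫⁻ q, Ψ ((S ω, record f c ε x (n + 1) ω), q) ∂(ρ.prod γ) ∂P := by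
      rw [← hcε, ← lintegral_of_indepFun (hS.prodMk (hrec (n + 1)))
        ((hc _).prodMk (he _)) (hp.indepFun hc he hci hei hce hSi (n + 1)) mΨ]
      refine lintegral_congr fun ω => ?_
      rw [record_succ f c ε x (by omega), hp.obs_eq _ (by omega), hp.decision_eq _ (by omega)]
    rw [step1, ih (fun q => ∫⁻ v, Ψ (q, v) ∂(ρ.prod γ)) mΨ.lintegral_prod_right']
    -- shift the noise
    have mE : Measurable fun q : Hist Dx Dc × (ℕ → ℝ) × (Fin Dc → ℝ) × ℝ =>
        ENNReal.ofReal (Real.exp ((q.2.2.2 * m (q.1, q.2.1, q.2.2.1) -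
          m (q.1, q.2.1, q.2.2.1) ^ 2 / 2) / σ ^ 2)) := by fun_prop
    have step2 : ∀ h s, ∫⁻ v, Ψ ((s, h), v) ∂(ρ.prod γ) =
        ∫⁻ v, ENNReal.ofReal (Real.exp ((v.2 * m (h, s, v.1) - m (h, s, v.1) ^ 2 / 2) / σ ^ 2)) *
          Φ (s, U (h, v)) ∂(ρ.prod γ) := by
      intro h s
      have h1 : Measurable fun v => Ψ ((s, h), v) := by fun_prop
      rw [lintegral_prod _ h1.aemeasurable, lintegral_prod]
      · refine lintegral_congr fun u => ?_
        have h2 : Measurable fun y : ℝ => Φ (s, U (h, u, y)) := by fun_prop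
        exact lintegral_gaussianReal_shift hσ (m (h, s, u)) h2
      · refine Measurable.aemeasurable (Measurable.mul ?_ (by fun_prop))
        fun_prop
    have mR : Measurable fun q : Hist Dx Dc × Ω =>
        ENNReal.ofReal (histLik Z z₀ σ e (n + 1) q.1 (S q.2)) * Φ (S q.2, q.1) := by
      have h1 : Measurable fun q : Hist Dx Dc × Ω =>
          ENNReal.ofReal (histLik Z z₀ σ e (n + 1) q.1 (S q.2)) :=
        mL'.comp (g := fun q : Hist Dx Dc × (ℕ → ℝ) =>
          ENNReal.ofReal (histLik Z z₀ σ e (n + 1) q.1 q.2))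
          (f := fun q : Hist Dx Dc × Ω => (q.1, S q.2)) (by fun_prop)
      exact h1.mul (by fun_prop)
    have mR' : Measurable fun h : Hist Dx Dc =>
        ∫⁻ ω, ENNReal.ofReal (histLik Z z₀ σ e (n + 1) h (S ω)) * Φ (S ω, h) ∂P :=
      mR.lintegral_prod_right'
    have mR'' : Measurable fun q => ∫⁻ ω, ENNReal.ofReal (histLik Z z₀ σ e (n + 1) (U q) (S ω)) *
        Φ (S ω, U q) ∂P := mR'.comp mU
    rw [lintegral_map mR' mU, lintegral_prod _ mR''.aemeasurable]
    refine lintegral_congr fun h => ?_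
    have mT : Measurable fun q : ((Fin Dc → ℝ) × ℝ) × Ω =>
        ENNReal.ofReal (histLik Z z₀ σ e (n + 1) (U (h, q.1)) (S q.2)) * Φ (S q.2, U (h, q.1)) :=
      mR.comp (g := fun q : Hist Dx Dc × Ω =>
          ENNReal.ofReal (histLik Z z₀ σ e (n + 1) q.1 (S q.2)) * Φ (S q.2, q.1))
        (f := fun q : ((Fin Dc → ℝ) × ℝ) × Ω => (U (h, q.1), q.2)) (by fun_prop)
    rw [lintegral_lintegral_swap (f := fun (v : (Fin Dc → ℝ) × ℝ) ω =>
      ENNReal.ofReal (histLik Z z₀ σ e (n + 1) (U (h, v)) (S ω)) * Φ (S ω, U (h, v)))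
      mT.aemeasurable]
    refine lintegral_congr fun ω => ?_
    rw [step2, ← lintegral_const_mul]
    · refine lintegral_congr fun v => ?_
      rw [← mul_assoc, ← ENNReal.ofReal_mul
        (show 0 ≤ histLik Z z₀ σ e n h (S ω) from (likelihood_pos _ _ _).le), hU]
      dsimp only
      -- The density produced by shifting the noise is the new factor of the likelihood.
      rw [histLik_update]
    · refine Measurable.mul ?_ (by fun_prop)
      fun_prop

end Histories

end DRBO

/-! ### Measurability of posterior means and covariances. -/

namespace DRBO

section MeasurableMatrices

variable {α : Type*} [MeasurableSpace α] {n : ℕ}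

lemma measurable_det {A : α → Matrix (Fin n) (Fin n) ℝ} (hA : ∀ i j, Measurable fun q => A q i j) :
    Measurable fun q => (A q).det := by
  simp only [Matrix.det_apply]
  fun_prop

lemma measurable_inv_apply {A : α → Matrix (Fin n) (Fin n) ℝ}
    (hA : ∀ i j, Measurable fun q => A q i j) (i j : Fin n) :
    Measurable fun q => (A q)⁻¹ i j := by
  simp only [Matrix.inv_def, Matrix.smul_apply, Ring.inverse_eq_inv', Matrix.adjugate_apply,
    smul_eq_mul]
  refine (measurable_det hA).inv.mul (measurable_det fun i' j' => ?_)
  simp only [Matrix.updateRow_apply]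
  split_ifs
  · exact measurable_const
  · exact hA _ _

variable {Z : Type*} [MeasurableSpace Z] {k : Z → Z → ℝ}
  (hk : Measurable fun q : Z × Z => k q.1 q.2) (σ : ℝ) {z : α → Fin n → Z} {y : α → Fin n → ℝ}
  {w w' : α → Z}
include hk

lemma measurable_gram_inv (hz : Measurable z) (i j : Fin n) :
    Measurable fun q => (gram k σ (z q))⁻¹ i j := by
  refine measurable_inv_apply (fun i j => ?_) i j
  have h1 : Measurable fun q => k (z q i) (z q j) :=
    hk.comp (by fun_prop : Measurable fun q => (z q i, z q j))
  simp only [gram, Matrix.add_apply, Matrix.of_apply]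
  fun_prop

lemma measurable_postMean (hz : Measurable z) (hy : Measurable y) (hw : Measurable w) :
    Measurable fun q => postMean k σ (z q) (y q) (w q) := by
  have h1 : ∀ i, Measurable fun q => k (z q i) (w q) := fun i =>
    hk.comp (by fun_prop : Measurable fun q => (z q i, w q))
  have h2 := measurable_gram_inv hk σ hz
  simp only [postMean, dotProduct, Matrix.mulVec]
  exact Finset.measurable_fun_sum _ fun i _ => (h1 i).mul
    (Finset.measurable_fun_sum _ fun j _ => (h2 i j).mul ((measurable_pi_apply j).comp hy))

lemma measurable_postCov (hz : Measurable z) (hw : Measurable w) (hw' : Measurable w') :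
    Measurable fun q => postCov k σ (z q) (w q) (w' q) := by
  have h0 : Measurable fun q => k (w q) (w' q) := hk.comp (hw.prodMk hw')
  have h1 : ∀ i, Measurable fun q => k (z q i) (w q) := fun i =>
    hk.comp (by fun_prop : Measurable fun q => (z q i, w q))
  have h1' : ∀ i, Measurable fun q => k (z q i) (w' q) := fun i =>
    hk.comp (by fun_prop : Measurable fun q => (z q i, w' q))
  have h2 := measurable_gram_inv hk σ hz
  simp only [postCov, dotProduct, Matrix.mulVec]
  exact h0.sub (Finset.measurable_fun_sum _ fun i _ => (h1 i).mul
    (Finset.measurable_fun_sum _ fun j _ => (h2 i j).mul (h1' j)))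

end MeasurableMatrices

/-- The kernel is not assumed measurable, and only its values on `Z` are tied to the process. On `Z`
it may be replaced by the covariance `pathKernel` of the encoded path, which is jointly measurable
everywhere. -/
lemma postMean_congr {E : Type*} {Z : Set E} {k k' : E → E → ℝ}
    (h : ∀ z ∈ Z, ∀ w ∈ Z, k z w = k' z w) (σ : ℝ) {n : ℕ} {z : Fin n → E} (hz : ∀ i, z i ∈ Z)
    (y : Fin n → ℝ) {w : E} (hw : w ∈ Z) : postMean k σ z y w = postMean k' σ z y w := by
  unfold postMean gram
  simp only [h _ (hz _) _ (hz _), h _ (hz _) _ hw]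

lemma postCov_congr {E : Type*} {Z : Set E} {k k' : E → E → ℝ}
    (h : ∀ z ∈ Z, ∀ w ∈ Z, k z w = k' z w) (σ : ℝ) {n : ℕ} {z : Fin n → E} (hz : ∀ i, z i ∈ Z)
    {w w' : E} (hw : w ∈ Z) (hw' : w' ∈ Z) : postCov k σ z w w' = postCov k' σ z w w' := by
  unfold postCov gram
  simp only [h _ (hz _) _ (hz _), h _ (hz _) _ hw, h _ (hz _) _ hw', h _ hw _ hw']

/-! ### Two moment bounds for normal variables. -/

section GaussianBounds

/-- An exponential moment bound: the positive part of `u` is at most `exp (l * u)` for `l ≥ 1`. The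
optimal exponent `l = √β / √s` is at least 1 because `s ≤ 1 ≤ β`. -/
lemma lintegral_ofReal_sub_gaussianReal_le {m s β : ℝ} (hs : 0 ≤ s) (hs1 : s ≤ 1) (hβ : 1 ≤ β) :
    ∫⁻ v, ENNReal.ofReal (v - (m + √β * √s)) ∂gaussianReal m (Real.toNNReal s) ≤
      ENNReal.ofReal (Real.exp (-β / 2)) := by
  rcases hs.eq_or_lt with rfl | hs0
  · simp
  set r := √s with hr
  have hr0 : 0 < r := Real.sqrt_pos.2 hs0
  have hrs : r ^ 2 = s := Real.sq_sqrt hs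
  have hr1 : r ≤ 1 := Real.sqrt_le_one.2 hs1
  set q := √β with hq
  have hq1 : 1 ≤ q := Real.one_le_sqrt.2 hβ
  have hqβ : q ^ 2 = β := Real.sq_sqrt (by linarith)
  set l := q / r with hl
  have hl1 : 1 ≤ l := by
    rw [hl, le_div_iff₀ hr0]
    linarith
  have hint := integrable_exp_mul_gaussianReal (μ := m) (v := Real.toNNReal s) l
  have hmgf : ∫ v, Real.exp (l * v) ∂gaussianReal m (Real.toNNReal s) =
      Real.exp (m * l + s * l ^ 2 / 2) := by
    have := congrFun (mgf_id_gaussianReal (μ := m) (v := Real.toNNReal s)) l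
    simpa [mgf, Real.coe_toNNReal _ hs] using this
  calc ∫⁻ v, ENNReal.ofReal (v - (m + q * r)) ∂gaussianReal m (Real.toNNReal s)
      ≤ ∫⁻ v, ENNReal.ofReal (Real.exp (l * v) * Real.exp (-(l * (m + q * r))))
          ∂gaussianReal m (Real.toNNReal s) := by
        refine lintegral_mono fun v => ENNReal.ofReal_le_ofReal ?_
        rw [← Real.exp_add]
        rcases le_or_gt (v - (m + q * r)) 0 with h | h
        · exact h.trans (Real.exp_pos _).le
        · have := Real.add_one_le_exp (l * v + -(l * (m + q * r)))
          nlinarith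
    _ = ENNReal.ofReal (Real.exp (-β / 2)) := by
        rw [← ofReal_integral_eq_lintegral_ofReal (hint.mul_const _)
          (ae_of_all _ fun v => by positivity), integral_mul_const, hmgf, ← Real.exp_add]
        congr 2
        rw [← hqβ, ← hrs, hl]
        field_simp
        ring

/-- The first absolute moment is controlled by the second, through `|u| ≤ u ^ 2 / (2 * r) + r / 2`
with `r` the standard deviation. -/
lemma lintegral_ofReal_abs_sub_gaussianReal_le {m s : ℝ} (hs : 0 ≤ s) :
    ∫⁻ v, ENNReal.ofReal |v - m| ∂gaussianReal m (Real.toNNReal s) ≤ ENNReal.ofReal (√s) := by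
  rcases hs.eq_or_lt with rfl | hs0
  · simp
  set r := √s with hr
  have hr0 : 0 < r := Real.sqrt_pos.2 hs0
  have hrs : r ^ 2 = s := Real.sq_sqrt hs
  have hvar : ∫ v, (v - m) ^ 2 ∂gaussianReal m (Real.toNNReal s) = s := by
    have h1 := variance_fun_id_gaussianReal (μ := m) (v := Real.toNNReal s)
    rw [variance_eq_integral (by fun_prop), integral_id_gaussianReal, Real.coe_toNNReal _ hs] at h1
    exact h1
  have hint : Integrable (fun v => (v - m) ^ 2) (gaussianReal m (Real.toNNReal s)) := by
    have h1 : MemLp (fun v : ℝ => v - m) 2 (gaussianReal m (Real.toNNReal s)) :=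
      (memLp_id_gaussianReal' 2 (by simp)).sub (memLp_const m)
    exact h1.integrable_sq
  calc ∫⁻ v, ENNReal.ofReal |v - m| ∂gaussianReal m (Real.toNNReal s)
      ≤ ∫⁻ v, ENNReal.ofReal ((v - m) ^ 2 / (2 * r) + r / 2)
          ∂gaussianReal m (Real.toNNReal s) := by
        refine lintegral_mono fun v => ENNReal.ofReal_le_ofReal ?_
        rw [div_add_div _ _ (by positivity) (by positivity), le_div_iff₀ (by positivity)]
        nlinarith [sq_nonneg (|v - m| - r), sq_abs (v - m)]
    _ = ENNReal.ofReal r := by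
        rw [← ofReal_integral_eq_lintegral_ofReal (f := fun v => (v - m) ^ 2 / (2 * r) + r / 2)
          ((hint.div_const _).add (integrable_const _)) (ae_of_all _ fun v => by positivity), integral_add (hint.div_const _)
          (integrable_const _), integral_div, hvar]
        congr 1
        simp only [integral_const, probReal_univ, smul_eq_mul, one_mul]
        rw [← hrs]
        field_simp
        norm_num

end GaussianBounds

/-! ### Conditional expectations given the history. -/

section Posterior

variable {Ω : Type*} [MeasurableSpace Ω] {Dx Dc : ℕ}

/-- The observations in a history. -/
def histObs (n : ℕ) (h : Hist Dx Dc) : Fin n → ℝ := fun i => (h (i + 1)).2.2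

/-- The design points in a history. -/
noncomputable def histSites (Z : Set (Pt Dx Dc)) (z₀ : Pt Dx Dc) (n : ℕ) (h : Hist Dx Dc) :
    Fin n → Pt Dx Dc := fun i => site Z z₀ h (i + 1)

lemma measurable_histObs (n : ℕ) : Measurable (histObs n : Hist Dx Dc → Fin n → ℝ) := by
  unfold histObs
  fun_prop

lemma measurable_histSites {Z : Set (Pt Dx Dc)} (hZ : MeasurableSet Z) (z₀ : Pt Dx Dc) (n : ℕ) :
    Measurable (histSites Z z₀ n) := measurable_pi_lambda _ fun _ => measurable_site hZ z₀ _

/-- The data of a Gaussian process `f`, read off by `e` from the random variable `S`, and of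
the history `R` of the first `n` observations, with the posterior law of `f` given `R`. -/
structure IsPosterior (P : Measure Ω) (Z : Set (Pt Dx Dc)) (z₀ : Pt Dx Dc)
    (k : Pt Dx Dc → Pt Dx Dc → ℝ) (a b σ : ℝ) (f : Ω → Pt Dx Dc → ℝ) (S : Ω → ℕ → ℝ)
    (e : (ℕ → ℝ) → Pt Dx Dc → ℝ) (n : ℕ) (R : Ω → Hist Dx Dc) (N : Measure (Hist Dx Dc)) :
    Prop where
  gp : IsLipschitzGP P Z k a b f
  pos : 0 < σ
  measurableSet : MeasurableSet Z
  mem : z₀ ∈ Z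
  measurable_path : Measurable S
  measurable_eval : Measurable (fun q : (ℕ → ℝ) × Pt Dx Dc => e q.1 q.2)
  eval_eq : ∀ ω, ∀ z ∈ Z, e (S ω) z = f ω z
  measurable_hist : Measurable R
  prob : IsProbabilityMeasure N
  law : ∀ Φ : (ℕ → ℝ) × Hist Dx Dc → ENNReal, Measurable Φ →
        ∫⁻ ω, Φ (S ω, R ω) ∂P =
          ∫⁻ h, ∫⁻ ω, ENNReal.ofReal (histLik Z z₀ σ e n h (S ω)) * Φ (S ω, h) ∂P ∂N

variable {P : Measure Ω} [IsProbabilityMeasure P] {Z : Set (Pt Dx Dc)} {z₀ : Pt Dx Dc}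
    {k : Pt Dx Dc → Pt Dx Dc → ℝ} {a b σ : ℝ} {f : Ω → Pt Dx Dc → ℝ} {S : Ω → ℕ → ℝ}
    {e : (ℕ → ℝ) → Pt Dx Dc → ℝ} {n : ℕ} {R : Ω → Hist Dx Dc} {N : Measure (Hist Dx Dc)}

namespace IsPosterior

lemma histSites_mem (hp : IsPosterior P Z z₀ k a b σ f S e n R N) (h : Hist Dx Dc) (i : Fin n) :
    histSites Z z₀ n h i ∈ Z := clip_mem hp.mem _

lemma histLik_eq (hp : IsPosterior P Z z₀ k a b σ f S e n R N) (h : Hist Dx Dc) (ω : Ω) :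
    histLik Z z₀ σ e n h (S ω) =
      likelihood σ (histObs n h) (fun i => f ω (histSites Z z₀ n h i)) := by
  unfold histLik
  congr 1
  ext i
  exact hp.eval_eq ω _ (clip_mem hp.mem _)

/-- The covariance kernel of the process `e ∘ S`, which is measurable on the whole space. -/
noncomputable def pathKernel (P : Measure Ω) (S : Ω → ℕ → ℝ) (e : (ℕ → ℝ) → Pt Dx Dc → ℝ)
    (z w : Pt Dx Dc) : ℝ := ∫ ω, e (S ω) z * e (S ω) w ∂P

lemma measurable_eval_path (hp : IsPosterior P Z z₀ k a b σ f S e n R N) :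
    Measurable fun q : Ω × Pt Dx Dc => e (S q.1) q.2 :=
  hp.measurable_eval.comp (f := fun q : Ω × Pt Dx Dc => (S q.1, q.2))
    ((hp.measurable_path.comp measurable_fst).prodMk measurable_snd)

lemma measurable_pathKernel (hp : IsPosterior P Z z₀ k a b σ f S e n R N) :
    Measurable fun q : Pt Dx Dc × Pt Dx Dc => pathKernel P S e q.1 q.2 := by
  have h0 := hp.measurable_eval_path
  have h1 : Measurable fun q : (Pt Dx Dc × Pt Dx Dc) × Ω => e (S q.2) q.1.1 :=
    h0.comp (f := fun q : (Pt Dx Dc × Pt Dx Dc) × Ω => (q.2, q.1.1)) (by fun_prop)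
  have h2 : Measurable fun q : (Pt Dx Dc × Pt Dx Dc) × Ω => e (S q.2) q.1.2 :=
    h0.comp (f := fun q : (Pt Dx Dc × Pt Dx Dc) × Ω => (q.2, q.1.2)) (by fun_prop)
  exact (h1.mul h2).stronglyMeasurable.integral_prod_right'.measurable

lemma pathKernel_eq (hp : IsPosterior P Z z₀ k a b σ f S e n R N) :
    ∀ z ∈ Z, ∀ w ∈ Z, k z w = pathKernel P S e z w := by
  intro z hz w hw
  rw [← hp.gp.integral_mul hz hw]
  unfold pathKernel
  congr 1
  ext ω
  rw [hp.eval_eq ω z hz, hp.eval_eq ω w hw]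

/-- The posterior mean, given a history. -/
noncomputable def mean (P : Measure Ω) (Z : Set (Pt Dx Dc)) (z₀ : Pt Dx Dc) (σ : ℝ)
    (S : Ω → ℕ → ℝ) (e : (ℕ → ℝ) → Pt Dx Dc → ℝ) (n : ℕ) (h : Hist Dx Dc) (w : Pt Dx Dc) : ℝ :=
  postMean (pathKernel P S e) σ (histSites Z z₀ n h) (histObs n h) w

/-- The posterior variance, given a history. -/
noncomputable def var (P : Measure Ω) (Z : Set (Pt Dx Dc)) (z₀ : Pt Dx Dc) (σ : ℝ)
    (S : Ω → ℕ → ℝ) (e : (ℕ → ℝ) → Pt Dx Dc → ℝ) (n : ℕ) (h : Hist Dx Dc) (w : Pt Dx Dc) : ℝ :=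
  postCov (pathKernel P S e) σ (histSites Z z₀ n h) w w

lemma measurable_mean (hp : IsPosterior P Z z₀ k a b σ f S e n R N) :
    Measurable fun q : Hist Dx Dc × Pt Dx Dc => mean P Z z₀ σ S e n q.1 q.2 :=
  measurable_postMean hp.measurable_pathKernel σ
    ((measurable_histSites hp.measurableSet z₀ n).comp measurable_fst)
    ((measurable_histObs n).comp measurable_fst) measurable_snd

lemma measurable_var (hp : IsPosterior P Z z₀ k a b σ f S e n R N) :
    Measurable fun q : Hist Dx Dc × Pt Dx Dc => var P Z z₀ σ S e n q.1 q.2 :=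
  measurable_postCov hp.measurable_pathKernel σ
    ((measurable_histSites hp.measurableSet z₀ n).comp measurable_fst)
    measurable_snd measurable_snd

lemma mean_eq (hp : IsPosterior P Z z₀ k a b σ f S e n R N) (h : Hist Dx Dc) {w : Pt Dx Dc}
    (hw : w ∈ Z) : mean P Z z₀ σ S e n h w =
      postMean k σ (histSites Z z₀ n h) (histObs n h) w :=
  (postMean_congr hp.pathKernel_eq σ (hp.histSites_mem h) _ hw).symm

lemma var_eq (hp : IsPosterior P Z z₀ k a b σ f S e n R N) (h : Hist Dx Dc) {w : Pt Dx Dc}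
    (hw : w ∈ Z) : var P Z z₀ σ S e n h w = postCov k σ (histSites Z z₀ n h) w w :=
  (postCov_congr hp.pathKernel_eq σ (hp.histSites_mem h) hw hw).symm

lemma var_nonneg (hp : IsPosterior P Z z₀ k a b σ f S e n R N) (h : Hist Dx Dc) {w : Pt Dx Dc}
    (hw : w ∈ Z) : 0 ≤ var P Z z₀ σ S e n h w := by
  rw [hp.var_eq h hw]
  exact hp.gp.postCov_nonneg hp.pos (hp.histSites_mem h) hw

lemma var_le_one (hp : IsPosterior P Z z₀ k a b σ f S e n R N) (h : Hist Dx Dc) {w : Pt Dx Dc}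
    (hw : w ∈ Z) : var P Z z₀ σ S e n h w ≤ 1 := by
  rw [hp.var_eq h hw]
  exact hp.gp.postCov_le_one hp.pos (hp.histSites_mem h) hw

/-- The density of the observations in a history, relative to pure noise. -/
noncomputable def histEvidence (P : Measure Ω) (Z : Set (Pt Dx Dc)) (z₀ : Pt Dx Dc) (σ : ℝ)
    (f : Ω → Pt Dx Dc → ℝ) (n : ℕ) (h : Hist Dx Dc) : ℝ :=
  evidence P f σ (histSites Z z₀ n h) (histObs n h)

lemma histEvidence_pos (hp : IsPosterior P Z z₀ k a b σ f S e n R N) (h : Hist Dx Dc) :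
    0 < histEvidence P Z z₀ σ f n h := hp.gp.evidence_pos (hp.histSites_mem h) _

lemma measurable_histLik (hp : IsPosterior P Z z₀ k a b σ f S e n R N) :
    Measurable (fun q : Hist Dx Dc × Ω => histLik Z z₀ σ e n q.1 (S q.2)) := by
  unfold histLik
  refine Measurable.likelihood σ (by fun_prop) (measurable_pi_lambda _ fun i => ?_)
  exact hp.measurable_eval_path.comp (f := fun q : Hist Dx Dc × Ω => (q.2, site Z z₀ q.1 (i + 1)))
    (measurable_snd.prodMk ((measurable_site hp.measurableSet z₀ _).comp measurable_fst))

lemma measurable_lintegral_histLik (hp : IsPosterior P Z z₀ k a b σ f S e n R N)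
    {Φ : (ℕ → ℝ) × Hist Dx Dc → ENNReal} (hΦ : Measurable Φ) :
    Measurable fun h =>
      ∫⁻ ω, ENNReal.ofReal (histLik Z z₀ σ e n h (S ω)) * Φ (S ω, h) ∂P := by
  have hS := hp.measurable_path
  have h1 := hp.measurable_histLik.ennreal_ofReal.mul
    (by fun_prop : Measurable fun q : Hist Dx Dc × Ω => Φ (S q.2, q.1))
  exact h1.lintegral_prod_right'

lemma lintegral_histLik (hp : IsPosterior P Z z₀ k a b σ f S e n R N) (h : Hist Dx Dc) :
    ∫⁻ ω, ENNReal.ofReal (histLik Z z₀ σ e n h (S ω)) ∂P =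
      ENNReal.ofReal (histEvidence P Z z₀ σ f n h) := by
  simp only [hp.histLik_eq]
  rw [histEvidence, evidence, ofReal_integral_eq_lintegral_ofReal
    (hp.gp.integrable_likelihood (hp.histSites_mem h) _)
    (ae_of_all _ fun ω => (likelihood_pos _ _ _).le)]

lemma lintegral_hist (hp : IsPosterior P Z z₀ k a b σ f S e n R N) {W : Hist Dx Dc → ENNReal}
    (hW : Measurable W) :
    ∫⁻ ω, W (R ω) ∂P = ∫⁻ h, ENNReal.ofReal (histEvidence P Z z₀ σ f n h) * W h ∂N := by
  have h := hp.law (fun q => W q.2) (by fun_prop)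
  simp only at h
  rw [h]
  refine lintegral_congr fun h => ?_
  have hm : Measurable fun ω => ENNReal.ofReal (histLik Z z₀ σ e n h (S ω)) :=
    (hp.measurable_histLik.comp measurable_prodMk_left).ennreal_ofReal
  rw [lintegral_mul_const _ hm, hp.lintegral_histLik]

/-- Expectations of functions of the history and of one value of the process. -/
lemma lintegral_hist_value (hp : IsPosterior P Z z₀ k a b σ f S e n R N)
    {w : Hist Dx Dc → Pt Dx Dc} (hw : Measurable w) (hwZ : ∀ h, w h ∈ Z)
    {φ : Hist Dx Dc × ℝ → ENNReal} (hφ : Measurable φ) :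
    ∫⁻ ω, φ (R ω, f ω (w (R ω))) ∂P =
      ∫⁻ h, ENNReal.ofReal (histEvidence P Z z₀ σ f n h) *
        ∫⁻ v, φ (h, v) ∂gaussianReal (mean P Z z₀ σ S e n h (w h))
          (Real.toNNReal (var P Z z₀ σ S e n h (w h))) ∂N := by
  have he : Measurable fun q : (ℕ → ℝ) × Hist Dx Dc => e q.1 (w q.2) :=
    hp.measurable_eval.comp (f := fun q : (ℕ → ℝ) × Hist Dx Dc => (q.1, w q.2)) (by fun_prop)
  have h := hp.law (fun q => φ (q.2, e q.1 (w q.2))) (hφ.comp (measurable_snd.prodMk he))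
  simp only [hp.eval_eq _ _ (hwZ _)] at h
  rw [h]
  refine lintegral_congr fun h => ?_
  simp only [hp.histLik_eq]
  rw [hp.gp.lintegral_likelihood_mul hp.pos (hp.histSites_mem h) (histObs n h) (hwZ h)
    (φ := fun v => φ (h, v)) (by fun_prop), hp.mean_eq h (hwZ h), hp.var_eq h (hwZ h), histEvidence]

/-- Conditionally on the history the value is normal with mean `mean` and variance `var`, and the
weight `W` is constant. In the application `W` is the density estimate at a fixed context, itself a
function of the history. -/
lemma lintegral_mul_sub_ucb_le (hp : IsPosterior P Z z₀ k a b σ f S e n R N)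
    {w : Hist Dx Dc → Pt Dx Dc} (hw : Measurable w) (hwZ : ∀ h, w h ∈ Z)
    {W : Hist Dx Dc → ENNReal} (hW : Measurable W) {β : ℝ} (hβ : 1 ≤ β) :
    ∫⁻ ω, W (R ω) * ENNReal.ofReal (f ω (w (R ω)) -
        (mean P Z z₀ σ S e n (R ω) (w (R ω)) + √β * √(var P Z z₀ σ S e n (R ω) (w (R ω))))) ∂P ≤
      ENNReal.ofReal (Real.exp (-β / 2)) * ∫⁻ ω, W (R ω) ∂P := by
  have m1 : Measurable fun h => mean P Z z₀ σ S e n h (w h) :=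
    hp.measurable_mean.comp (measurable_id.prodMk hw)
  have m2 : Measurable fun h => var P Z z₀ σ S e n h (w h) :=
    hp.measurable_var.comp (measurable_id.prodMk hw)
  rw [hp.lintegral_hist_value hw hwZ (φ := fun q => W q.1 * ENNReal.ofReal (q.2 -
    (mean P Z z₀ σ S e n q.1 (w q.1) + √β * √(var P Z z₀ σ S e n q.1 (w q.1)))))
    ((hW.comp measurable_fst).mul (measurable_snd.sub ((m1.comp measurable_fst).add
      ((m2.comp measurable_fst).sqrt.const_mul _))).ennreal_ofReal),
    hp.lintegral_hist hW, ← lintegral_const_mul' _ _ ENNReal.ofReal_ne_top]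
  refine lintegral_mono fun h => ?_
  simp only
  rw [lintegral_const_mul _ (by fun_prop)]
  calc _ ≤ ENNReal.ofReal (histEvidence P Z z₀ σ f n h) *
        (W h * ENNReal.ofReal (Real.exp (-β / 2))) := by
        gcongr
        exact lintegral_ofReal_sub_gaussianReal_le (hp.var_nonneg h (hwZ h))
          (hp.var_le_one h (hwZ h)) hβ
    _ = _ := by ring

/-- The point may depend on the history, so this covers the decision itself, for which no uniform
bound over a net is needed. -/
lemma lintegral_mul_abs_sub_mean_le (hp : IsPosterior P Z z₀ k a b σ f S e n R N)
    {w : Hist Dx Dc → Pt Dx Dc} (hw : Measurable w) (hwZ : ∀ h, w h ∈ Z)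
    {W : Hist Dx Dc → ENNReal} (hW : Measurable W) :
    ∫⁻ ω, W (R ω) * ENNReal.ofReal |f ω (w (R ω)) - mean P Z z₀ σ S e n (R ω) (w (R ω))| ∂P ≤
      ∫⁻ ω, W (R ω) * ENNReal.ofReal (√(var P Z z₀ σ S e n (R ω) (w (R ω)))) ∂P := by
  have m1 : Measurable fun h => mean P Z z₀ σ S e n h (w h) :=
    hp.measurable_mean.comp (measurable_id.prodMk hw)
  have m2 : Measurable fun h => var P Z z₀ σ S e n h (w h) :=
    hp.measurable_var.comp (measurable_id.prodMk hw)
  rw [hp.lintegral_hist_value hw hwZ (φ := fun q => W q.1 * ENNReal.ofReal |q.2 -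
    mean P Z z₀ σ S e n q.1 (w q.1)|)
    ((hW.comp measurable_fst).mul
      (measurable_snd.sub (m1.comp measurable_fst)).abs.ennreal_ofReal),
    hp.lintegral_hist (W := fun h => W h * ENNReal.ofReal (√(var P Z z₀ σ S e n h (w h))))
    (by fun_prop)]
  refine lintegral_mono fun h => ?_
  simp only
  rw [lintegral_const_mul _ (by fun_prop)]
  gcongr
  exact lintegral_ofReal_abs_sub_gaussianReal_le (hp.var_nonneg h (hwZ h))

/-- The posterior mean is dominated by the conditional expectation of a bound of the paths. -/
lemma exists_bound_mean (hp : IsPosterior P Z z₀ k a b σ f S e n R N) {M : (ℕ → ℝ) → ENNReal}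
    (hM : Measurable M) (hfM : ∀ ω, ∀ z ∈ Z, ENNReal.ofReal |f ω z| ≤ M (S ω)) :
    ∃ m : Hist Dx Dc → ENNReal, Measurable m ∧
      (∀ h, ∀ z ∈ Z, ENNReal.ofReal |mean P Z z₀ σ S e n h z| ≤ m h) ∧
      ∫⁻ ω, m (R ω) ∂P = ∫⁻ ω, M (S ω) ∂P := by
  have hm0 := hp.measurable_lintegral_histLik (Φ := fun q => M q.1) (by fun_prop)
  have hev : Measurable fun h => ENNReal.ofReal (histEvidence P Z z₀ σ f n h) := by
    have := hp.measurable_lintegral_histLik (Φ := fun q => 1) (by fun_prop)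
    simpa [hp.lintegral_histLik] using this
  -- The posterior mean of `M`. Integrating it over histories cancels the evidence in the
  -- denominator and returns the prior mean.
  refine ⟨fun h => (∫⁻ ω, ENNReal.ofReal (histLik Z z₀ σ e n h (S ω)) * M (S ω) ∂P) /
    ENNReal.ofReal (histEvidence P Z z₀ σ f n h), hm0.div hev, fun h z hz => ?_, ?_⟩
  · have hE := hp.histEvidence_pos h
    rw [ENNReal.le_div_iff_mul_le (Or.inl (by simpa using hE)) (Or.inl ENNReal.ofReal_ne_top)]
    have h1 := hp.gp.integral_likelihood_mul hp.pos (hp.histSites_mem h) (histObs n h) hz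
      measurable_id
    simp only [id, integral_id_gaussianReal] at h1
    have h2 : mean P Z z₀ σ S e n h z * histEvidence P Z z₀ σ f n h =
        ∫ ω, likelihood σ (histObs n h) (fun i => f ω (histSites Z z₀ n h i)) * f ω z ∂P := by
      rw [h1, hp.mean_eq h hz, mul_comm, histEvidence]
    rw [← ENNReal.ofReal_mul (abs_nonneg _), ← abs_of_pos hE, ← abs_mul, h2,
      ← Real.enorm_eq_ofReal_abs]
    refine (enorm_integral_le_lintegral_enorm _).trans (lintegral_mono fun ω => ?_)
    rw [enorm_mul, hp.histLik_eq, Real.enorm_eq_ofReal_abs, Real.enorm_eq_ofReal_abs,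
      abs_of_pos (likelihood_pos _ _ _)]
    gcongr
    exact hfM ω z hz
  · rw [hp.lintegral_hist (W := fun h => (∫⁻ ω, ENNReal.ofReal (histLik Z z₀ σ e n h (S ω)) *
      M (S ω) ∂P) / ENNReal.ofReal (histEvidence P Z z₀ σ f n h)) (hm0.div hev),
      hp.law (fun q => M q.1) (by fun_prop)]
    refine lintegral_congr fun h => ?_
    rw [mul_comm, ENNReal.div_mul_cancel (by simpa using hp.histEvidence_pos h)
      ENNReal.ofReal_ne_top]

end IsPosterior

end Posterior

end DRBO

/-! ### Second differences of the density in the square mean. -/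

namespace DRBO

section SecondDifferences

lemma lintegral_mul_sq_le {α : Type*} [MeasurableSpace α] (μ : Measure α) {f g : α → ENNReal}
    (hf : Measurable f) (hg : Measurable g) :
    (∫⁻ x, f x * g x ∂μ) ^ 2 ≤ (∫⁻ x, f x ^ 2 ∂μ) * ∫⁻ x, g x ^ 2 ∂μ := by
  have h := ENNReal.lintegral_mul_le_Lp_mul_Lq μ Real.HolderConjugate.two_two
    hf.aemeasurable hg.aemeasurable
  simp only [Pi.mul_apply, ENNReal.rpow_ofNat] at h
  refine (pow_le_pow_left' h 2).trans (le_of_eq ?_)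
  rw [mul_pow]
  congr 1 <;>
  · rw [← ENNReal.rpow_natCast, ← ENNReal.rpow_mul]
    norm_num

/-- The second difference is the increment of `s ↦ g s - g (s - 1)` over the unit interval; the mean
value theorem turns it into `g' x - g' (x - 1)`, an integral of `g''`. If `g''` is not integrable
the bound is infinite, so no continuity of `g''` is needed. -/
lemma enorm_second_difference_le {g g' g'' : ℝ → ℝ} (hg : ∀ s, HasDerivAt g (g' s) s)
    (hg' : ∀ s, HasDerivAt g' (g'' s) s) :
    ‖g 1 + g (-1) - 2 * g 0‖ₑ ≤ ∫⁻ s in Set.Icc (-1 : ℝ) 1, ‖g'' s‖ₑ := by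
  have hd : ∀ s, HasDerivAt (fun s => g s - g (s - 1)) (g' s - g' (s - 1)) s := fun s => by
    have h1 : HasDerivAt (fun s => g (s - 1)) (g' (s - 1)) s := by
      simpa [Function.comp_def] using (hg (s - 1)).comp s ((hasDerivAt_id s).sub_const 1)
    exact (hg s).sub h1
  obtain ⟨x, hx, hxe⟩ := exists_hasDerivAt_eq_slope (fun s => g s - g (s - 1))
    (fun s => g' s - g' (s - 1)) (zero_lt_one)
    (fun s _ => (hd s).continuousAt.continuousWithinAt) (fun s _ => hd s)
  have h0 : g 1 + g (-1) - 2 * g 0 = g' x - g' (x - 1) := by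
    rw [hxe]
    norm_num
    ring
  rw [h0]
  by_cases htop : ∫⁻ s in Set.Icc (-1 : ℝ) 1, ‖g'' s‖ₑ = ⊤
  · rw [htop]
    exact le_top
  have hsub : Set.Ioc (x - 1) x ⊆ Set.Icc (-1 : ℝ) 1 := fun s hs =>
    ⟨by linarith [hs.1, hx.1], by linarith [hs.2, hx.2]⟩
  have hm : Measurable g'' := by
    have : g'' = deriv g' := funext fun s => (hg' s).deriv.symm
    rw [this]
    exact measurable_deriv g'
  have hint : IntegrableOn g'' (Set.Icc (-1 : ℝ) 1) :=
    ⟨hm.aestronglyMeasurable, lt_top_iff_ne_top.2 htop⟩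
  have hii : IntervalIntegrable g'' volume (x - 1) x :=
    (intervalIntegrable_iff_integrableOn_Ioc_of_le (by linarith)).2 (hint.mono_set hsub)
  rw [← intervalIntegral.integral_eq_sub_of_hasDerivAt (fun s _ => hg' s) hii,
    intervalIntegral.integral_of_le (by linarith)]
  exact (enorm_integral_le_lintegral_enorm _).trans
    (lintegral_mono_set hsub)

variable {d : ℕ}

/-- The second difference of `p` at `c` with step `w`. -/
def secondDiff (p : (Fin d → ℝ) → ℝ) (c w : Fin d → ℝ) : ℝ := p (c + w) + p (c - w) - 2 * p c

lemma measurable_secondDiff {p : (Fin d → ℝ) → ℝ} (hp : Measurable p) :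
    Measurable fun q : (Fin d → ℝ) × (Fin d → ℝ) => secondDiff p q.1 q.2 := by
  unfold secondDiff
  fun_prop

lemma enorm_bilin_le (A : (Fin d → ℝ) →L[ℝ] (Fin d → ℝ) →L[ℝ] ℝ) (w : Fin d → ℝ) :
    ‖A w w‖ₑ ≤ ‖w‖ₑ ^ 2 * ∑ i, ∑ j, ‖A (Pi.single i 1) (Pi.single j 1)‖ₑ := by
  have hw : w = ∑ i, w i • (Pi.single i 1 : Fin d → ℝ) := pi_eq_sum_univ' w
  have h1 : A w w = ∑ i, ∑ j, w i * w j * A (Pi.single i 1) (Pi.single j 1) := by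
    conv_lhs => rw [hw]
    simp only [map_sum, map_smul, _root_.sum_apply, _root_.smul_apply,
      smul_eq_mul, Finset.mul_sum]
    rw [Finset.sum_comm]
    exact Finset.sum_congr rfl fun i _ => Finset.sum_congr rfl fun j _ => by ring
  have hle : ∀ i, ‖w i‖ₑ ≤ ‖w‖ₑ := fun i => by
    rw [enorm_le_iff_norm_le]
    exact norm_le_pi_norm w i
  rw [h1, Finset.mul_sum]
  refine (enorm_sum_le _ _).trans (Finset.sum_le_sum fun i _ => ?_)
  rw [Finset.mul_sum]
  refine (enorm_sum_le _ _).trans (Finset.sum_le_sum fun j _ => ?_)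
  rw [enorm_mul, enorm_mul, sq]
  gcongr
  exacts [hle i, hle j]

/-- Square the bound along each segment and integrate over its centre. Translation invariance of
Lebesgue measure reduces the result to the square integrals of the second derivatives, so they need
not be bounded. -/
theorem IsSmoothPDFOn.exists_lintegral_secondDiff_le {C : Set (Fin d → ℝ)} {p : (Fin d → ℝ) → ℝ}
    (hp : IsSmoothPDFOn C p) : ∃ A : NNReal, ∀ w,
      ∫⁻ c, ‖secondDiff p c w‖ₑ ^ 2 ≤ A * ‖w‖ₑ ^ 4 := by
  set D : (Fin d → ℝ) → (Fin d → ℝ) →L[ℝ] (Fin d → ℝ) →L[ℝ] ℝ := fderiv ℝ (fderiv ℝ p) with hD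
  set Q : (Fin d → ℝ) → ENNReal := fun c =>
    (∑ i, ∑ j, ‖D c (Pi.single i 1) (Pi.single j 1)‖ₑ) with hQ
  have hDm : ∀ w, Measurable fun c => D c w w := fun w =>
    (measurable_fderiv_apply_const ℝ (fderiv ℝ p) w).apply_continuousLinearMap w
  have hL2 : MemLp (fun c => ∑ i, ∑ j, ‖D c (Pi.single i 1) (Pi.single j 1)‖) 2 volume :=
    memLp_finsetSum _ fun i _ => memLp_finsetSum _ fun j _ => (hp.memLp_second_deriv i j).norm
  have hfin : ∫⁻ c, Q c ^ 2 ≠ ⊤ := by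
    have h1 := (hL2.eLpNorm_lt_top)
    rw [eLpNorm_lt_top_iff_lintegral_rpow_enorm_lt_top (by norm_num) (by norm_num)] at h1
    refine ne_of_lt (lt_of_le_of_lt (le_of_eq ?_) h1)
    refine lintegral_congr fun c => ?_
    simp only [ENNReal.toReal_ofNat, ENNReal.rpow_ofNat]
    congr 1
    rw [hQ, Real.enorm_of_nonneg (by positivity), ENNReal.ofReal_sum_of_nonneg fun i _ => by positivity]
    refine Finset.sum_congr rfl fun i _ => ?_
    rw [ENNReal.ofReal_sum_of_nonneg fun i _ => by positivity]
    exact Finset.sum_congr rfl fun j _ => (ofReal_norm _).symm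
  -- The length 2 of the segment parameter interval enters twice: in the Cauchy-Schwarz inequality
  -- and in the integration over the parameter.
  refine ⟨4 * (∫⁻ c, Q c ^ 2).toNNReal, fun w => ?_⟩
  have hpt : ∀ c, ‖secondDiff p c w‖ₑ ^ 2 ≤
      2 * ∫⁻ s in Set.Icc (-1 : ℝ) 1, ‖D (c + s • w) w w‖ₑ ^ 2 := by
    intro c
    have hline : ∀ s : ℝ, HasDerivAt (fun s : ℝ => c + s • w) w s := fun s => by
      simpa using ((hasDerivAt_id s).smul_const w).const_add c
    have h1 : ∀ s : ℝ, HasDerivAt (fun s : ℝ => p (c + s • w)) (fderiv ℝ p (c + s • w) w) s :=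
      fun s => (hp.differentiable _).hasFDerivAt.comp_hasDerivAt s (hline s)
    have h2 : ∀ s : ℝ, HasDerivAt (fun s : ℝ => fderiv ℝ p (c + s • w) w) (D (c + s • w) w w) s :=
      fun s => by
        have := (hp.differentiable_fderiv _).hasFDerivAt.comp_hasDerivAt s (hline s)
        simpa using this.clm_apply (hasDerivAt_const s w)
    have h3 := enorm_second_difference_le h1 h2
    have h4 : secondDiff p c w = p (c + (1 : ℝ) • w) + p (c + (-1 : ℝ) • w) - 2 * p (c + (0 : ℝ) • w) := by
      simp [secondDiff, sub_eq_add_neg]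
    rw [h4]
    have hmeas : Measurable fun s : ℝ => ‖D (c + s • w) w w‖ₑ :=
      ((hDm w).comp (by fun_prop : Measurable fun s : ℝ => c + s • w)).enorm
    have h5 := lintegral_mul_sq_le (volume.restrict (Set.Icc (-1 : ℝ) 1))
      (measurable_const (a := (1 : ENNReal))) hmeas
    simp only [one_mul, one_pow, lintegral_const, Measure.restrict_apply MeasurableSet.univ,
      Set.univ_inter, Real.volume_Icc] at h5
    refine (pow_le_pow_left' h3 2).trans (h5.trans (le_of_eq ?_))
    norm_num
  have hm2 : Measurable fun q : (Fin d → ℝ) × ℝ => ‖D (q.1 + q.2 • w) w w‖ₑ ^ 2 :=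
    ((hDm w).comp (by fun_prop : Measurable fun q : (Fin d → ℝ) × ℝ => q.1 + q.2 • w)).enorm.pow_const 2
  calc ∫⁻ c, ‖secondDiff p c w‖ₑ ^ 2
      ≤ ∫⁻ c, 2 * ∫⁻ s in Set.Icc (-1 : ℝ) 1, ‖D (c + s • w) w w‖ₑ ^ 2 := lintegral_mono hpt
    _ = 2 * ∫⁻ s in Set.Icc (-1 : ℝ) 1, ∫⁻ c, ‖D (c + s • w) w w‖ₑ ^ 2 := by
        rw [lintegral_const_mul' _ _ (by norm_num), lintegral_lintegral_swap hm2.aemeasurable]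
    _ = 2 * ∫⁻ s in Set.Icc (-1 : ℝ) 1, ∫⁻ c, ‖D c w w‖ₑ ^ 2 := by
        congr 1
        refine lintegral_congr fun s => ?_
        exact lintegral_add_right_eq_self (fun c => ‖D c w w‖ₑ ^ 2) (s • w)
    _ = 4 * ∫⁻ c, ‖D c w w‖ₑ ^ 2 := by
        rw [lintegral_const, Measure.restrict_apply MeasurableSet.univ, Set.univ_inter,
          Real.volume_Icc, mul_comm _ (ENNReal.ofReal _), ← mul_assoc]
        norm_num
    _ ≤ 4 * ∫⁻ c, (‖w‖ₑ ^ 2) ^ 2 * Q c ^ 2 := by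
        gcongr with c
        rw [← mul_pow]
        gcongr
        exact enorm_bilin_le _ _
    _ = _ := by
        rw [lintegral_const_mul' _ _ (by finiteness), ENNReal.coe_mul, ENNReal.coe_toNNReal hfin]
        norm_num
        ring

end SecondDifferences

end DRBO

/-! ### Smoothing of the density and its bias. -/

namespace DRBO

section Smoothing

variable {d : ℕ}

/-- The smoothing `∫ W(u) p(c - hu) du` of `p`. -/
noncomputable def smooth (W : (Fin d → ℝ) → ℝ) (h : Fin d → ℝ) (p : (Fin d → ℝ) → ℝ)
    (c : Fin d → ℝ) : ENNReal := ∫⁻ u, ENNReal.ofReal (W u) * ENNReal.ofReal (p (c - h * u))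

/-- A bound of the smoothing error, for symmetric weights. -/
noncomputable def smoothErr (W : (Fin d → ℝ) → ℝ) (h : Fin d → ℝ) (p : (Fin d → ℝ) → ℝ)
    (c : Fin d → ℝ) : ENNReal := ∫⁻ u, ENNReal.ofReal (W u) * ‖secondDiff p c (h * u)‖ₑ

variable {W p : (Fin d → ℝ) → ℝ} (hW : Measurable W) (hp : Measurable p) (h : Fin d → ℝ)
include hW hp

lemma measurable_smooth : Measurable (smooth W h p) := by
  have : Measurable fun q : (Fin d → ℝ) × (Fin d → ℝ) =>
    ENNReal.ofReal (W q.2) * ENNReal.ofReal (p (q.1 - h * q.2)) := by fun_prop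
  exact this.lintegral_prod_right'

lemma measurable_smoothErr : Measurable (smoothErr W h p) := by
  have h1 : Measurable fun q : (Fin d → ℝ) × (Fin d → ℝ) => secondDiff p q.1 (h * q.2) :=
    (measurable_secondDiff hp).comp
      (by fun_prop : Measurable fun q : (Fin d → ℝ) × (Fin d → ℝ) => (q.1, h * q.2))
  have : Measurable fun q : (Fin d → ℝ) × (Fin d → ℝ) =>
    ENNReal.ofReal (W q.2) * ‖secondDiff p q.1 (h * q.2)‖ₑ := by fun_prop
  exact this.lintegral_prod_right'

/-- Symmetry of the weight pairs opposite steps, so the first order term of the bias disappears and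
only second differences remain. -/
lemma two_mul_smooth (hsymm : ∀ u, W (-u) = W u) (c : Fin d → ℝ) :
    2 * smooth W h p c = ∫⁻ u, ENNReal.ofReal (W u) *
      (ENNReal.ofReal (p (c - h * u)) + ENNReal.ofReal (p (c + h * u))) := by
  have h1 : smooth W h p c =
      ∫⁻ u, ENNReal.ofReal (W u) * ENNReal.ofReal (p (c + h * u)) := by
    unfold smooth
    rw [← lintegral_neg_eq_self]
    refine lintegral_congr fun u => ?_
    rw [hsymm, mul_neg, sub_neg_eq_add]
  rw [two_mul]
  nth_rewrite 2 [h1]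
  rw [smooth, ← lintegral_add_left (by fun_prop)]
  exact lintegral_congr fun u => by ring

lemma smooth_le (hp0 : ∀ c, 0 ≤ p c) (hsymm : ∀ u, W (-u) = W u) (c : Fin d → ℝ) :
    smooth W h p c ≤ (∫⁻ u, ENNReal.ofReal (W u)) * ENNReal.ofReal (p c) + smoothErr W h p c := by
  have h2 : 2 * smooth W h p c ≤
      2 * ((∫⁻ u, ENNReal.ofReal (W u)) * ENNReal.ofReal (p c)) + smoothErr W h p c := by
    rw [two_mul_smooth hW hp h hsymm, ← lintegral_mul_const' _ _ ENNReal.ofReal_ne_top,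
      ← lintegral_const_mul' _ _ (by norm_num), smoothErr, ← lintegral_add_left (by fun_prop)]
    refine lintegral_mono fun u => ?_
    have : ENNReal.ofReal (p (c - h * u)) + ENNReal.ofReal (p (c + h * u)) ≤
        2 * ENNReal.ofReal (p c) + ‖secondDiff p c (h * u)‖ₑ := by
      rw [Real.enorm_eq_ofReal_abs, ← ENNReal.ofReal_add (hp0 _) (hp0 _),
        ← ENNReal.ofReal_ofNat 2, ← ENNReal.ofReal_mul zero_le_two,
        ← ENNReal.ofReal_add (mul_nonneg zero_le_two (hp0 _)) (abs_nonneg _)]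
      apply ENNReal.ofReal_le_ofReal
      have := le_abs_self (secondDiff p c (h * u))
      unfold secondDiff at this ⊢
      linarith
    calc _ ≤ ENNReal.ofReal (W u) *
          (2 * ENNReal.ofReal (p c) + ‖secondDiff p c (h * u)‖ₑ) := by gcongr
      _ = _ := by ring
  refine (ENNReal.mul_le_mul_iff_right (a := 2) (by norm_num) (by norm_num)).1 (h2.trans ?_)
  rw [mul_add]
  gcongr
  rw [two_mul]
  exact le_self_add

lemma le_smooth (hp0 : ∀ c, 0 ≤ p c) (hsymm : ∀ u, W (-u) = W u) (c : Fin d → ℝ) :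
    (∫⁻ u, ENNReal.ofReal (W u)) * ENNReal.ofReal (p c) ≤ smooth W h p c + smoothErr W h p c := by
  have h2 : 2 * ((∫⁻ u, ENNReal.ofReal (W u)) * ENNReal.ofReal (p c)) ≤
      2 * smooth W h p c + smoothErr W h p c := by
    rw [two_mul_smooth hW hp h hsymm, ← lintegral_mul_const' _ _ ENNReal.ofReal_ne_top,
      ← lintegral_const_mul' _ _ (by norm_num), smoothErr, ← lintegral_add_left (by fun_prop)]
    refine lintegral_mono fun u => ?_
    have : 2 * ENNReal.ofReal (p c) ≤ ENNReal.ofReal (p (c - h * u)) +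
        ENNReal.ofReal (p (c + h * u)) + ‖secondDiff p c (h * u)‖ₑ := by
      rw [Real.enorm_eq_ofReal_abs, ← ENNReal.ofReal_add (hp0 _) (hp0 _),
        ← ENNReal.ofReal_ofNat 2, ← ENNReal.ofReal_mul zero_le_two,
        ← ENNReal.ofReal_add (add_nonneg (hp0 _) (hp0 _)) (abs_nonneg _)]
      apply ENNReal.ofReal_le_ofReal
      have := neg_abs_le (secondDiff p c (h * u))
      unfold secondDiff at this ⊢
      linarith
    calc _ = ENNReal.ofReal (W u) * (2 * ENNReal.ofReal (p c)) := by ring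
      _ ≤ ENNReal.ofReal (W u) * (ENNReal.ofReal (p (c - h * u)) +
          ENNReal.ofReal (p (c + h * u)) + ‖secondDiff p c (h * u)‖ₑ) := by gcongr
      _ = _ := by ring
  refine (ENNReal.mul_le_mul_iff_right (a := 2) (by norm_num) (by norm_num)).1 (h2.trans ?_)
  rw [mul_add]
  gcongr
  rw [two_mul]
  exact le_self_add

lemma lintegral_smooth : ∫⁻ c, smooth W h p c =
    (∫⁻ u, ENNReal.ofReal (W u)) * ∫⁻ c, ENNReal.ofReal (p c) := by
  unfold smooth
  rw [lintegral_lintegral_swap (by fun_prop), ← lintegral_mul_const _ (by fun_prop)]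
  refine lintegral_congr fun u => ?_
  rw [lintegral_const_mul _ (by fun_prop),
    lintegral_sub_right_eq_self (fun c => ENNReal.ofReal (p c)) (h * u)]

omit hW hp in
lemma enorm_mul_le_of_abs_le {η : ℝ} (hη : ∀ j, |h j| ≤ η) (u : Fin d → ℝ) :
    ‖h * u‖ₑ ≤ ENNReal.ofReal η * ‖u‖ₑ := by
  rcases isEmpty_or_nonempty (Fin d) with hd | ⟨⟨j⟩⟩
  · rw [Subsingleton.elim (h * u) 0, enorm_zero]
    exact zero_le
  have h0 : 0 ≤ η := (abs_nonneg _).trans (hη j)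
  rw [← ofReal_norm, ← ofReal_norm, ← ENNReal.ofReal_mul h0]
  refine ENNReal.ofReal_le_ofReal ((pi_norm_le_iff_of_nonneg (by positivity)).2 fun i => ?_)
  rw [Pi.mul_apply, norm_mul]
  exact mul_le_mul (hη i) (norm_le_pi_norm u i) (norm_nonneg _) h0

/-- In the Cauchy-Schwarz inequality split the integrand as `‖u‖` times the second difference over
`‖u‖`. The bound of order `‖u‖ ^ 4` on squared second differences then becomes `‖u‖ ^ 2`, and a
second moment of the weight suffices. -/
lemma lintegral_smoothErr_sq_le {A : NNReal}
    (hA : ∀ w, ∫⁻ c, ‖secondDiff p c w‖ₑ ^ 2 ≤ A * ‖w‖ₑ ^ 4) {η : ℝ} (hη : ∀ j, |h j| ≤ η) :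
    ∫⁻ c, smoothErr W h p c ^ 2 ≤
      A * (∫⁻ u, ENNReal.ofReal (W u) * ‖u‖ₑ ^ 2) ^ 2 * ENNReal.ofReal η ^ 4 := by
  set M := ∫⁻ u, ENNReal.ofReal (W u) * ‖u‖ₑ ^ 2 with hM
  have hs : ∀ u, ENNReal.ofReal (W u) = ENNReal.ofReal (√(W u)) ^ 2 := fun u => by
    rcases le_or_gt 0 (W u) with h0 | h0
    · rw [← ENNReal.ofReal_pow (Real.sqrt_nonneg _), Real.sq_sqrt h0]
    · rw [Real.sqrt_eq_zero_of_nonpos h0.le, ENNReal.ofReal_of_nonpos h0.le]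
      simp
  have hm : Measurable fun q : (Fin d → ℝ) × (Fin d → ℝ) => secondDiff p q.1 (h * q.2) :=
    (measurable_secondDiff hp).comp
      (by fun_prop : Measurable fun q : (Fin d → ℝ) × (Fin d → ℝ) => (q.1, h * q.2))
  have hm1 : ∀ c, Measurable fun u => secondDiff p c (h * u) := fun c =>
    hm.comp measurable_prodMk_left
  have hm2 : ∀ w, Measurable fun c => secondDiff p c w := fun w =>
    (measurable_secondDiff hp).comp (measurable_id.prodMk measurable_const)
  have hpt : ∀ c, smoothErr W h p c ^ 2 ≤
      M * ∫⁻ u, ENNReal.ofReal (W u) * (‖secondDiff p c (h * u)‖ₑ / ‖u‖ₑ) ^ 2 := by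
    intro c
    have h1 := lintegral_mul_sq_le volume
      (f := fun u : Fin d → ℝ => ENNReal.ofReal (√(W u)) * ‖u‖ₑ)
      (g := fun u : Fin d → ℝ => ENNReal.ofReal (√(W u)) * (‖secondDiff p c (h * u)‖ₑ / ‖u‖ₑ))
      (by fun_prop) (by have := hm1 c; fun_prop)
    refine le_trans (le_of_eq ?_) (h1.trans (le_of_eq ?_))
    · rw [smoothErr]
      congr 1
      refine lintegral_congr fun u => ?_
      rcases eq_or_ne u 0 with rfl | hu
      · simp [secondDiff, two_mul]
      · rw [hs u]
        have : ‖u‖ₑ * (‖secondDiff p c (h * u)‖ₑ / ‖u‖ₑ) = ‖secondDiff p c (h * u)‖ₑ :=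
          ENNReal.mul_div_cancel (by simpa using hu) enorm_ne_top
        nth_rewrite 1 [← this]
        ring
    · simp only [mul_pow, ← hs, hM]
  calc ∫⁻ c, smoothErr W h p c ^ 2
      ≤ ∫⁻ c, M * ∫⁻ u, ENNReal.ofReal (W u) * (‖secondDiff p c (h * u)‖ₑ / ‖u‖ₑ) ^ 2 :=
        lintegral_mono hpt
    _ = M * ∫⁻ u, ∫⁻ c, ENNReal.ofReal (W u) * (‖secondDiff p c (h * u)‖ₑ / ‖u‖ₑ) ^ 2 := by
        have hm3 : Measurable fun q : (Fin d → ℝ) × (Fin d → ℝ) =>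
          ENNReal.ofReal (W q.2) * (‖secondDiff p q.1 (h * q.2)‖ₑ / ‖q.2‖ₑ) ^ 2 := by fun_prop
        rw [lintegral_const_mul _ hm3.lintegral_prod_right',
          lintegral_lintegral_swap hm3.aemeasurable]
    _ ≤ M * ∫⁻ u, ENNReal.ofReal (W u) * ‖u‖ₑ ^ 2 * (A * ENNReal.ofReal η ^ 4) := by
        gcongr with u
        have := hm2 (h * u)
        rw [lintegral_const_mul _ (by fun_prop), mul_assoc]
        gcongr
        rcases eq_or_ne u 0 with rfl | hu
        · simp [secondDiff, two_mul]
        simp only [div_eq_mul_inv, mul_pow]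
        rw [lintegral_mul_const _ (by fun_prop)]
        have hu0 : ‖u‖ₑ ^ 2 ≠ 0 := by simpa using hu
        have hu1 : ‖u‖ₑ ^ 2 ≠ ⊤ := by finiteness
        calc _ ≤ A * (ENNReal.ofReal η * ‖u‖ₑ) ^ 4 * ‖u‖ₑ⁻¹ ^ 2 := by
              gcongr
              refine (hA _).trans ?_
              gcongr
              exact enorm_mul_le_of_abs_le h hη u
          _ = A * ENNReal.ofReal η ^ 4 * (‖u‖ₑ ^ 2 * (‖u‖ₑ ^ 2 * (‖u‖ₑ ^ 2)⁻¹)) := by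
              rw [ENNReal.inv_pow]
              ring
          _ = _ := by
              rw [ENNReal.mul_inv_cancel hu0 hu1]
              ring
    _ = _ := by
        rw [lintegral_mul_const _ (by fun_prop)]
        ring

end Smoothing

/-! ### Kernel density estimates: mean and variance. -/

section KDE

variable {d : ℕ}

lemma lintegral_scale {h : Fin d → ℝ} (hh : ∀ j, 0 < h j) {g : (Fin d → ℝ) → ENNReal}
    (hg : Measurable g) :
    ENNReal.ofReal (∏ j, h j) * ∫⁻ v, g (h * v) = ∫⁻ v, g v := by
  have hdet : (Matrix.diagonal h).det ≠ 0 := by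
    rw [Matrix.det_diagonal]
    exact (Finset.prod_pos fun j _ => hh j).ne'
  have h1 := Real.smul_map_diagonal_volume_pi hdet
  conv_rhs => rw [← h1]
  rw [Matrix.det_diagonal, abs_of_pos (Finset.prod_pos fun j _ => hh j), lintegral_smul_measure,
    lintegral_map hg (by fun_prop), smul_eq_mul]
  congr 2
  ext v
  congr 1
  ext j
  simp [Matrix.mulVec_diagonal]

/-- The rescaled kernel `K(H⁻¹ u) / |H|`. -/
noncomputable def scaleKernel (K : (Fin d → ℝ) → ℝ) (h u : Fin d → ℝ) : ℝ :=
  K (fun j => u j / h j) / ∏ j, h j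

variable {K p : (Fin d → ℝ) → ℝ}

lemma measurable_scaleKernel (hK : Measurable K) (h : Fin d → ℝ) :
    Measurable (scaleKernel K h) := by
  unfold scaleKernel
  fun_prop

lemma lintegral_scaleKernel_mul (hK : Measurable K) {h : Fin d → ℝ}
    (hh : ∀ j, 0 < h j) {g : (Fin d → ℝ) → ENNReal} (hg : Measurable g) :
    ∫⁻ u, ENNReal.ofReal (scaleKernel K h u) * g u = ∫⁻ u, ENNReal.ofReal (K u) * g (h * u) := by
  have hpos : 0 < ∏ j, h j := Finset.prod_pos fun j _ => hh j
  have hm := measurable_scaleKernel hK h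
  rw [← lintegral_scale hh (by fun_prop), ← lintegral_const_mul _ (by fun_prop)]
  refine lintegral_congr fun u => ?_
  have : (fun j => (h * u) j / h j) = u := by
    ext j
    rw [Pi.mul_apply, mul_div_cancel_left₀ _ (hh j).ne']
  rw [← mul_assoc, ← ENNReal.ofReal_mul hpos.le, scaleKernel, this, mul_div_cancel₀ _ hpos.ne']

lemma kde_eq_sum_scaleKernel (K : (Fin d → ℝ) → ℝ) (h : Fin d → ℝ) (t : ℕ) (c : ℕ → Fin d → ℝ)
    (u : Fin d → ℝ) :
    kde K h t c u = (t : ℝ)⁻¹ * ∑ i ∈ Finset.range t, scaleKernel K h (u - c i) := by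
  unfold kde scaleKernel
  rw [Finset.mul_sum]
  refine Finset.sum_congr rfl fun i _ => ?_
  simp only [Pi.sub_apply]
  rw [mul_comm (t : ℝ), ← div_div, div_eq_inv_mul _ (t : ℝ)]

lemma IsPDF.integrable {q : (Fin d → ℝ) → ℝ} (hq : IsPDF q) : Integrable q := by
  by_contra h
  have := hq.integral_eq_one
  rw [integral_undef h] at this
  exact zero_ne_one this

lemma IsPDF.lintegral_eq_one {q : (Fin d → ℝ) → ℝ} (hq : IsPDF q) :
    ∫⁻ c, ENNReal.ofReal (q c) = 1 := by
  rw [← ofReal_integral_eq_lintegral_ofReal hq.integrable (ae_of_all _ hq.nonneg),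
    hq.integral_eq_one, ENNReal.ofReal_one]

lemma isPDF_of_lintegral {q : (Fin d → ℝ) → ℝ} (hm : Measurable q) (h0 : ∀ c, 0 ≤ q c)
    (h1 : ∫⁻ c, ENNReal.ofReal (q c) = 1) : IsPDF q :=
  ⟨hm, h0, by rw [integral_eq_lintegral_of_nonneg_ae (ae_of_all _ h0) hm.aestronglyMeasurable, h1,
    ENNReal.toReal_one]⟩

lemma isPDF_scaleKernel (hK : IsPDF K) {h : Fin d → ℝ} (hh : ∀ j, 0 < h j) (x : Fin d → ℝ) :
    IsPDF fun u => scaleKernel K h (u - x) := by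
  refine isPDF_of_lintegral ((measurable_scaleKernel hK.measurable h).comp (by fun_prop))
    (fun u => div_nonneg (hK.nonneg _) (Finset.prod_nonneg fun j _ => (hh j).le)) ?_
  rw [lintegral_sub_right_eq_self (fun u => ENNReal.ofReal (scaleKernel K h u)) x]
  have := lintegral_scaleKernel_mul hK.measurable hh (g := fun _ => 1) measurable_const
  simpa [hK.lintegral_eq_one] using this

lemma isPDF_kde (hK : IsPDF K) {h : Fin d → ℝ} (hh : ∀ j, 0 < h j) {t : ℕ} (ht : 1 ≤ t)
    (c : ℕ → Fin d → ℝ) : IsPDF (kde K h t c) := by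
  have hpdf := fun i => isPDF_scaleKernel hK hh (c i)
  have e : kde K h t c =
      fun u => (t : ℝ)⁻¹ * ∑ i ∈ Finset.range t, scaleKernel K h (u - c i) :=
    funext fun u => kde_eq_sum_scaleKernel K h t c u
  rw [e]
  refine ⟨(Finset.measurable_fun_sum _ fun i _ => (hpdf i).measurable).const_mul _, fun u =>
    mul_nonneg (by positivity) (Finset.sum_nonneg fun i _ => (hpdf i).nonneg u), ?_⟩
  rw [integral_const_mul, integral_finsetSum _ fun i _ => (hpdf i).integrable]
  simp only [(hpdf _).integral_eq_one, Finset.sum_const, Finset.card_range, nsmul_eq_mul, mul_one]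
  exact inv_mul_cancel₀ (by positivity)

lemma measurable_kde (hK : Measurable K) (h : Fin d → ℝ) (t : ℕ) :
    Measurable fun q : (ℕ → Fin d → ℝ) × (Fin d → ℝ) => kde K h t q.1 q.2 := by
  unfold kde
  refine Finset.measurable_fun_sum _ fun i _ => (hK.comp ?_).div_const _
  fun_prop

variable {Ω : Type*} [MeasurableSpace Ω] {P : Measure Ω} [IsProbabilityMeasure P]
  {c : ℕ → Ω → Fin d → ℝ}

/-- The mean of one kernel term is the smoothed density, by the change of variables `u - x = h * v`.
-/
lemma lintegral_scaleKernel_sub (hK : Measurable K) (hp : Measurable p) {h : Fin d → ℝ}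
    (hh : ∀ j, 0 < h j) (u : Fin d → ℝ) {X : Ω → Fin d → ℝ} (hX : Measurable X)
    (hlaw : P.map X = law p) :
    ∫⁻ ω, ENNReal.ofReal (scaleKernel K h (u - X ω)) ∂P = smooth K h p u := by
  have hm := measurable_scaleKernel hK h
  rw [← lintegral_map (f := fun x => ENNReal.ofReal (scaleKernel K h (u - x))) (by fun_prop) hX,
    hlaw, law, lintegral_withDensity_eq_lintegral_mul _ (by fun_prop) (by fun_prop)]
  simp only [Pi.mul_apply]
  rw [← lintegral_sub_left_eq_self _ u]
  simp only [sub_sub_cancel]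
  simp_rw [mul_comm (ENNReal.ofReal (p _))]
  exact lintegral_scaleKernel_mul hK hh (g := fun v => ENNReal.ofReal (p (u - v))) (by fun_prop)

/-- The variance of kernel density estimates. -/
lemma lintegral_kde_sub_sq_le (hK : IsPDF K) {B : ℝ} (hB : ∀ u, K u ≤ B) (hp : Measurable p)
    {h : Fin d → ℝ} (hh : ∀ j, 0 < h j) {t : ℕ} (ht : 1 ≤ t) (hc : ∀ t, Measurable (c t))
    (hlaw : ∀ t, P.map (c t) = law p) (hind : iIndepFun c P) (u : Fin d → ℝ) :
    smooth K h p u ≠ ⊤ ∧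
    ∫⁻ ω, ENNReal.ofReal ((kde K h t (fun i => c i ω) u - (smooth K h p u).toReal) ^ 2) ∂P ≤
      ENNReal.ofReal (B / (t * ∏ j, h j)) * smooth K h p u := by
  have hpos : 0 < ∏ j, h j := Finset.prod_pos fun j _ => hh j
  have ht0 : (0 : ℝ) < t := by exact_mod_cast ht
  have hm := measurable_scaleKernel hK.measurable h
  have hs0 : ∀ v, 0 ≤ scaleKernel K h v := fun v => div_nonneg (hK.nonneg _) hpos.le
  have hsB : ∀ v, scaleKernel K h v ≤ B / ∏ j, h j := fun v =>
    div_le_div_of_nonneg_right (hB _) hpos.le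
  have hB0 : 0 ≤ B := (hK.nonneg 0).trans (hB 0)
  set X : ℕ → Ω → ℝ := fun i ω => (t : ℝ)⁻¹ * scaleKernel K h (u - c i ω) with hX
  have mX : ∀ i, Measurable (X i) := fun i => by
    have := hc i
    exact (hm.comp (by fun_prop : Measurable fun ω => u - c i ω)).const_mul _
  have hX0 : ∀ i ω, 0 ≤ X i ω := fun i ω => mul_nonneg (by positivity) (hs0 _)
  have hXB : ∀ i ω, X i ω ≤ B / (t * ∏ j, h j) := fun i ω => by
    calc X i ω ≤ (t : ℝ)⁻¹ * (B / ∏ j, h j) := by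
          exact mul_le_mul_of_nonneg_left (hsB _) (by positivity)
      _ = _ := by
          field_simp
  have hXL : ∀ i, MemLp (X i) 2 P := fun i =>
    MemLp.of_bound (mX i).aestronglyMeasurable (B / (t * ∏ j, h j)) (ae_of_all _ fun ω => by
      rw [Real.norm_of_nonneg (hX0 i ω)]
      exact hXB i ω)
  have hXi : ∀ i, Integrable (X i) P := fun i => (hXL i).integrable one_le_two
  have hEX : ∀ i, ENNReal.ofReal (∫ ω, X i ω ∂P) = ENNReal.ofReal ((t : ℝ)⁻¹) * smooth K h p u := by
    intro i
    rw [ofReal_integral_eq_lintegral_ofReal (hXi i) (ae_of_all _ (hX0 i)),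
      ← lintegral_scaleKernel_sub hK.measurable hp hh u (hc i) (hlaw i),
      ← lintegral_const_mul' _ _ ENNReal.ofReal_ne_top]
    exact lintegral_congr fun ω => ENNReal.ofReal_mul (by positivity)
  have htop : smooth K h p u ≠ ⊤ := by
    intro h1
    have h2 := hEX 0
    rw [h1, ENNReal.mul_top (by simpa using Nat.ne_zero_of_lt ht)] at h2
    exact ENNReal.ofReal_ne_top h2
  refine ⟨htop, ?_⟩
  have hEX' : ∀ i, ∫ ω, X i ω ∂P = (t : ℝ)⁻¹ * (smooth K h p u).toReal := fun i => by
    have := congrArg ENNReal.toReal (hEX i)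
    rwa [ENNReal.toReal_ofReal (integral_nonneg (hX0 i)), ENNReal.toReal_mul,
      ENNReal.toReal_ofReal (by positivity)] at this
  have hkde : ∀ ω, kde K h t (fun i => c i ω) u = (∑ i ∈ Finset.range t, X i) ω := fun ω => by
    rw [kde_eq_sum_scaleKernel, Finset.mul_sum, Finset.sum_apply]
  have hmean : ∫ ω, (∑ i ∈ Finset.range t, X i) ω ∂P = (smooth K h p u).toReal := by
    simp only [Finset.sum_apply]
    rw [integral_finsetSum _ fun i _ => hXi i]
    simp only [hEX', Finset.sum_const, Finset.card_range, nsmul_eq_mul]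
    rw [← mul_assoc, mul_inv_cancel₀ ht0.ne', one_mul]
  have hvar := IndepFun.variance_sum (μ := P) (X := X) (s := Finset.range t) (fun i _ => hXL i)
    (fun i _ j _ hij => (hind.indepFun hij).comp
      (hm.comp (by fun_prop : Measurable fun v => u - v) |>.const_mul _)
      (hm.comp (by fun_prop : Measurable fun v => u - v) |>.const_mul _))
  have hsumL : MemLp (∑ i ∈ Finset.range t, X i) 2 P := memLp_finsetSum' _ fun i _ => hXL i
  -- A nonnegative bounded variable has variance at most its bound times its mean. Keeping the mean,
  -- rather than squaring the bound, makes the variance integrable in `u`.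
  have hv : ∀ i, Var[X i; P] ≤ B / (t * ∏ j, h j) * ∫ ω, X i ω ∂P := fun i => by
    refine (variance_le_expectation_sq (mX i).aestronglyMeasurable).trans ?_
    rw [← integral_const_mul]
    refine integral_mono (hXL i).integrable_sq ((hXi i).const_mul _) fun ω => ?_
    simp only [Pi.pow_apply, sq]
    exact mul_le_mul_of_nonneg_right (hXB i ω) (hX0 i ω)
  have hfinal : ∫ ω, (kde K h t (fun i => c i ω) u - (smooth K h p u).toReal) ^ 2 ∂P ≤
      B / (t * ∏ j, h j) * (smooth K h p u).toReal := by
    simp only [hkde]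
    rw [← hmean, ← variance_eq_integral hsumL.aestronglyMeasurable.aemeasurable, hvar]
    calc _ ≤ ∑ i ∈ Finset.range t, B / (t * ∏ j, h j) * ∫ ω, X i ω ∂P :=
          Finset.sum_le_sum fun i _ => hv i
      _ = _ := by
          rw [← Finset.mul_sum]
          simp only [Finset.sum_apply]
          rw [integral_finsetSum _ fun i _ => hXi i]
  have hint : Integrable (fun ω => (kde K h t (fun i => c i ω) u - (smooth K h p u).toReal) ^ 2) P := by
    simp only [hkde]
    exact (hsumL.sub (memLp_const _)).integrable_sq
  rw [← ofReal_integral_eq_lintegral_ofReal hint (ae_of_all _ fun ω => sq_nonneg _)]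
  refine (ENNReal.ofReal_le_ofReal hfinal).trans (le_of_eq ?_)
  rw [ENNReal.ofReal_mul (by positivity), ENNReal.ofReal_toReal htop]

end KDE

end DRBO

/-! ### Expectations of a regular function under the density estimate. -/

namespace DRBO

section KeyEstimate

variable {d : ℕ} {K p : (Fin d → ℝ) → ℝ}

lemma ofReal_abs_toReal_smooth_sub_le (hK : IsPDF K) (hsymm : ∀ u, K (-u) = K u)
    (hp : Measurable p) (hp0 : ∀ c, 0 ≤ p c) (h : Fin d → ℝ) (c : Fin d → ℝ)
    (htop : smooth K h p c ≠ ⊤) :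
    ENNReal.ofReal |(smooth K h p c).toReal - p c| ≤ smoothErr K h p c := by
  have h1 := smooth_le hK.measurable hp h hp0 hsymm c
  have h2 := le_smooth hK.measurable hp h hp0 hsymm c
  rw [hK.lintegral_eq_one, one_mul] at h1 h2
  by_cases he : smoothErr K h p c = ⊤
  · rw [he]
    exact le_top
  rw [ENNReal.ofReal_le_iff_le_toReal he, abs_sub_le_iff]
  have h3 := ENNReal.toReal_mono (by finiteness) h1
  have h4 := ENNReal.toReal_mono (by finiteness) h2
  rw [ENNReal.toReal_add (by finiteness) he, ENNReal.toReal_ofReal (hp0 c)] at h3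
  rw [ENNReal.toReal_add htop he, ENNReal.toReal_ofReal (hp0 c)] at h4
  constructor <;> linarith

/-- The smoothing of `p` is at most a multiple of `p`, hence of `l` on this region, plus the
smoothing error. The latter is controlled in the square mean and linearized by `e ≤ e ^ 2 / q + q`.
Low density regions thus carry little smoothed mass. -/
lemma lintegral_smooth_le_of_lt {W : (Fin d → ℝ) → ℝ} (hW : Measurable W)
    (hsymm : ∀ u, W (-u) = W u) (hp : Measurable p) (hp0 : ∀ c, 0 ≤ p c) {h : Fin d → ℝ}
    {A : NNReal} (hA : ∀ w, ∫⁻ c, ‖secondDiff p c w‖ₑ ^ 2 ≤ A * ‖w‖ₑ ^ 4) {η : ℝ} (hη0 : 0 ≤ η)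
    (hη : ∀ j, |h j| ≤ η) {M : ℝ} (hM0 : 0 ≤ M) (hM : ∫⁻ u, ENNReal.ofReal (W u) ≤ ENNReal.ofReal M)
    (hM2 : ∫⁻ u, ENNReal.ofReal (W u) * ‖u‖ₑ ^ 2 ≤ ENNReal.ofReal M) {C : Set (Fin d → ℝ)}
    (hC : MeasurableSet C) (hCfin : volume C ≠ ⊤) {l q : ℝ} (hl : 0 < l) (hq : 0 < q) :
    ∫⁻ c in C ∩ {c | p c < l}, smooth W h p c ≤
      ENNReal.ofReal (M * l * (volume C).toReal + A * M ^ 2 * η ^ 4 / q + q * (volume C).toReal) := by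
  have hm := measurable_smoothErr hW hp h
  have hS : MeasurableSet (C ∩ {c | p c < l}) := hC.inter (measurableSet_lt hp measurable_const)
  have hlt : ∀ x : ENNReal, x ≤ x ^ 2 * ENNReal.ofReal q⁻¹ + ENNReal.ofReal q := by
    intro x
    by_cases hx : x = ⊤
    · rw [hx, ENNReal.top_pow two_ne_zero, ENNReal.top_mul (by simpa using hq)]
      simp
    lift x to NNReal using hx
    have : (x : ℝ) ≤ x ^ 2 * q⁻¹ + q := by
      rw [← div_eq_mul_inv, ← sub_le_iff_le_add, le_div_iff₀ hq]
      nlinarith [sq_nonneg ((x : ℝ) - q), x.2]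
    rw [← ENNReal.ofReal_coe_nnreal, ← ENNReal.ofReal_pow (NNReal.coe_nonneg x), ← ENNReal.ofReal_mul (by positivity),
      ← ENNReal.ofReal_add (by positivity) hq.le]
    exact ENNReal.ofReal_le_ofReal this
  calc ∫⁻ c in C ∩ {c | p c < l}, smooth W h p c
      ≤ ∫⁻ c in C ∩ {c | p c < l}, (ENNReal.ofReal M * ENNReal.ofReal l +
          (smoothErr W h p c ^ 2 * ENNReal.ofReal q⁻¹ + ENNReal.ofReal q)) := by
        refine setLIntegral_mono' hS fun c hc => ?_
        refine (smooth_le hW hp h hp0 hsymm c).trans ?_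
        gcongr
        · exact hc.2.le
        · exact hlt _
    _ ≤ ∫⁻ c in C, (ENNReal.ofReal M * ENNReal.ofReal l +
          (smoothErr W h p c ^ 2 * ENNReal.ofReal q⁻¹ + ENNReal.ofReal q)) :=
        lintegral_mono_set Set.inter_subset_left
    _ = ENNReal.ofReal M * ENNReal.ofReal l * volume C +
          ((∫⁻ c in C, smoothErr W h p c ^ 2) * ENNReal.ofReal q⁻¹ + ENNReal.ofReal q * volume C) := by
        rw [lintegral_add_left measurable_const, lintegral_add_left (by fun_prop),
          lintegral_mul_const (ENNReal.ofReal q⁻¹) (by fun_prop)]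
        simp only [lintegral_const, Measure.restrict_apply MeasurableSet.univ, Set.univ_inter]
    _ ≤ ENNReal.ofReal M * ENNReal.ofReal l * volume C +
          ((A * ENNReal.ofReal M ^ 2 * ENNReal.ofReal η ^ 4) * ENNReal.ofReal q⁻¹ +
            ENNReal.ofReal q * volume C) := by
        gcongr
        refine (setLIntegral_le_lintegral _ _).trans ((lintegral_smoothErr_sq_le hW hp h hA hη).trans ?_)
        gcongr
    _ = _ := by
        rw [← ENNReal.ofReal_toReal hCfin, ENNReal.toReal_ofReal ENNReal.toReal_nonneg,
          ← ENNReal.ofReal_coe_nnreal, ← ENNReal.ofReal_pow hM0, ← ENNReal.ofReal_pow hη0,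
          ← ENNReal.ofReal_mul hM0, ← ENNReal.ofReal_mul (by positivity),
          ← ENNReal.ofReal_mul (by positivity), ← ENNReal.ofReal_mul (by positivity),
          ← ENNReal.ofReal_mul (by positivity), ← ENNReal.ofReal_mul (by positivity),
          ← ENNReal.ofReal_add (by positivity) (by positivity),
          ← ENNReal.ofReal_add (by positivity) (by positivity), ← add_assoc, div_eq_mul_inv]

variable {Ω : Type*} [MeasurableSpace Ω] {P : Measure Ω} [IsProbabilityMeasure P]
  {c : ℕ → Ω → Fin d → ℝ}

lemma measurable_kde_path (hK : Measurable K) (h : Fin d → ℝ) (t : ℕ) (hc : ∀ t, Measurable (c t)) :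
    Measurable fun q : Ω × (Fin d → ℝ) => kde K h t (fun i => c i q.1) q.2 := by
  have hc' : Measurable fun ω i => c i ω := measurable_pi_lambda _ hc
  exact (measurable_kde hK h t).comp
    (f := fun q : Ω × (Fin d → ℝ) => ((fun i => c i q.1), q.2)) (by fun_prop)

/-- The mean integrated squared error of kernel density estimates. -/
lemma lintegral_kde_sub_density_sq_le (hK : IsPDF K) (hsymm : ∀ u, K (-u) = K u) {B : ℝ}
    (hB : ∀ u, K u ≤ B) (hp : IsPDF p) {h : Fin d → ℝ} (hh : ∀ j, 0 < h j)
    {A : NNReal} (hA : ∀ w, ∫⁻ c, ‖secondDiff p c w‖ₑ ^ 2 ≤ A * ‖w‖ₑ ^ 4) {η : ℝ} (hη0 : 0 ≤ η)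
    (hη : ∀ j, |h j| ≤ η) {M : ℝ} (hM0 : 0 ≤ M)
    (hM2 : ∫⁻ u, ENNReal.ofReal (K u) * ‖u‖ₑ ^ 2 ≤ ENNReal.ofReal M) {t : ℕ} (ht : 1 ≤ t)
    (hc : ∀ t, Measurable (c t)) (hlaw : ∀ t, P.map (c t) = law p) (hind : iIndepFun c P) :
    ∫⁻ ω, (∫⁻ u, ENNReal.ofReal ((kde K h t (fun i => c i ω) u - p u) ^ 2)) ∂P ≤
      ENNReal.ofReal (2 * (B / (t * ∏ j, h j)) + 2 * (A * M ^ 2 * η ^ 4)) := by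
  have hpos : 0 < ∏ j, h j := Finset.prod_pos fun j _ => hh j
  have hB0 : 0 ≤ B := (hK.nonneg 0).trans (hB 0)
  have mk := measurable_kde_path hK.measurable h t hc
  have mp := hp.measurable
  have ms := measurable_smooth hK.measurable hp.measurable h
  have me := measurable_smoothErr hK.measurable hp.measurable h
  have hv := fun u => lintegral_kde_sub_sq_le hK hB hp.measurable hh ht hc hlaw hind u
  rw [lintegral_lintegral_swap (by fun_prop)]
  calc ∫⁻ u, ∫⁻ ω, ENNReal.ofReal ((kde K h t (fun i => c i ω) u - p u) ^ 2) ∂P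
      ≤ ∫⁻ u, (2 * (ENNReal.ofReal (B / (t * ∏ j, h j)) * smooth K h p u) +
          2 * smoothErr K h p u ^ 2) := by
        refine lintegral_mono fun u => ?_
        have mku : Measurable fun ω => kde K h t (fun i => c i ω) u :=
          mk.comp measurable_prodMk_right
        calc ∫⁻ ω, ENNReal.ofReal ((kde K h t (fun i => c i ω) u - p u) ^ 2) ∂P
            ≤ ∫⁻ ω, (2 * ENNReal.ofReal ((kde K h t (fun i => c i ω) u -
                (smooth K h p u).toReal) ^ 2) + 2 * smoothErr K h p u ^ 2) ∂P := by
              refine lintegral_mono fun ω => ?_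
              have h1 := ofReal_abs_toReal_smooth_sub_le hK hsymm hp.measurable hp.nonneg h u (hv u).1
              have h2 : ENNReal.ofReal (((smooth K h p u).toReal - p u) ^ 2) ≤
                  smoothErr K h p u ^ 2 := by
                rw [← sq_abs, ENNReal.ofReal_pow (abs_nonneg _)]
                gcongr
              refine le_trans ?_ (add_le_add_right (mul_le_mul_right h2 2) _)
              rw [← ENNReal.ofReal_ofNat 2, ← ENNReal.ofReal_mul zero_le_two,
                ← ENNReal.ofReal_mul zero_le_two, ← ENNReal.ofReal_add (by positivity) (by positivity)]
              apply ENNReal.ofReal_le_ofReal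
              nlinarith [sq_nonneg ((kde K h t (fun i => c i ω) u - (smooth K h p u).toReal) -
                ((smooth K h p u).toReal - p u))]
          _ ≤ _ := by
              rw [lintegral_add_right _ measurable_const, lintegral_const, measure_univ, mul_one,
                lintegral_const_mul _ (by fun_prop)]
              gcongr
              exact (hv u).2
    _ = 2 * ENNReal.ofReal (B / (t * ∏ j, h j)) + 2 * ∫⁻ u, smoothErr K h p u ^ 2 := by
        rw [lintegral_add_left (by fun_prop), lintegral_const_mul _ (by fun_prop),
          lintegral_const_mul _ (by fun_prop), lintegral_const_mul _ (by fun_prop),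
          lintegral_smooth hK.measurable hp.measurable, hK.lintegral_eq_one, hp.lintegral_eq_one]
        simp
    _ ≤ 2 * ENNReal.ofReal (B / (t * ∏ j, h j)) +
          2 * (A * ENNReal.ofReal M ^ 2 * ENNReal.ofReal η ^ 4) := by
        gcongr
        refine (lintegral_smoothErr_sq_le hK.measurable hp.measurable h hA hη).trans ?_
        gcongr
    _ = _ := by
        rw [← ENNReal.ofReal_coe_nnreal, ← ENNReal.ofReal_pow hM0, ← ENNReal.ofReal_pow hη0,
          ← ENNReal.ofReal_mul (by positivity), ← ENNReal.ofReal_mul (by positivity),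
          ← ENNReal.ofReal_ofNat 2, ← ENNReal.ofReal_mul zero_le_two,
          ← ENNReal.ofReal_mul zero_le_two, ← ENNReal.ofReal_add (by positivity) (by positivity)]

lemma min_one_le_rpow {x θ : ℝ} (hx : 0 ≤ x) (hθ0 : 0 < θ) (hθ1 : θ ≤ 1) : min 1 x ≤ x ^ θ := by
  rcases le_or_gt x 1 with h | h
  · rw [min_eq_right h]
    exact Real.self_le_rpow_of_le_one hx h hθ1
  · rw [min_eq_left h.le]
    exact Real.one_le_rpow h.le hθ0.le

/-- The mean deviation is at most the root of `v` times the smoothed density, and the root of `(v /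
κ) * (κ * m)` is at most the sum of the two factors. -/
lemma lintegral_abs_kde_sub_smooth_le (hK : IsPDF K) {B : ℝ} (hB : ∀ u, K u ≤ B)
    (hp : Measurable p) {h : Fin d → ℝ} (hh : ∀ j, 0 < h j) {t : ℕ} (ht : 1 ≤ t)
    (hc : ∀ t, Measurable (c t)) (hlaw : ∀ t, P.map (c t) = law p) (hind : iIndepFun c P)
    (u : Fin d → ℝ) {κ : ℝ} (hκ : 0 < κ) :
    ∫⁻ ω, ENNReal.ofReal |kde K h t (fun i => c i ω) u - (smooth K h p u).toReal| ∂P ≤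
      ENNReal.ofReal (B / (t * ∏ j, h j) / κ) + ENNReal.ofReal κ * smooth K h p u := by
  have hpos : 0 < ∏ j, h j := Finset.prod_pos fun j _ => hh j
  have hB0 : 0 ≤ B := (hK.nonneg 0).trans (hB 0)
  obtain ⟨htop, hv⟩ := lintegral_kde_sub_sq_le hK hB hp hh ht hc hlaw hind u
  have mku : Measurable fun ω => kde K h t (fun i => c i ω) u :=
    (measurable_kde_path hK.measurable h t hc).comp measurable_prodMk_right
  set y := ∫⁻ ω, ENNReal.ofReal |kde K h t (fun i => c i ω) u - (smooth K h p u).toReal| ∂P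
  set v := B / (t * ∏ j, h j) with hvdef
  have hv0 : 0 ≤ v := by positivity
  have h1 : y ^ 2 ≤ ENNReal.ofReal v * smooth K h p u := by
    have h2 := lintegral_mul_sq_le P (measurable_const (a := (1 : ENNReal)))
      (g := fun ω => ENNReal.ofReal |kde K h t (fun i => c i ω) u - (smooth K h p u).toReal|)
      (by fun_prop)
    simp only [one_mul, one_pow, lintegral_const, measure_univ, mul_one] at h2
    refine h2.trans (le_trans (lintegral_mono fun ω => ?_) hv)
    rw [← ENNReal.ofReal_pow (abs_nonneg _), sq_abs]
  have h3 : ENNReal.ofReal v * smooth K h p u ≤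
      (ENNReal.ofReal (v / κ) + ENNReal.ofReal κ * smooth K h p u) ^ 2 := by
    have : ENNReal.ofReal v = ENNReal.ofReal (v / κ) * ENNReal.ofReal κ := by
      rw [← ENNReal.ofReal_mul (by positivity), div_mul_cancel₀ _ hκ.ne']
    rw [this, sq, mul_assoc]
    gcongr
    · exact le_self_add
    · exact le_add_self
  by_contra hcon
  rw [not_le] at hcon
  exact absurd (h1.trans h3) (not_le.2 (ENNReal.pow_right_strictMono two_ne_zero hcon))

/-- Expectations of a Hölder continuous function under kernel density estimates. -/
theorem lintegral_kde_mul_le (hK : IsPDF K) {B : ℝ} (hB : ∀ u, K u ≤ B) (hp : IsPDF p) {C : Set (Fin d → ℝ)} (hC : MeasurableSet C)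
    (hpC : ∀ c, c ∉ C → p c = 0) {h : Fin d → ℝ} (hh : ∀ j, 0 < h j) {η : ℝ} (hη0 : 0 ≤ η)
    (hη : ∀ j, |h j| ≤ η) {t : ℕ} (ht : 1 ≤ t)
    (hc : ∀ t, Measurable (c t)) (hlaw : ∀ t, P.map (c t) = law p) (hind : iIndepFun c P)
    {s : Ω → (Fin d → ℝ) → ℝ} (hs : Measurable fun q : Ω × (Fin d → ℝ) => s q.1 q.2)
    (hs0 : ∀ ω, ∀ u ∈ C, 0 ≤ s ω u) (hs1 : ∀ ω, ∀ u ∈ C, s ω u ≤ 1) {L : ℝ} (hL : 0 ≤ L)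
    (hsL : ∀ ω, ∀ u ∈ C, ∀ v ∈ C, s ω u ≤ s ω v + L * ‖u - v‖) {θ : ℝ} (hθ0 : 0 < θ) (hθ1 : θ ≤ 1)
    {l κ : ℝ} (hl : 0 < l) (hκ : 0 < κ) :
    ∫⁻ ω, (∫⁻ u in C, ENNReal.ofReal (kde K h t (fun i => c i ω) u) * ENNReal.ofReal (s ω u)) ∂P ≤
      3 * (∫⁻ ω, (∫⁻ u in C, ENNReal.ofReal (p u) * ENNReal.ofReal (s ω u)) ∂P) +
      (ENNReal.ofReal l⁻¹ * (∫⁻ ω, (∫⁻ u,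
        ENNReal.ofReal ((kde K h t (fun i => c i ω) u - p u) ^ 2)) ∂P) +
      (ENNReal.ofReal (B / (t * ∏ j, h j) / κ) * volume C +
      (ENNReal.ofReal κ * (∫⁻ u in C ∩ {u | p u < l}, smooth K h p u) +
      ENNReal.ofReal ((L * η) ^ θ) *
        ∫⁻ u in C ∩ {u | p u < l}, smooth (fun u => K u * ‖u‖ ^ θ) h p u))) := by
  have mk := measurable_kde_path hK.measurable h t hc
  have mK := hK.measurable
  have mp := hp.measurable
  have ms := measurable_smooth mK mp h
  set S := C ∩ {u | p u < l} with hSdef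
  have hS : MeasurableSet S := hC.inter (measurableSet_lt mp measurable_const)
  set k : Ω → (Fin d → ℝ) → ℝ := fun ω u => kde K h t (fun i => c i ω) u with hk
  have hpdf : ∀ ω, IsPDF (k ω) := fun ω => isPDF_kde hK hh ht _
  set m : (Fin d → ℝ) → ℝ := fun u => (smooth K h p u).toReal with hm
  have mm : Measurable m := ms.ennreal_toReal
  have htop : ∀ u, smooth K h p u ≠ ⊤ := fun u =>
    (lintegral_kde_sub_sq_le hK hB mp hh ht hc hlaw hind u).1
  set I : ENNReal := ENNReal.ofReal ((L * η) ^ θ) *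
        ∫⁻ u in S, smooth (fun u => K u * ‖u‖ ^ θ) h p u with hI
  -- the smoothed density
  have hsm : ∀ ω, ∫⁻ u in S, smooth K h p u * ENNReal.ofReal (s ω u) ≤
      (∫⁻ u in C, ENNReal.ofReal (p u) * ENNReal.ofReal (s ω u)) + I := by
    intro ω
    have msω : Measurable (s ω) := hs.comp measurable_prodMk_left
    have hpt : ∀ u ∈ S, smooth K h p u * ENNReal.ofReal (s ω u) ≤
        (∫⁻ v, ENNReal.ofReal (K v) * (ENNReal.ofReal (p (u - h * v)) *
          ENNReal.ofReal (s ω (u - h * v)))) +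
          ENNReal.ofReal ((L * η) ^ θ) * smooth (fun u => K u * ‖u‖ ^ θ) h p u := by
      intro u hu
      unfold smooth
      rw [← lintegral_mul_const _ (by fun_prop), ← lintegral_const_mul _ (by fun_prop),
        ← lintegral_add_left (by fun_prop)]
      refine lintegral_mono fun v => ?_
      by_cases hv : u - h * v ∈ C
      · have hnorm : ‖h * v‖ ≤ η * ‖v‖ := by
          have := enorm_mul_le_of_abs_le h hη v
          rw [← ofReal_norm, ← ofReal_norm, ← ENNReal.ofReal_mul hη0] at this
          exact (ENNReal.ofReal_le_ofReal_iff (by positivity)).1 this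
        -- A Lipschitz function with values between 0 and 1 has a Hölder modulus of every exponent
        -- `θ ≤ 1`. A small `θ` requires only a slightly higher moment of the kernel.
        have h1 : s ω u ≤ s ω (u - h * v) + (L * η) ^ θ * ‖v‖ ^ θ := by
          rw [← Real.mul_rpow (by positivity) (norm_nonneg _)]
          refine le_trans ?_ (add_le_add_right
            (min_one_le_rpow (x := L * η * ‖v‖) (by positivity) hθ0 hθ1) _)
          rcases le_total 1 (L * η * ‖v‖) with h2 | h2
          · rw [min_eq_left h2]
            have := hs1 ω u hu.1
            have := hs0 ω _ hv
            linarith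
          · rw [min_eq_right h2]
            have h3 := hsL ω u hu.1 _ hv
            rw [sub_sub_cancel] at h3
            have := mul_le_mul_of_nonneg_left hnorm hL
            linarith
        have h2 : ENNReal.ofReal (s ω u) ≤ ENNReal.ofReal (s ω (u - h * v)) +
            ENNReal.ofReal ((L * η) ^ θ) * ENNReal.ofReal (‖v‖ ^ θ) := by
          rw [← ENNReal.ofReal_mul (by positivity), ← ENNReal.ofReal_add (hs0 ω _ hv) (by positivity)]
          exact ENNReal.ofReal_le_ofReal h1
        rw [ENNReal.ofReal_mul (hK.nonneg v)]
        calc _ ≤ ENNReal.ofReal (K v) * ENNReal.ofReal (p (u - h * v)) *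
              (ENNReal.ofReal (s ω (u - h * v)) +
              ENNReal.ofReal ((L * η) ^ θ) * ENNReal.ofReal (‖v‖ ^ θ)) := by gcongr
          _ = _ := by ring
      -- Off `C` the density vanishes, so the regularity of `s` is only used on `C`.
      · simp [hpC _ hv]
    calc ∫⁻ u in S, smooth K h p u * ENNReal.ofReal (s ω u)
        ≤ ∫⁻ u in S, ((∫⁻ v, ENNReal.ofReal (K v) * (ENNReal.ofReal (p (u - h * v)) *
          ENNReal.ofReal (s ω (u - h * v)))) +
          ENNReal.ofReal ((L * η) ^ θ) * smooth (fun u => K u * ‖u‖ ^ θ) h p u) :=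
          setLIntegral_mono' hS hpt
      _ = (∫⁻ u in S, ∫⁻ v, ENNReal.ofReal (K v) * (ENNReal.ofReal (p (u - h * v)) *
          ENNReal.ofReal (s ω (u - h * v)))) + I := by
          have m1 : Measurable (smooth (fun u => K u * ‖u‖ ^ θ) h p) :=
            measurable_smooth (by fun_prop) mp h
          rw [lintegral_add_right _ (by fun_prop), lintegral_const_mul _ m1]
      _ ≤ (∫⁻ u, ∫⁻ v, ENNReal.ofReal (K v) * (ENNReal.ofReal (p (u - h * v)) *
          ENNReal.ofReal (s ω (u - h * v)))) + I := by
          gcongr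
          exact Measure.restrict_le_self
      _ = _ := by
          congr 1
          have m2 : Measurable fun u => ENNReal.ofReal (p u) * ENNReal.ofReal (s ω u) := by fun_prop
          rw [lintegral_lintegral_swap (by fun_prop)]
          have h3 : ∀ v, ∫⁻ u, ENNReal.ofReal (K v) * (ENNReal.ofReal (p (u - h * v)) *
              ENNReal.ofReal (s ω (u - h * v))) =
              ENNReal.ofReal (K v) * ∫⁻ u, ENNReal.ofReal (p u) * ENNReal.ofReal (s ω u) := fun v => by
            rw [lintegral_const_mul _ (by fun_prop), lintegral_sub_right_eq_self
              (fun u => ENNReal.ofReal (p u) * ENNReal.ofReal (s ω u)) (h * v)]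
          simp only [h3]
          rw [lintegral_mul_const _ (by fun_prop), hK.lintegral_eq_one, one_mul,
            setLIntegral_eq_of_support_subset]
          intro u hu
          by_contra hcon
          exact hu (by simp [hpC u hcon])
  -- pointwise decomposition
  have hpt : ∀ ω, ∀ u ∈ C, ENNReal.ofReal (k ω u) * ENNReal.ofReal (s ω u) ≤
      2 * (ENNReal.ofReal (p u) * ENNReal.ofReal (s ω u)) +
      (ENNReal.ofReal l⁻¹ * ENNReal.ofReal ((k ω u - p u) ^ 2) +
      S.indicator (fun u => ENNReal.ofReal |k ω u - m u| + smooth K h p u * ENNReal.ofReal (s ω u)) u) := by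
    intro ω u hu
    have e1 : ENNReal.ofReal (s ω u) ≤ 1 := by
      rw [← ENNReal.ofReal_one]
      exact ENNReal.ofReal_le_ofReal (hs1 ω u hu)
    by_cases hpl : p u < l
    -- Low density: replace the estimate by its mean. Its random deviation is paired with `s ≤ 1`,
    -- while the mean keeps the factor `s`.
    · rw [Set.indicator_of_mem (show u ∈ S from ⟨hu, hpl⟩)]
      refine le_add_left (le_add_left ?_)
      have h1 : ENNReal.ofReal (k ω u) ≤ ENNReal.ofReal |k ω u - m u| + smooth K h p u := by
        rw [← ENNReal.ofReal_toReal (htop u), ← ENNReal.ofReal_add (abs_nonneg _) ENNReal.toReal_nonneg]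
        apply ENNReal.ofReal_le_ofReal
        have := le_abs_self (k ω u - m u)
        simp only [hm] at this ⊢
        linarith
      calc _ ≤ (ENNReal.ofReal |k ω u - m u| + smooth K h p u) * ENNReal.ofReal (s ω u) := by gcongr
        _ = ENNReal.ofReal |k ω u - m u| * ENNReal.ofReal (s ω u) +
            smooth K h p u * ENNReal.ofReal (s ω u) := by ring
        _ ≤ ENNReal.ofReal |k ω u - m u| * 1 + smooth K h p u * ENNReal.ofReal (s ω u) := by gcongr
        _ = _ := by rw [mul_one]
    · rw [not_lt] at hpl
      rw [← add_assoc]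
      refine le_add_right ?_
      -- High density: if the estimate exceeds `2 * p`, its error exceeds `p ≥ l`, so the error is
      -- at most its square over `l`.
      have h1 : ENNReal.ofReal (k ω u) ≤ 2 * ENNReal.ofReal (p u) +
          ENNReal.ofReal l⁻¹ * ENNReal.ofReal ((k ω u - p u) ^ 2) := by
        rw [← ENNReal.ofReal_mul (by positivity), ← ENNReal.ofReal_ofNat 2,
          ← ENNReal.ofReal_mul zero_le_two, ← ENNReal.ofReal_add
            (mul_nonneg zero_le_two (hp.nonneg u)) (by positivity)]
        apply ENNReal.ofReal_le_ofReal
        rw [← div_eq_inv_mul, ← sub_le_iff_le_add', le_div_iff₀ hl]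
        rcases le_or_gt (k ω u) (2 * p u) with h2 | h2
        · nlinarith [sq_nonneg (k ω u - p u)]
        · nlinarith
      calc _ ≤ (2 * ENNReal.ofReal (p u) +
          ENNReal.ofReal l⁻¹ * ENNReal.ofReal ((k ω u - p u) ^ 2)) * ENNReal.ofReal (s ω u) := by
            gcongr
        _ = 2 * (ENNReal.ofReal (p u) * ENNReal.ofReal (s ω u)) + ENNReal.ofReal l⁻¹ *
            ENNReal.ofReal ((k ω u - p u) ^ 2) * ENNReal.ofReal (s ω u) := by ring
        _ ≤ 2 * (ENNReal.ofReal (p u) * ENNReal.ofReal (s ω u)) + ENNReal.ofReal l⁻¹ *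
            ENNReal.ofReal ((k ω u - p u) ^ 2) * 1 := by gcongr
        _ = _ := by rw [mul_one]
  have mkω : ∀ ω, Measurable (k ω) := fun ω => (hpdf ω).measurable
  have msω : ∀ ω, Measurable (s ω) := fun ω => hs.comp measurable_prodMk_left
  have mJ : Measurable fun ω => ∫⁻ u in C, ENNReal.ofReal (p u) * ENNReal.ofReal (s ω u) := by
    have : Measurable fun q : Ω × (Fin d → ℝ) =>
      ENNReal.ofReal (p q.2) * ENNReal.ofReal (s q.1 q.2) := by fun_prop
    exact this.lintegral_prod_right'
  have mQ : Measurable fun ω => ∫⁻ u, ENNReal.ofReal ((k ω u - p u) ^ 2) := by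
    have : Measurable fun q : Ω × (Fin d → ℝ) =>
      ENNReal.ofReal ((k q.1 q.2 - p q.2) ^ 2) := by fun_prop
    exact this.lintegral_prod_right'
  have mD : Measurable fun q : Ω × (Fin d → ℝ) => ENNReal.ofReal |k q.1 q.2 - m q.2| := by fun_prop
  have mD' : Measurable fun ω => ∫⁻ u in S, ENNReal.ofReal |k ω u - m u| := mD.lintegral_prod_right'
  have hω : ∀ ω, ∫⁻ u in C, ENNReal.ofReal (k ω u) * ENNReal.ofReal (s ω u) ≤
      3 * (∫⁻ u in C, ENNReal.ofReal (p u) * ENNReal.ofReal (s ω u)) +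
      (ENNReal.ofReal l⁻¹ * (∫⁻ u, ENNReal.ofReal ((k ω u - p u) ^ 2)) +
      ((∫⁻ u in S, ENNReal.ofReal |k ω u - m u|) + I)) := by
    intro ω
    have := mkω ω
    have := msω ω
    calc _ ≤ ∫⁻ u in C, (2 * (ENNReal.ofReal (p u) * ENNReal.ofReal (s ω u)) +
      (ENNReal.ofReal l⁻¹ * ENNReal.ofReal ((k ω u - p u) ^ 2) +
      S.indicator (fun u => ENNReal.ofReal |k ω u - m u| + smooth K h p u * ENNReal.ofReal (s ω u)) u)) :=
          setLIntegral_mono' hC (hpt ω)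
      _ = 2 * (∫⁻ u in C, ENNReal.ofReal (p u) * ENNReal.ofReal (s ω u)) +
          (ENNReal.ofReal l⁻¹ * (∫⁻ u in C, ENNReal.ofReal ((k ω u - p u) ^ 2)) +
          ((∫⁻ u in S, ENNReal.ofReal |k ω u - m u|) +
            ∫⁻ u in S, smooth K h p u * ENNReal.ofReal (s ω u))) := by
          rw [lintegral_add_left (by fun_prop), lintegral_const_mul _ (by fun_prop),
            lintegral_add_left (by fun_prop), lintegral_const_mul _ (by fun_prop),
            lintegral_indicator hS, Measure.restrict_restrict hS,
            Set.inter_eq_left.2 (Set.inter_subset_left : S ⊆ C), lintegral_add_left (by fun_prop)]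
      _ ≤ 2 * (∫⁻ u in C, ENNReal.ofReal (p u) * ENNReal.ofReal (s ω u)) +
          (ENNReal.ofReal l⁻¹ * (∫⁻ u, ENNReal.ofReal ((k ω u - p u) ^ 2)) +
          ((∫⁻ u in S, ENNReal.ofReal |k ω u - m u|) +
            ((∫⁻ u in C, ENNReal.ofReal (p u) * ENNReal.ofReal (s ω u)) + I))) := by
          gcongr
          · exact Measure.restrict_le_self
          · exact hsm ω
      _ = _ := by ring
  calc _ ≤ ∫⁻ ω, (3 * (∫⁻ u in C, ENNReal.ofReal (p u) * ENNReal.ofReal (s ω u)) +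
      (ENNReal.ofReal l⁻¹ * (∫⁻ u, ENNReal.ofReal ((k ω u - p u) ^ 2)) +
      ((∫⁻ u in S, ENNReal.ofReal |k ω u - m u|) + I))) ∂P := lintegral_mono hω
    _ = 3 * (∫⁻ ω, (∫⁻ u in C, ENNReal.ofReal (p u) * ENNReal.ofReal (s ω u)) ∂P) +
      (ENNReal.ofReal l⁻¹ * (∫⁻ ω, (∫⁻ u, ENNReal.ofReal ((k ω u - p u) ^ 2)) ∂P) +
      ((∫⁻ ω, (∫⁻ u in S, ENNReal.ofReal |k ω u - m u|) ∂P) + I)) := by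
        rw [lintegral_add_left (by fun_prop), lintegral_const_mul _ mJ,
          lintegral_add_left (by fun_prop), lintegral_const_mul _ mQ, lintegral_add_left mD',
          lintegral_const, measure_univ, mul_one]
    _ ≤ _ := by
        gcongr 3 * _ + (_ + ?_)
        rw [← add_assoc]
        gcongr
        rw [lintegral_lintegral_swap mD.aemeasurable]
        calc _ ≤ ∫⁻ u in S, (ENNReal.ofReal (B / (t * ∏ j, h j) / κ) +
              ENNReal.ofReal κ * smooth K h p u) :=
              lintegral_mono fun u =>
                lintegral_abs_kde_sub_smooth_le hK hB mp hh ht hc hlaw hind u hκ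
          _ ≤ _ := by
              rw [lintegral_add_left measurable_const, lintegral_const_mul _ ms, lintegral_const,
                Measure.restrict_apply MeasurableSet.univ, Set.univ_inter]
              gcongr
              exact Set.inter_subset_left

end KeyEstimate

end DRBO

/-! ### Rates of the density estimates. -/

namespace DRBO

section Rates

variable {d : ℕ}

/-- The order `t^{-1/(4+d)}` of the bandwidths. -/
noncomputable def bandRate (d t : ℕ) : ℝ := (t : ℝ) ^ (-(1 / (4 + (d : ℝ))))

lemma bandRate_pos (d : ℕ) {t : ℕ} (ht : 1 ≤ t) : 0 < bandRate d t :=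
  Real.rpow_pos_of_pos (by exact_mod_cast ht) _

lemma bandRate_le_one (d : ℕ) {t : ℕ} (ht : 1 ≤ t) : bandRate d t ≤ 1 :=
  Real.rpow_le_one_of_one_le_of_nonpos (by exact_mod_cast ht)
    (neg_nonpos.2 (by positivity))

lemma bandRate_rpow (d t : ℕ) (s : ℝ) : bandRate d t ^ s = (t : ℝ) ^ (-(s / (4 + (d : ℝ)))) := by
  rw [bandRate, ← Real.rpow_mul (Nat.cast_nonneg t)]
  congr 1
  ring

/-- The bandwidth balances variance and squared bias: with bandwidth `x`, the variance `1 / (t * x ^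
d)` equals `x ^ 4`. -/
lemma bandRate_pow_mul (d : ℕ) {t : ℕ} (ht : 1 ≤ t) : bandRate d t ^ (4 + d) * t = 1 := by
  have ht0 : (0 : ℝ) < t := by exact_mod_cast ht
  rw [← Real.rpow_natCast, bandRate_rpow]
  push_cast
  rw [div_self (by positivity), Real.rpow_neg_one, inv_mul_cancel₀ ht0.ne']

/-- Positivity of the bandwidths and of the rate makes the two asymptotic bounds hold from `t = 1`
on, with larger constants; sums of constants serve all coordinates. -/
lemma IsBandwidth.exists_bounds {h : ℕ → Fin d → ℝ} (hh : IsBandwidth h) :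
    ∃ c₁ c₂ : ℝ, 0 < c₁ ∧ 0 < c₂ ∧ ∀ t, 1 ≤ t → ∀ i,
      c₁ * bandRate d t ≤ h t i ∧ h t i ≤ c₂ * bandRate d t := by
  have h1 : ∀ i, ∃ C > 0, ∀ t, 1 ≤ t → h t i ≤ C * bandRate d t := fun i => by
    obtain ⟨C, hC, h1⟩ := bound_of_isBigO_nat_atTop (hh.order i).1
    refine ⟨C, hC, fun t ht => ?_⟩
    have h2 := h1 (x := t) (bandRate_pos d ht).ne'
    rw [Real.norm_of_nonneg (hh.pos t ht i).le] at h2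
    rwa [show ‖(t : ℝ) ^ (-(1 / (4 + (d : ℝ))))‖ = bandRate d t from
      Real.norm_of_nonneg (bandRate_pos d ht).le] at h2
  have h2 : ∀ i, ∃ C > 0, ∀ t, 1 ≤ t → bandRate d t ≤ C * h t i := fun i => by
    obtain ⟨C, hC, h1⟩ := bound_of_isBigO_nat_atTop (hh.order i).2
    refine ⟨C, hC, fun t ht => ?_⟩
    have h2 := h1 (x := t) (hh.pos t ht i).ne'
    rw [Real.norm_of_nonneg (hh.pos t ht i).le] at h2
    rwa [show ‖(t : ℝ) ^ (-(1 / (4 + (d : ℝ))))‖ = bandRate d t from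
      Real.norm_of_nonneg (bandRate_pos d ht).le] at h2
  choose U hU hU' using h1
  choose V hV hV' using h2
  have hUs : ∀ i, U i ≤ 1 + ∑ j, U j := fun i => by
    have := Finset.single_le_sum (fun j _ => (hU j).le) (Finset.mem_univ i)
    linarith
  have hVs : ∀ i, V i ≤ 1 + ∑ j, V j := fun i => by
    have := Finset.single_le_sum (fun j _ => (hV j).le) (Finset.mem_univ i)
    linarith
  have hU0 : 0 < 1 + ∑ j, U j := by
    have := Finset.sum_nonneg fun j (_ : j ∈ Finset.univ) => (hU j).le
    linarith
  have hV0 : 0 < 1 + ∑ j, V j := by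
    have := Finset.sum_nonneg fun j (_ : j ∈ Finset.univ) => (hV j).le
    linarith
  refine ⟨(1 + ∑ j, V j)⁻¹, 1 + ∑ j, U j, by positivity, hU0, fun t ht i => ⟨?_, ?_⟩⟩
  · rw [inv_mul_le_iff₀ hV0]
    exact (hV' i t ht).trans (mul_le_mul_of_nonneg_right (hVs i) (hh.pos t ht i).le)
  · exact (hU' i t ht).trans (mul_le_mul_of_nonneg_right (hUs i) (bandRate_pos d ht).le)

lemma rpow_le_one_add_rpow {r s q : ℝ} (hr : 0 ≤ r) (hs : 0 ≤ s) (hsq : s ≤ q) :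
    r ^ s ≤ 1 + r ^ q := by
  rcases le_total r 1 with h | h
  · have := Real.rpow_le_one hr h hs
    have := Real.rpow_nonneg hr q
    linarith
  · have := Real.rpow_le_rpow_of_exponent_le h hsq
    linarith

/-- Moments of orders 2, `θ` and `2 + θ` with `θ = min η 1` are all dominated by that of `1 + ‖u‖ ^
(2 + η)`. -/
lemma IsKDEKernel.exists_moments {K : (Fin d → ℝ) → ℝ} (hK : IsKDEKernel K) :
    ∃ θ M : ℝ, 0 < θ ∧ θ ≤ 1 ∧ 1 ≤ M ∧
      ∫⁻ u, ENNReal.ofReal (K u) * ‖u‖ₑ ^ 2 ≤ ENNReal.ofReal M ∧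
      ∫⁻ u, ENNReal.ofReal (K u * ‖u‖ ^ θ) ≤ ENNReal.ofReal M ∧
      ∫⁻ u, ENNReal.ofReal (K u * ‖u‖ ^ θ) * ‖u‖ₑ ^ 2 ≤ ENNReal.ofReal M := by
  obtain ⟨η, hη, hint⟩ := hK.higher_moment
  have hint' : Integrable fun u => (1 + ‖u‖ ^ (2 + η)) * K u := by
    simp only [add_mul, one_mul]
    exact hK.isPDF.integrable.add hint
  set M := ∫ u, (1 + ‖u‖ ^ (2 + η)) * K u with hM
  have hK0 := hK.isPDF.nonneg
  have hMe : ENNReal.ofReal M = ∫⁻ u, ENNReal.ofReal ((1 + ‖u‖ ^ (2 + η)) * K u) :=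
    ofReal_integral_eq_lintegral_ofReal hint' (ae_of_all _ fun u =>
      mul_nonneg (by positivity) (hK0 u))
  have hM1 : 1 ≤ M := by
    rw [← hK.isPDF.integral_eq_one]
    refine integral_mono hK.isPDF.integrable hint' fun u => ?_
    have : 0 ≤ ‖u‖ ^ (2 + η) := by positivity
    have := hK0 u
    simp only
    nlinarith
  have hpow : ∀ u : Fin d → ℝ, ‖u‖ₑ ^ 2 = ENNReal.ofReal (‖u‖ ^ (2 : ℝ)) := fun u => by
    rw [← ofReal_norm, ← ENNReal.ofReal_pow (norm_nonneg _), Real.rpow_ofNat]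
  refine ⟨min η 1, M, lt_min hη one_pos, min_le_right _ _, hM1, ?_, ?_, ?_⟩
  · rw [hMe]
    refine lintegral_mono fun u => ?_
    rw [hpow, ← ENNReal.ofReal_mul (hK0 u), mul_comm]
    exact ENNReal.ofReal_le_ofReal (mul_le_mul_of_nonneg_right
      (rpow_le_one_add_rpow (norm_nonneg u) zero_le_two (by linarith)) (hK0 u))
  · rw [hMe]
    refine lintegral_mono fun u => ?_
    rw [mul_comm]
    exact ENNReal.ofReal_le_ofReal (mul_le_mul_of_nonneg_right
      (rpow_le_one_add_rpow (norm_nonneg u) (le_min hη.le zero_le_one)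
        (by linarith [min_le_left η 1])) (hK0 u))
  · rw [hMe]
    refine lintegral_mono fun u => ?_
    rw [hpow, ← ENNReal.ofReal_mul (mul_nonneg (hK0 u) (by positivity)), mul_assoc,
      ← Real.rpow_add_of_nonneg (norm_nonneg _) (le_min hη.le zero_le_one) zero_le_two, mul_comm]
    exact ENNReal.ofReal_le_ofReal (mul_le_mul_of_nonneg_right
      (rpow_le_one_add_rpow (norm_nonneg u) (add_nonneg (le_min hη.le zero_le_one) zero_le_two)
        (by linarith [min_le_left η 1])) (hK0 u))

/-- Mean absolute errors, in terms of mean squared errors. -/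
lemma lintegral_abs_sub_le_of_sq {Ω : Type*} [MeasurableSpace Ω] (P : Measure Ω)
    [IsProbabilityMeasure P] {g : Ω → (Fin d → ℝ) → ℝ} {p : (Fin d → ℝ) → ℝ}
    (hg : Measurable fun q : Ω × (Fin d → ℝ) => g q.1 q.2) (hp : Measurable p)
    (C : Set (Fin d → ℝ)) {q : ℝ} (hq : 0 < q) :
    ∫⁻ ω, (∫⁻ u in C, ENNReal.ofReal |g ω u - p u|) ∂P ≤
      ENNReal.ofReal q⁻¹ * (∫⁻ ω, (∫⁻ u, ENNReal.ofReal ((g ω u - p u) ^ 2)) ∂P) +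
        ENNReal.ofReal q * volume C := by
  have mQ : Measurable fun q : Ω × (Fin d → ℝ) => ENNReal.ofReal ((g q.1 q.2 - p q.2) ^ 2) := by
    fun_prop
  have mQ' : Measurable fun ω => ∫⁻ u, ENNReal.ofReal ((g ω u - p u) ^ 2) :=
    mQ.lintegral_prod_right'
  have hω : ∀ ω, ∫⁻ u in C, ENNReal.ofReal |g ω u - p u| ≤
      ENNReal.ofReal q⁻¹ * (∫⁻ u, ENNReal.ofReal ((g ω u - p u) ^ 2)) +
        ENNReal.ofReal q * volume C := by
    intro ω
    have mgω : Measurable (g ω) := hg.comp measurable_prodMk_left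
    calc _ ≤ ∫⁻ u in C, (ENNReal.ofReal q⁻¹ * ENNReal.ofReal ((g ω u - p u) ^ 2) +
          ENNReal.ofReal q) := by
          refine lintegral_mono fun u => ?_
          rw [← ENNReal.ofReal_mul (by positivity),
            ← ENNReal.ofReal_add (by positivity) (by positivity)]
          apply ENNReal.ofReal_le_ofReal
          rw [← div_eq_inv_mul, ← sub_le_iff_le_add, le_div_iff₀ (by positivity)]
          set D := g ω u - p u
          nlinarith [sq_nonneg (|D| - q), sq_abs D, abs_nonneg D]
      _ = ENNReal.ofReal q⁻¹ * (∫⁻ u in C, ENNReal.ofReal ((g ω u - p u) ^ 2)) +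
          ENNReal.ofReal q * volume C := by
          rw [lintegral_add_right _ measurable_const, lintegral_const_mul _ (by fun_prop),
            lintegral_const, Measure.restrict_apply MeasurableSet.univ, Set.univ_inter]
      _ ≤ _ := by
          gcongr
          exact Measure.restrict_le_self
  refine (lintegral_mono hω).trans (le_of_eq ?_)
  rw [lintegral_add_right _ measurable_const, lintegral_const, measure_univ, mul_one,
    lintegral_const_mul _ mQ']

universe u

set_option maxHeartbeats 1000000 in
/-- Rates of convergence of kernel density estimates. -/
theorem exists_kde_rates {C : Set (Fin d → ℝ)} (hC : IsCompact C) {p K : (Fin d → ℝ) → ℝ}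
    (hp : IsSmoothPDFOn C p) (hK : IsKDEKernel K) {h : ℕ → Fin d → ℝ} (hh : IsBandwidth h)
    {L : ℝ} (hL : 0 ≤ L) : ∃ θ Q : ℝ, 0 < θ ∧ 0 < Q ∧ ∀ t, 1 ≤ t →
      ∀ (Ω : Type u) [MeasurableSpace Ω] (P : Measure Ω) [IsProbabilityMeasure P]
        (c : ℕ → Ω → Fin d → ℝ), (∀ t, Measurable (c t)) → (∀ t, P.map (c t) = law p) →
        iIndepFun c P →
        ∫⁻ ω, (∫⁻ u in C, ENNReal.ofReal |kde K (h t) t (fun i => c i ω) u - p u|) ∂P ≤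
          ENNReal.ofReal (Q * bandRate d t ^ 2) ∧
        ∀ s : Ω → (Fin d → ℝ) → ℝ, Measurable (fun q : Ω × (Fin d → ℝ) => s q.1 q.2) →
          (∀ ω, ∀ u ∈ C, 0 ≤ s ω u) → (∀ ω, ∀ u ∈ C, s ω u ≤ 1) →
          (∀ ω, ∀ u ∈ C, ∀ v ∈ C, s ω u ≤ s ω v + L * ‖u - v‖) →
          ∫⁻ ω, (∫⁻ u in C, ENNReal.ofReal (kde K (h t) t (fun i => c i ω) u) *
              ENNReal.ofReal (s ω u)) ∂P ≤
            3 * (∫⁻ ω, (∫⁻ u in C, ENNReal.ofReal (p u) * ENNReal.ofReal (s ω u)) ∂P) +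
            ENNReal.ofReal (Q * (bandRate d t ^ 2 * bandRate d t ^ (θ / 2))) := by
  obtain ⟨A, hA⟩ := hp.exists_lintegral_secondDiff_le
  obtain ⟨B, hB⟩ := hK.bounded
  obtain ⟨c₁, c₂, hc₁, hc₂, hcb⟩ := hh.exists_bounds
  obtain ⟨θ, M, hθ0, hθ1, hM1, hM2, hMθ, hMθ2⟩ := hK.exists_moments
  have hB0 : 0 ≤ B := (hK.isPDF.nonneg 0).trans (hB 0)
  have hM0 : 0 ≤ M := by linarith
  have hCm : MeasurableSet C := hC.measurableSet
  have hCfin : volume C ≠ ⊤ := hC.measure_lt_top.ne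
  set V := (volume C).toReal with hV
  have hV0 : 0 ≤ V := ENNReal.toReal_nonneg
  set Bv := B / c₁ ^ d with hBv
  have hBv0 : 0 ≤ Bv := by positivity
  set E₀ := 2 * Bv + 2 * (A * M ^ 2 * c₂ ^ 4) with hE₀
  have hE₀0 : 0 ≤ E₀ := by positivity
  set E₁ := M * V + A * M ^ 2 * c₂ ^ 4 + V with hE₁
  have hE₁0 : 0 ≤ E₁ := by positivity
  refine ⟨θ, 1 + V + E₀ + Bv * V + E₁ + (L * c₂) ^ θ * E₁, hθ0, by positivity, ?_⟩
  intro t ht Ω _ P _ c hc hlaw hind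
  set x := bandRate d t with hx
  have hx0 : 0 < x := bandRate_pos d ht
  have hx1 : x ≤ 1 := bandRate_le_one d ht
  set a := x ^ (θ / 2) with ha
  have ha0 : 0 < a := Real.rpow_pos_of_pos hx0 _
  have ha1 : a ≤ 1 := Real.rpow_le_one hx0.le hx1 (by positivity)
  have ha2 : x ^ θ = a ^ 2 := by
    rw [ha, ← Real.rpow_natCast, ← Real.rpow_mul hx0.le]
    congr 1
    push_cast
    ring
  have ha3 : x ^ 2 ≤ a ^ 3 := by
    rw [ha, ← Real.rpow_natCast, ← Real.rpow_natCast, ← Real.rpow_mul hx0.le]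
    refine Real.rpow_le_rpow_of_exponent_ge hx0 hx1 ?_
    push_cast
    linarith
  have hpos : ∀ j, 0 < h t j := hh.pos t ht
  have hη0 : 0 ≤ c₂ * x := by positivity
  have hη : ∀ j, |h t j| ≤ c₂ * x := fun j => by
    rw [abs_of_pos (hpos j)]
    exact (hcb t ht j).2
  have hprod : c₁ ^ d * x ^ d ≤ ∏ j, h t j := by
    have := Finset.prod_le_prod (s := Finset.univ) (f := fun _ : Fin d => c₁ * x)
      (g := fun j => h t j) (fun j _ => by positivity) fun j _ => (hcb t ht j).1
    simpa [mul_pow] using this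
  have ht0 : (0 : ℝ) < t := by exact_mod_cast ht
  have hv : B / (t * ∏ j, h t j) ≤ Bv * x ^ 4 := by
    have h1 := bandRate_pow_mul d ht
    rw [← hx] at h1
    rw [div_le_iff₀ (mul_pos ht0 (Finset.prod_pos fun j _ => hpos j))]
    calc B = B * (x ^ (4 + d) * t) := by rw [h1, mul_one]
      _ = Bv * x ^ 4 * (t * (c₁ ^ d * x ^ d)) := by
          rw [hBv]
          field_simp
          ring
      _ ≤ _ := by gcongr
  have hv0 : 0 ≤ B / (t * ∏ j, h t j) :=
    div_nonneg hB0 (mul_pos ht0 (Finset.prod_pos fun j _ => hpos j)).le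
  have hmise := lintegral_kde_sub_density_sq_le hK.isPDF hK.symm hB hp.isPDF hpos hA hη0 hη hM0 hM2
    ht hc hlaw hind
  have hmise' : ∫⁻ ω, (∫⁻ u, ENNReal.ofReal ((kde K (h t) t (fun i => c i ω) u - p u) ^ 2)) ∂P ≤
      ENNReal.ofReal (E₀ * x ^ 4) := by
    refine hmise.trans (ENNReal.ofReal_le_ofReal ?_)
    rw [hE₀]
    nlinarith
  have mk := measurable_kde_path hK.isPDF.measurable (h t) t hc
  have mp := hp.isPDF.measurable
  have hVe : volume C = ENNReal.ofReal V := (ENNReal.ofReal_toReal hCfin).symm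
  refine ⟨?_, fun s hs hs0 hs1 hsL => ?_⟩
  · calc ∫⁻ ω, (∫⁻ u in C, ENNReal.ofReal |kde K (h t) t (fun i => c i ω) u - p u|) ∂P
        ≤ ENNReal.ofReal (x ^ 2)⁻¹ * (∫⁻ ω, (∫⁻ u,
            ENNReal.ofReal ((kde K (h t) t (fun i => c i ω) u - p u) ^ 2)) ∂P) +
            ENNReal.ofReal (x ^ 2) * volume C :=
          lintegral_abs_sub_le_of_sq P mk mp C (by positivity)
      _ ≤ ENNReal.ofReal (x ^ 2)⁻¹ * ENNReal.ofReal (E₀ * x ^ 4) +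
            ENNReal.ofReal (x ^ 2) * ENNReal.ofReal V := by
          rw [hVe]
          gcongr
      _ ≤ _ := by
          rw [← ENNReal.ofReal_mul (by positivity), ← ENNReal.ofReal_mul (by positivity),
            ← ENNReal.ofReal_add (by positivity) (by positivity)]
          apply ENNReal.ofReal_le_ofReal
          have e : (x ^ 2)⁻¹ * (E₀ * x ^ 4) = E₀ * x ^ 2 := by
            field_simp
          rw [e]
          have h1 : 0 ≤ (L * c₂) ^ θ := by positivity
          have : 0 ≤ (1 + Bv * V + E₁ + (L * c₂) ^ θ * E₁) * x ^ 2 := by positivity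
          nlinarith
  -- With `a = x ^ (θ / 2)`, the level `l = x ^ 2 / a` makes the squared error over `l` of order `x
  -- ^ 2 * a`. The region `p < l` has smoothed mass of order `l`, which the factors `κ = a ^ 2` and
  -- `x ^ θ = a ^ 2` reduce to `x ^ 2 * a`. The variance term `x ^ 4 / a ^ 2` is as small because `x
  -- ^ 2 ≤ a ^ 3`.
  · have hl : 0 < x ^ 2 / a := by positivity
    have hκ : 0 < a ^ 2 := by positivity
    have hq : 0 < x ^ 2 := by positivity
    refine (lintegral_kde_mul_le hK.isPDF hB hp.isPDF hCm hp.eq_zero_off hpos hη0 hη ht hc hlaw hind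
      hs hs0 hs1 hL hsL hθ0 hθ1 hl hκ).trans ?_
    have hm : MeasurableSet {u | p u < x ^ 2 / a} := measurableSet_lt mp measurable_const
    have hS1 := lintegral_smooth_le_of_lt hK.isPDF.measurable hK.symm mp hp.isPDF.nonneg (h := h t)
      hA hη0 hη hM0 (by rw [hK.isPDF.lintegral_eq_one, ← ENNReal.ofReal_one]
                        exact ENNReal.ofReal_le_ofReal hM1) hM2 hCm hCfin hl hq
    have mKθ : Measurable fun u : Fin d → ℝ => K u * ‖u‖ ^ θ := by
      have := hK.isPDF.measurable
      fun_prop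
    have hS2 := lintegral_smooth_le_of_lt mKθ (fun u => by rw [hK.symm, norm_neg]) mp
      hp.isPDF.nonneg (h := h t) hA hη0 hη hM0 hMθ hMθ2 hCm hCfin hl hq
    have hEl : M * (x ^ 2 / a) * V + A * M ^ 2 * (c₂ * x) ^ 4 / x ^ 2 + x ^ 2 * V ≤
        E₁ * (x ^ 2 / a) := by
      have h1 : x ^ 2 ≤ x ^ 2 / a := by
        rw [le_div_iff₀ ha0]
        nlinarith
      have h2 : A * M ^ 2 * (c₂ * x) ^ 4 / x ^ 2 = A * M ^ 2 * c₂ ^ 4 * x ^ 2 := by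
        field_simp
      have h3 : (A * M ^ 2 * c₂ ^ 4) * x ^ 2 ≤ (A * M ^ 2 * c₂ ^ 4) * (x ^ 2 / a) := by
        gcongr
      rw [h2, hE₁]
      nlinarith
    have hS1' := hS1.trans (ENNReal.ofReal_le_ofReal hEl)
    have hS2' := hS2.trans (ENNReal.ofReal_le_ofReal hEl)
    gcongr 3 * _ + ?_
    calc _ ≤ ENNReal.ofReal (x ^ 2 / a)⁻¹ * ENNReal.ofReal (E₀ * x ^ 4) +
          (ENNReal.ofReal (Bv * x ^ 4 / a ^ 2) * ENNReal.ofReal V +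
          (ENNReal.ofReal (a ^ 2) * ENNReal.ofReal (E₁ * (x ^ 2 / a)) +
          ENNReal.ofReal ((L * (c₂ * x)) ^ θ) * ENNReal.ofReal (E₁ * (x ^ 2 / a)))) := by
          rw [← hVe]
          gcongr
      _ ≤ _ := by
          have h1 : 0 ≤ (L * c₂) ^ θ := by positivity
          rw [← ENNReal.ofReal_mul (by positivity), ← ENNReal.ofReal_mul (by positivity),
            ← ENNReal.ofReal_mul (by positivity), ← ENNReal.ofReal_mul (by positivity),
            ← ENNReal.ofReal_add (by positivity) (by positivity),
            ← ENNReal.ofReal_add (by positivity) (by positivity),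
            ← ENNReal.ofReal_add (by positivity) (by positivity)]
          apply ENNReal.ofReal_le_ofReal
          have e1 : (x ^ 2 / a)⁻¹ * (E₀ * x ^ 4) = E₀ * (x ^ 2 * a) := by
            field_simp
          have e2 : Bv * x ^ 4 / a ^ 2 * V ≤ Bv * V * (x ^ 2 * a) := by
            rw [div_mul_eq_mul_div, div_le_iff₀ hκ]
            have : x ^ 4 ≤ x ^ 2 * a * a ^ 2 := by nlinarith
            have h5 := mul_le_mul_of_nonneg_left this (mul_nonneg hBv0 hV0)
            linarith
          have e3 : a ^ 2 * (E₁ * (x ^ 2 / a)) = E₁ * (x ^ 2 * a) := by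
            field_simp
          have e4 : (L * (c₂ * x)) ^ θ * (E₁ * (x ^ 2 / a)) =
              (L * c₂) ^ θ * E₁ * (x ^ 2 * a) := by
            rw [← mul_assoc L, Real.mul_rpow (by positivity) hx0.le, ha2]
            field_simp
          rw [e1, e3, e4]
          have : 0 ≤ (1 + V) * (x ^ 2 * a) := by positivity
          nlinarith

end Rates

end DRBO

/-! ### Total variation balls. -/

namespace DRBO

section TotalVariation

variable {d : ℕ}

lemma self_mem_tvBall {p : (Fin d → ℝ) → ℝ} (hp : IsPDF p) {δ : ℝ} (hδ : 0 ≤ δ) :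
    p ∈ tvBall p δ := by
  refine ⟨hp, Measure.AbsolutelyContinuous.rfl, ?_⟩
  have : (fun c => p c * |p c / p c - 1|) = fun _ => 0 := by
    ext c
    rcases eq_or_ne (p c) 0 with h | h
    · rw [h, zero_mul]
    · rw [div_self h, sub_self, abs_zero, mul_zero]
  rw [tvDist, this, integral_zero]
  exact hδ

/-- Where `p` vanishes the integrand of `tvDist` is 0, whatever `q` is; absolute continuity is what
prevents `q` from hiding mass there. -/
lemma integral_abs_sub_le_of_mem_tvBall {p q : (Fin d → ℝ) → ℝ} (hp : IsPDF p) {δ : ℝ}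
    (hq : q ∈ tvBall p δ) : ∫ c, |q c - p c| ≤ δ := by
  obtain ⟨hq1, hac, htv⟩ := hq
  refine le_trans (le_of_eq (integral_congr_ae ?_)) htv
  have hm : MeasurableSet {c | p c = 0} := hp.measurable (measurableSet_singleton 0)
  have h1 : law p {c | p c = 0} = 0 := by
    rw [law, withDensity_apply _ hm]
    refine (setLIntegral_congr_fun hm fun c hc => ?_).trans lintegral_zero
    rw [show p c = 0 from hc, ENNReal.ofReal_zero]
  have h2 := hac h1
  rw [law, withDensity_apply _ hm, lintegral_eq_zero_iff (by have := hq1.measurable; fun_prop),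
    EventuallyEq, ae_restrict_iff' hm] at h2
  filter_upwards [h2] with c hc
  rcases eq_or_ne (p c) 0 with h | h
  · have h3 := hc h
    simp only [Pi.zero_apply, ENNReal.ofReal_eq_zero] at h3
    have h4 := le_antisymm h3 (hq1.nonneg c)
    rw [h, h4]
    simp
  · have h5 : q c - p c = p c * (q c / p c - 1) := by
      field_simp
    rw [h5, abs_mul, abs_of_nonneg (hp.nonneg c)]

variable {C : Set (Fin d → ℝ)}

lemma integrableOn_mul_pdf (hC : MeasurableSet C) {q g : (Fin d → ℝ) → ℝ} (hq : Integrable q)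
    (hg : AEStronglyMeasurable g (volume.restrict C)) {B : ℝ} (hB : ∀ s ∈ C, |g s| ≤ B) :
    IntegrableOn (fun s => g s * q s) C :=
  hq.integrableOn.bdd_mul hg ((ae_restrict_iff' hC).2 (ae_of_all _ hB))

lemma abs_expect_le (hC : MeasurableSet C) {q g : (Fin d → ℝ) → ℝ} (hq : IsPDF q) {B : ℝ}
    (hB0 : 0 ≤ B) (hB : ∀ s ∈ C, |g s| ≤ B) : |expect C q g| ≤ B := by
  have h1 : ‖∫ s in C, g s * q s‖ ≤ ∫ s in C, B * q s := by
    refine norm_integral_le_of_norm_le (hq.integrable.integrableOn.const_mul B)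
      ((ae_restrict_iff' hC).2 (ae_of_all _ fun s hs => ?_))
    rw [norm_mul, Real.norm_of_nonneg (hq.nonneg s)]
    exact mul_le_mul_of_nonneg_right (hB s hs) (hq.nonneg s)
  refine h1.trans ?_
  rw [integral_const_mul]
  have := setIntegral_le_integral (s := C) hq.integrable (ae_of_all _ hq.nonneg)
  rw [hq.integral_eq_one] at this
  exact mul_le_of_le_one_right hB0 this

lemma abs_setIntegral_mul_le (hC : MeasurableSet C) {q g : (Fin d → ℝ) → ℝ} (hq : Integrable q)
    {B : ℝ} (hB : ∀ s ∈ C, |g s| ≤ B) : |∫ s in C, g s * q s| ≤ B * ∫ s in C, |q s| := by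
  have h1 : ‖∫ s in C, g s * q s‖ ≤ ∫ s in C, B * |q s| := by
    refine norm_integral_le_of_norm_le (hq.abs.integrableOn.const_mul B)
      ((ae_restrict_iff' hC).2 (ae_of_all _ fun s hs => ?_))
    rw [norm_mul]
    exact mul_le_mul_of_nonneg_right (hB s hs) (abs_nonneg _)
  rwa [integral_const_mul] at h1

lemma abs_expect_sub_expect_le (hC : MeasurableSet C) {q q' g : (Fin d → ℝ) → ℝ} (hq : IsPDF q)
    (hq' : IsPDF q') (hg : AEStronglyMeasurable g (volume.restrict C)) {B : ℝ}
    (hB : ∀ s ∈ C, |g s| ≤ B) :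
    |expect C q g - expect C q' g| ≤ B * ∫ s in C, |q s - q' s| := by
  unfold expect
  rw [← integral_sub (integrableOn_mul_pdf hC hq.integrable hg hB)
    (integrableOn_mul_pdf hC hq'.integrable hg hB)]
  simp only [← mul_sub]
  exact abs_setIntegral_mul_le hC (hq.integrable.sub hq'.integrable) hB

end TotalVariation

/-! ### Pathwise regret of one maximization, and nets. -/

section OneStep

variable {Dx Dc : ℕ} {X : Set (Fin Dx → ℝ)} {C : Set (Fin Dc → ℝ)}

/-- The regret of one maximization of the robust acquisition function, for a fixed path `F`. -/
theorem expect_sub_expect_le (hC : MeasurableSet C) {p p' : (Fin Dc → ℝ) → ℝ}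
    (hp : IsPDF p) (hp' : IsPDF p') {δ : ℝ} (hδ : 0 ≤ δ) {u F μ ς : Pt Dx Dc → ℝ}
    {xs x g : Fin Dx → ℝ} (hxs : xs ∈ X) (hx : x ∈ X) (hg : g ∈ X)
    (hmax : IsMaxOn (robustAcq C u p' δ) X x) {b M m ρ : ℝ} (hb : 0 ≤ b) (hM0 : 0 ≤ M) (hm0 : 0 ≤ m)
    (hu : ∀ v ∈ X, ∀ s ∈ C, u (v, s) = μ (v, s) + b * ς (v, s))
    (hFm : ∀ v ∈ X, AEStronglyMeasurable (fun s => F (v, s)) (volume.restrict C))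
    (hμm : ∀ v ∈ X, AEStronglyMeasurable (fun s => μ (v, s)) (volume.restrict C))
    (hςm : ∀ v ∈ X, AEStronglyMeasurable (fun s => ς (v, s)) (volume.restrict C))
    (hFM : ∀ v ∈ X, ∀ s ∈ C, |F (v, s)| ≤ M) (hμM : ∀ v ∈ X, ∀ s ∈ C, |μ (v, s)| ≤ m)
    (hς0 : ∀ v ∈ X, ∀ s ∈ C, 0 ≤ ς (v, s)) (hς1 : ∀ v ∈ X, ∀ s ∈ C, ς (v, s) ≤ 1)
    (hρ0 : 0 ≤ ρ) (hρ : ∀ s ∈ C, |F (xs, s) - F (g, s)| ≤ ρ) :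
    expect C p (fun s => F (xs, s)) - expect C p (fun s => F (x, s)) ≤
      ρ + 2 * M * (∫ s in C, |p' s - p s|) + δ * (2 * M + m) +
      (∫ s in C, max (F (g, s) - (μ (g, s) + b * ς (g, s))) 0 * p' s) +
      (∫ s in C, |F (x, s) - μ (x, s)| * p' s) + b * ∫ s in C, ς (x, s) * p' s := by
  have hum : ∀ v ∈ X, AEStronglyMeasurable (fun s => μ (v, s) + b * ς (v, s))
      (volume.restrict C) := fun v hv => (hμm v hv).add ((hςm v hv).const_mul b)
  have hub : ∀ v ∈ X, ∀ s ∈ C, |μ (v, s) + b * ς (v, s)| ≤ m + b := fun v hv s hs => by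
    refine (abs_add_le _ _).trans (add_le_add (hμM v hv s hs) ?_)
    rw [abs_of_nonneg (mul_nonneg hb (hς0 v hv s hs))]
    exact mul_le_of_le_one_right hb (hς1 v hv s hs)
  have huexp : ∀ v ∈ X, ∀ q, expect C q (fun s => u (v, s)) =
      expect C q (fun s => μ (v, s) + b * ς (v, s)) := fun v hv q =>
    setIntegral_congr_fun hC fun s hs => by simp only [hu v hv s hs]
  have s1 : expect C p (fun s => F (xs, s)) ≤ expect C p (fun s => F (g, s)) + ρ := by
    have h1 := abs_expect_le hC hp hρ0 (g := fun s => F (xs, s) - F (g, s)) hρ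
    have h2 : expect C p (fun s => F (xs, s) - F (g, s)) =
        expect C p (fun s => F (xs, s)) - expect C p (fun s => F (g, s)) := by
      unfold expect
      rw [← integral_sub (integrableOn_mul_pdf hC hp.integrable (hFm _ hxs) (hFM _ hxs))
        (integrableOn_mul_pdf hC hp.integrable (hFm _ hg) (hFM _ hg))]
      simp only [sub_mul]
    rw [h2] at h1
    linarith [le_abs_self (expect C p (fun s => F (xs, s)) - expect C p (fun s => F (g, s)))]
  have s2 := abs_expect_sub_expect_le hC hp' hp (hFm _ hg) (hFM _ hg)
  have s6 := abs_expect_sub_expect_le hC hp' hp (hFm _ hx) (hFM _ hx)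
  -- lower bound of the robust acquisition function at `g`
  have hpm : AEStronglyMeasurable (fun s => max (F (g, s) - (μ (g, s) + b * ς (g, s))) 0)
      (volume.restrict C) := ((hFm _ hg).sub (hum _ hg)).sup aestronglyMeasurable_const
  -- The bound does not contain `b`, since `b * ς ≥ 0` only lowers the positive part. Hence the
  -- radius enters the regret without the factor `√β`.
  have hpb : ∀ s ∈ C, |max (F (g, s) - (μ (g, s) + b * ς (g, s))) 0| ≤ M + m := fun s hs => by
    rw [abs_of_nonneg (le_max_right _ _)]
    refine max_le ?_ (by positivity)
    have h1 := (abs_le.1 (hFM g hg s hs)).2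
    have h2 := (abs_le.1 (hμM g hg s hs)).1
    have h3 := mul_nonneg hb (hς0 g hg s hs)
    linarith
  have s3 : expect C p' (fun s => F (g, s)) -
      (∫ s in C, max (F (g, s) - (μ (g, s) + b * ς (g, s))) 0 * p' s) - δ * (2 * M + m) ≤
      robustAcq C u p' δ g := by
    refine le_csInf (Set.image_nonempty.2 ⟨p', self_mem_tvBall hp' hδ⟩) ?_
    rintro _ ⟨q, hq, rfl⟩
    simp only
    rw [huexp g hg]
    have hqp := hq.1
    have htv : ∫ s in C, |q s - p' s| ≤ δ :=
      (setIntegral_le_integral (hqp.integrable.sub hp'.integrable).abs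
        (ae_of_all _ fun s => abs_nonneg _)).trans (integral_abs_sub_le_of_mem_tvBall hp' hq)
    have h1 := abs_expect_sub_expect_le hC hqp hp' (hFm _ hg) (hFM _ hg)
    have h2 := abs_expect_sub_expect_le hC hqp hp' hpm hpb
    -- Only `F` and the positive part are moved from `q` to `p'`, never the upper confidence bound
    -- itself; the costs `δ * M` and `δ * (M + m)` add up to `δ * (2 * M + m)`.
    have h3 : expect C q (fun s => F (g, s)) -
        expect C q (fun s => max (F (g, s) - (μ (g, s) + b * ς (g, s))) 0) ≤
        expect C q (fun s => μ (g, s) + b * ς (g, s)) := by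
      unfold expect
      rw [← integral_sub (integrableOn_mul_pdf hC hqp.integrable (hFm _ hg) (hFM _ hg))
        (integrableOn_mul_pdf hC hqp.integrable hpm hpb)]
      refine integral_mono ((integrableOn_mul_pdf hC hqp.integrable (hFm _ hg) (hFM _ hg)).sub
        (integrableOn_mul_pdf hC hqp.integrable hpm hpb))
        (integrableOn_mul_pdf hC hqp.integrable (hum _ hg) (hub _ hg)) fun s => ?_
      simp only
      rw [← sub_mul]
      refine mul_le_mul_of_nonneg_right ?_ (hqp.nonneg s)
      linarith [le_max_left (F (g, s) - (μ (g, s) + b * ς (g, s))) 0]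
    have h4 := (abs_le.1 h1).1
    have h5 := (abs_le.1 h2).2
    have h6 := mul_le_mul_of_nonneg_left htv hM0
    have h7 := mul_le_mul_of_nonneg_left htv (add_nonneg hM0 hm0)
    unfold expect at *
    linarith
  -- upper bound at `x`
  have s4 : robustAcq C u p' δ g ≤ robustAcq C u p' δ x := hmax hg
  have s5 : robustAcq C u p' δ x ≤ expect C p' (fun s => μ (x, s) + b * ς (x, s)) := by
    rw [← huexp x hx]
    -- A lower bound is required, as the real infimum of a set unbounded below is 0 by convention.
    refine csInf_le ⟨-(m + b), ?_⟩ ⟨p', self_mem_tvBall hp' hδ, rfl⟩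
    rintro _ ⟨q, hq, rfl⟩
    simp only
    rw [huexp x hx]
    exact (abs_le.1 (abs_expect_le hC hq.1 (by positivity) (hub x hx))).1
  have s7 : expect C p' (fun s => μ (x, s) + b * ς (x, s)) ≤ expect C p' (fun s => F (x, s)) +
      (∫ s in C, |F (x, s) - μ (x, s)| * p' s) + b * ∫ s in C, ς (x, s) * p' s := by
    have i1 := integrableOn_mul_pdf hC hp'.integrable (hFm _ hx) (hFM _ hx)
    have i2 : IntegrableOn (fun s => |F (x, s) - μ (x, s)| * p' s) C :=
      integrableOn_mul_pdf hC hp'.integrable ((hFm _ hx).sub (hμm _ hx)).norm (B := M + m)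
        fun s hs => by
          rw [abs_abs]
          exact (abs_sub _ _).trans (add_le_add (hFM x hx s hs) (hμM x hx s hs))
    have i3 := integrableOn_mul_pdf hC hp'.integrable (hςm _ hx) (B := 1) fun s hs => by
      rw [abs_of_nonneg (hς0 x hx s hs)]
      exact hς1 x hx s hs
    have i12 : IntegrableOn (fun s => F (x, s) * p' s + |F (x, s) - μ (x, s)| * p' s) C := i1.add i2
    unfold expect
    rw [← integral_const_mul, ← integral_add i1 i2, ← integral_add i12 (i3.const_mul b)]
    refine integral_mono (integrableOn_mul_pdf hC hp'.integrable (hum _ hx) (hub _ hx))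
      (i12.add (i3.const_mul b)) fun s => ?_
    simp only
    have h1 := neg_abs_le (F (x, s) - μ (x, s))
    have h2 : μ (x, s) + b * ς (x, s) ≤ F (x, s) + |F (x, s) - μ (x, s)| + b * ς (x, s) := by
      linarith
    have := mul_le_mul_of_nonneg_right h2 (hp'.nonneg s)
    linarith
  have h1 := (abs_le.1 s2).1
  have h2 := (abs_le.1 s6).2
  linarith

/-- Cut the cube into cells of side `r / n` and keep one point of `X` in each cell that meets `X`,
because vertices of the grid need not lie in `X`. The extra index `n` in each direction accounts for
the face where a coordinate equals `r`. -/
lemma exists_finset_net {d : ℕ} {X : Set (Fin d → ℝ)} {r : ℝ} (hr : 0 < r)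
    (hX : X ⊆ Set.Icc 0 (fun _ => r)) {n : ℕ} (hn : 1 ≤ n) :
    ∃ G : Finset (Fin d → ℝ), (∀ g ∈ G, g ∈ X) ∧ G.card ≤ (n + 1) ^ d ∧
      ∀ x ∈ X, ∃ g ∈ G, dist x g ≤ r / n := by
  classical
  have hn0 : (0 : ℝ) < n := by exact_mod_cast hn
  set cell : (Fin d → ℝ) → Fin d → Fin (n + 1) := fun x i =>
    ⟨min ⌊x i * n / r⌋₊ n, by omega⟩ with hcell
  have hsel : ∀ k : Fin d → Fin (n + 1), ∃ g, (∃ x ∈ X, cell x = k) → g ∈ X ∧ cell g = k := fun k => by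
    by_cases h : ∃ x ∈ X, cell x = k
    · obtain ⟨x, hx⟩ := h
      exact ⟨x, fun _ => hx⟩
    · exact ⟨0, fun h' => absurd h' h⟩
  choose sel hsel using hsel
  refine ⟨(Finset.univ.filter fun k => ∃ x ∈ X, cell x = k).image sel, fun g hg => ?_, ?_,
    fun x hx => ⟨sel (cell x), ?_, ?_⟩⟩
  · obtain ⟨k, hk, rfl⟩ := Finset.mem_image.1 hg
    exact (hsel k (Finset.mem_filter.1 hk).2).1
  · refine Finset.card_image_le.trans ((Finset.card_filter_le _ _).trans (le_of_eq ?_))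
    simp
  · exact Finset.mem_image_of_mem _ (Finset.mem_filter.2 ⟨Finset.mem_univ _, x, hx, rfl⟩)
  · obtain ⟨hgX, hg⟩ := hsel (cell x) ⟨x, hx, rfl⟩
    refine (dist_pi_le_iff (by positivity)).2 fun i => ?_
    have hfl : ∀ y ∈ X, min ⌊y i * n / r⌋₊ n = ⌊y i * n / r⌋₊ := fun y hy => by
      refine min_eq_left (Nat.floor_le_of_le ?_)
      rw [div_le_iff₀ hr, mul_comm]
      exact mul_le_mul_of_nonneg_left ((hX hy).2 i) hn0.le
    have h1 : ⌊x i * n / r⌋₊ = ⌊sel (cell x) i * n / r⌋₊ := by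
      have h2 := congrArg Fin.val (congrFun hg i)
      simp only [hcell] at h2
      rw [hfl x hx] at h2
      have h3 := hfl _ hgX
      simp only [hcell] at h3
      rw [h3] at h2
      exact h2.symm
    have a1 : 0 ≤ x i * n / r := div_nonneg (mul_nonneg ((hX hx).1 i) hn0.le) hr.le
    have a2 : 0 ≤ sel (cell x) i * n / r := div_nonneg (mul_nonneg ((hX hgX).1 i) hn0.le) hr.le
    have b1 := Nat.floor_le a1
    have b2 := Nat.lt_floor_add_one (x i * n / r)
    have b3 := Nat.floor_le a2
    have b4 := Nat.lt_floor_add_one (sel (cell x) i * n / r)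
    rw [h1] at b1 b2
    have c1 : |x i * n / r - sel (cell x) i * n / r| ≤ 1 := by
      rw [abs_le]
      constructor <;> linarith
    have c2 : x i * n / r - sel (cell x) i * n / r = (x i - sel (cell x) i) / (r / n) := by
      field_simp
    rw [c2, abs_div, abs_of_pos (by positivity : 0 < r / n), div_le_one (by positivity)] at c1
    rwa [Real.dist_eq]

end OneStep

end DRBO

/-! ### Integrable bounds of the paths. -/

namespace DRBO

section PathBounds

variable {Ω : Type*} [MeasurableSpace Ω] {P : Measure Ω} [IsProbabilityMeasure P] {Dx Dc : ℕ}
  {Z : Set (Pt Dx Dc)} {k : Pt Dx Dc → Pt Dx Dc → ℝ} {a b : ℝ} {f : Ω → Pt Dx Dc → ℝ}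

/-- A bound of the paths on a set of diameter at most `r`. -/
noncomputable def pathBound (d : ℕ → Z) (r : ℝ) (s : ℕ → ℝ) : ENNReal :=
  ENNReal.ofReal |s 0| + lipConst (fun n => (d n : Pt Dx Dc)) s * ENNReal.ofReal r

lemma measurable_pathBound (d : ℕ → Z) (r : ℝ) : Measurable (pathBound d r) := by
  have := measurable_lipConst (fun n => (d n : Pt Dx Dc))
  unfold pathBound
  fun_prop

lemma IsLipschitzGP.ofReal_abs_sub_le (hf : IsLipschitzGP P Z k a b f) {d : ℕ → Z}
    (hd : DenseRange d) (ω : Ω) {z w : Pt Dx Dc} (hz : z ∈ Z) (hw : w ∈ Z) {ρ : ℝ} (hρ : 0 < ρ)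
    (hzw : dist z w ≤ ρ) :
    ENNReal.ofReal |f ω z - f ω w| ≤
      lipConst (fun n => (d n : Pt Dx Dc)) (fun n => f ω (d n)) * ENNReal.ofReal ρ := by
  by_cases htop : lipConst (fun n => (d n : Pt Dx Dc)) (fun n => f ω (d n)) = ⊤
  · rw [htop, ENNReal.top_mul (by simpa using hρ)]
    exact le_top
  · have h1 := abs_sub_le_lipConst (hf.differentiableOn ω).continuousOn hd htop hz hw
    rw [← ENNReal.ofReal_toReal htop, ← ENNReal.ofReal_mul ENNReal.toReal_nonneg]
    exact ENNReal.ofReal_le_ofReal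
      (h1.trans (mul_le_mul_of_nonneg_left hzw ENNReal.toReal_nonneg))

lemma IsLipschitzGP.ofReal_abs_le_pathBound (hf : IsLipschitzGP P Z k a b f) {d : ℕ → Z}
    (hd : DenseRange d) {r : ℝ} (hr : 0 < r) (hZr : ∀ z ∈ Z, ∀ w ∈ Z, dist z w ≤ r) (ω : Ω)
    {z : Pt Dx Dc} (hz : z ∈ Z) :
    ENNReal.ofReal |f ω z| ≤ pathBound d r (fun n => f ω (d n)) := by
  have h1 := hf.ofReal_abs_sub_le hd ω hz (d 0).2 hr (hZr _ hz _ (d 0).2)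
  refine le_trans ?_ (add_le_add_right h1 _)
  rw [← ENNReal.ofReal_add (abs_nonneg _) (abs_nonneg _)]
  apply ENNReal.ofReal_le_ofReal
  have := abs_sub_abs_le_abs_sub (f ω z) (f ω (d 0))
  linarith

lemma lintegral_le_of_sq {g : Ω → ENNReal} (hg : Measurable g) {A : ENNReal} (hA : 1 ≤ A)
    (h : ∫⁻ ω, g ω ^ 2 ∂P ≤ A) : ∫⁻ ω, g ω ∂P ≤ A := by
  have h1 := lintegral_mul_sq_le P (measurable_const (a := (1 : ENNReal))) hg
  simp only [one_mul, one_pow, lintegral_const, measure_univ, mul_one] at h1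
  refine (ENNReal.pow_le_pow_left_iff two_ne_zero).1 (h1.trans (h.trans ?_))
  calc A = A * 1 := (mul_one A).symm
    _ ≤ A * A := by gcongr
    _ = A ^ 2 := (sq A).symm

lemma IsLipschitzGP.lintegral_lipConst_le (hf : IsLipschitzGP P Z k a b f) (hD : 0 < Dx + Dc)
    (ha : 0 < a) (hb : 0 < b) (hZ : Convex ℝ Z) (d : ℕ → Z) :
    ∫⁻ ω, lipConst (fun n => (d n : Pt Dx Dc)) (fun n => f ω (d n)) ∂P ≤
      ENNReal.ofReal (lipMoment Dx Dc a b) := by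
  refine lintegral_le_of_sq ((measurable_lipConst _).comp
    (measurable_pi_lambda _ fun n => hf.measurable _ (d n).2)) ?_
    (hf.lintegral_lipConst_sq_le hD ha hb hZ d)
  rw [← ENNReal.ofReal_one]
  exact ENNReal.ofReal_le_ofReal (lipMoment_ge_one Dx Dc ha)

lemma IsLipschitzGP.lintegral_pathBound_le (hf : IsLipschitzGP P Z k a b f) (hD : 0 < Dx + Dc)
    (ha : 0 < a) (hb : 0 < b) (hZ : Convex ℝ Z) (d : ℕ → Z) {r : ℝ} (hr : 0 < r) :
    ∫⁻ ω, pathBound d r (fun n => f ω (d n)) ∂P ≤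
      ENNReal.ofReal (1 + lipMoment Dx Dc a b * r) := by
  have hS : Measurable fun ω => fun n => f ω (d n) :=
    measurable_pi_lambda _ fun n => hf.measurable _ (d n).2
  have hm : Measurable fun ω => lipConst (fun n => (d n : Pt Dx Dc)) (fun n => f ω (d n)) :=
    (measurable_lipConst (fun n => (d n : Pt Dx Dc))).comp hS
  have hm0 := hf.measurable _ (d 0).2
  have hL : 0 ≤ lipMoment Dx Dc a b := zero_le_one.trans (lipMoment_ge_one Dx Dc ha)
  unfold pathBound
  rw [lintegral_add_left (by fun_prop), lintegral_mul_const _ hm,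
    ENNReal.ofReal_add zero_le_one (by positivity), ENNReal.ofReal_mul hL]
  gcongr
  · rw [ENNReal.ofReal_one]
    refine lintegral_le_of_sq (by fun_prop) le_rfl ?_
    have h1 : ∫ ω, f ω (d 0) ^ 2 ∂P ≤ 1 := by
      have h2 := hf.integral_mul (d 0).2 (d 0).2
      simp only [← sq] at h2
      rw [h2]
      exact hf.kernel_le_one _ (d 0).2 _ (d 0).2
    rw [← ENNReal.ofReal_one]
    refine le_trans (le_of_eq ?_) (ENNReal.ofReal_le_ofReal h1)
    rw [ofReal_integral_eq_lintegral_ofReal (hf.memLp_two (d 0).2).integrable_sq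
      (ae_of_all _ fun ω => sq_nonneg _)]
    refine lintegral_congr fun ω => ?_
    rw [← ENNReal.ofReal_pow (abs_nonneg _), sq_abs]
  · exact hf.lintegral_lipConst_le hD ha hb hZ d

/-- The square mean of an increment is at most the second moment of the Lipschitz constant times the
squared distance. With `sqrt_postCov_le` this gives a Lipschitz constant of posterior standard
deviations that depends on neither the kernel nor the data. -/
lemma IsLipschitzGP.sqrt_integral_sub_sq_le (hf : IsLipschitzGP P Z k a b f) (hD : 0 < Dx + Dc)
    (ha : 0 < a) (hb : 0 < b) (hZ : Convex ℝ Z) {d : ℕ → Z} (hd : DenseRange d) {z w : Pt Dx Dc}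
    (hz : z ∈ Z) (hw : w ∈ Z) :
    √(∫ ω, (f ω z - f ω w) ^ 2 ∂P) ≤ √(lipMoment Dx Dc a b) * dist z w := by
  have hL : 0 ≤ lipMoment Dx Dc a b := zero_le_one.trans (lipMoment_ge_one Dx Dc ha)
  rcases eq_or_ne z w with rfl | hne
  · simp
  have hρ : 0 < dist z w := dist_pos.2 hne
  rw [← Real.sqrt_sq hρ.le, ← Real.sqrt_mul hL]
  apply Real.sqrt_le_sqrt
  have hi : Integrable (fun ω => (f ω z - f ω w) ^ 2) P :=
    ((hf.memLp_two hz).sub (hf.memLp_two hw)).integrable_sq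
  rw [← ENNReal.ofReal_le_ofReal_iff (by positivity), ofReal_integral_eq_lintegral_ofReal hi
      (ae_of_all _ fun ω => sq_nonneg _), ENNReal.ofReal_mul hL, ENNReal.ofReal_pow hρ.le]
  have hS : Measurable fun ω => fun n => f ω (d n) :=
    measurable_pi_lambda _ fun n => hf.measurable _ (d n).2
  have hm : Measurable fun ω => lipConst (fun n => (d n : Pt Dx Dc)) (fun n => f ω (d n)) :=
    (measurable_lipConst (fun n => (d n : Pt Dx Dc))).comp hS
  calc ∫⁻ ω, ENNReal.ofReal ((f ω z - f ω w) ^ 2) ∂P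
      ≤ ∫⁻ ω, lipConst (fun n => (d n : Pt Dx Dc)) (fun n => f ω (d n)) ^ 2 *
          ENNReal.ofReal (dist z w) ^ 2 ∂P := by
        refine lintegral_mono fun ω => ?_
        rw [← sq_abs, ENNReal.ofReal_pow (abs_nonneg _), ← mul_pow]
        gcongr
        exact hf.ofReal_abs_sub_le hd ω hz hw hρ le_rfl
    _ = (∫⁻ ω, lipConst (fun n => (d n : Pt Dx Dc)) (fun n => f ω (d n)) ^ 2 ∂P) *
          ENNReal.ofReal (dist z w) ^ 2 := lintegral_mul_const _ (hm.pow_const 2)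
    _ ≤ _ := by
        gcongr
        exact hf.lintegral_lipConst_sq_le hD ha hb hZ d

lemma dist_le_of_subset_Icc {X : Set (Fin Dx → ℝ)} {C : Set (Fin Dc → ℝ)} {r : ℝ} (hr : 0 < r)
    (hXr : X ⊆ Set.Icc 0 (fun _ => r)) (hCr : C ⊆ Set.Icc 0 (fun _ => r)) :
    ∀ z ∈ X ×ˢ C, ∀ w ∈ X ×ˢ C, dist z w ≤ r := by
  rintro ⟨z1, z2⟩ ⟨hz1, hz2⟩ ⟨w1, w2⟩ ⟨hw1, hw2⟩
  rw [Prod.dist_eq]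
  refine max_le ((dist_pi_le_iff hr.le).2 fun i => ?_) ((dist_pi_le_iff hr.le).2 fun i => ?_)
  · have h1 := (hXr hz1).1 i
    have h2 := (hXr hz1).2 i
    have h3 := (hXr hw1).1 i
    have h4 := (hXr hw1).2 i
    simp only [Pi.zero_apply] at h1 h2 h3 h4
    rw [Real.dist_eq, abs_le]
    constructor <;> simp only <;> linarith
  · have h1 := (hCr hz2).1 i
    have h2 := (hCr hz2).2 i
    have h3 := (hCr hw2).1 i
    have h4 := (hCr hw2).2 i
    simp only [Pi.zero_apply] at h1 h2 h3 h4
    rw [Real.dist_eq, abs_le]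
    constructor <;> simp only <;> linarith

end PathBounds

/-! ### A run as a policy acting on histories. -/

section Runs

variable {Ω : Type*} [MeasurableSpace Ω] {P : Measure Ω} [IsProbabilityMeasure P] {Dx Dc : ℕ}
  {X : Set (Fin Dx → ℝ)} {C : Set (Fin Dc → ℝ)} {a b r σ : ℝ} {p K : (Fin Dc → ℝ) → ℝ}
  {h : ℕ → Fin Dc → ℝ} {δ : ℕ → ℝ} {k : Pt Dx Dc → Pt Dx Dc → ℝ} {f : Ω → Pt Dx Dc → ℝ}
  {c : ℕ → Ω → Fin Dc → ℝ} {ε : ℕ → Ω → ℝ} {x : ℕ → Ω → Fin Dx → ℝ} {xs : Ω → Fin Dx → ℝ}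

/-- Adaptedness alone gives each decision as a measurable function of the observed history; the
shape of the acquisition function plays no role here. The true values are read off the encoded path.
-/
lemma IsRun.exists_followsPolicy (hrun : IsRun P X C a b r σ p K h δ k f c ε x xs)
    (hX : IsCompact X) (hC : IsCompact C) :
    ∃ z₀ ∈ X ×ˢ C, ∃ d : ℕ → ↥(X ×ˢ C), DenseRange d ∧ ∃ π : ℕ → Hist Dx Dc → Fin Dx → ℝ,
      (∀ t q, π t q ∈ X) ∧ FollowsPolicy (X ×ˢ C) z₀ f c ε x (fun ω n => f ω (d n))
        (pathEval fun n => (d n : Pt Dx Dc)) π := by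
  obtain ⟨ω₀⟩ : Nonempty Ω := nonempty_of_isProbabilityMeasure P
  have hz₀ : (xs ω₀, c 0 ω₀) ∈ X ×ˢ C := ⟨hrun.opt_mem ω₀, hrun.context_mem 0 ω₀⟩
  have hne : Nonempty ↥(X ×ˢ C) := ⟨⟨_, hz₀⟩⟩
  have hdense := TopologicalSpace.denseRange_denseSeq ↥(X ×ˢ C)
  set d := TopologicalSpace.denseSeq ↥(X ×ˢ C) with hd
  have hmeas : MeasurableSet (X ×ˢ C) := hX.measurableSet.prod hC.measurableSet
  have hcl : ∀ z ∈ X ×ˢ C, z ∈ closure (Set.range fun n => (d n : Pt Dx Dc)) := fun z hz => by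
    have h1 : (⟨z, hz⟩ : ↥(X ×ˢ C)) ∈ closure (Set.range d) := hdense _
    have h2 := image_closure_subset_closure_image continuous_subtype_val
      (Set.mem_image_of_mem (Subtype.val : ↥(X ×ˢ C) → Pt Dx Dc) h1)
    rwa [← Set.range_comp] at h2
  have heval : ∀ ω, ∀ z ∈ X ×ˢ C,
      pathEval (fun n => (d n : Pt Dx Dc)) (fun n => f ω (d n)) z = f ω z := fun ω z hz =>
    pathEval_eq (hrun.gp.differentiableOn ω).continuousOn (fun n => (d n).2) hz (hcl z hz)
  have hpol : ∀ t, ∃ π : Hist Dx Dc → Fin Dx → ℝ, Measurable π ∧ (∀ q, π q ∈ X) ∧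
      (1 ≤ t → ∀ ω, x t ω = π (record f c ε x t ω)) := by
    intro t
    rcases Nat.eq_zero_or_pos t with rfl | ht
    · exact ⟨fun _ => xs ω₀, measurable_const, fun _ => hrun.opt_mem ω₀, fun h => absurd h (by simp)⟩
    -- Factorization of a function measurable with respect to a generated σ-algebra.
    · obtain ⟨g, hg, hxg⟩ := (StronglyMeasurable.exists_eq_measurable_comp
        (Measurable.stronglyMeasurable (hrun.decision_adapted t ht)))
      set H : Hist Dx Dc → (Fin t → Fin Dc → ℝ) × (Fin (t - 1) → (Fin Dx → ℝ) × ℝ) := fun q =>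
        (fun i => (q i).2.1, fun i => ((q (i + 1)).1, (q (i + 1)).2.2)) with hH
      have mH : Measurable H := by
        rw [hH]
        fun_prop
      -- The factor is only known on histories that occur; clipping forces values in `X` on all of
      -- them, as needed for integrals over the reference law.
      refine ⟨fun q => clip X (xs ω₀) (g (H q)),
        (measurable_clip hX.measurableSet _).comp (hg.measurable.comp mH),
        fun q => clip_mem (hrun.opt_mem ω₀) _, fun _ ω => ?_⟩
      have h1 : H (record f c ε x t ω) = history f c ε x t ω := by
        refine Prod.ext ?_ ?_
        · ext1 i
          simp only [hH, record, history, i.2, if_true]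
          split_ifs with h0
          · rw [h0]
          · rfl
        · ext1 i
          have h2 : (i : ℕ) + 1 < t := by have := i.2; omega
          simp [hH, record, history, h2]
      have h2 : x t ω = g (history f c ε x t ω) := congrFun hxg ω
      show x t ω = clip X (xs ω₀) (g (H (record f c ε x t ω)))
      rw [h1, ← h2, clip_eq _ (hrun.decision_mem t ht ω)]
  choose π hπm hπX hπ using hpol
  refine ⟨_, hz₀, d, hdense, π, hπX, ⟨hmeas, ?_, measurable_pathEval _, hπm, fun t ht ω => ?_,
    fun t ht ω => hπ t ht ω⟩⟩
  · exact measurable_pi_lambda _ fun n => hrun.gp.measurable _ (d n).2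
  · have hm : (x t ω, c t ω) ∈ X ×ˢ C := ⟨hrun.decision_mem t ht ω, hrun.context_mem t ω⟩
    rw [clip_eq _ hm, heval ω _ hm]
    rfl

lemma IsRun.indepFun_path (hrun : IsRun P X C a b r σ p K h δ k f c ε x xs)
    (d : ℕ → ↥(X ×ˢ C)) :
    IndepFun (fun ω n => f ω (d n)) (fun ω => ((fun t => c t ω, fun t => ε t ω) :
      (ℕ → Fin Dc → ℝ) × (ℕ → ℝ))) P :=
  hrun.gp_indep.comp (φ := fun (q : ↥(X ×ˢ C) → ℝ) n => q (d n))
    (measurable_pi_lambda _ fun _ => measurable_pi_apply _) measurable_id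

lemma IsRun.exists_isPosterior (hrun : IsRun P X C a b r σ p K h δ k f c ε x xs) (hσ : 0 < σ)
    {z₀ : Pt Dx Dc} (hz₀ : z₀ ∈ X ×ˢ C) {d : ℕ → ↥(X ×ˢ C)} (hd : DenseRange d)
    {π : ℕ → Hist Dx Dc → Fin Dx → ℝ}
    (hpol : FollowsPolicy (X ×ˢ C) z₀ f c ε x (fun ω n => f ω (d n))
        (pathEval fun n => (d n : Pt Dx Dc)) π) (n : ℕ) :
    ∃ N, IsPosterior P (X ×ˢ C) z₀ k a b σ f (fun ω n => f ω (d n))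
      (pathEval fun n => (d n : Pt Dx Dc)) n (record f c ε x (n + 1)) N := by
  obtain ⟨N, hN, hlaw⟩ := hpol.exists_disintegration hrun.context_measurable hrun.noise_measurable
    hrun.context_indep hrun.noise_indep hrun.context_noise_indep (hrun.indepFun_path d) hσ
    hrun.noise_law n
  refine ⟨N, hrun.gp, hσ, hpol.measurableSet, hz₀, hpol.measurable_path, hpol.measurable_eval,
    fun ω z hz => ?_, hpol.measurable_record hrun.context_measurable hrun.noise_measurable _, hN,
    hlaw⟩
  refine pathEval_eq (hrun.gp.differentiableOn ω).continuousOn (fun n => (d n).2) hz ?_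
  have h1 : (⟨z, hz⟩ : ↥(X ×ˢ C)) ∈ closure (Set.range d) := hd _
  have h2 := image_closure_subset_closure_image continuous_subtype_val
    (Set.mem_image_of_mem (Subtype.val : ↥(X ×ˢ C) → Pt Dx Dc) h1)
  rwa [← Set.range_comp] at h2

lemma IsRun.histSites_record (hrun : IsRun P X C a b r σ p K h δ k f c ε x xs) (z₀ : Pt Dx Dc)
    (n : ℕ) (ω : Ω) : histSites (X ×ˢ C) z₀ n (record f c ε x (n + 1) ω) =
      fun i : Fin n => ((x (i + 1) ω, c (i + 1) ω) : Pt Dx Dc) := by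
  ext1 i
  have hi : (i : ℕ) + 1 < n + 1 := by have := i.2; omega
  have hm : (x (i + 1) ω, c (i + 1) ω) ∈ X ×ˢ C :=
    ⟨hrun.decision_mem _ (by omega) ω, hrun.context_mem _ ω⟩
  simp [histSites, site, record, clip_eq _ hm]

lemma histObs_record (n : ℕ) (ω : Ω) : histObs n (record f c ε x (n + 1) ω) =
      fun i : Fin n => obs f c ε x (i + 1) ω := by
  ext1 i
  simp [histObs, record]

lemma kde_record (K : (Fin Dc → ℝ) → ℝ) (h : Fin Dc → ℝ) (t : ℕ) (ω : Ω) (u : Fin Dc → ℝ) :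
    kde K h t (fun i => (record f c ε x t ω i).2.1) u = kde K h t (fun i => c i ω) u := by
  unfold kde
  refine Finset.sum_congr rfl fun i hi => ?_
  have hi' := Finset.mem_range.1 hi
  have h1 : (record f c ε x t ω i).2.1 = c i ω := by
    simp only [record, hi', if_true]
    split_ifs with h0
    · rw [h0]
    · rfl
  simp only [h1]

lemma IsRun.ucbAt_eq (hrun : IsRun P X C a b r σ p K h δ k f c ε x xs) {z₀ : Pt Dx Dc}
    {S : Ω → ℕ → ℝ} {e : (ℕ → ℝ) → Pt Dx Dc → ℝ} {n : ℕ} {N : Measure (Hist Dx Dc)}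
    (hp : IsPosterior P (X ×ˢ C) z₀ k a b σ f S e n (record f c ε x (n + 1)) N) (β : ℝ) (ω : Ω)
    {w : Pt Dx Dc} (hw : w ∈ X ×ˢ C) :
    ucbAt k σ β f c ε x (n + 1) ω w =
      IsPosterior.mean P (X ×ˢ C) z₀ σ S e n (record f c ε x (n + 1) ω) w +
      √β * √(IsPosterior.var P (X ×ˢ C) z₀ σ S e n (record f c ε x (n + 1) ω) w) := by
  rw [hp.mean_eq _ hw, hp.var_eq _ hw, hrun.histSites_record, histObs_record]
  rfl

end Runs

end DRBO

/-! ### Expected regret of one iteration. -/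

namespace DRBO

section OneStepExpectation

variable {Dx Dc : ℕ} {X : Set (Fin Dx → ℝ)} {C : Set (Fin Dc → ℝ)}

lemma ofReal_integral_le_lintegral {α : Type*} [MeasurableSpace α] {μ : Measure α} {g : α → ℝ}
    (hg : ∀ x, 0 ≤ g x) : ENNReal.ofReal (∫ x, g x ∂μ) ≤ ∫⁻ x, ENNReal.ofReal (g x) ∂μ := by
  by_cases hi : Integrable g μ
  · rw [ofReal_integral_eq_lintegral_ofReal hi (ae_of_all _ hg)]
  · rw [integral_undef hi, ENNReal.ofReal_zero]
    exact zero_le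

lemma ofReal_max_zero (u : ℝ) : ENNReal.ofReal (max u 0) = ENNReal.ofReal u := by
  rcases le_total u 0 with h | h
  · rw [max_eq_right h, ENNReal.ofReal_zero, ENNReal.ofReal_of_nonpos h]
  · rw [max_eq_left h]

/-- The regret of one maximization of the robust acquisition function, for a fixed path `F` with
possibly infinite bounds. -/
theorem ofReal_expect_sub_expect_le (hC : MeasurableSet C) {p p' : (Fin Dc → ℝ) → ℝ}
    (hp : IsPDF p) (hp' : IsPDF p') {δ : ℝ} (hδ : 0 < δ) {u F μ ς : Pt Dx Dc → ℝ}
    {xs x : Fin Dx → ℝ} (hxs : xs ∈ X) (hx : x ∈ X) {G : Finset (Fin Dx → ℝ)}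
    (hG : ∀ g ∈ G, g ∈ X) (hmax : IsMaxOn (robustAcq C u p' δ) X x) {b ρ : ℝ} {M m Λ : ENNReal}
    (hb : 0 ≤ b) (hu : ∀ v ∈ X, ∀ s ∈ C, u (v, s) = μ (v, s) + b * ς (v, s))
    (hFm : Measurable F) (hμm : Measurable μ) (hςm : Measurable ς)
    (hFM : ∀ v ∈ X, ∀ s ∈ C, ENNReal.ofReal |F (v, s)| ≤ M)
    (hμM : ∀ v ∈ X, ∀ s ∈ C, ENNReal.ofReal |μ (v, s)| ≤ m)
    (hς0 : ∀ v ∈ X, ∀ s ∈ C, 0 ≤ ς (v, s)) (hς1 : ∀ v ∈ X, ∀ s ∈ C, ς (v, s) ≤ 1)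
    (hρ0 : 0 < ρ)
    (hρ : ∃ g ∈ G, ∀ s ∈ C, ENNReal.ofReal |F (xs, s) - F (g, s)| ≤ Λ * ENNReal.ofReal ρ) :
    ENNReal.ofReal (expect C p (fun s => F (xs, s)) - expect C p (fun s => F (x, s))) ≤
      Λ * ENNReal.ofReal ρ + 2 * M * (∫⁻ s in C, ENNReal.ofReal |p' s - p s|) +
      ENNReal.ofReal δ * (2 * M + m) +
      (∑ g ∈ G, ∫⁻ s in C, ENNReal.ofReal (p' s) *
        ENNReal.ofReal (F (g, s) - (μ (g, s) + b * ς (g, s)))) +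
      (∫⁻ s in C, ENNReal.ofReal (p' s) * ENNReal.ofReal |F (x, s) - μ (x, s)|) +
      ENNReal.ofReal b * ∫⁻ s in C, ENNReal.ofReal (p' s) * ENNReal.ofReal (ς (x, s)) := by
  have hδ' : ENNReal.ofReal δ ≠ 0 := by simpa using hδ
  have hρ' : ENNReal.ofReal ρ ≠ 0 := by simpa using hρ0
  -- An infinite random bound makes the right side infinite, because `ρ` and `δ` are strictly
  -- positive. Otherwise the real estimate applies.
  by_cases hΛ : Λ = ⊤
  · simp [hΛ, ENNReal.top_mul hρ']
  by_cases hM : M = ⊤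
  · simp [hM, ENNReal.mul_top hδ']
  by_cases hm : m = ⊤
  · simp [hm, ENNReal.mul_top hδ']
  obtain ⟨g, hgG, hg⟩ := hρ
  have key := expect_sub_expect_le hC hp hp' hδ.le (u := u) (F := F) (μ := μ) (ς := ς) hxs hx
    (hG g hgG) hmax (M := M.toReal) (m := m.toReal) (ρ := Λ.toReal * ρ) hb ENNReal.toReal_nonneg
    ENNReal.toReal_nonneg hu
    (fun v _ => (hFm.comp measurable_prodMk_left).aestronglyMeasurable)
    (fun v _ => (hμm.comp measurable_prodMk_left).aestronglyMeasurable)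
    (fun v _ => (hςm.comp measurable_prodMk_left).aestronglyMeasurable)
    (fun v hv s hs => (ENNReal.ofReal_le_iff_le_toReal hM).1 (hFM v hv s hs))
    (fun v hv s hs => (ENNReal.ofReal_le_iff_le_toReal hm).1 (hμM v hv s hs)) hς0 hς1
    (mul_nonneg ENNReal.toReal_nonneg hρ0.le) (fun s hs => by
      have h1 := hg s hs
      rwa [← ENNReal.ofReal_toReal hΛ, ← ENNReal.ofReal_mul ENNReal.toReal_nonneg,
        ENNReal.ofReal_le_ofReal_iff (mul_nonneg ENNReal.toReal_nonneg hρ0.le)] at h1)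
  refine (ENNReal.ofReal_le_ofReal key).trans ?_
  refine ENNReal.ofReal_add_le.trans (add_le_add ?_ ?_)
  · refine ENNReal.ofReal_add_le.trans (add_le_add ?_ ?_)
    · refine ENNReal.ofReal_add_le.trans (add_le_add ?_ ?_)
      · refine ENNReal.ofReal_add_le.trans (add_le_add ?_ ?_)
        · refine ENNReal.ofReal_add_le.trans (add_le_add ?_ ?_)
          · rw [ENNReal.ofReal_mul ENNReal.toReal_nonneg, ENNReal.ofReal_toReal hΛ]
          · rw [ENNReal.ofReal_mul (mul_nonneg zero_le_two ENNReal.toReal_nonneg),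
              ENNReal.ofReal_mul zero_le_two, ENNReal.ofReal_toReal hM, ENNReal.ofReal_ofNat]
            gcongr
            exact ofReal_integral_le_lintegral fun s => abs_nonneg _
        · rw [ENNReal.ofReal_mul hδ.le, ENNReal.ofReal_add (mul_nonneg zero_le_two
            ENNReal.toReal_nonneg) ENNReal.toReal_nonneg, ENNReal.ofReal_mul zero_le_two,
            ENNReal.ofReal_toReal hM, ENNReal.ofReal_toReal hm, ENNReal.ofReal_ofNat]
      -- The net point near the optimum depends on the path, while the posterior bound requires a
      -- point that does not look beyond the history; so all net points are summed.
      · refine le_trans ?_ (Finset.single_le_sum (f := fun g => ∫⁻ s in C, ENNReal.ofReal (p' s) *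
          ENNReal.ofReal (F (g, s) - (μ (g, s) + b * ς (g, s)))) (fun _ _ => zero_le) hgG)
        refine (ofReal_integral_le_lintegral fun s =>
          mul_nonneg (le_max_right _ _) (hp'.nonneg s)).trans (lintegral_mono fun s => ?_)
        rw [mul_comm, ENNReal.ofReal_mul (hp'.nonneg s)]
        rw [ofReal_max_zero]
    · refine (ofReal_integral_le_lintegral fun s =>
        mul_nonneg (abs_nonneg _) (hp'.nonneg s)).trans (lintegral_mono fun s => ?_)
      rw [mul_comm, ENNReal.ofReal_mul (hp'.nonneg s)]
  · rw [ENNReal.ofReal_mul hb]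
    gcongr
    have h1 : ∫ s in C, ς (x, s) * p' s = ∫ s in C, max (ς (x, s)) 0 * p' s :=
      setIntegral_congr_fun hC fun s hs => by simp only [max_eq_left (hς0 x hx s hs)]
    rw [h1]
    refine (ofReal_integral_le_lintegral fun s =>
        mul_nonneg (le_max_right _ _) (hp'.nonneg s)).trans (lintegral_mono fun s => ?_)
    rw [mul_comm, ENNReal.ofReal_mul (hp'.nonneg s), ofReal_max_zero]

end OneStepExpectation

section Runs

variable {Ω : Type*} [MeasurableSpace Ω] {P : Measure Ω} [IsProbabilityMeasure P] {Dx Dc : ℕ}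
  {X : Set (Fin Dx → ℝ)} {C : Set (Fin Dc → ℝ)} {a b r σ : ℝ} {p K : (Fin Dc → ℝ) → ℝ}
  {h : ℕ → Fin Dc → ℝ} {δ : ℕ → ℝ} {k : Pt Dx Dc → Pt Dx Dc → ℝ} {f : Ω → Pt Dx Dc → ℝ}
  {c : ℕ → Ω → Fin Dc → ℝ} {ε : ℕ → Ω → ℝ} {x : ℕ → Ω → Fin Dx → ℝ} {xs : Ω → Fin Dx → ℝ}

/-- The posterior variance at iteration `t`, at the chosen decision and the realized context. -/
noncomputable def stepVar (k : Pt Dx Dc → Pt Dx Dc → ℝ) (σ : ℝ) (c : ℕ → Ω → Fin Dc → ℝ)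
    (x : ℕ → Ω → Fin Dx → ℝ) (n : ℕ) (ω : Ω) : ℝ :=
  postCov k σ (fun i : Fin n => ((x (i + 1) ω, c (i + 1) ω) : Pt Dx Dc))
    (x (n + 1) ω, c (n + 1) ω) (x (n + 1) ω, c (n + 1) ω)

lemma IsRun.stepVar_eq (hrun : IsRun P X C a b r σ p K h δ k f c ε x xs) {z₀ : Pt Dx Dc}
    {S : Ω → ℕ → ℝ} {e : (ℕ → ℝ) → Pt Dx Dc → ℝ} {n : ℕ} {N : Measure (Hist Dx Dc)}
    (hp : IsPosterior P (X ×ˢ C) z₀ k a b σ f S e n (record f c ε x (n + 1)) N) (ω : Ω) :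
    stepVar k σ c x n ω = IsPosterior.var P (X ×ˢ C) z₀ σ S e n (record f c ε x (n + 1) ω)
      (x (n + 1) ω, c (n + 1) ω) := by
  rw [hp.var_eq _ ⟨hrun.decision_mem _ n.succ_pos ω, hrun.context_mem _ ω⟩, hrun.histSites_record]
  rfl

set_option maxHeartbeats 2000000 in
/-- The expected regret of one iteration. -/
theorem IsRun.lintegral_regret_le (hrun : IsRun P X C a b r σ p K h δ k f c ε x xs)
    (hD : 0 < Dx + Dc) (ha : 0 < a) (hb : 0 < b) (hr : 0 < r) (hσ : 0 < σ)
    (hX : Convex ℝ X) (hXc : IsCompact X) (hXr : X ⊆ Set.Icc 0 (fun _ => r))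
    (hC : Convex ℝ C) (hCc : IsCompact C) (hCr : C ⊆ Set.Icc 0 (fun _ => r))
    (hp : IsPDF p) (hK : IsPDF K) (hh : IsBandwidth h) {n : ℕ} (hδ : 0 < δ (n + 1))
    (hβ : 1 ≤ ucbBeta Dx a b r (n + 1)) {q₁ q₂ ρ : ℝ} (hq₁ : 0 ≤ q₁) (hρ : 0 < ρ)
    (htv : ∫⁻ ω, (∫⁻ u in C, ENNReal.ofReal
      |kde K (h (n + 1)) (n + 1) (fun i => c i ω) u - p u|) ∂P ≤ ENNReal.ofReal q₁)
    (hkey : ∀ s : Ω → (Fin Dc → ℝ) → ℝ, Measurable (fun q : Ω × (Fin Dc → ℝ) => s q.1 q.2) →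
          (∀ ω, ∀ u ∈ C, 0 ≤ s ω u) → (∀ ω, ∀ u ∈ C, s ω u ≤ 1) →
          (∀ ω, ∀ u ∈ C, ∀ v ∈ C, s ω u ≤ s ω v + √(lipMoment Dx Dc a b) * ‖u - v‖) →
          ∫⁻ ω, (∫⁻ u in C, ENNReal.ofReal (kde K (h (n + 1)) (n + 1) (fun i => c i ω) u) *
              ENNReal.ofReal (s ω u)) ∂P ≤
            3 * (∫⁻ ω, (∫⁻ u in C, ENNReal.ofReal (p u) * ENNReal.ofReal (s ω u)) ∂P) +
            ENNReal.ofReal q₂)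
    {G : Finset (Fin Dx → ℝ)} (hG : ∀ g ∈ G, g ∈ X) (hnet : ∀ v ∈ X, ∃ g ∈ G, dist v g ≤ ρ) :
    ∫⁻ ω, ENNReal.ofReal (expect C p (fun s => f ω (xs ω, s)) -
        expect C p (fun s => f ω (x (n + 1) ω, s))) ∂P ≤
      ENNReal.ofReal (lipMoment Dx Dc a b * ρ + 2 * (1 + lipMoment Dx Dc a b * r) * q₁ +
        δ (n + 1) * (3 * (1 + lipMoment Dx Dc a b * r)) +
        G.card * Real.exp (-(ucbBeta Dx a b r (n + 1)) / 2)) +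
      ENNReal.ofReal (1 + √(ucbBeta Dx a b r (n + 1))) *
        (3 * (∫⁻ ω, ENNReal.ofReal (√(stepVar k σ c x n ω)) ∂P) + ENNReal.ofReal q₂) := by
  have hCm := hCc.measurableSet
  have hZ : Convex ℝ (X ×ˢ C) := hX.prod hC
  have hL : 0 ≤ lipMoment Dx Dc a b := zero_le_one.trans (lipMoment_ge_one Dx Dc ha)
  obtain ⟨z₀, hz₀, d, hd, π, hπX, hpol⟩ := hrun.exists_followsPolicy hXc hCc
  obtain ⟨N, hpost⟩ := hrun.exists_isPosterior hσ hz₀ hd hpol n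
  have hgp := hrun.gp
  set β := ucbBeta Dx a b r (n + 1) with hβdef
  set R := record f c ε x (n + 1) with hR
  set S : Ω → ℕ → ℝ := fun ω n => f ω (d n) with hS
  set e := pathEval (fun n => (d n : Pt Dx Dc)) with he
  set μ : Hist Dx Dc → Pt Dx Dc → ℝ := IsPosterior.mean P (X ×ˢ C) z₀ σ S e n with hμ
  set v : Hist Dx Dc → Pt Dx Dc → ℝ := IsPosterior.var P (X ×ˢ C) z₀ σ S e n with hv
  have mS : Measurable S := hpol.measurable_path
  have mR : Measurable R := hpost.measurable_hist
  have mμ : Measurable fun q : Hist Dx Dc × Pt Dx Dc => μ q.1 q.2 := hpost.measurable_mean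
  have mv : Measurable fun q : Hist Dx Dc × Pt Dx Dc => v q.1 q.2 := hpost.measurable_var
  have me := hpost.measurable_eval_path
  have mπ := hpol.measurable_policy (n + 1)
  have hxπ : ∀ ω, x (n + 1) ω = π (n + 1) (R ω) := hpol.decision_eq (n + 1) n.succ_pos
  have mx : Measurable (x (n + 1)) := by
    rw [funext hxπ]
    exact mπ.comp mR
  have mc := hrun.context_measurable
  set κ : Hist Dx Dc → (Fin Dc → ℝ) → ℝ := fun q => kde K (h (n + 1)) (n + 1) fun i => (q i).2.1
    with hκ
  have mκ : Measurable fun q : Hist Dx Dc × (Fin Dc → ℝ) => κ q.1 q.2 :=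
    (measurable_kde hK.measurable (h (n + 1)) (n + 1)).comp
      (f := fun q : Hist Dx Dc × (Fin Dc → ℝ) => ((fun i => (q.1 i).2.1), q.2)) (by fun_prop)
  have hκR : ∀ ω, κ (R ω) = kde K (h (n + 1)) (n + 1) fun i => c i ω := fun ω => by
    ext1 u
    exact kde_record K _ _ ω u
  have hκpdf : ∀ q, IsPDF (κ q) := fun q => isPDF_kde hK (hh.pos _ n.succ_pos) n.succ_pos _
  have mef : ∀ ω, Measurable (e (S ω)) := fun ω =>
    me.comp (f := fun z : Pt Dx Dc => (ω, z)) measurable_prodMk_left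
  have mμf : ∀ ω, Measurable (μ (R ω)) := fun ω =>
    mμ.comp (f := fun z : Pt Dx Dc => (R ω, z)) measurable_prodMk_left
  have mvf : ∀ ω, Measurable (v (R ω)) := fun ω =>
    mv.comp (f := fun z : Pt Dx Dc => (R ω, z)) measurable_prodMk_left
  clear_value e
  -- random bounds
  set Λ : (ℕ → ℝ) → ENNReal := lipConst (fun n => (d n : Pt Dx Dc)) with hΛ
  set M : (ℕ → ℝ) → ENNReal := pathBound d r with hM
  have mM : Measurable M := measurable_pathBound d r
  have mΛ : Measurable Λ := measurable_lipConst _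
  have hdiam := dist_le_of_subset_Icc hr hXr hCr
  have hfM : ∀ ω, ∀ z ∈ X ×ˢ C, ENNReal.ofReal |f ω z| ≤ M (S ω) := fun ω z hz =>
    hgp.ofReal_abs_le_pathBound hd hr hdiam ω hz
  obtain ⟨m, mm, hμm, hmM⟩ := hpost.exists_bound_mean mM hfM
  have hEM : ∫⁻ ω, M (S ω) ∂P ≤ ENNReal.ofReal (1 + lipMoment Dx Dc a b * r) :=
    hgp.lintegral_pathBound_le hD ha hb hZ d hr
  have hEΛ : ∫⁻ ω, Λ (S ω) ∂P ≤ ENNReal.ofReal (lipMoment Dx Dc a b) :=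
    hgp.lintegral_lipConst_le hD ha hb hZ d
  -- the pathwise bound
  have hpath : ∀ ω, ENNReal.ofReal (expect C p (fun s => f ω (xs ω, s)) -
        expect C p (fun s => f ω (x (n + 1) ω, s))) ≤
      Λ (S ω) * ENNReal.ofReal ρ + 2 * M (S ω) * (∫⁻ s in C, ENNReal.ofReal |κ (R ω) s - p s|) +
      ENNReal.ofReal (δ (n + 1)) * (2 * M (S ω) + m (R ω)) +
      (∑ g ∈ G, ∫⁻ s in C, ENNReal.ofReal (κ (R ω) s) *
        ENNReal.ofReal (e (S ω) (g, s) - (μ (R ω) (g, s) + √β * √(v (R ω) (g, s))))) +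
      (∫⁻ s in C, ENNReal.ofReal (κ (R ω) s) *
        ENNReal.ofReal |e (S ω) (x (n + 1) ω, s) - μ (R ω) (x (n + 1) ω, s)|) +
      ENNReal.ofReal (√β) * ∫⁻ s in C, ENNReal.ofReal (κ (R ω) s) *
        ENNReal.ofReal (√(v (R ω) (x (n + 1) ω, s))) := by
    intro ω
    have hxX := hrun.decision_mem (n + 1) n.succ_pos ω
    have h1 : ∀ w ∈ X, expect C p (fun s => f ω (w, s)) = expect C p (fun s => e (S ω) (w, s)) :=
      fun w hw => setIntegral_congr_fun hCm fun s hs => by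
        simp only [hpost.eval_eq ω (w, s) ⟨hw, hs⟩]
    rw [h1 _ (hrun.opt_mem ω), h1 _ hxX]
    have hmax := hrun.decision_max (n + 1) n.succ_pos ω
    rw [← hκR ω] at hmax
    refine ofReal_expect_sub_expect_le hCm hp (hκpdf (R ω)) hδ
      (u := ucbAt k σ β f c ε x (n + 1) ω) (F := e (S ω)) (μ := μ (R ω))
      (ς := fun z => √(v (R ω) z)) (hrun.opt_mem ω) hxX hG hmax (Real.sqrt_nonneg _)
      (fun w hw s hs => hrun.ucbAt_eq hpost β ω ⟨hw, hs⟩)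
      (mef ω) (mμf ω) (mvf ω).sqrt (fun w hw s hs => ?_)
      (fun w hw s hs => hμm _ _ ⟨hw, hs⟩) (fun w hw s hs => Real.sqrt_nonneg _)
      (fun w hw s hs => ?_) hρ ?_
    · rw [hpost.eval_eq ω (w, s) ⟨hw, hs⟩]
      exact hfM ω _ ⟨hw, hs⟩
    · exact Real.sqrt_le_one.2 (hpost.var_le_one (R ω) ⟨hw, hs⟩)
    · obtain ⟨g, hgG, hg⟩ := hnet _ (hrun.opt_mem ω)
      refine ⟨g, hgG, fun s hs => ?_⟩
      rw [hpost.eval_eq ω (xs ω, s) ⟨hrun.opt_mem ω, hs⟩, hpost.eval_eq ω (g, s) ⟨hG g hgG, hs⟩]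
      refine hgp.ofReal_abs_sub_le hd ω ⟨hrun.opt_mem ω, hs⟩ ⟨hG g hgG, hs⟩ hρ ?_
      rw [Prod.dist_eq]
      exact max_le hg (by simpa using hρ.le)
  -- measurability
  have mκΩ : Measurable fun q : Ω × (Fin Dc → ℝ) => ENNReal.ofReal (κ (R q.1) q.2) :=
    (mκ.comp (f := fun q : Ω × (Fin Dc → ℝ) => (R q.1, q.2)) (by fun_prop)).ennreal_ofReal
  have mTV : Measurable fun ω => ∫⁻ s in C, ENNReal.ofReal |κ (R ω) s - p s| := by
    have h1 : Measurable fun q : Ω × (Fin Dc → ℝ) => ENNReal.ofReal |κ (R q.1) q.2 - p q.2| :=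
      ((mκ.comp (f := fun q : Ω × (Fin Dc → ℝ) => (R q.1, q.2)) (by fun_prop)).sub
        (hp.measurable.comp measurable_snd)).abs.ennreal_ofReal
    exact h1.lintegral_prod_right'
  have mg1 : ∀ g : Fin Dx → ℝ, Measurable fun q : Ω × (Fin Dc → ℝ) => ENNReal.ofReal (κ (R q.1) q.2) *
      ENNReal.ofReal (e (S q.1) (g, q.2) - (μ (R q.1) (g, q.2) + √β * √(v (R q.1) (g, q.2)))) :=
    fun g => by
      have h1 : Measurable fun q : Ω × (Fin Dc → ℝ) => e (S q.1) (g, q.2) :=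
        me.comp (f := fun q : Ω × (Fin Dc → ℝ) => (q.1, ((g, q.2) : Pt Dx Dc))) (by fun_prop)
      have h2 : Measurable fun q : Ω × (Fin Dc → ℝ) => μ (R q.1) (g, q.2) :=
        mμ.comp (f := fun q : Ω × (Fin Dc → ℝ) => (R q.1, ((g, q.2) : Pt Dx Dc))) (by fun_prop)
      have h3 : Measurable fun q : Ω × (Fin Dc → ℝ) => v (R q.1) (g, q.2) :=
        mv.comp (f := fun q : Ω × (Fin Dc → ℝ) => (R q.1, ((g, q.2) : Pt Dx Dc))) (by fun_prop)
      exact mκΩ.mul (h1.sub (h2.add (h3.sqrt.const_mul _))).ennreal_ofReal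
  have mx1 : Measurable fun q : Ω × (Fin Dc → ℝ) => e (S q.1) (x (n + 1) q.1, q.2) :=
    me.comp (f := fun q : Ω × (Fin Dc → ℝ) => (q.1, ((x (n + 1) q.1, q.2) : Pt Dx Dc))) (by fun_prop)
  have mx2 : Measurable fun q : Ω × (Fin Dc → ℝ) => μ (R q.1) (x (n + 1) q.1, q.2) :=
    mμ.comp (f := fun q : Ω × (Fin Dc → ℝ) => (R q.1, ((x (n + 1) q.1, q.2) : Pt Dx Dc)))
      (by fun_prop)
  have mx3 : Measurable fun q : Ω × (Fin Dc → ℝ) => v (R q.1) (x (n + 1) q.1, q.2) :=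
    mv.comp (f := fun q : Ω × (Fin Dc → ℝ) => (R q.1, ((x (n + 1) q.1, q.2) : Pt Dx Dc)))
      (by fun_prop)
  have mx4 : Measurable fun q : Ω × (Fin Dc → ℝ) => ENNReal.ofReal (κ (R q.1) q.2) *
      ENNReal.ofReal |e (S q.1) (x (n + 1) q.1, q.2) - μ (R q.1) (x (n + 1) q.1, q.2)| :=
    mκΩ.mul (mx1.sub mx2).abs.ennreal_ofReal
  have mx5 : Measurable fun q : Ω × (Fin Dc → ℝ) => ENNReal.ofReal (κ (R q.1) q.2) *
      ENNReal.ofReal (√(v (R q.1) (x (n + 1) q.1, q.2))) := mκΩ.mul mx3.sqrt.ennreal_ofReal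
  have mMS : Measurable fun ω => M (S ω) := mM.comp mS
  have mmR : Measurable fun ω => m (R ω) := mm.comp mR
  have mΛS : Measurable fun ω => Λ (S ω) := mΛ.comp mS
  have hκ1 : ∀ ω, ∫⁻ u in C, ENNReal.ofReal (κ (R ω) u) ≤ 1 := fun ω =>
    (setLIntegral_le_lintegral _ _).trans (hκpdf (R ω)).lintegral_eq_one.le
  -- expectations of the terms
  have E2 : ∫⁻ ω, M (S ω) * (∫⁻ s in C, ENNReal.ofReal |κ (R ω) s - p s|) ∂P ≤
      ENNReal.ofReal (1 + lipMoment Dx Dc a b * r) * ENNReal.ofReal q₁ := by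
    -- The path bound depends on the process and the total variation on the contexts only, so the
    -- mean of the product splits, and first moments are enough.
    have hind : IndepFun (fun ω => M (S ω))
        (fun ω => ∫⁻ s in C, ENNReal.ofReal |κ (R ω) s - p s|) P := by
      have h1 : Measurable fun q : (ℕ → Fin Dc → ℝ) × (ℕ → ℝ) =>
          ∫⁻ s in C, ENNReal.ofReal |kde K (h (n + 1)) (n + 1) q.1 s - p s| := by
        have h2 : Measurable fun q : ((ℕ → Fin Dc → ℝ) × (ℕ → ℝ)) × (Fin Dc → ℝ) =>
            ENNReal.ofReal |kde K (h (n + 1)) (n + 1) q.1.1 q.2 - p q.2| :=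
          (((measurable_kde hK.measurable (h (n + 1)) (n + 1)).comp
            (f := fun q : ((ℕ → Fin Dc → ℝ) × (ℕ → ℝ)) × (Fin Dc → ℝ) => (q.1.1, q.2))
              (by fun_prop)).sub (hp.measurable.comp measurable_snd)).abs.ennreal_ofReal
        exact h2.lintegral_prod_right'
      have h3 := (hrun.indepFun_path d).comp (φ := M) mM h1
      have h4 : (fun ω => ∫⁻ s in C, ENNReal.ofReal |κ (R ω) s - p s|) = fun ω =>
          ∫⁻ s in C, ENNReal.ofReal |kde K (h (n + 1)) (n + 1) (fun i => c i ω) s - p s| := by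
        ext1 ω
        rw [hκR]
      rw [h4]
      exact h3
    rw [lintegral_mul_eq_lintegral_mul_lintegral_of_indepFun'' mMS.aemeasurable
      mTV.aemeasurable hind]
    simp only [hκR]
    gcongr
  -- For a fixed context the density estimate is a function of the history, hence an admissible
  -- weight; integrating over contexts afterwards uses its total mass 1.
  have E4 : ∀ g ∈ G, ∫⁻ ω, (∫⁻ s in C, ENNReal.ofReal (κ (R ω) s) *
      ENNReal.ofReal (e (S ω) (g, s) - (μ (R ω) (g, s) + √β * √(v (R ω) (g, s))))) ∂P ≤
      ENNReal.ofReal (Real.exp (-β / 2)) := fun g hg => by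
    rw [lintegral_lintegral_swap (mg1 g).aemeasurable]
    calc _ ≤ ∫⁻ s in C, ENNReal.ofReal (Real.exp (-β / 2)) *
          (∫⁻ ω, ENNReal.ofReal (κ (R ω) s) ∂P) := by
          refine setLIntegral_mono' hCm fun s hs => ?_
          have h1 := hpost.lintegral_mul_sub_ucb_le (w := fun _ => (g, s)) measurable_const
            (fun _ => ⟨hG g hg, hs⟩) (W := fun q => ENNReal.ofReal (κ q s))
            (mκ.comp measurable_prodMk_right).ennreal_ofReal hβ
          simp only [hpost.eval_eq _ (g, s) ⟨hG g hg, hs⟩]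
          exact h1
      _ = ENNReal.ofReal (Real.exp (-β / 2)) *
          ∫⁻ ω, (∫⁻ s in C, ENNReal.ofReal (κ (R ω) s)) ∂P := by
          rw [lintegral_const_mul' _ _ ENNReal.ofReal_ne_top, lintegral_lintegral_swap]
          exact (mκΩ.comp measurable_swap).aemeasurable
      _ ≤ ENNReal.ofReal (Real.exp (-β / 2)) * ∫⁻ ω, 1 ∂P := by
          gcongr with ω
          exact hκ1 ω
      _ = _ := by simp
  have E5 : ∫⁻ ω, (∫⁻ s in C, ENNReal.ofReal (κ (R ω) s) *
        ENNReal.ofReal |e (S ω) (x (n + 1) ω, s) - μ (R ω) (x (n + 1) ω, s)|) ∂P ≤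
      ∫⁻ ω, (∫⁻ s in C, ENNReal.ofReal (κ (R ω) s) *
        ENNReal.ofReal (√(v (R ω) (x (n + 1) ω, s)))) ∂P := by
    refine (lintegral_lintegral_swap mx4.aemeasurable).le.trans (le_trans ?_
      (lintegral_lintegral_swap mx5.aemeasurable).ge)
    refine setLIntegral_mono' hCm fun s hs => ?_
    have hmem : ∀ q, ((π (n + 1) q, s) : Pt Dx Dc) ∈ X ×ˢ C := fun q => ⟨hπX _ q, hs⟩
    have h1 := hpost.lintegral_mul_abs_sub_mean_le (w := fun q => (π (n + 1) q, s))
      (by fun_prop) hmem (W := fun q => ENNReal.ofReal (κ q s))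
      (mκ.comp measurable_prodMk_right).ennreal_ofReal
    simp only [hxπ, hpost.eval_eq _ _ (hmem _)]
    exact h1
  -- The posterior standard deviation at the decision takes values in `[0, 1]` and is Lipschitz in
  -- the context, so the density estimate may be exchanged for `p` by the key estimate.
  have E6 : ∫⁻ ω, (∫⁻ s in C, ENNReal.ofReal (κ (R ω) s) *
        ENNReal.ofReal (√(v (R ω) (x (n + 1) ω, s)))) ∂P ≤
      3 * (∫⁻ ω, ENNReal.ofReal (√(stepVar k σ c x n ω)) ∂P) + ENNReal.ofReal q₂ := by
    have h1 := hkey (fun ω s => √(v (R ω) (x (n + 1) ω, s))) mx3.sqrt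
      (fun ω u hu => Real.sqrt_nonneg _) (fun ω u hu => Real.sqrt_le_one.2
        (hpost.var_le_one (R ω) ⟨hrun.decision_mem _ n.succ_pos ω, hu⟩)) (fun ω u hu w hw => by
        have a1 : (x (n + 1) ω, u) ∈ X ×ˢ C := ⟨hrun.decision_mem _ n.succ_pos ω, hu⟩
        have a2 : (x (n + 1) ω, w) ∈ X ×ˢ C := ⟨hrun.decision_mem _ n.succ_pos ω, hw⟩
        simp only [hv, hpost.var_eq (R ω) a1, hpost.var_eq (R ω) a2]
        refine (hgp.sqrt_postCov_le hσ (hpost.histSites_mem (R ω)) a1 a2).trans ?_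
        have a3 := hgp.sqrt_integral_sub_sq_le hD ha hb hZ hd a1 a2
        have a4 : dist (x (n + 1) ω, u) (x (n + 1) ω, w) = ‖u - w‖ := by
          rw [Prod.dist_eq, dist_self, dist_eq_norm, max_eq_right (norm_nonneg _)]
        rw [a4] at a3
        gcongr)
    simp only [hκR]
    refine h1.trans ?_
    gcongr 3 * ?_ + _
    -- The current context has density `p` and is independent of the history, so the `p`-expectation
    -- of the standard deviation becomes its value at the realized context. This is the quantity the
    -- information gain controls.
    have hind : IndepFun R (c (n + 1)) P :=
      (hpol.indepFun mc hrun.noise_measurable hrun.context_indep hrun.noise_indep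
        hrun.context_noise_indep (hrun.indepFun_path d) (n + 1)).comp
        (φ := fun q : (ℕ → ℝ) × Hist Dx Dc => q.2) (ψ := fun q : (Fin Dc → ℝ) × ℝ => q.1)
        measurable_snd measurable_fst
    have mΦ : Measurable fun q : Hist Dx Dc × (Fin Dc → ℝ) =>
        ENNReal.ofReal (√(v q.1 (π (n + 1) q.1, q.2))) :=
      (mv.comp (f := fun q : Hist Dx Dc × (Fin Dc → ℝ) =>
        (q.1, ((π (n + 1) q.1, q.2) : Pt Dx Dc))) (by fun_prop)).sqrt.ennreal_ofReal
    have h2 := lintegral_of_indepFun mR (mc (n + 1)) hind mΦ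
    simp only [hrun.stepVar_eq hpost]
    simp only [← hv, ← hR, hxπ]
    simp only at h2
    rw [h2, hrun.context_law]
    refine lintegral_mono fun ω => ?_
    have mΦω : Measurable fun y => ENNReal.ofReal (√(v (R ω) (π (n + 1) (R ω), y))) :=
      mΦ.comp (f := fun y : Fin Dc → ℝ => (R ω, y)) measurable_prodMk_left
    rw [law, lintegral_withDensity_eq_lintegral_mul _ hp.measurable.ennreal_ofReal mΦω]
    exact setLIntegral_le_lintegral _ _
  -- conclusion
  have m3 : Measurable fun ω => 2 * M (S ω) + m (R ω) := (mMS.const_mul 2).add mmR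
  have m2 : Measurable fun ω => 2 * M (S ω) * ∫⁻ s in C, ENNReal.ofReal |κ (R ω) s - p s| :=
    (mMS.const_mul 2).mul mTV
  have mi : ∀ g, Measurable fun ω => ∫⁻ s in C, ENNReal.ofReal (κ (R ω) s) *
        ENNReal.ofReal (e (S ω) (g, s) - (μ (R ω) (g, s) + √β * √(v (R ω) (g, s)))) :=
    fun g => (mg1 g).lintegral_prod_right'
  have mi4 : Measurable fun ω => ∫⁻ s in C, ENNReal.ofReal (κ (R ω) s) *
        ENNReal.ofReal |e (S ω) (x (n + 1) ω, s) - μ (R ω) (x (n + 1) ω, s)| :=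
    mx4.lintegral_prod_right'
  have mi5 : Measurable fun ω => ∫⁻ s in C, ENNReal.ofReal (κ (R ω) s) *
        ENNReal.ofReal (√(v (R ω) (x (n + 1) ω, s))) := mx5.lintegral_prod_right'
  refine (lintegral_mono hpath).trans ?_
  rw [lintegral_add_right _ (mi5.const_mul _), lintegral_add_right _ mi4,
    lintegral_add_right _ (Finset.measurable_sum _ fun g _ => mi g),
    lintegral_add_right _ (m3.const_mul _), lintegral_add_right _ m2, lintegral_mul_const _ mΛS,
    lintegral_const_mul _ m3, lintegral_add_right _ mmR,
    lintegral_const_mul _ mMS, hmM, lintegral_finsetSum _ (fun g _ => mi g),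
    lintegral_const_mul _ mi5]
  simp only [mul_assoc (2 : ENNReal)]
  have m1 : Measurable fun ω => M (S ω) * ∫⁻ s in C, ENNReal.ofReal |κ (R ω) s - p s| :=
    mMS.mul mTV
  rw [lintegral_const_mul _ m1]
  have hMb : 0 ≤ 1 + lipMoment Dx Dc a b * r := by positivity
  rw [ENNReal.ofReal_add (by positivity) (by positivity),
    ENNReal.ofReal_add (by positivity) (by positivity),
    ENNReal.ofReal_add (by positivity) (by positivity),
    ENNReal.ofReal_add zero_le_one (Real.sqrt_nonneg _), add_mul, ENNReal.ofReal_one, one_mul,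
    ENNReal.ofReal_mul hL, mul_assoc 2, ENNReal.ofReal_mul zero_le_two, ENNReal.ofReal_mul hMb,
    ENNReal.ofReal_mul hδ.le, ENNReal.ofReal_mul (by norm_num), ENNReal.ofReal_mul (by positivity),
    ENNReal.ofReal_natCast, ENNReal.ofReal_ofNat, ENNReal.ofReal_ofNat, ← add_assoc]
  gcongr ?_ * _ + 2 * ?_ + _ * ?_ + ?_ + ?_ + _ * ?_
  -- Two copies of `M` and one of `m`, whose mean equals that of `M`.
  · calc _ = 3 * ∫⁻ ω, M (S ω) ∂P := by ring
      _ ≤ _ := by gcongr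
  · refine (Finset.sum_le_sum E4).trans (le_of_eq ?_)
    rw [Finset.sum_const, nsmul_eq_mul]
  · exact E5.trans E6

end Runs

end DRBO

/-! ### Growth of the confidence parameter. -/

namespace DRBO

section Beta

variable {Dx : ℕ} {a b r : ℝ}

lemma ucbBeta_eq (hDx : 0 < Dx) (ha : 0 < a) (hb : 0 < b) (hr : 0 < r) {t : ℕ} (ht : 1 ≤ t) :
    ucbBeta Dx a b r t = ucbBeta Dx a b r 1 + 4 * (1 + Dx) * Real.log t := by
  have ht0 : (0 : ℝ) < t := by exact_mod_cast ht
  have hD : (0 : ℝ) < Dx := by exact_mod_cast hDx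
  have hpi := Real.pi_pos
  have e1 : (t : ℝ) ^ 2 * Dx * a * b * r * √Real.pi / 2 =
      (t : ℝ) ^ 2 * (Dx * a * b * r * √Real.pi / 2) := by ring
  have e2 : ((1 : ℕ) : ℝ) ^ 2 * Dx * a * b * r * √Real.pi / 2 =
      Dx * a * b * r * √Real.pi / 2 := by push_cast; ring
  unfold ucbBeta
  rw [e1, e2, Real.log_div (by positivity) (by positivity),
    Real.log_div (by norm_num) (by positivity), Real.log_mul (by positivity) (by positivity),
    Real.log_pow]
  simp only [Nat.cast_one, one_pow, Real.log_one]
  push_cast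
  ring

lemma ucbBeta_mono (hDx : 0 < Dx) (ha : 0 < a) (hb : 0 < b) (hr : 0 < r) {s t : ℕ} (hs : 1 ≤ s)
    (hst : s ≤ t) : ucbBeta Dx a b r s ≤ ucbBeta Dx a b r t := by
  rw [ucbBeta_eq hDx ha hb hr hs, ucbBeta_eq hDx ha hb hr (hs.trans hst)]
  have hs0 : (0 : ℝ) < s := by exact_mod_cast hs
  gcongr

/-- The failure probability of the confidence bounds, on a grid of mesh `r / t²`. -/
lemma card_mul_exp_ucbBeta_le (hDx : 0 < Dx) (ha : 0 < a) (hb : 0 < b) (hr : 0 < r) {t : ℕ}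
    (ht : 1 ≤ t) {m : ℕ} (hm : m ≤ (t ^ 2 + 1) ^ Dx) :
    m * Real.exp (-ucbBeta Dx a b r t / 2) ≤
      √(2 * Real.pi) * (2 / (Dx * a * b * r * √Real.pi / 2)) ^ Dx * (1 / (t : ℝ) ^ 2) := by
  have ht0 : (0 : ℝ) < t := by exact_mod_cast ht
  have ht1 : (1 : ℝ) ≤ t := by exact_mod_cast ht
  have hD : (0 : ℝ) < Dx := by exact_mod_cast hDx
  have hpi := Real.pi_pos
  set q := Dx * a * b * r * √Real.pi / 2 with hq
  have hq0 : 0 < q := by positivity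
  have e1 : (t : ℝ) ^ 2 * Dx * a * b * r * √Real.pi / 2 = (t : ℝ) ^ 2 * q := by rw [hq]; ring
  have e2 : Real.exp (-ucbBeta Dx a b r t / 2) =
      (√(2 * Real.pi) / (t : ℝ) ^ 2) * ((((t : ℝ) ^ 2 * q) ^ Dx)⁻¹) := by
    have h1 : -ucbBeta Dx a b r t / 2 = -Real.log ((t : ℝ) ^ 2 / √(2 * Real.pi)) +
        -(Dx * Real.log ((t : ℝ) ^ 2 * q)) := by
      rw [ucbBeta, e1]
      ring
    rw [h1, Real.exp_add, Real.exp_neg, Real.exp_neg, Real.exp_log (by positivity),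
      Real.exp_nat_mul, Real.exp_log (by positivity), inv_div]
  have h3 : (m : ℝ) ≤ (2 * (t : ℝ) ^ 2) ^ Dx := by
    refine le_trans (Nat.cast_le.2 hm) ?_
    push_cast
    gcongr
    nlinarith
  rw [e2]
  calc _ ≤ (2 * (t : ℝ) ^ 2) ^ Dx * ((√(2 * Real.pi) / (t : ℝ) ^ 2) * ((((t : ℝ) ^ 2 * q) ^ Dx)⁻¹)) := by
        gcongr
    _ = _ := by
        rw [div_pow, mul_pow, mul_pow]
        field_simp

lemma one_div_le_bandRate (d : ℕ) {t : ℕ} (ht : 1 ≤ t) : 1 / (t : ℝ) ≤ bandRate d t := by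
  have ht1 : (1 : ℝ) ≤ t := by exact_mod_cast ht
  rw [one_div, ← Real.rpow_neg_one]
  refine Real.rpow_le_rpow_of_exponent_le ht1 (neg_le_neg ?_)
  rw [div_le_one (by positivity)]
  have : (0 : ℝ) ≤ d := by positivity
  linarith

/-- `ucbBeta` grows like `log t`, slower than any power. This is where the extra power gained in the
key estimate absorbs `√β`. -/
lemma exists_sqrt_ucbBeta_mul_le (hDx : 0 < Dx) (ha : 0 < a) (hb : 0 < b) (hr : 0 < r) (d : ℕ)
    {s : ℝ} (hs : 0 < s) : ∃ D : ℝ, 0 ≤ D ∧ ∀ t : ℕ, 1 ≤ t →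
      (1 + √(ucbBeta Dx a b r t)) * bandRate d t ^ s ≤ D := by
  set η := s / (4 + (d : ℝ)) with hη
  have hη0 : 0 < η := by positivity
  refine ⟨2 + |ucbBeta Dx a b r 1| + 4 * (1 + Dx) / η, by positivity, fun t ht => ?_⟩
  have ht0 : (0 : ℝ) < t := by exact_mod_cast ht
  have ht1 : (1 : ℝ) ≤ t := by exact_mod_cast ht
  rw [bandRate_rpow, ← hη, Real.rpow_neg ht0.le, ← div_eq_mul_inv, div_le_iff₀ (by positivity)]
  have h1 : 1 ≤ (t : ℝ) ^ η := Real.one_le_rpow ht1 hη0.le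
  have h2 := Real.log_le_rpow_div ht0.le hη0
  have h3 : √(ucbBeta Dx a b r t) ≤ 1 + (|ucbBeta Dx a b r 1| + 4 * (1 + Dx) * Real.log t) := by
    have h4 : ucbBeta Dx a b r t ≤ |ucbBeta Dx a b r 1| + 4 * (1 + Dx) * Real.log t := by
      rw [ucbBeta_eq hDx ha hb hr ht]
      gcongr
      exact le_abs_self _
    have h5 : 0 ≤ |ucbBeta Dx a b r 1| + 4 * (1 + Dx) * Real.log t := by
      have := Real.log_nonneg ht1
      positivity
    rw [Real.sqrt_le_left (by linarith)]
    nlinarith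
  have h6 : 4 * (1 + (Dx : ℝ)) * Real.log t ≤ 4 * (1 + Dx) / η * (t : ℝ) ^ η := by
    calc _ ≤ 4 * (1 + (Dx : ℝ)) * ((t : ℝ) ^ η / η) := by gcongr
      _ = _ := by ring
  have h7 : (2 + |ucbBeta Dx a b r 1|) * 1 ≤ (2 + |ucbBeta Dx a b r 1|) * (t : ℝ) ^ η := by gcongr
  rw [add_mul]
  linarith

end Beta

/-! ### Integrability of the regret and uniform constants. -/

section Integrability

variable {Ω : Type*} [MeasurableSpace Ω] {P : Measure Ω} [IsProbabilityMeasure P] {Dx Dc : ℕ}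
  {X : Set (Fin Dx → ℝ)} {C : Set (Fin Dc → ℝ)} {a b r σ : ℝ} {p K : (Fin Dc → ℝ) → ℝ}
  {h : ℕ → Fin Dc → ℝ} {δ : ℕ → ℝ} {k : Pt Dx Dc → Pt Dx Dc → ℝ} {f : Ω → Pt Dx Dc → ℝ}
  {c : ℕ → Ω → Fin Dc → ℝ} {ε : ℕ → Ω → ℝ} {x : ℕ → Ω → Fin Dx → ℝ} {xs : Ω → Fin Dx → ℝ}

lemma ofReal_abs_expect_le (hC : MeasurableSet C) (hp : IsPDF p) {g : (Fin Dc → ℝ) → ℝ}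
    {M : ENNReal} (hg : ∀ s ∈ C, ENNReal.ofReal |g s| ≤ M) : ENNReal.ofReal |expect C p g| ≤ M := by
  by_cases hM : M = ⊤
  · rw [hM]
    exact le_top
  · rw [ENNReal.ofReal_le_iff_le_toReal hM]
    exact abs_expect_le hC hp ENNReal.toReal_nonneg fun s hs =>
      (ENNReal.ofReal_le_iff_le_toReal hM).1 (hg s hs)

lemma IsRun.integrable_expect_of_aestronglyMeasurable
    (hrun : IsRun P X C a b r σ p K h δ k f c ε x xs) (hD : 0 < Dx + Dc) (ha : 0 < a) (hb : 0 < b)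
    (hr : 0 < r) (hX : Convex ℝ X) (hXc : IsCompact X) (hXr : X ⊆ Set.Icc 0 (fun _ => r))
    (hC : Convex ℝ C) (hCc : IsCompact C) (hCr : C ⊆ Set.Icc 0 (fun _ => r)) (hp : IsPDF p)
    {y : Ω → Fin Dx → ℝ} (hy : ∀ ω, y ω ∈ X)
    (hm : AEStronglyMeasurable (fun ω => expect C p (fun s => f ω (y ω, s))) P) :
    Integrable (fun ω => expect C p (fun s => f ω (y ω, s))) P ∧
      ∫⁻ ω, ENNReal.ofReal |expect C p (fun s => f ω (y ω, s))| ∂P ≤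
        ENNReal.ofReal (1 + lipMoment Dx Dc a b * r) := by
  obtain ⟨z₀, hz₀, d, hd, π, hπX, hpol⟩ := hrun.exists_followsPolicy hXc hCc
  have h1 : ∫⁻ ω, ENNReal.ofReal |expect C p (fun s => f ω (y ω, s))| ∂P ≤
      ENNReal.ofReal (1 + lipMoment Dx Dc a b * r) := by
    refine le_trans (lintegral_mono fun ω => ofReal_abs_expect_le hCc.measurableSet hp fun s hs =>
      hrun.gp.ofReal_abs_le_pathBound hd hr (dist_le_of_subset_Icc hr hXr hCr) ω ⟨hy ω, hs⟩)
      (hrun.gp.lintegral_pathBound_le hD ha hb (hX.prod hC) d hr)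
  refine ⟨⟨hm, ?_⟩, h1⟩
  rw [hasFiniteIntegral_iff_norm]
  exact h1.trans_lt ENNReal.ofReal_lt_top

/-- The optimizer `xs` is not assumed measurable, but the optimal value is almost surely the
supremum over a dense sequence of `X`, which is. The integrable bound is the path bound. -/
lemma IsRun.integrable_expect (hrun : IsRun P X C a b r σ p K h δ k f c ε x xs)
    (hD : 0 < Dx + Dc) (ha : 0 < a) (hb : 0 < b) (hr : 0 < r) (hX : Convex ℝ X)
    (hXc : IsCompact X) (hXr : X ⊆ Set.Icc 0 (fun _ => r)) (hC : Convex ℝ C) (hCc : IsCompact C)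
    (hCr : C ⊆ Set.Icc 0 (fun _ => r)) (hp : IsPDF p) :
    (Integrable (fun ω => expect C p (fun s => f ω (xs ω, s))) P ∧
      ∫⁻ ω, ENNReal.ofReal |expect C p (fun s => f ω (xs ω, s))| ∂P ≤
        ENNReal.ofReal (1 + lipMoment Dx Dc a b * r)) ∧
    ∀ n, Measurable (x (n + 1)) ∧ (Integrable (fun ω => expect C p (fun s => f ω (x (n + 1) ω, s))) P ∧
      ∫⁻ ω, ENNReal.ofReal |expect C p (fun s => f ω (x (n + 1) ω, s))| ∂P ≤
        ENNReal.ofReal (1 + lipMoment Dx Dc a b * r)) := by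
  obtain ⟨z₀, hz₀, d, hd, π, hπX, hpol⟩ := hrun.exists_followsPolicy hXc hCc
  have hCm := hCc.measurableSet
  set S : Ω → ℕ → ℝ := fun ω n => f ω (d n) with hS
  have mS : Measurable S := hpol.measurable_path
  have heval : ∀ ω, ∀ z ∈ X ×ˢ C, pathEval (fun n => (d n : Pt Dx Dc)) (S ω) z = f ω z :=
    fun ω z hz => by
      refine pathEval_eq (hrun.gp.differentiableOn ω).continuousOn (fun n => (d n).2) hz ?_
      have h1 : (⟨z, hz⟩ : ↥(X ×ˢ C)) ∈ closure (Set.range d) := hd _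
      have h2 := image_closure_subset_closure_image continuous_subtype_val
        (Set.mem_image_of_mem (Subtype.val : ↥(X ×ˢ C) → Pt Dx Dc) h1)
      rwa [← Set.range_comp] at h2
  have hmeas : ∀ y : Ω → Fin Dx → ℝ, Measurable y → (∀ ω, y ω ∈ X) →
      Measurable fun ω => expect C p (fun s => f ω (y ω, s)) := fun y my hy => by
    have e1 : (fun ω => expect C p (fun s => f ω (y ω, s))) = fun ω =>
        ∫ s in C, pathEval (fun n => (d n : Pt Dx Dc)) (S ω) (y ω, s) * p s :=
      funext fun ω => setIntegral_congr_fun hCm fun s hs => by simp only [heval ω (y ω, s) ⟨hy ω, hs⟩]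
    have h1 : Measurable fun q : Ω × (Fin Dc → ℝ) =>
        pathEval (fun n => (d n : Pt Dx Dc)) (S q.1) (y q.1, q.2) * p q.2 :=
      (hpol.measurable_eval.comp (f := fun q : Ω × (Fin Dc → ℝ) =>
        (S q.1, ((y q.1, q.2) : Pt Dx Dc))) (by fun_prop)).mul (hp.measurable.comp measurable_snd)
    rw [e1]
    exact h1.stronglyMeasurable.integral_prod_right'.measurable
  have mx : ∀ n, Measurable (x (n + 1)) := fun n => by
    rw [funext (hpol.decision_eq (n + 1) n.succ_pos)]
    exact (hpol.measurable_policy _).comp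
      (hpol.measurable_record hrun.context_measurable hrun.noise_measurable _)
  refine ⟨hrun.integrable_expect_of_aestronglyMeasurable hD ha hb hr hX hXc hXr hC hCc hCr hp
    hrun.opt_mem ?_, fun n => ⟨mx n, hrun.integrable_expect_of_aestronglyMeasurable hD ha hb hr hX
    hXc hXr hC hCc hCr hp (hrun.decision_mem _ n.succ_pos)
    (hmeas _ (mx n) (hrun.decision_mem _ n.succ_pos)).aestronglyMeasurable⟩⟩
  obtain ⟨ω₀⟩ : Nonempty Ω := nonempty_of_isProbabilityMeasure P
  have hne : Nonempty ↥X := ⟨⟨_, hrun.opt_mem ω₀⟩⟩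
  set g := TopologicalSpace.denseSeq ↥X with hg
  have hgd : DenseRange g := TopologicalSpace.denseRange_denseSeq ↥X
  have hsup : Measurable fun ω => ⨆ n, expect C p (fun s => f ω ((g n : Fin Dx → ℝ), s)) :=
    Measurable.iSup fun n => hmeas (fun _ => (g n : Fin Dx → ℝ)) measurable_const fun _ => (g n).2
  refine ⟨_, hsup.stronglyMeasurable, ?_⟩
  -- Paths of finite Lipschitz constant have objectives that are uniformly continuous in the
  -- decision, so a dense sequence reaches the supremum.
  have hΛ : ∀ᵐ ω ∂P, lipConst (fun n => (d n : Pt Dx Dc)) (S ω) < ⊤ :=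
    ae_lt_top ((measurable_lipConst _).comp mS) ((hrun.gp.lintegral_lipConst_le hD ha hb
      (hX.prod hC) d).trans_lt ENNReal.ofReal_lt_top).ne
  filter_upwards [hΛ] with ω hω
  set Λ := (lipConst (fun n => (d n : Pt Dx Dc)) (S ω)).toReal with hΛdef
  have hbdd : BddAbove (Set.range fun n => expect C p (fun s => f ω ((g n : Fin Dx → ℝ), s))) := by
    refine ⟨expect C p (fun s => f ω (xs ω, s)), ?_⟩
    rintro _ ⟨n, rfl⟩
    exact hrun.opt_max ω (g n).2
  have hint : ∀ v ∈ X, IntegrableOn (fun s => f ω (v, s) * p s) C := fun v hv => by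
    have hcont : ContinuousOn (fun s => f ω (v, s)) C :=
      (hrun.gp.differentiableOn ω).continuousOn.comp (by fun_prop) fun s hs => ⟨hv, hs⟩
    obtain ⟨B, hB⟩ := hCc.exists_bound_of_continuousOn hcont
    exact integrableOn_mul_pdf hCm hp.integrable (hcont.aestronglyMeasurable hCm) hB
  refine le_antisymm (le_of_forall_pos_le_add fun η hη => ?_)
    (ciSup_le fun n => hrun.opt_max ω (g n).2)
  obtain ⟨n, hn⟩ : ∃ n, dist (⟨xs ω, hrun.opt_mem ω⟩ : ↥X) (g n) < η / (Λ + 1) :=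
    hgd.exists_dist_lt _ (div_pos hη (by positivity))
  have h1 : |expect C p (fun s => f ω (xs ω, s) - f ω ((g n : Fin Dx → ℝ), s))| ≤ η := by
    refine abs_expect_le hCm hp hη.le fun s hs => ?_
    refine (abs_sub_le_lipConst (hrun.gp.differentiableOn ω).continuousOn hd hω.ne
      ⟨hrun.opt_mem ω, hs⟩ ⟨(g n).2, hs⟩).trans ?_
    rw [Prod.dist_eq, dist_self, max_eq_left dist_nonneg]
    have h2 : dist (xs ω) (g n : Fin Dx → ℝ) < η / (Λ + 1) := hn
    rw [lt_div_iff₀ (by positivity)] at h2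
    have h3 : 0 ≤ dist (xs ω) (g n : Fin Dx → ℝ) := dist_nonneg
    change Λ * _ ≤ η
    nlinarith
  have h2 : expect C p (fun s => f ω (xs ω, s) - f ω ((g n : Fin Dx → ℝ), s)) =
      expect C p (fun s => f ω (xs ω, s)) - expect C p (fun s => f ω ((g n : Fin Dx → ℝ), s)) := by
    unfold expect
    rw [← integral_sub (hint _ (hrun.opt_mem ω)) (hint _ (g n).2)]
    simp only [sub_mul]
  rw [h2] at h1
  have h3 := le_ciSup hbdd n
  have h4 := (abs_le.1 h1).2
  linarith

lemma IsRun.measurable_stepVar (hrun : IsRun P X C a b r σ p K h δ k f c ε x xs)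
    (hσ : 0 < σ) (hXc : IsCompact X) (hCc : IsCompact C) (n : ℕ) :
    Measurable (stepVar k σ c x n) := by
  obtain ⟨z₀, hz₀, d, hd, π, hπX, hpol⟩ := hrun.exists_followsPolicy hXc hCc
  obtain ⟨N, hpost⟩ := hrun.exists_isPosterior hσ hz₀ hd hpol n
  rw [funext (hrun.stepVar_eq hpost)]
  have mx : Measurable (x (n + 1)) := by
    rw [funext (hpol.decision_eq (n + 1) n.succ_pos)]
    exact (hpol.measurable_policy _).comp hpost.measurable_hist
  exact hpost.measurable_var.comp (f := fun ω => (record f c ε x (n + 1) ω,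
    ((x (n + 1) ω, c (n + 1) ω) : Pt Dx Dc)))
    (hpost.measurable_hist.prodMk (mx.prodMk (hrun.context_measurable _)))

end Integrability

universe u

/-- A bound of the expected regret of each iteration with uniform constants. -/
theorem exists_lintegral_regret_le {Dx Dc : ℕ} (hDx : 0 < Dx)
    {X : Set (Fin Dx → ℝ)} {C : Set (Fin Dc → ℝ)} {a b r σ : ℝ}
    (ha : 0 < a) (hb : 0 < b) (hr : 0 < r) (hσ : 0 < σ)
    (hX : Convex ℝ X) (hXc : IsCompact X) (hXr : X ⊆ Set.Icc 0 (fun _ => r))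
    (hC : Convex ℝ C) (hCc : IsCompact C) (hCr : C ⊆ Set.Icc 0 (fun _ => r))
    {p K : (Fin Dc → ℝ) → ℝ} (hp : IsSmoothPDFOn C p) (hK : IsKDEKernel K)
    {h : ℕ → Fin Dc → ℝ} (hh : IsBandwidth h) :
    ∃ A : ℝ, 0 < A ∧ ∀ (Ω : Type u) [MeasurableSpace Ω] (P : Measure Ω) [IsProbabilityMeasure P]
      (δ : ℕ → ℝ) (k : Pt Dx Dc → Pt Dx Dc → ℝ) (f : Ω → Pt Dx Dc → ℝ) (c : ℕ → Ω → Fin Dc → ℝ)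
      (ε : ℕ → Ω → ℝ) (x : ℕ → Ω → Fin Dx → ℝ) (xs : Ω → Fin Dx → ℝ),
      IsRun P X C a b r σ p K h δ k f c ε x xs → ∀ n : ℕ, 0 < δ (n + 1) →
      ∫⁻ ω, ENNReal.ofReal (expect C p (fun s => f ω (xs ω, s)) -
          expect C p (fun s => f ω (x (n + 1) ω, s))) ∂P ≤
        ENNReal.ofReal (A * bandRate Dc (n + 1) ^ 2 + A * δ (n + 1)) +
        ENNReal.ofReal (6 * √(ucbBeta Dx a b r (n + 1))) *
          ∫⁻ ω, ENNReal.ofReal (√(stepVar k σ c x n ω)) ∂P := by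
  have hD : 0 < Dx + Dc := by omega
  have hL1 := lipMoment_ge_one Dx Dc (b := b) ha
  set L := lipMoment Dx Dc a b with hL
  obtain ⟨θ, Q, hθ, hQ, hrates⟩ := exists_kde_rates.{u} hCc hp hK hh (Real.sqrt_nonneg L)
  obtain ⟨E, hE0, hE⟩ := exists_sqrt_ucbBeta_mul_le hDx ha hb hr Dc (half_pos hθ)
  set Mb := 1 + L * r with hMb
  have hMb0 : 0 < Mb := by positivity
  set q := √(2 * Real.pi) * (2 / (Dx * a * b * r * √Real.pi / 2)) ^ Dx with hq
  have hq0 : 0 ≤ q := by positivity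
  -- An iteration with `ucbBeta < 1` comes before `T₀`. The trivial regret bound `2 * Mb` is used
  -- there, at a constant cost of `2 * Mb * T₀ ^ 2`.
  set T₀ := Real.exp ((1 - ucbBeta Dx a b r 1) / (4 * (1 + Dx))) with hT₀
  set A₁ := L * r + 2 * Mb * Q + q + E * Q with hA₁
  have hA₁0 : 0 < A₁ := by positivity
  refine ⟨A₁ + 3 * Mb + 2 * Mb * T₀ ^ 2, by positivity, ?_⟩
  intro Ω _ P _ δ k f c ε x xs hrun n hδ
  have ht : 1 ≤ n + 1 := n.succ_pos
  have htpos : (0 : ℝ) < ((n + 1 : ℕ) : ℝ) := by positivity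
  have hinv := one_div_le_bandRate Dc ht
  have hτ0 := bandRate_pos Dc ht
  have hτ1 := bandRate_le_one Dc ht
  have hEτ := hE (n + 1) ht
  have hrt := hrates (n + 1) ht Ω P c hrun.context_measurable hrun.context_law hrun.context_indep
  have hcard := fun m => card_mul_exp_ucbBeta_le (m := m) hDx ha hb hr ht
  have hbeta := ucbBeta_eq hDx ha hb hr ht
  generalize hτ : bandRate Dc (n + 1) = τ at *
  have hinv2 : 1 / ((n + 1 : ℕ) : ℝ) ^ 2 ≤ τ ^ 2 := by
    rw [← one_div_pow]
    gcongr
  by_cases hβ : 1 ≤ ucbBeta Dx a b r (n + 1)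
  -- Mesh `r / t ^ 2` makes both the net error and the sum of the failure terms of order `1 / t ^
  -- 2`, hence at most a constant times the squared bandwidth.
  · obtain ⟨G, hG, hGc, hnet⟩ := exists_finset_net hr hXr (n := (n + 1) ^ 2)
      (Nat.one_le_pow _ _ n.succ_pos)
    have h1 := hrun.lintegral_regret_le hD ha hb hr hσ hX hXc hXr hC hCc hCr hp.isPDF hK.isPDF hh
      hδ hβ (q₁ := Q * τ ^ 2) (q₂ := Q * (τ ^ 2 * τ ^ (θ / 2)))
      (ρ := r / ((n + 1) ^ 2 : ℕ)) (by positivity) (by positivity) hrt.1 hrt.2 hG hnet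
    refine h1.trans ?_
    rw [← hL, ← hMb, mul_add (ENNReal.ofReal _), ← add_assoc, add_right_comm, ← mul_assoc (ENNReal.ofReal _),
      ← ENNReal.ofReal_mul (by positivity), ← ENNReal.ofReal_add (by positivity) (by positivity)]
    have hs1 : 1 ≤ √(ucbBeta Dx a b r (n + 1)) := Real.one_le_sqrt.2 hβ
    refine add_le_add (ENNReal.ofReal_le_ofReal ?_) (mul_le_mul' ?_ le_rfl)
    · have b1 : L * (r / ((n + 1) ^ 2 : ℕ)) ≤ L * r * τ ^ 2 := by
        have : r / (((n + 1) ^ 2 : ℕ) : ℝ) = r * (1 / ((n + 1 : ℕ) : ℝ) ^ 2) := by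
          push_cast
          ring
        rw [this, ← mul_assoc]
        gcongr
      have b2 : (G.card : ℝ) * Real.exp (-ucbBeta Dx a b r (n + 1) / 2) ≤ q * τ ^ 2 :=
        (hcard _ hGc).trans (mul_le_mul_of_nonneg_left hinv2 hq0)
      have b3 : (1 + √(ucbBeta Dx a b r (n + 1))) * (Q * (τ ^ 2 * τ ^ (θ / 2))) ≤
          E * Q * τ ^ 2 := by
        calc _ = (1 + √(ucbBeta Dx a b r (n + 1))) * τ ^ (θ / 2) * (Q * τ ^ 2) := by ring
          _ ≤ E * (Q * τ ^ 2) := by gcongr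
          _ = _ := by ring
      have b4 : 0 ≤ (3 * Mb + 2 * Mb * T₀ ^ 2) * τ ^ 2 := by positivity
      have b5 : 0 ≤ (A₁ + 2 * Mb * T₀ ^ 2) * δ (n + 1) := by positivity
      rw [hA₁] at b5 ⊢
      linarith
    -- Since `√β ≥ 1`, three times `1 + √β` is at most `6 * √β`.
    · rw [← ENNReal.ofReal_ofNat 3, ← ENNReal.ofReal_mul (by positivity)]
      exact ENNReal.ofReal_le_ofReal (by linarith)
  · have hlog : Real.log ((n + 1 : ℕ) : ℝ) ≤ (1 - ucbBeta Dx a b r 1) / (4 * (1 + Dx)) := by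
      rw [le_div_iff₀ (by positivity)]
      push Not at hβ
      linarith
    have h1 : ((n + 1 : ℕ) : ℝ) ≤ T₀ := by
      rw [← Real.exp_log htpos]
      exact Real.exp_le_exp.2 hlog
    have h2 : 1 ≤ T₀ ^ 2 * τ ^ 2 := by
      calc (1 : ℝ) = ((n + 1 : ℕ) : ℝ) ^ 2 * (1 / ((n + 1 : ℕ) : ℝ) ^ 2) := by field_simp
        _ ≤ _ := by gcongr
    obtain ⟨⟨i1, b1⟩, hx⟩ := hrun.integrable_expect hD ha hb hr hX hXc hXr hC hCc hCr hp.isPDF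
    obtain ⟨-, i2, b2⟩ := hx n
    have m2 := i2.aestronglyMeasurable.aemeasurable.abs.ennreal_ofReal
    refine le_trans ?_ (le_add_right (le_refl _))
    calc _ ≤ ∫⁻ ω, (ENNReal.ofReal |expect C p (fun s => f ω (xs ω, s))| +
          ENNReal.ofReal |expect C p (fun s => f ω (x (n + 1) ω, s))|) ∂P := by
          refine lintegral_mono fun ω => ?_
          rw [← ENNReal.ofReal_add (abs_nonneg _) (abs_nonneg _)]
          exact ENNReal.ofReal_le_ofReal ((le_abs_self _).trans (abs_sub _ _))
      _ ≤ ENNReal.ofReal Mb + ENNReal.ofReal Mb := by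
          rw [lintegral_add_right' _ m2]
          exact add_le_add b1 b2
      _ ≤ _ := by
          rw [← ENNReal.ofReal_add hMb0.le hMb0.le]
          refine ENNReal.ofReal_le_ofReal ?_
          have b3 : Mb * 1 ≤ Mb * (T₀ ^ 2 * τ ^ 2) := by gcongr
          have b4 : 0 ≤ (A₁ + 3 * Mb) * τ ^ 2 := by positivity
          have b5 : 0 ≤ (A₁ + 3 * Mb + 2 * Mb * T₀ ^ 2) * δ (n + 1) := by positivity
          linarith

end DRBO

/-! ### Summation over the iterations. -/

namespace DRBO

lemma sum_Icc_one_eq_sum_range {M : Type*} [AddCommMonoid M] (g : ℕ → M) (T : ℕ) :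
    ∑ t ∈ Finset.Icc 1 T, g t = ∑ n ∈ Finset.range T, g (n + 1) := by
  induction T with
  | zero => simp
  | succ T ih => rw [Finset.sum_Icc_succ_top (by omega), ih, Finset.sum_range_succ]

/-- By Bernoulli's inequality for exponents in `(0, 1]`, each term is at most the increment of `t ^
s / s`. -/
lemma sum_rpow_sub_one_le {s : ℝ} (hs0 : 0 < s) (hs1 : s ≤ 1) (T : ℕ) :
    ∑ n ∈ Finset.range T, ((n + 1 : ℕ) : ℝ) ^ (s - 1) ≤ (T : ℝ) ^ s / s := by
  induction T with
  | zero => simp [Real.zero_rpow hs0.ne']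
  | succ T ih =>
    rw [Finset.sum_range_succ]
    have hT : (0 : ℝ) < ((T + 1 : ℕ) : ℝ) := by positivity
    have h1 : (T : ℝ) = ((T + 1 : ℕ) : ℝ) * (1 + -(1 / ((T + 1 : ℕ) : ℝ))) := by
      field_simp
      push_cast
      ring
    have h0 : -1 ≤ -(1 / ((T + 1 : ℕ) : ℝ)) := by
      rw [neg_le_neg_iff, div_le_one hT]
      push_cast
      linarith [(Nat.cast_nonneg T : (0 : ℝ) ≤ T)]
    have h2 : (T : ℝ) ^ s ≤ ((T + 1 : ℕ) : ℝ) ^ s - s * ((T + 1 : ℕ) : ℝ) ^ (s - 1) := by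
      have h3 := rpow_one_add_le_one_add_mul_self h0 hs0.le hs1
      calc (T : ℝ) ^ s = ((T + 1 : ℕ) : ℝ) ^ s * (1 + -(1 / ((T + 1 : ℕ) : ℝ))) ^ s := by
            rw [← Real.mul_rpow hT.le (by linarith), ← h1]
        _ ≤ ((T + 1 : ℕ) : ℝ) ^ s * (1 + s * -(1 / ((T + 1 : ℕ) : ℝ))) := by gcongr
        _ = _ := by
            rw [Real.rpow_sub_one hT.ne']
            ring
    have h4 : (T : ℝ) ^ s / s ≤ (((T + 1 : ℕ) : ℝ) ^ s - s * ((T + 1 : ℕ) : ℝ) ^ (s - 1)) / s := by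
      gcongr
    have h5 : (((T + 1 : ℕ) : ℝ) ^ s - s * ((T + 1 : ℕ) : ℝ) ^ (s - 1)) / s =
        ((T + 1 : ℕ) : ℝ) ^ s / s - ((T + 1 : ℕ) : ℝ) ^ (s - 1) := by
      field_simp
    linarith

lemma sum_bandRate_sq_le (d T : ℕ) :
    ∑ t ∈ Finset.Icc 1 T, bandRate d t ^ 2 ≤
      (4 + (d : ℝ)) / (2 + d) * (T : ℝ) ^ ((2 + (d : ℝ)) / (4 + d)) := by
  have hd : (0 : ℝ) ≤ d := by positivity
  have h1 := sum_rpow_sub_one_le (s := (2 + (d : ℝ)) / (4 + d)) (by positivity)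
    (by rw [div_le_one (by positivity)]; linarith) T
  rw [sum_Icc_one_eq_sum_range]
  have h2 : ∀ n : ℕ, bandRate d (n + 1) ^ 2 = ((n + 1 : ℕ) : ℝ) ^ ((2 + (d : ℝ)) / (4 + d) - 1) :=
    fun n => by
      rw [← Real.rpow_natCast, bandRate_rpow]
      congr 1
      field_simp
      push_cast
      ring
  simp only [h2]
  refine h1.trans (le_of_eq ?_)
  field_simp

section Sum

variable {Ω : Type*} [MeasurableSpace Ω] {P : Measure Ω} [IsProbabilityMeasure P] {Dx Dc : ℕ}
  {X : Set (Fin Dx → ℝ)} {C : Set (Fin Dc → ℝ)} {a b r σ : ℝ} {p K : (Fin Dc → ℝ) → ℝ}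
  {h : ℕ → Fin Dc → ℝ} {δ : ℕ → ℝ} {k : Pt Dx Dc → Pt Dx Dc → ℝ} {f : Ω → Pt Dx Dc → ℝ}
  {c : ℕ → Ω → Fin Dc → ℝ} {ε : ℕ → Ω → ℝ} {x : ℕ → Ω → Fin Dx → ℝ} {xs : Ω → Fin Dx → ℝ}

/-- Posterior variances depend on the design points but not on the observations, so for each outcome
the realized adaptive design may be treated as a deterministic one. -/
lemma IsRun.sum_stepVar_le (hrun : IsRun P X C a b r σ p K h δ k f c ε x xs) (hσ : 0 < σ) (T : ℕ)
    (ω : Ω) : ∑ n ∈ Finset.range T, stepVar k σ c x n ω ≤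
      2 / Real.log (1 + 1 / σ ^ 2) * maxInfoGain P (X ×ˢ C) f ε T := by
  have hfe : IndepFun (fun ω (z : ↥(X ×ˢ C)) => f ω z) (fun ω t => ε t ω) P :=
    hrun.gp_indep.comp (ψ := fun q : (ℕ → Fin Dc → ℝ) × (ℕ → ℝ) => q.2) measurable_id measurable_snd
  exact hrun.gp.sum_postCov_le hσ hrun.noise_measurable hrun.noise_law hrun.noise_indep hfe
    (z := fun i => (x (i + 1) ω, c (i + 1) ω))
    (fun i => ⟨hrun.decision_mem _ i.succ_pos ω, hrun.context_mem _ ω⟩) T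

lemma IsRun.stepVar_nonneg (hrun : IsRun P X C a b r σ p K h δ k f c ε x xs) (hσ : 0 < σ) (n : ℕ)
    (ω : Ω) : 0 ≤ stepVar k σ c x n ω :=
  hrun.gp.postCov_nonneg hσ (fun _ => ⟨hrun.decision_mem _ (Nat.succ_pos _) ω, hrun.context_mem _ ω⟩)
    ⟨hrun.decision_mem _ n.succ_pos ω, hrun.context_mem _ ω⟩

/-- Monotonicity of `ucbBeta`, then the Cauchy-Schwarz inequality over iterations, for each outcome.
The constant 36 is the square of the factor 6. -/
lemma IsRun.sum_sqrt_stepVar_le (hrun : IsRun P X C a b r σ p K h δ k f c ε x xs) (hDx : 0 < Dx)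
    (ha : 0 < a) (hb : 0 < b) (hr : 0 < r) (hσ : 0 < σ) (T : ℕ) (ω : Ω) :
    ∑ n ∈ Finset.range T, 6 * √(ucbBeta Dx a b r (n + 1)) * √(stepVar k σ c x n ω) ≤
      √(ucbBeta Dx a b r T * maxInfoGain P (X ×ˢ C) f ε T *
        (36 * (2 / Real.log (1 + 1 / σ ^ 2)))) * √T := by
  have hl : 0 < Real.log (1 + 1 / σ ^ 2) := Real.log_pos (by
    have : 0 < 1 / σ ^ 2 := by positivity
    linarith)
  have hγ : 0 ≤ maxInfoGain P (X ×ˢ C) f ε T := ENNReal.toReal_nonneg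
  calc ∑ n ∈ Finset.range T, 6 * √(ucbBeta Dx a b r (n + 1)) * √(stepVar k σ c x n ω)
      ≤ ∑ n ∈ Finset.range T, 6 * √(ucbBeta Dx a b r T) * (√1 * √(stepVar k σ c x n ω)) := by
        refine Finset.sum_le_sum fun n hn => ?_
        rw [Real.sqrt_one, one_mul]
        have := ucbBeta_mono hDx ha hb hr n.succ_pos (Finset.mem_range.1 hn)
        gcongr
    _ = 6 * √(ucbBeta Dx a b r T) * ∑ n ∈ Finset.range T, √1 * √(stepVar k σ c x n ω) := by
        rw [Finset.mul_sum]
    _ ≤ 6 * √(ucbBeta Dx a b r T) * (√(∑ n ∈ Finset.range T, 1) *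
          √(∑ n ∈ Finset.range T, stepVar k σ c x n ω)) := by
        gcongr
        exact Real.sum_sqrt_mul_sqrt_le _ (fun _ => zero_le_one) fun n => hrun.stepVar_nonneg hσ n ω
    _ ≤ 6 * √(ucbBeta Dx a b r T) *
          (√T * √(2 / Real.log (1 + 1 / σ ^ 2) * maxInfoGain P (X ×ˢ C) f ε T)) := by
        gcongr
        · simp
        · exact hrun.sum_stepVar_le hσ T ω
    _ = _ := by
        have h36 : √(36 : ℝ) = 6 := by
          rw [show (36 : ℝ) = 6 ^ 2 by norm_num]
          exact Real.sqrt_sq (by norm_num)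
        have hcγ : 0 ≤ 2 / Real.log (1 + 1 / σ ^ 2) * maxInfoGain P (X ×ˢ C) f ε T := by positivity
        generalize hg : 2 / Real.log (1 + 1 / σ ^ 2) * maxInfoGain P (X ×ˢ C) f ε T = g at hcγ
        -- `ucbBeta` may be negative; `Real.sqrt_mul'` needs only the other factor to be
        -- nonnegative.
        rw [mul_assoc (ucbBeta Dx a b r T),
          show maxInfoGain P (X ×ˢ C) f ε T * (36 * (2 / Real.log (1 + 1 / σ ^ 2))) =
            36 * (2 / Real.log (1 + 1 / σ ^ 2) * maxInfoGain P (X ×ˢ C) f ε T) by ring,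
          hg, Real.sqrt_mul' _ (by positivity), Real.sqrt_mul' _ hcγ, h36]
        ring

lemma IsRun.integrable_cumRegret (hrun : IsRun P X C a b r σ p K h δ k f c ε x xs)
    (hD : 0 < Dx + Dc) (ha : 0 < a) (hb : 0 < b) (hr : 0 < r) (hX : Convex ℝ X)
    (hXc : IsCompact X) (hXr : X ⊆ Set.Icc 0 (fun _ => r)) (hC : Convex ℝ C) (hCc : IsCompact C)
    (hCr : C ⊆ Set.Icc 0 (fun _ => r)) (hp : IsPDF p) (T : ℕ) :
    Integrable (cumRegret C p f x xs T) P := by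
  obtain ⟨⟨i1, -⟩, hx⟩ := hrun.integrable_expect hD ha hb hr hX hXc hXr hC hCc hCr hp
  unfold cumRegret
  simp only [sum_Icc_one_eq_sum_range]
  exact integrable_finsetSum _ fun n _ => i1.sub (hx n).2.1

lemma IsRun.regret_nonneg (hrun : IsRun P X C a b r σ p K h δ k f c ε x xs) (n : ℕ) (ω : Ω) :
    0 ≤ expect C p (fun s => f ω (xs ω, s)) - expect C p (fun s => f ω (x (n + 1) ω, s)) :=
  sub_nonneg.2 (hrun.opt_max ω (hrun.decision_mem _ n.succ_pos ω))

lemma IsRun.cumRegret_nonneg (hrun : IsRun P X C a b r σ p K h δ k f c ε x xs) (T : ℕ) (ω : Ω) :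
    0 ≤ cumRegret C p f x xs T ω := by
  unfold cumRegret
  rw [sum_Icc_one_eq_sum_range]
  exact Finset.sum_nonneg fun n _ => hrun.regret_nonneg n ω

end Sum

universe u

/-- A bound of the Bayesian cumulative regret. -/
theorem exists_BCR_le {Dx Dc : ℕ} (hDx : 0 < Dx)
    {X : Set (Fin Dx → ℝ)} {C : Set (Fin Dc → ℝ)} {a b r σ : ℝ}
    (ha : 0 < a) (hb : 0 < b) (hr : 0 < r) (hσ : 0 < σ)
    (hX : Convex ℝ X) (hXc : IsCompact X) (hXr : X ⊆ Set.Icc 0 (fun _ => r))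
    (hC : Convex ℝ C) (hCc : IsCompact C) (hCr : C ⊆ Set.Icc 0 (fun _ => r))
    {p K : (Fin Dc → ℝ) → ℝ} (hp : IsSmoothPDFOn C p) (hK : IsKDEKernel K)
    {h : ℕ → Fin Dc → ℝ} (hh : IsBandwidth h) :
    ∃ A : ℝ, 0 < A ∧ ∀ (Ω : Type u) [MeasurableSpace Ω] (P : Measure Ω) [IsProbabilityMeasure P]
      (δ : ℕ → ℝ) (k : Pt Dx Dc → Pt Dx Dc → ℝ) (f : Ω → Pt Dx Dc → ℝ) (c : ℕ → Ω → Fin Dc → ℝ)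
      (ε : ℕ → Ω → ℝ) (x : ℕ → Ω → Fin Dx → ℝ) (xs : Ω → Fin Dx → ℝ),
      (∀ t, 1 ≤ t → 0 < δ t) → IsRun P X C a b r σ p K h δ k f c ε x xs → ∀ T : ℕ,
      Integrable (cumRegret C p f x xs T) P ∧ 0 ≤ BCR P C p f x xs T ∧
      BCR P C p f x xs T ≤
        A * (T : ℝ) ^ ((2 + (Dc : ℝ)) / (4 + Dc)) + (∑ t ∈ Finset.Icc 1 T, A * δ t) +
        √(ucbBeta Dx a b r T * maxInfoGain P (X ×ˢ C) f ε T *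
          (36 * (2 / Real.log (1 + 1 / σ ^ 2)))) * √T := by
  obtain ⟨A, hA, hstep⟩ := exists_lintegral_regret_le.{u} hDx ha hb hr hσ hX hXc hXr hC hCc hCr
    hp hK hh
  have hD : 0 < Dx + Dc := by omega
  -- The second entry comes from summing the squared bandwidths; the first keeps the coefficient of
  -- the radii.
  refine ⟨A * max 1 ((4 + (Dc : ℝ)) / (2 + Dc)), by positivity, ?_⟩
  intro Ω _ P _ δ k f c ε x xs hδ hrun T
  have hint := hrun.integrable_cumRegret hD ha hb hr hX hXc hXr hC hCc hCr hp.isPDF T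
  refine ⟨hint, integral_nonneg fun ω => hrun.cumRegret_nonneg T ω, ?_⟩
  obtain ⟨⟨i1, -⟩, hx⟩ := hrun.integrable_expect hD ha hb hr hX hXc hXr hC hCc hCr hp.isPDF
  have mv := fun n => hrun.measurable_stepVar hσ hXc hCc n
  set Y := √(ucbBeta Dx a b r T * maxInfoGain P (X ×ˢ C) f ε T *
    (36 * (2 / Real.log (1 + 1 / σ ^ 2)))) * √T with hY
  have hY0 : 0 ≤ Y := by positivity
  have hδ0 : ∀ n, 0 < δ (n + 1) := fun n => hδ _ n.succ_pos
  have key : ENNReal.ofReal (BCR P C p f x xs T) ≤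
      ENNReal.ofReal ((∑ n ∈ Finset.range T,
        (A * bandRate Dc (n + 1) ^ 2 + A * δ (n + 1))) + Y) := by
    unfold BCR
    rw [ofReal_integral_eq_lintegral_ofReal hint (ae_of_all _ fun ω => hrun.cumRegret_nonneg T ω)]
    calc ∫⁻ ω, ENNReal.ofReal (cumRegret C p f x xs T ω) ∂P
        = ∫⁻ ω, (∑ n ∈ Finset.range T, ENNReal.ofReal (expect C p (fun s => f ω (xs ω, s)) -
            expect C p (fun s => f ω (x (n + 1) ω, s)))) ∂P := by
          refine lintegral_congr fun ω => ?_
          rw [cumRegret, sum_Icc_one_eq_sum_range,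
            ENNReal.ofReal_sum_of_nonneg fun n _ => hrun.regret_nonneg n ω]
      _ = ∑ n ∈ Finset.range T, ∫⁻ ω, ENNReal.ofReal (expect C p (fun s => f ω (xs ω, s)) -
            expect C p (fun s => f ω (x (n + 1) ω, s))) ∂P :=
          lintegral_finsetSum' _ fun n _ =>
            (i1.sub (hx n).2.1).aestronglyMeasurable.aemeasurable.ennreal_ofReal
      _ ≤ ∑ n ∈ Finset.range T,
            (ENNReal.ofReal (A * bandRate Dc (n + 1) ^ 2 + A * δ (n + 1)) +
              ENNReal.ofReal (6 * √(ucbBeta Dx a b r (n + 1))) *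
                ∫⁻ ω, ENNReal.ofReal (√(stepVar k σ c x n ω)) ∂P) :=
          Finset.sum_le_sum fun n _ => hstep Ω P δ k f c ε x xs hrun n (hδ0 n)
      _ = ENNReal.ofReal (∑ n ∈ Finset.range T, (A * bandRate Dc (n + 1) ^ 2 + A * δ (n + 1))) +
            ∫⁻ ω, ENNReal.ofReal (∑ n ∈ Finset.range T,
              6 * √(ucbBeta Dx a b r (n + 1)) * √(stepVar k σ c x n ω)) ∂P := by
          rw [Finset.sum_add_distrib, ENNReal.ofReal_sum_of_nonneg fun n _ => by
            have := hδ0 n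
            positivity]
          congr 1
          have e1 : ∀ ω, ENNReal.ofReal (∑ n ∈ Finset.range T,
              6 * √(ucbBeta Dx a b r (n + 1)) * √(stepVar k σ c x n ω)) =
              ∑ n ∈ Finset.range T, ENNReal.ofReal (6 * √(ucbBeta Dx a b r (n + 1))) *
                ENNReal.ofReal (√(stepVar k σ c x n ω)) := fun ω => by
            rw [ENNReal.ofReal_sum_of_nonneg fun n _ => by positivity]
            exact Finset.sum_congr rfl fun n _ => ENNReal.ofReal_mul (by positivity)
          simp only [e1]
          have m1 : ∀ n, Measurable fun ω => ENNReal.ofReal (√(stepVar k σ c x n ω)) := fun n =>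
            (mv n).sqrt.ennreal_ofReal
          rw [lintegral_finsetSum _ fun n _ => (m1 n).const_mul _]
          exact Finset.sum_congr rfl fun n _ => (lintegral_const_mul _ (m1 n)).symm
      _ ≤ ENNReal.ofReal (∑ n ∈ Finset.range T, (A * bandRate Dc (n + 1) ^ 2 + A * δ (n + 1))) +
            ∫⁻ _, ENNReal.ofReal Y ∂P := by
          gcongr with ω
          exact hrun.sum_sqrt_stepVar_le hDx ha hb hr hσ T ω
      _ = _ := by
          rw [lintegral_const, measure_univ, mul_one, ENNReal.ofReal_add _ hY0]
          exact Finset.sum_nonneg fun n _ => by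
            have := hδ0 n
            positivity
  rw [ENNReal.ofReal_le_ofReal_iff (add_nonneg (Finset.sum_nonneg fun n _ => by
    have := hδ0 n
    positivity) hY0), Finset.sum_add_distrib, ← Finset.mul_sum, ← Finset.mul_sum] at key
  have h1 := sum_bandRate_sq_le Dc T
  rw [sum_Icc_one_eq_sum_range] at h1
  rw [← Finset.mul_sum, sum_Icc_one_eq_sum_range]
  have h2 : 0 ≤ ∑ n ∈ Finset.range T, δ (n + 1) := Finset.sum_nonneg fun n _ => (hδ0 n).le
  have h3 : A * ∑ n ∈ Finset.range T, bandRate Dc (n + 1) ^ 2 ≤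
      A * max 1 ((4 + (Dc : ℝ)) / (2 + Dc)) * (T : ℝ) ^ ((2 + (Dc : ℝ)) / (4 + Dc)) := by
    rw [mul_assoc]
    refine mul_le_mul_of_nonneg_left (h1.trans ?_) hA.le
    gcongr
    exact le_max_right _ _
  have h4 : A * ∑ n ∈ Finset.range T, δ (n + 1) ≤
      A * max 1 ((4 + (Dc : ℝ)) / (2 + Dc)) * ∑ n ∈ Finset.range T, δ (n + 1) := by
    refine mul_le_mul_of_nonneg_right (le_mul_of_one_le_right hA.le (le_max_left _ _)) h2
  linarith

end DRBO

/-! ### The regret bound and the rate. -/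

theorem theorem2 {Dx Dc : ℕ} (hDx : 0 < Dx) (hDc : 0 < Dc)
    (X : Set (Fin Dx → ℝ)) (C : Set (Fin Dc → ℝ)) (a b r σ : ℝ)
    (ha : 0 < a) (hb : 0 < b) (hr : 0 < r) (hσ : 0 < σ)
    (hXne : X.Nonempty) (hXconv : Convex ℝ X) (hXcomp : IsCompact X)
    (hXr : X ⊆ Set.Icc 0 (fun _ => r))
    (hCconv : Convex ℝ C) (hCcomp : IsCompact C) (hCr : C ⊆ Set.Icc 0 (fun _ => r))
    (p K : (Fin Dc → ℝ) → ℝ) (hp : IsSmoothPDFOn C p) (hK : IsKDEKernel K)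
    (h : ℕ → Fin Dc → ℝ) (hh : IsBandwidth h) :
    -- the regret bound
    (∃ C₁ C₂ C₃ C₄ : ℝ, 0 < C₁ ∧ 0 < C₂ ∧ 0 < C₃ ∧ 0 < C₄ ∧
      ∀ δ : ℕ → ℝ, (∀ t, 1 ≤ t → 0 < δ t) →
      ∀ (Ω : Type*) [MeasurableSpace Ω] (P : Measure Ω) [IsProbabilityMeasure P]
        (k : Pt Dx Dc → Pt Dx Dc → ℝ) (f : Ω → Pt Dx Dc → ℝ) (c : ℕ → Ω → Fin Dc → ℝ)
        (ε : ℕ → Ω → ℝ) (x : ℕ → Ω → Fin Dx → ℝ) (xs : Ω → Fin Dx → ℝ),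
        IsRun P X C a b r σ p K h δ k f c ε x xs →
        ∀ T : ℕ, 1 ≤ T →
          Integrable (cumRegret C p f x xs T) P ∧
          BCR P C p f x xs T ≤
            Real.pi ^ 2 / 3
            + Real.sqrt (ucbBeta Dx a b r T * maxInfoGain P (X ×ˢ C) f ε T * C₂)
              * (Real.sqrt ((T : ℝ) ^ ((Dc : ℝ) / (4 + Dc))) + Real.sqrt T
                + Real.sqrt (C₃ * ∑ t ∈ Finset.Icc 1 T, δ t ^ 2))
            + 2 * C₁ * (T : ℝ) ^ ((2 + (Dc : ℝ)) / (4 + Dc))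
            + ∑ t ∈ Finset.Icc 1 T, C₄ * δ t) ∧
    -- the rate for radii of order `t^{-2/(4+Dc)}`
    (∀ A : ℝ, ∃ B : ℝ, 0 < B ∧
      ∀ δ : ℕ → ℝ,
        (∀ t : ℕ, 1 ≤ t → 0 < δ t ∧ δ t ≤ A * (t : ℝ) ^ (-(2 / (4 + (Dc : ℝ))))) →
      ∀ (Ω : Type*) [MeasurableSpace Ω] (P : Measure Ω) [IsProbabilityMeasure P]
        (k : Pt Dx Dc → Pt Dx Dc → ℝ) (f : Ω → Pt Dx Dc → ℝ) (c : ℕ → Ω → Fin Dc → ℝ)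
        (ε : ℕ → Ω → ℝ) (x : ℕ → Ω → Fin Dx → ℝ) (xs : Ω → Fin Dx → ℝ),
        IsRun P X C a b r σ p K h δ k f c ε x xs →
        (∀ T : ℕ, 1 ≤ T →
          BCR P C p f x xs T ≤
            B * ((T : ℝ) ^ ((2 + (Dc : ℝ)) / (4 + Dc))
              + Real.sqrt (ucbBeta Dx a b r T * maxInfoGain P (X ×ˢ C) f ε T * T))) ∧
        ((fun T : ℕ => ucbBeta Dx a b r T * maxInfoGain P (X ×ˢ C) f ε T)
            =O[atTop] (fun T : ℕ => (T : ℝ) ^ ((Dc : ℝ) / (4 + Dc))) →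
          (fun T : ℕ => BCR P C p f x xs T)
              =O[atTop] (fun T : ℕ => (T : ℝ) ^ ((2 + (Dc : ℝ)) / (4 + Dc))) ∧
          Tendsto (fun T : ℕ => BCR P C p f x xs T / T) atTop (𝓝 0))) := by
  have hD : 0 < Dx + Dc := by omega
  have hl : 0 < Real.log (1 + 1 / σ ^ 2) := Real.log_pos (by
    have : 0 < 1 / σ ^ 2 := by positivity
    linarith)
  set C₂ := 36 * (2 / Real.log (1 + 1 / σ ^ 2)) with hC₂
  have hC₂0 : 0 < C₂ := by positivity
  constructor
  · obtain ⟨A, hA, hbound⟩ := exists_BCR_le hDx ha hb hr hσ hXconv hXcomp hXr hCconv hCcomp hCr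
      hp hK hh
    -- The bound of `exists_BCR_le` is stronger than required: the term `π² / 3` and the two further
    -- square roots are nonnegative slack, so any positive `C₃` would do.
    refine ⟨A / 2, C₂, 1, A, half_pos hA, hC₂0, one_pos, hA, ?_⟩
    intro δ hδ Ω _ P _ k f c ε x xs hrun T hT
    obtain ⟨h1, -, h2⟩ := hbound Ω P δ k f c ε x xs hδ hrun T
    refine ⟨h1, h2.trans ?_⟩
    have h3 : 0 ≤ Real.sqrt (ucbBeta Dx a b r T * maxInfoGain P (X ×ˢ C) f ε T * C₂) *
        (Real.sqrt ((T : ℝ) ^ ((Dc : ℝ) / (4 + Dc))) +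
          Real.sqrt (1 * ∑ t ∈ Finset.Icc 1 T, δ t ^ 2)) := by positivity
    have h4 : 0 ≤ Real.pi ^ 2 / 3 := by positivity
    linarith
  · intro A₀
    obtain ⟨A, hA, hbound⟩ := exists_BCR_le hDx ha hb hr hσ hXconv hXcomp hXr hCconv hCcomp hCr
      hp hK hh
    set s := (2 + (Dc : ℝ)) / (4 + Dc) with hs
    set D := (4 + (Dc : ℝ)) / (2 + Dc) with hDdef
    have hD0 : 0 < D := by positivity
    -- The three summands come from the estimation error, from the summed radii, and from the
    -- confidence widths.
    set B := A + A * (|A₀| * D) + Real.sqrt C₂ with hB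
    have hB0 : 0 < B := by positivity
    refine ⟨B, hB0, ?_⟩
    intro δ hδ Ω _ P _ k f c ε x xs hrun
    have hmain : ∀ T : ℕ, BCR P C p f x xs T ≤ B * ((T : ℝ) ^ s +
        Real.sqrt (ucbBeta Dx a b r T * maxInfoGain P (X ×ˢ C) f ε T * T)) := fun T => by
      obtain ⟨-, -, h2⟩ := hbound Ω P δ k f c ε x xs (fun t ht => (hδ t ht).1) hrun T
      have h3 : ∑ t ∈ Finset.Icc 1 T, A * δ t ≤ A * (|A₀| * D) * (T : ℝ) ^ s := by
        rw [← Finset.mul_sum, mul_assoc A, mul_assoc |A₀|]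
        refine mul_le_mul_of_nonneg_left ?_ hA.le
        calc ∑ t ∈ Finset.Icc 1 T, δ t ≤ ∑ t ∈ Finset.Icc 1 T, |A₀| * bandRate Dc t ^ 2 := by
              refine Finset.sum_le_sum fun t ht => ((hδ t (Finset.mem_Icc.1 ht).1).2.trans ?_)
              rw [← Real.rpow_natCast, bandRate_rpow, Nat.cast_ofNat]
              exact mul_le_mul_of_nonneg_right (le_abs_self _) (by positivity)
          _ = |A₀| * ∑ t ∈ Finset.Icc 1 T, bandRate Dc t ^ 2 := by rw [Finset.mul_sum]
          _ ≤ _ := by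
              gcongr
              exact sum_bandRate_sq_le Dc T
      have h4 : Real.sqrt (ucbBeta Dx a b r T * maxInfoGain P (X ×ˢ C) f ε T * C₂) * Real.sqrt T =
          Real.sqrt C₂ *
            Real.sqrt (ucbBeta Dx a b r T * maxInfoGain P (X ×ˢ C) f ε T * T) := by
        rw [Real.sqrt_mul' _ hC₂0.le, Real.sqrt_mul' _ (Nat.cast_nonneg T)]
        ring
      rw [h4] at h2
      have h5 : 0 ≤ (A + A * (|A₀| * D)) *
          Real.sqrt (ucbBeta Dx a b r T * maxInfoGain P (X ×ˢ C) f ε T * T) := by positivity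
      have h6 : 0 ≤ Real.sqrt C₂ * (T : ℝ) ^ s := by positivity
      rw [hB]
      linarith
    refine ⟨fun T _ => hmain T, fun hO => ?_⟩
    have hnonneg : ∀ T, 0 ≤ BCR P C p f x xs T := fun T =>
      (hbound Ω P δ k f c ε x xs (fun t ht => (hδ t ht).1) hrun T).2.1
    have hrate : (fun T : ℕ => BCR P C p f x xs T) =O[atTop] (fun T : ℕ => (T : ℝ) ^ s) := by
      obtain ⟨M, hM0, hM⟩ := hO.exists_pos
      refine IsBigO.of_bound (B * (1 + Real.sqrt M)) ?_
      filter_upwards [hM.bound, eventually_ge_atTop 1] with T hT hT1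
      have hT0 : (0 : ℝ) < T := by exact_mod_cast hT1
      rw [Real.norm_of_nonneg (hnonneg T), Real.norm_of_nonneg (by positivity)]
      rw [Real.norm_of_nonneg (by positivity : 0 ≤ (T : ℝ) ^ ((Dc : ℝ) / (4 + Dc)))] at hT
      have h1 : Real.sqrt (ucbBeta Dx a b r T * maxInfoGain P (X ×ˢ C) f ε T * T) ≤
          Real.sqrt M * (T : ℝ) ^ s := by
        rw [← Real.sqrt_sq (by positivity : 0 ≤ (T : ℝ) ^ s), ← Real.sqrt_mul hM0.le]
        apply Real.sqrt_le_sqrt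
        -- The exponents match because `Dc / (4 + Dc) + 1 = 2 * s`.
        calc _ ≤ M * (T : ℝ) ^ ((Dc : ℝ) / (4 + Dc)) * T := by
              exact mul_le_mul_of_nonneg_right ((Real.le_norm_self _).trans hT) hT0.le
          _ = M * ((T : ℝ) ^ s) ^ 2 := by
              rw [mul_assoc, ← Real.rpow_add_one hT0.ne', ← Real.rpow_natCast, ← Real.rpow_mul hT0.le]
              congr 2
              rw [hs]
              field_simp
              push_cast
              ring
      calc _ ≤ B * ((T : ℝ) ^ s + Real.sqrt M * (T : ℝ) ^ s) := (hmain T).trans (by gcongr)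
        _ = _ := by ring
    refine ⟨hrate, ?_⟩
    have h1 : (fun T : ℕ => BCR P C p f x xs T / T) =O[atTop]
        (fun T : ℕ => (T : ℝ) ^ s / (T : ℝ)) := hrate.mul (isBigO_refl _ _)
    refine h1.trans_tendsto ?_
    -- The average regret is of order `T ^ (s - 1)`, with `s - 1 = -2 / (4 + Dc)`.
    have h2 : Tendsto (fun T : ℕ => (T : ℝ) ^ (-(2 / (4 + (Dc : ℝ))))) atTop (𝓝 0) :=
      (tendsto_rpow_neg_atTop (by positivity)).comp tendsto_natCast_atTop_atTop
    refine h2.congr' ?_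
    filter_upwards [eventually_ge_atTop 1] with T hT1
    have hT0 : (0 : ℝ) < T := by exact_mod_cast hT1
    rw [← Real.rpow_sub_one hT0.ne']
    congr 1
    rw [hs]
    field_simp
    ring
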